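/- Let $d\ge 2$ and let $\Omega_-\subset\mathbb{R}^d$ be a bounded open set whose boundary $\Gamma:=\partial\Omega_-$ is a $C^{2,\alpha}$ hypersurface for some $\alpha>0$; that is, near each point of $\Gamma$ and after a rigid motion, $\Omega_-$ is the region $\{x_d<F(x')\}$ below the graph of a $C^2$ function $F:\mathbb{R}^{d-1}\to\mathbb{R}$ whose second derivative is Hölder continuous with exponent $\alpha$. Let $s$ be the surface measure on $\Gamma$, let $n$ be the unit normal pointing out of $\Omega_-$, let $k>0$, and let $$\Phi_k(x,y)=\frac{\mathrm i}{4}\left(\frac{k}{2\pi|x-y|}\right)^{(d-2)/2}H^{(1)}_{\frac d2-1}(k|x-y|)$$ be the outgoing fundamental solution of the Helmholtz equation, where $H^{(1)}_\nu$ is the Hankel function of the first kind (so $\Phi_k=\frac{\mathrm i}{4}H^{(1)}_0(k|x-y|)$ for $d=2$ and $\Phi_k=\frac{e^{\mathrm ik|x-y|}}{4\pi|x-y|}$ for $d=3$). For $\phi\in L^2(\Gamma)$ define the double-layer operator and the adjoint double-layer operator by $$D_k\phi(x)=\int_\Gamma\frac{\partial\Phi_k(x,y)}{\partial n(y)}\,\phi(y)\,\mathrm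 ds(y),\qquad D_k'\phi(x)=\int_\Gamma\frac{\partial\Phi_k(x,y)}{\partial n(x)}\,\phi(y)\,\mathrm ds(y),\qquad x\in\Gamma.$$ Then, for every $\phi\in L^2(\Gamma)$, both integrals converge absolutely for almost every $x\in\Gamma$, and $D_k$ and $D_k'$ are bounded operators from $L^2(\Gamma)$ to $H^1(\Gamma)$: there is a constant $C$, depending only on $\Omega_-$ and $k$, such that for all $\phi\in L^2(\Gamma)$ one has $D_k\phi,\,D_k'\phi\in H^1(\Gamma)$ and $$\|D_k\phi\|_{H^1(\Gamma)}\le C\|\phi\|_{L^2(\Gamma)},\qquad \|D_k'\phi\|_{H^1(\Gamma)}\le C\|\phi\|_{L^2(\Gamma)}.$$ Here $H^1(\Gamma)$ is the space of $u\in L^2(\Gamma)$ whose weak surface gradient $\nabla_\Gamma u$ (defined through local graph parametrizations of $\Gamma$) lies in $L^2(\Gamma)$, with norm $\big(\|u\|_{L^2(\Gamma)}^2+\|\nabla_\Gamma u\|_{L^2(\Gamma)}^2\big)^{1/2}$. -/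

import Mathlib

open MeasureTheory Set Filter Topology
open scoped ENNReal NNReal ContDiff

noncomputable section

namespace BoundaryLayer

/-- Euclidean space `ℝⁿ`. -/
abbrev Euc (n : ℕ) : Type := EuclideanSpace ℝ (Fin n)

/-! ### Bessel and Hankel functions of order `ν ≥ 0`, on the positive half line -/

/-- The Bessel function of the first kind,
`J_ν(z) = (z/2)^ν ∑ₘ (-1)ᵐ (z²/4)ᵐ / (m! Γ(ν+m+1))`. -/
def besselJ (ν z : ℝ) : ℝ :=
  (z / 2) ^ ν * ∑' m : ℕ, (-1) ^ m * (z ^ 2 / 4) ^ m / (m.factorial * Real.Gamma (ν + m + 1))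

/-- The digamma function at the positive integer `m + 1`: `ψ(m+1) = -γ + ∑_{j=1}^m 1/j`. -/
def digammaSucc (m : ℕ) : ℝ := -Real.eulerMascheroniConstant + (harmonic m : ℝ)

/-- The Bessel function of the second kind `Y_N` of integer order `N ≥ 0`. -/
def besselYNat (N : ℕ) (z : ℝ) : ℝ :=
  -((z / 2) ^ N)⁻¹ / Real.pi *
      ∑ j ∈ Finset.range N, ((N - j - 1).factorial : ℝ) / j.factorial * (z ^ 2 / 4) ^ j
    + 2 / Real.pi * Real.log (z / 2) * besselJ N z
    - (z / 2) ^ N / Real.pi *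
      ∑' j : ℕ, (digammaSucc j + digammaSucc (N + j)) * (-(z ^ 2 / 4)) ^ j
        / (j.factorial * (N + j).factorial)

/-- The Bessel function of the second kind `Y_ν`, for real `ν ≥ 0`. -/
def besselY (ν z : ℝ) : ℝ :=
  if ν = (⌊ν⌋₊ : ℝ) then besselYNat ⌊ν⌋₊ z
  else (besselJ ν z * Real.cos (ν * Real.pi) - besselJ (-ν) z) / Real.sin (ν * Real.pi)

/-- The Hankel function of the first kind, `H_ν⁽¹⁾ = J_ν + i Y_ν`. -/
def hankel1 (ν z : ℝ) : ℂ := (besselJ ν z : ℂ) + Complex.I * (besselY ν z : ℂ)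

/-- The outgoing fundamental solution of the Helmholtz equation in `ℝᵈ`, `d = n + 1`:
`Φ_k(x,y) = (i/4) (k / (2π|x-y|))^{(d-2)/2} H⁽¹⁾_{d/2-1}(k|x-y|)`. -/
def fundSol {n : ℕ} (k : ℝ) (x y : Euc (n + 1)) : ℂ :=
  Complex.I / 4 * (((k / (2 * Real.pi * ‖x - y‖)) ^ (((n : ℝ) - 1) / 2) : ℝ) : ℂ)
    * hankel1 (((n : ℝ) - 1) / 2) (k * ‖x - y‖)

/-! ### Open sets with boundary that is locally a graph -/

/-- The first `n` coordinates of a point of `ℝⁿ⁺¹`. -/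
def horiz {n : ℕ} (x : Euc (n + 1)) : Euc n := WithLp.toLp 2 fun i => x i.castSucc

/-- The last coordinate of a point of `ℝⁿ⁺¹`. -/
def vert {n : ℕ} (x : Euc (n + 1)) : ℝ := x (Fin.last n)

/-- The point `(x', t)` of `ℝⁿ⁺¹`. -/
def pair {n : ℕ} (x' : Euc n) (t : ℝ) : Euc (n + 1) :=
  WithLp.toLp 2 (Fin.snoc (α := fun _ => ℝ) (fun i => x' i) t)

/-- A representation of `Ω` inside an open set `W` as the region below a graph `t = F(x')`, after a
rigid motion. -/
structure LocalGraph {n : ℕ} (Ω : Set (Euc (n + 1))) where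
  /-- the rigid motion -/
  motion : Euc (n + 1) ≃ᵃⁱ[ℝ] Euc (n + 1)
  /-- the open set in which `Ω` is described -/
  W : Set (Euc (n + 1))
  isOpen_W : IsOpen W
  /-- the function whose graph is the boundary -/
  F : Euc n → ℝ
  mem_iff : ∀ x ∈ W, x ∈ Ω ↔ vert (motion x) < F (horiz (motion x))

/-- The parametrization `x' ↦ (x', F(x'))` of the boundary, in the original coordinates. -/
def LocalGraph.param {n : ℕ} {Ω : Set (Euc (n + 1))} (c : LocalGraph Ω) (x' : Euc n) :
    Euc (n + 1) :=
  c.motion.symm (pair x' (c.F x'))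

/-- The set of parameters of the boundary points that lie in `W`. -/
def LocalGraph.dom {n : ℕ} {Ω : Set (Euc (n + 1))} (c : LocalGraph Ω) : Set (Euc n) :=
  {x' | c.param x' ∈ c.W}

/-- `∂Ω` is a `C^{2,α}` hypersurface with `Ω` locally on one side: near each of its points `Ω` is
the region below the graph of a `C²` function whose second derivative is `α`-Hölder. -/
def HasC2HolderBoundary {n : ℕ} (Ω : Set (Euc (n + 1))) (α : ℝ) : Prop :=
  ∀ x ∈ frontier Ω, ∃ c : LocalGraph Ω, x ∈ c.W ∧ ContDiff ℝ 2 c.F ∧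
    ∃ M : ℝ, ∀ y z : Euc n,
      ‖fderiv ℝ (fderiv ℝ c.F) y - fderiv ℝ (fderiv ℝ c.F) z‖ ≤ M * ‖y - z‖ ^ α

/-- `ν` is the outward unit normal of `Ω` at `x`: rays from `x` that make an obtuse angle with `ν`
start inside `Ω`, those that make an acute angle start outside. There is at most one such `ν`. -/
def IsOutwardNormal {n : ℕ} (Ω : Set (Euc (n + 1))) (x ν : Euc (n + 1)) : Prop :=
  ‖ν‖ = 1 ∧
    (∀ v, inner ℝ v ν < 0 → ∀ᶠ t : ℝ in 𝓝[>] 0, x + t • v ∈ Ω) ∧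
    (∀ v, 0 < inner ℝ v ν → ∀ᶠ t : ℝ in 𝓝[>] 0, x + t • v ∉ Ω)

/-- The outward unit normal field of `Ω` (meaningful at the boundary points that have one). -/
def outwardNormal {n : ℕ} (Ω : Set (Euc (n + 1))) (x : Euc (n + 1)) : Euc (n + 1) :=
  Classical.epsilon (IsOutwardNormal Ω x)

/-- The surface measure on `∂Ω`: the `n`-dimensional Hausdorff measure, normalized to be Lebesgue
measure on `n`-dimensional planes. -/
def surfaceMeasure {n : ℕ} (Ω : Set (Euc (n + 1))) : Measure (Euc (n + 1)) :=
  (μHE[n]).restrict (frontier Ω)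

/-! ### The Sobolev space `H¹(∂Ω)` -/

/-- `w` is the weak `i`-th partial derivative of `v` on the open set `U ⊆ ℝⁿ`. -/
def HasWeakPartialDeriv {n : ℕ} (U : Set (Euc n)) (i : Fin n) (v w : Euc n → ℂ) : Prop :=
  LocallyIntegrableOn v U ∧ LocallyIntegrableOn w U ∧
    ∀ ψ : Euc n → ℝ, ContDiff ℝ ∞ ψ → HasCompactSupport ψ → tsupport ψ ⊆ U →
      ∫ x, v x * (fderiv ℝ ψ x (EuclideanSpace.single i 1) : ℂ) = -∫ x, w x * (ψ x : ℂ)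

/-- The bilinear product of a real and a complex vector. -/
def dotRC {m : ℕ} (v : Euc m) (g : EuclideanSpace ℂ (Fin m)) : ℂ := ∑ j, (v j : ℂ) * g j

/-- `g` is the weak surface gradient `∇_Γ u` of `u` on `Γ = ∂Ω`: it is tangential, and near every
point of `Γ` there is a `C¹` graph parametrization `Ψ` of `Γ` in which `u ∘ Ψ` has the weak
partial derivatives `∂ᵢ(u ∘ Ψ) = ∂ᵢΨ · (g ∘ Ψ)`. -/
def IsWeakSurfaceGradient {n : ℕ} (Ω : Set (Euc (n + 1))) (u : Euc (n + 1) → ℂ)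
    (g : Euc (n + 1) → EuclideanSpace ℂ (Fin (n + 1))) : Prop :=
  AEStronglyMeasurable g (surfaceMeasure Ω) ∧
  (∀ᵐ x ∂(surfaceMeasure Ω), dotRC (outwardNormal Ω x) (g x) = 0) ∧
  ∀ x ∈ frontier Ω, ∃ c : LocalGraph Ω, x ∈ c.W ∧ ContDiff ℝ 1 c.F ∧
    ∀ i : Fin n, HasWeakPartialDeriv c.dom i (fun x' => u (c.param x'))
      (fun x' => dotRC (fderiv ℝ c.param x' (EuclideanSpace.single i 1)) (g (c.param x')))

/-- `u ∈ H¹(∂Ω)`: both `u` and its weak surface gradient are square integrable. -/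
def MemH1 {n : ℕ} (Ω : Set (Euc (n + 1))) (u : Euc (n + 1) → ℂ) : Prop :=
  MemLp u 2 (surfaceMeasure Ω) ∧
    ∃ g, IsWeakSurfaceGradient Ω u g ∧ MemLp g 2 (surfaceMeasure Ω)

/-- The norm `(‖u‖²_{L²(∂Ω)} + ‖∇_Γ u‖²_{L²(∂Ω)})^{1/2}`; it is `∞` if `u` has no weak surface
gradient. The gradient is unique almost everywhere, so the infimum is over equal values. -/
def h1Norm {n : ℕ} (Ω : Set (Euc (n + 1))) (u : Euc (n + 1) → ℂ) : ℝ≥0∞ :=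
  ⨅ (g : Euc (n + 1) → EuclideanSpace ℂ (Fin (n + 1))) (_ : IsWeakSurfaceGradient Ω u g),
    (eLpNorm u 2 (surfaceMeasure Ω) ^ 2 + eLpNorm g 2 (surfaceMeasure Ω) ^ 2) ^ (1 / 2 : ℝ)

/-! ### The double-layer operator and its adjoint -/

/-- The kernel `∂Φ_k(x,y)/∂n(y)`. -/
def doubleLayerKernel {n : ℕ} (Ω : Set (Euc (n + 1))) (k : ℝ) (x y : Euc (n + 1)) : ℂ :=
  fderiv ℝ (fun z => fundSol k x z) y (outwardNormal Ω y)

/-- The kernel `∂Φ_k(x,y)/∂n(x)`. -/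
def adjDoubleLayerKernel {n : ℕ} (Ω : Set (Euc (n + 1))) (k : ℝ) (x y : Euc (n + 1)) : ℂ :=
  fderiv ℝ (fun z => fundSol k z y) x (outwardNormal Ω x)

/-- The double-layer operator `D_k φ(x) = ∫_Γ ∂Φ_k(x,y)/∂n(y) φ(y) ds(y)`. -/
def doubleLayer {n : ℕ} (Ω : Set (Euc (n + 1))) (k : ℝ) (φ : Euc (n + 1) → ℂ)
    (x : Euc (n + 1)) : ℂ :=
  ∫ y, doubleLayerKernel Ω k x y * φ y ∂(surfaceMeasure Ω)

/-- The adjoint double-layer operator `D'_k φ(x) = ∫_Γ ∂Φ_k(x,y)/∂n(x) φ(y) ds(y)`. -/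
def adjDoubleLayer {n : ℕ} (Ω : Set (Euc (n + 1))) (k : ℝ) (φ : Euc (n + 1) → ℂ)
    (x : Euc (n + 1)) : ℂ :=
  ∫ y, adjDoubleLayerKernel Ω k x y * φ y ∂(surfaceMeasure Ω)

end BoundaryLayer

end

/-! Write $s=|x-y|^2$ and $\nu=(n-1)/2$. The Bessel series give $\Phi_k=g_1(s)+\mathrm i\,g_2(s)$
with real $g_j$ of the form $s^{-\nu}P(s)+\log s\,Q(s)+S(s)$ and $P,Q,S$ smooth. Hence, off the
diagonal, the real and imaginary parts of both kernels are, up to sign, $a(|x-y|^2)\,(x-y)\cdot N$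
with $N$ the normal at $y$ or at $x$. Here $a(t^2)=O(t^{-n-1})$, and each of the first two
derivatives of $a$ costs two more powers of $t$ (`exists_fderiv_fundSol_eq`). Since $(x-y)\cdot
N=O(|x-y|^2)$ on $\Gamma$, the kernels are $O(|x-y|^{1-n})$, and Schur's test gives absolute
convergence and the $L^2$ bound.

The tangential gradient of such a kernel has the critical size $|x-y|^{-n}$, so cancellation is
needed. Put $\beta=\min(\alpha,1)$ and $r=|x-y|$. Two facts about the surface enter
(`HasDefiningFuns.exists_weingarten`): $N(x)-N(y)=S(y)(x-y)+O(r^{1+\beta})$, and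
$(x-y)\cdot(N(x)+N(y))=O(r^{2+\beta})$, the latter being the trapezoidal rule for a defining
function that vanishes at both end points. Together they give $(x-y)\cdot N(y)=-\frac12(x-y)\cdot
S(y)(x-y)+O(r^{2+\beta})$. Inserted in the gradients, this leaves a finite sum of products
$p(x)\,\kappa(x-y)\,q(y)$, with $p,q$ bounded and $\kappa$ an odd kernel $a'(|z|^2)z_iz_kz_l$ or
$a(|z|^2)z_k$ of degree $-n$, plus an error $O(r^{\beta-n})$ that Schur's test handles
(`IsNormalField.abs_dlGrad_sub_le`, `IsNormalField.abs_adjGrad_sub_le`). The Hölder exponent is what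
makes the error integrable.

Odd kernels are bounded on $L^2(\Gamma)$ by the Cotlar–Stein lemma
(`IsSurfaceLike.exists_norm_opCLM_le`). The dyadic pieces are skew-adjoint, and products of pieces
on scales $r\le s$ have norm $O(r/s)$, because the integral over $\Gamma$ of a piece of scale $r$
centred at a point of $\Gamma$ is $O(r)$. That cancellation comes from reflecting a graph chart
through the parameter of the centre: the reflection is $(1+O(r))$-Lipschitz, so it preserves
Hausdorff measure up to a factor $1+O(r)$ (`HasC2HolderBoundary.exists_surfaceLike`).

To make the differentiation legitimate, $|x-y|^2$ is replaced by $|x-y|^2+\varepsilon^2$. The symbol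
bounds, and hence the $L^2$ bounds of the gradient operators, do not depend on $\varepsilon$. For
fixed $\varepsilon$ the potential has a first-order Taylor expansion along $\Gamma$ itself, which
justifies integration by parts in charts. As $\varepsilon\to0$ the potentials converge in $L^2$ and
their gradients have a weak limit point; tangentiality and the weak-derivative identity are tested
by continuous functionals on $L^2(\Gamma)$ and survive (`HasL2Gradient.exists_of_tendsto`,
`IsSymbol.mapsL2ToH1`). -/

noncomputable section

namespace BoundaryLayer

/-! ### Almost orthogonality -/

section Cotlar

variable {A ι : Type*} [NormedRing A]

/-- The weight of a chain of indices that controls the norm of the corresponding product. -/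
def chainWeight (B : ℝ) (c : ι → ι → ℝ) : List ι → ℝ
  | [] => 1
  | [_] => B
  | i :: j :: l => c i j * chainWeight B c (j :: l)

/-- The bound for a product obtained by grouping the factors in pairs from the left. -/
def pairWeight (B : ℝ) (c : ι → ι → ℝ) : List ι → ℝ
  | [] => 1
  | [_] => B
  | i :: j :: l => c i j ^ 2 * pairWeight B c l

lemma pairWeight_nonneg {B : ℝ} (hB : 0 ≤ B) (c : ι → ι → ℝ) :
    ∀ l : List ι, 0 ≤ pairWeight B c l
  | [] => zero_le_one
  | [_] => hB
  | _ :: _ :: l => mul_nonneg (sq_nonneg _) (pairWeight_nonneg hB c l)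

lemma chainWeight_nonneg {B : ℝ} (hB : 0 ≤ B) {c : ι → ι → ℝ} (hc : ∀ i j, 0 ≤ c i j) :
    ∀ l : List ι, 0 ≤ chainWeight B c l
  | [] => zero_le_one
  | [_] => hB
  | i :: j :: l => mul_nonneg (hc i j) (chainWeight_nonneg hB hc (j :: l))

lemma norm_prod_le_pairWeight [NormOneClass A] {B : ℝ} {c : ι → ι → ℝ} {t : ι → A}
    (hB : ∀ i, ‖t i‖ ≤ B) (ht : ∀ i j, ‖t i * t j‖ ≤ c i j ^ 2) :
    ∀ l : List ι, ‖(l.map t).prod‖ ≤ pairWeight B c l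
  | [] => by simp [pairWeight]
  | [i] => by simpa [pairWeight] using hB i
  | i :: j :: l => by
    have h := norm_prod_le_pairWeight hB ht l
    simp only [List.map_cons, List.prod_cons, pairWeight, ← mul_assoc]
    exact (norm_mul_le _ _).trans
      (mul_le_mul (ht i j) h (norm_nonneg _) (sq_nonneg _))

/-- A word can be grouped in pairs from its first letter, or from its second after splitting off the
first. The two groupings together see every pair of neighbours exactly once, and leave two single
letters, each bounded by `B`. -/
lemma pairWeight_cons_mul (B : ℝ) (c : ι → ι → ℝ) (i : ι) (l : List ι) :
    pairWeight B c (i :: l) * (B * pairWeight B c l) = chainWeight B c (i :: l) ^ 2 := by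
  induction l generalizing i with
  | nil => simp [pairWeight, chainWeight]; ring
  | cons j l ih =>
    have := ih j
    simp only [pairWeight, chainWeight] at this ⊢
    rw [mul_pow, ← this]; ring

/-- Both groupings bound the norm of the product, so the norm is at most their geometric mean. -/
lemma norm_prod_le_chainWeight [NormOneClass A] {B : ℝ} (hB0 : 0 ≤ B) {c : ι → ι → ℝ}
    (hc : ∀ i j, 0 ≤ c i j) {t : ι → A}
    (hB : ∀ i, ‖t i‖ ≤ B) (ht : ∀ i j, ‖t i * t j‖ ≤ c i j ^ 2) (i : ι) (l : List ι) :
    ‖((i :: l).map t).prod‖ ≤ chainWeight B c (i :: l) := by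
  refine le_of_sq_le_sq ?_ (chainWeight_nonneg hB0 hc _)
  rw [← pairWeight_cons_mul, sq]
  refine mul_le_mul (norm_prod_le_pairWeight hB ht _) ?_ (norm_nonneg _)
    (pairWeight_nonneg hB0 c _)
  rw [List.map_cons, List.prod_cons]
  exact (norm_mul_le _ _).trans
    (mul_le_mul (hB i) (norm_prod_le_pairWeight hB ht l) (norm_nonneg _) hB0)

lemma sum_pow_eq_sum_prod [Fintype ι] (t : ι → A) (M : ℕ) :
    (∑ i, t i) ^ M = ∑ p : Fin M → ι, ((List.ofFn p).map t).prod := by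
  induction M with
  | zero => simp
  | succ M ih =>
    rw [pow_succ', ih, Finset.sum_mul_sum,
      ← (Fin.consEquiv fun _ : Fin (M + 1) => ι).sum_comp, Fintype.sum_prod_type]
    simp [Fin.consEquiv, List.ofFn_succ]

lemma sum_chainWeight_le [Fintype ι] {B D : ℝ} (hB : 0 ≤ B) (hD : 0 ≤ D) {c : ι → ι → ℝ}
    (hc : ∀ i j, 0 ≤ c i j) (hcD : ∀ i, ∑ j, c i j ≤ D) (M : ℕ) (i : ι) :
    ∑ p : Fin M → ι, chainWeight B c (i :: List.ofFn p) ≤ B * D ^ M := by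
  induction M generalizing i with
  | zero => simp [chainWeight]
  | succ M ih =>
    rw [← (Fin.consEquiv fun _ : Fin (M + 1) => ι).sum_comp, Fintype.sum_prod_type]
    simp only [Fin.consEquiv, List.ofFn_succ, Equiv.coe_fn_mk, Fin.cons_zero, Fin.cons_succ,
      chainWeight, ← Finset.mul_sum]
    calc ∑ j, c i j * ∑ p : Fin M → ι, chainWeight B c (j :: List.ofFn p)
        ≤ ∑ j, c i j * (B * D ^ M) :=
          Finset.sum_le_sum fun j _ => mul_le_mul_of_nonneg_left (ih j) (hc i j)
      _ = (∑ j, c i j) * (B * D ^ M) := by rw [Finset.sum_mul]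
      _ ≤ D * (B * D ^ M) := mul_le_mul_of_nonneg_right (hcD i) (by positivity)
      _ = B * D ^ (M + 1) := by ring

/-- Expand the power into words. Given the first letter, each further letter costs a row sum of `c`,
at most `D`; only the first is counted with the full cardinality, so the number of operators enters
linearly whatever the power. -/
lemma norm_sum_pow_le [NormOneClass A] [Fintype ι] {B D : ℝ} (hB0 : 0 ≤ B) (hD : 0 ≤ D)
    {c : ι → ι → ℝ} (hc : ∀ i j, 0 ≤ c i j) (hcD : ∀ i, ∑ j, c i j ≤ D) {t : ι → A}
    (hB : ∀ i, ‖t i‖ ≤ B) (ht : ∀ i j, ‖t i * t j‖ ≤ c i j ^ 2) (M : ℕ) :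
    ‖(∑ i, t i) ^ (M + 1)‖ ≤ Fintype.card ι * B * D ^ M := by
  rw [sum_pow_eq_sum_prod, ← (Fin.consEquiv fun _ : Fin (M + 1) => ι).sum_comp,
    Fintype.sum_prod_type]
  simp only [Fin.consEquiv, List.ofFn_succ, Equiv.coe_fn_mk, Fin.cons_zero, Fin.cons_succ]
  calc _ ≤ ∑ i, ∑ p : Fin M → ι, chainWeight B c (i :: List.ofFn p) :=
        (norm_sum_le _ _).trans <| Finset.sum_le_sum fun i _ =>
          (norm_sum_le _ _).trans <| Finset.sum_le_sum fun p _ =>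
            norm_prod_le_chainWeight hB0 hc hB ht i _
    _ ≤ ∑ _i : ι, B * D ^ M :=
        Finset.sum_le_sum fun i _ => sum_chainWeight_le hB0 hD hc hcD M i
    _ = _ := by simp [mul_assoc]

/-- The fixed factor `K` disappears on taking roots of order `2 ^ m`. -/
lemma le_of_pow_two_pow_le {u K D : ℝ} (hD : 0 < D)
    (h : ∀ m : ℕ, u ^ (2 ^ m) ≤ K * D ^ (2 ^ m)) : u ≤ D := by
  by_contra! hlt
  have h1 : 1 < u / D := (one_lt_div hD).2 hlt
  have h2 : Tendsto (fun m : ℕ => (u / D) ^ (2 ^ m)) atTop atTop :=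
    (tendsto_pow_atTop_atTop_of_one_lt h1).comp
      (tendsto_pow_atTop_atTop_of_one_lt (one_lt_two : (1 : ℕ) < 2))
  obtain ⟨m, hm⟩ := (h2.eventually_gt_atTop K).exists
  rw [div_pow, lt_div_iff₀ (by positivity)] at hm
  exact absurd (h m) (not_le.2 hm)

/-- The Cotlar–Stein lemma for finitely many skew-adjoint elements. -/
theorem norm_sum_le_of_almost_orthogonal [StarRing A] [CStarRing A] [NormOneClass A] [Fintype ι]
    {D : ℝ} (hD : 0 < D) {c : ι → ι → ℝ} (hc : ∀ i j, 0 ≤ c i j) (hcD : ∀ i, ∑ j, c i j ≤ D)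
    {t : ι → A} (hs : ∀ i, star (t i) = -t i) (ht : ∀ i j, ‖t i * t j‖ ≤ c i j ^ 2) :
    ‖∑ i, t i‖ ≤ D := by
  set u := ∑ i, t i with hu
  have hsu : star u = -u := by simp [hu, star_sum, hs]
  -- The square of a skew-adjoint element is self-adjoint, so the C⋆-identity makes the norm
  -- multiplicative on these powers.
  have hpow : ∀ m : ℕ, ‖u ^ (2 ^ (m + 1))‖ = ‖u‖ ^ (2 ^ (m + 1)) := by
    have h2 : IsSelfAdjoint (u ^ 2) := by
      rw [IsSelfAdjoint, star_pow, hsu, neg_sq]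
    have h3 : ‖u ^ 2‖ = ‖u‖ ^ 2 := by
      have := CStarRing.norm_star_mul_self (x := u)
      rw [hsu, neg_mul, norm_neg] at this
      rw [sq, sq, this]
    intro m
    have h4 := congrArg NNReal.toReal (h2.nnnorm_pow_two_pow m)
    simp only [NNReal.coe_pow, coe_nnnorm] at h4
    rw [pow_succ', pow_mul, h4, h3, ← pow_mul]
  -- The hypothesis with equal indices already bounds the individual norms, so `D` can play the part
  -- of `B`.
  have hBD : ∀ i, ‖t i‖ ≤ D := fun i => by
    have h1 := CStarRing.norm_star_mul_self (x := t i)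
    rw [hs, neg_mul, norm_neg] at h1
    have h2 : ‖t i‖ ≤ c i i := le_of_sq_le_sq (by rw [sq, ← h1]; exact ht i i) (hc i i)
    exact h2.trans ((Finset.single_le_sum (fun j _ => hc i j) (Finset.mem_univ i)).trans (hcD i))
  have key : ∀ m : ℕ, ‖u‖ ^ (2 ^ (m + 1)) ≤ Fintype.card ι * D ^ (2 ^ (m + 1)) := fun m => by
    obtain ⟨M, hM⟩ : ∃ M, 2 ^ (m + 1) = M + 1 := Nat.exists_eq_succ_of_ne_zero (by positivity)
    have := norm_sum_pow_le hD.le hD.le hc hcD hBD ht M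
    rw [← hpow, hM, pow_succ D]
    linarith
  have := le_of_pow_two_pow_le (u := ‖u‖ ^ 2) (K := Fintype.card ι) (D := D ^ 2)
    (by positivity) (fun m => by
      rw [← pow_mul, ← pow_mul, ← pow_succ']; exact key m)
  exact le_of_sq_le_sq this hD.le

end Cotlar

/-! ### Integral operators on `L²` -/

section IntegralOperators

variable {X : Type*} [MeasurableSpace X] {σ : Measure X}

lemma enorm_complex_ofReal (a : ℝ) : ‖(a : ℂ)‖ₑ = ‖a‖ₑ := by
  rw [← ofReal_norm, ← ofReal_norm, Complex.norm_real]

lemma eLpNorm_two_sq {Y F : Type*} [MeasurableSpace Y] [NormedAddCommGroup F] (μ : Measure Y)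
    (f : Y → F) : eLpNorm f 2 μ ^ 2 = ∫⁻ x, ‖f x‖ₑ ^ 2 ∂μ := by
  have := eLpNorm_nnreal_pow_eq_lintegral (μ := μ) (f := f) (p := 2) (by norm_num)
  simpa using this

lemma eLpNorm_two_le_of_lintegral_le {Y F F' : Type*} [MeasurableSpace Y] [NormedAddCommGroup F]
    [NormedAddCommGroup F'] {μ : Measure Y} {f : Y → F} {g : Y → F'} {C : ℝ≥0∞}
    (h : ∫⁻ x, ‖f x‖ₑ ^ 2 ∂μ ≤ C ^ 2 * ∫⁻ x, ‖g x‖ₑ ^ 2 ∂μ) :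
    eLpNorm f 2 μ ≤ C * eLpNorm g 2 μ := by
  rw [← eLpNorm_two_sq, ← eLpNorm_two_sq, ← mul_pow] at h
  exact (ENNReal.pow_le_pow_left_iff two_ne_zero).1 h

/-- Cauchy–Schwarz for `h · 1` with respect to the measure of density `w`. -/
lemma lintegral_mul_sq_le {μ : Measure X} {w h : X → ℝ≥0∞} (hw : AEMeasurable w μ)
    (hh : AEMeasurable h μ) :
    (∫⁻ x, w x * h x ∂μ) ^ 2 ≤ (∫⁻ x, w x ∂μ) * ∫⁻ x, w x * h x ^ 2 ∂μ := by
  have key := ENNReal.lintegral_mul_norm_pow_le (μ := μ) hw (hw.mul (hh.pow_const 2))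
    (p := 1 / 2) (q := 1 / 2) (by norm_num) (by norm_num) (by norm_num)
  have e1 : ∀ x, w x ^ (1 / 2 : ℝ) * (w x * h x ^ 2) ^ (1 / 2 : ℝ) = w x * h x := fun x => by
    rw [ENNReal.mul_rpow_of_nonneg _ _ (by norm_num), ← mul_assoc, ← ENNReal.rpow_add_of_nonneg _ _
      (by norm_num) (by norm_num), ← ENNReal.rpow_natCast, ← ENNReal.rpow_mul]
    norm_num
  simp only [Pi.mul_apply, e1] at key
  calc _ ≤ ((∫⁻ x, w x ∂μ) ^ (1 / 2 : ℝ) * (∫⁻ x, w x * h x ^ 2 ∂μ) ^ (1 / 2 : ℝ)) ^ 2 :=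
        pow_le_pow_left₀ zero_le key 2
    _ = _ := by
        rw [mul_pow, ← ENNReal.rpow_natCast, ← ENNReal.rpow_natCast, ← ENNReal.rpow_mul,
          ← ENNReal.rpow_mul]
        norm_num

/-- The integral operator with real kernel `G`. -/
def integralOp (σ : Measure X) (G : X → X → ℝ) (φ : X → ℂ) (x : X) : ℂ :=
  ∫ y, (G x y : ℂ) * φ y ∂σ

lemma integralOp_congr (G : X → X → ℝ) {φ ψ : X → ℂ} (h : φ =ᵐ[σ] ψ) :
    integralOp σ G φ = integralOp σ G ψ := by
  ext x
  refine integral_congr_ae ?_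
  filter_upwards [h] with y hy
  rw [hy]

lemma integralOp_smul_right (G : X → X → ℝ) (c : ℂ) (φ : X → ℂ) :
    integralOp σ G (c • φ) = c • integralOp σ G φ := by
  ext x
  simp only [integralOp, Pi.smul_apply, smul_eq_mul, mul_left_comm]
  exact integral_const_mul c _

/-- Bounded measurable kernels. -/
structure IsBddKernel (G : X → X → ℝ) : Prop where
  meas : Measurable (Function.uncurry G)
  bdd : ∃ M : ℝ, ∀ x y, |G x y| ≤ M

lemma IsBddKernel.integrable [IsFiniteMeasure σ] {G : X → X → ℝ} (hG : IsBddKernel G)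
    {φ : X → ℂ} (hφ : Integrable φ σ) (x : X) : Integrable (fun y => (G x y : ℂ) * φ y) σ := by
  obtain ⟨M, hM⟩ := hG.bdd
  refine hφ.bdd_mul (c := M)
    (Complex.measurable_ofReal.comp (hG.meas.comp measurable_prodMk_left)).aestronglyMeasurable
    (ae_of_all _ fun y => by simpa using hM x y)

lemma IsBddKernel.flip {G : X → X → ℝ} (hG : IsBddKernel G) : IsBddKernel fun x y => G y x :=
  ⟨hG.meas.comp measurable_swap, hG.bdd.imp fun _ h x y => h y x⟩

lemma IsBddKernel.add {G H : X → X → ℝ} (hG : IsBddKernel G) (hH : IsBddKernel H) :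
    IsBddKernel fun x y => G x y + H x y := by
  obtain ⟨M, hM⟩ := hG.bdd
  obtain ⟨M', hM'⟩ := hH.bdd
  exact ⟨hG.meas.add hH.meas, M + M', fun x y =>
    (abs_add_le _ _).trans (add_le_add (hM x y) (hM' x y))⟩

lemma IsBddKernel.mul {G H : X → X → ℝ} (hG : IsBddKernel G) (hH : IsBddKernel H) :
    IsBddKernel fun x y => G x y * H x y := by
  obtain ⟨M, hM⟩ := hG.bdd
  obtain ⟨M', hM'⟩ := hH.bdd
  exact ⟨hG.meas.mul hH.meas, M * M', fun x y => by
    rw [abs_mul]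
    exact mul_le_mul (hM x y) (hM' x y) (abs_nonneg _) ((abs_nonneg _).trans (hM x y))⟩

lemma IsBddKernel.finset_sum {ι : Type*} {s : Finset ι} {G : ι → X → X → ℝ}
    (h : ∀ i ∈ s, IsBddKernel (G i)) : IsBddKernel fun x y => ∑ i ∈ s, G i x y := by
  classical
  induction s using Finset.induction_on with
  | empty => exact ⟨by simp only [Finset.sum_empty]; exact measurable_const, 0, by simp⟩
  | insert i s hi ih =>
    simp only [Finset.sum_insert hi]
    exact (h i (Finset.mem_insert_self _ _)).add (ih fun j hj => h j (Finset.mem_insert_of_mem hj))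

lemma isBddKernel_left {b : X → ℝ} (hb : Measurable b) {B : ℝ} (hB : ∀ x, |b x| ≤ B) :
    IsBddKernel fun x (_ : X) => b x :=
  ⟨hb.comp measurable_fst, B, fun x _ => hB x⟩

lemma isBddKernel_right {b : X → ℝ} (hb : Measurable b) {B : ℝ} (hB : ∀ x, |b x| ≤ B) :
    IsBddKernel fun (_ : X) y => b y :=
  ⟨hb.comp measurable_snd, B, fun _ y => hB y⟩

section SFinite

variable [SFinite σ]

/-- Schur's test for the absolute values. -/
theorem lintegral_lintegral_mul_sq_le {G : X → X → ℝ} (hG : Measurable (Function.uncurry G))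
    {C : ℝ≥0∞} (h1 : ∀ᵐ x ∂σ, ∫⁻ y, ‖G x y‖ₑ ∂σ ≤ C) (h2 : ∀ᵐ y ∂σ, ∫⁻ x, ‖G x y‖ₑ ∂σ ≤ C)
    {φ : X → ℂ} (hφ : AEStronglyMeasurable φ σ) :
    ∫⁻ x, (∫⁻ y, ‖G x y‖ₑ * ‖φ y‖ₑ ∂σ) ^ 2 ∂σ ≤ C ^ 2 * ∫⁻ x, ‖φ x‖ₑ ^ 2 ∂σ := by
  have hGx : ∀ x, Measurable (fun y => ‖G x y‖ₑ) := fun x =>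
    (hG.comp measurable_prodMk_left).enorm
  -- Cauchy–Schwarz with weight `|G x ·|` uses the row bound; after Tonelli the column bound gives
  -- the second factor `C`.
  calc ∫⁻ x, (∫⁻ y, ‖G x y‖ₑ * ‖φ y‖ₑ ∂σ) ^ 2 ∂σ
      ≤ ∫⁻ x, C * ∫⁻ y, ‖G x y‖ₑ * ‖φ y‖ₑ ^ 2 ∂σ ∂σ := by
        refine lintegral_mono_ae ?_
        filter_upwards [h1] with x hx
        exact (lintegral_mul_sq_le (hGx x).aemeasurable hφ.enorm).trans (mul_le_mul_left hx _)
    _ = C * ∫⁻ x, ∫⁻ y, ‖G x y‖ₑ * ‖φ y‖ₑ ^ 2 ∂σ ∂σ := by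
        refine lintegral_const_mul'' _ ?_
        refine AEMeasurable.lintegral_prod_right' (f := fun p : X × X => ‖G p.1 p.2‖ₑ * ‖φ p.2‖ₑ ^ 2)
          (hG.enorm.aemeasurable.mul ?_)
        exact (hφ.comp_snd.enorm.pow_const 2)
    _ = C * ∫⁻ y, ∫⁻ x, ‖G x y‖ₑ * ‖φ y‖ₑ ^ 2 ∂σ ∂σ := by
        rw [lintegral_lintegral_swap]
        exact hG.enorm.aemeasurable.mul (hφ.comp_snd.enorm.pow_const 2)
    _ ≤ C * ∫⁻ y, C * ‖φ y‖ₑ ^ 2 ∂σ := by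
        refine mul_le_mul_right (lintegral_mono_ae ?_) _
        filter_upwards [h2] with y hy
        rw [lintegral_mul_const]
        · exact mul_le_mul_left hy _
        · exact (hG.comp measurable_prodMk_right).enorm
    _ = _ := by
        rw [lintegral_const_mul'' _ (hφ.enorm.pow_const 2)]; ring

/-- Schur's test. -/
theorem eLpNorm_integralOp_le {G : X → X → ℝ} (hG : Measurable (Function.uncurry G))
    {C : ℝ≥0∞} (h1 : ∀ᵐ x ∂σ, ∫⁻ y, ‖G x y‖ₑ ∂σ ≤ C) (h2 : ∀ᵐ y ∂σ, ∫⁻ x, ‖G x y‖ₑ ∂σ ≤ C)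
    {φ : X → ℂ} (hφ : AEStronglyMeasurable φ σ) :
    eLpNorm (integralOp σ G φ) 2 σ ≤ C * eLpNorm φ 2 σ := by
  refine eLpNorm_two_le_of_lintegral_le (le_trans (lintegral_mono fun x => ?_)
    (lintegral_lintegral_mul_sq_le hG h1 h2 hφ))
  refine pow_le_pow_left₀ zero_le ((enorm_integral_le_lintegral_enorm _).trans_eq ?_) 2
  simp only [enorm_mul, enorm_complex_ofReal]

theorem ae_integrable_of_schur {G : X → X → ℝ} (hG : Measurable (Function.uncurry G))
    {C : ℝ≥0∞} (hC : C ≠ ⊤) (h1 : ∀ᵐ x ∂σ, ∫⁻ y, ‖G x y‖ₑ ∂σ ≤ C)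
    (h2 : ∀ᵐ y ∂σ, ∫⁻ x, ‖G x y‖ₑ ∂σ ≤ C) {φ : X → ℂ} (hφ : MemLp φ 2 σ) :
    ∀ᵐ x ∂σ, Integrable (fun y => (G x y : ℂ) * φ y) σ := by
  have hfin : ∫⁻ x, (∫⁻ y, ‖G x y‖ₑ * ‖φ y‖ₑ ∂σ) ^ 2 ∂σ ≠ ⊤ := by
    refine ne_top_of_le_ne_top ?_ (lintegral_lintegral_mul_sq_le hG h1 h2 hφ.1)
    rw [← eLpNorm_two_sq]
    exact ENNReal.mul_ne_top (ENNReal.pow_ne_top hC) (ENNReal.pow_ne_top hφ.2.ne)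
  have hm : AEMeasurable (fun x => (∫⁻ y, ‖G x y‖ₑ * ‖φ y‖ₑ ∂σ) ^ 2) σ :=
    (AEMeasurable.lintegral_prod_right' (f := fun p : X × X => ‖G p.1 p.2‖ₑ * ‖φ p.2‖ₑ)
          (hG.enorm.aemeasurable.mul hφ.1.comp_snd.enorm)).pow_const 2
  filter_upwards [ae_lt_top' hm hfin] with x hx
  refine ⟨?_, ?_⟩
  · exact (Complex.measurable_ofReal.comp (hG.comp measurable_prodMk_left)).aestronglyMeasurable.mul
      hφ.1
  · rw [hasFiniteIntegral_iff_enorm]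
    refine lt_of_le_of_lt (lintegral_mono fun y => ?_) ((ENNReal.pow_lt_top_iff.1 hx).resolve_right
      two_ne_zero)
    simp only [enorm_mul, enorm_complex_ofReal, le_refl]

lemma aestronglyMeasurable_integralOp {G : X → X → ℝ} (hG : Measurable (Function.uncurry G))
    {φ : X → ℂ} (hφ : AEStronglyMeasurable φ σ) :
    AEStronglyMeasurable (integralOp σ G φ) σ :=
  AEStronglyMeasurable.integral_prod_right' (f := fun p : X × X => (G p.1 p.2 : ℂ) * φ p.2)
    ((Complex.measurable_ofReal.comp hG).aestronglyMeasurable.mul hφ.comp_snd)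

end SFinite

/-- This constant only serves to know that the operator is well defined and bounded; it depends on
the supremum of the kernel. The quantitative estimates come from `norm_opCLM_le` and from almost
orthogonality. -/
lemma IsBddKernel.exists_schur {G : X → X → ℝ} (hG : IsBddKernel G) (σ : Measure X)
    [IsFiniteMeasure σ] :
    ∃ C : ℝ≥0, (∀ x, ∫⁻ y, ‖G x y‖ₑ ∂σ ≤ C) ∧ ∀ y, ∫⁻ x, ‖G x y‖ₑ ∂σ ≤ C := by
  obtain ⟨M, hM⟩ := hG.bdd
  have h : ∀ x y, ‖G x y‖ₑ ≤ ENNReal.ofReal M := fun x y => by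
    rw [Real.enorm_eq_ofReal_abs]
    exact ENNReal.ofReal_le_ofReal (hM x y)
  have hc : (((ENNReal.ofReal M * σ univ).toNNReal : ℝ≥0) : ℝ≥0∞) = ENNReal.ofReal M * σ univ :=
    ENNReal.coe_toNNReal (ENNReal.mul_ne_top ENNReal.ofReal_ne_top (measure_ne_top _ _))
  refine ⟨(ENNReal.ofReal M * σ univ).toNNReal, fun x => ?_, fun y => ?_⟩
  · rw [hc]
    exact (lintegral_mono fun y => h x y).trans_eq (lintegral_const _)
  · rw [hc]
    exact (lintegral_mono fun x => h x y).trans_eq (lintegral_const _)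

variable [IsFiniteMeasure σ]

lemma IsBddKernel.memLp {G : X → X → ℝ} (hG : IsBddKernel G) {φ : X → ℂ} (hφ : MemLp φ 2 σ) :
    MemLp (integralOp σ G φ) 2 σ := by
  obtain ⟨C, h1, h2⟩ := hG.exists_schur σ
  exact ⟨aestronglyMeasurable_integralOp hG.meas hφ.1,
    (eLpNorm_integralOp_le hG.meas (ae_of_all _ h1) (ae_of_all _ h2) hφ.1).trans_lt
      (ENNReal.mul_lt_top (by simp) hφ.2)⟩

lemma integralOp_add_right {G : X → X → ℝ} (hG : IsBddKernel G) {φ ψ : X → ℂ}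
    (hφ : Integrable φ σ) (hψ : Integrable ψ σ) :
    integralOp σ G (φ + ψ) = integralOp σ G φ + integralOp σ G ψ := by
  ext x
  simp only [integralOp, Pi.add_apply, mul_add]
  exact integral_add (hG.integrable hφ x) (hG.integrable hψ x)

lemma integralOp_add_left {G H : X → X → ℝ} (hG : IsBddKernel G) (hH : IsBddKernel H)
    {φ : X → ℂ} (hφ : Integrable φ σ) :
    integralOp σ (fun x y => G x y + H x y) φ = integralOp σ G φ + integralOp σ H φ := by
  ext x
  simp only [integralOp, Pi.add_apply, Complex.ofReal_add, add_mul]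
  exact integral_add (hG.integrable hφ x) (hH.integrable hφ x)

lemma integralOp_sum_left {ι : Type*} (s : Finset ι) {G : ι → X → X → ℝ}
    (hG : ∀ i ∈ s, IsBddKernel (G i)) {φ : X → ℂ} (hφ : Integrable φ σ) :
    integralOp σ (fun x y => ∑ i ∈ s, G i x y) φ = ∑ i ∈ s, integralOp σ (G i) φ := by
  ext x
  simp only [integralOp, Finset.sum_apply, Complex.ofReal_sum, Finset.sum_mul]
  exact integral_finsetSum _ fun i hi => (hG i hi).integrable hφ x

/-- The integral operator with bounded kernel, as an operator on `L²`. -/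
def opCLM (σ : Measure X) [IsFiniteMeasure σ] {G : X → X → ℝ} (hG : IsBddKernel G) :
    Lp ℂ 2 σ →L[ℂ] Lp ℂ 2 σ :=
  LinearMap.mkContinuous
    { toFun := fun f => (hG.memLp (Lp.memLp f)).toLp _
      map_add' := fun f g => by
        rw [← MemLp.toLp_add]
        refine MemLp.toLp_congr _ _ (ae_of_all _ fun x => ?_)
        rw [integralOp_congr G (Lp.coeFn_add f g), integralOp_add_right hG
          ((Lp.memLp f).integrable one_le_two) ((Lp.memLp g).integrable one_le_two)]
      map_smul' := fun c f => by
        rw [RingHom.id_apply, ← MemLp.toLp_const_smul]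
        refine MemLp.toLp_congr _ _ (ae_of_all _ fun x => ?_)
        rw [integralOp_congr G (Lp.coeFn_smul c f), integralOp_smul_right] }
    (hG.exists_schur σ).choose
    (fun f => by
      have h := (hG.exists_schur σ).choose_spec
      simp only [LinearMap.coe_mk, AddHom.coe_mk, Lp.norm_toLp]
      rw [Lp.norm_def, ← ENNReal.coe_toReal, ← ENNReal.toReal_mul]
      exact ENNReal.toReal_mono (ENNReal.mul_ne_top (by simp) (Lp.memLp f).2.ne)
        (eLpNorm_integralOp_le hG.meas (ae_of_all _ h.1) (ae_of_all _ h.2) (Lp.memLp f).1))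

lemma opCLM_apply {G : X → X → ℝ} (hG : IsBddKernel G) (f : Lp ℂ 2 σ) :
    opCLM σ hG f = (hG.memLp (Lp.memLp f)).toLp _ := rfl

lemma coeFn_opCLM {G : X → X → ℝ} (hG : IsBddKernel G) (f : Lp ℂ 2 σ) :
    opCLM σ hG f =ᵐ[σ] integralOp σ G f := by
  rw [opCLM_apply]; exact MemLp.coeFn_toLp _

lemma norm_opCLM_le {G : X → X → ℝ} (hG : IsBddKernel G) {C : ℝ≥0}
    (h1 : ∀ᵐ x ∂σ, ∫⁻ y, ‖G x y‖ₑ ∂σ ≤ C) (h2 : ∀ᵐ y ∂σ, ∫⁻ x, ‖G x y‖ₑ ∂σ ≤ C) :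
    ‖opCLM σ hG‖ ≤ C := by
  refine ContinuousLinearMap.opNorm_le_bound _ C.2 fun f => ?_
  rw [opCLM_apply, Lp.norm_toLp, Lp.norm_def]
  rw [← ENNReal.coe_toReal, ← ENNReal.toReal_mul]
  exact ENNReal.toReal_mono (ENNReal.mul_ne_top (by simp) (Lp.memLp f).2.ne)
    (eLpNorm_integralOp_le hG.meas h1 h2 (Lp.memLp f).1)

lemma eLpNorm_integralOp_le_of_norm_opCLM_le {G : X → X → ℝ} (hG : IsBddKernel G) {C : ℝ≥0}
    (h : ‖opCLM σ hG‖ ≤ C) {φ : X → ℂ} (hφ : MemLp φ 2 σ) :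
    eLpNorm (integralOp σ G φ) 2 σ ≤ C * eLpNorm φ 2 σ := by
  have h1 := (opCLM σ hG).le_of_opNorm_le h (hφ.toLp φ)
  rw [opCLM_apply, Lp.norm_toLp, Lp.norm_toLp, integralOp_congr G hφ.coeFn_toLp] at h1
  rw [← ENNReal.toReal_le_toReal (hG.memLp hφ).2.ne (ENNReal.mul_ne_top (by simp) hφ.2.ne),
    ENNReal.toReal_mul]
  exact h1

/-- The kernel of a composition. -/
def compKernel (σ : Measure X) (G H : X → X → ℝ) (x w : X) : ℝ := ∫ y, G x y * H y w ∂σ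

lemma IsBddKernel.comp {G H : X → X → ℝ} (hG : IsBddKernel G) (hH : IsBddKernel H) :
    IsBddKernel (compKernel σ G H) := by
  obtain ⟨M, hM⟩ := hG.bdd
  obtain ⟨M', hM'⟩ := hH.bdd
  constructor
  · refine (StronglyMeasurable.integral_prod_right' (ν := σ)
      (f := fun p : (X × X) × X => G p.1.1 p.2 * H p.2 p.1.2) ?_).measurable
    refine Measurable.stronglyMeasurable ?_
    exact (hG.meas.comp ((measurable_fst.comp measurable_fst).prodMk measurable_snd)).mul
      (hH.meas.comp (measurable_snd.prodMk (measurable_snd.comp measurable_fst)))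
  · refine ⟨M * M' * σ.real univ, fun x w => ?_⟩
    rw [compKernel, ← Real.norm_eq_abs]
    refine norm_integral_le_of_norm_le_const (ae_of_all _ fun y => ?_)
    rw [norm_mul]
    exact mul_le_mul (hM _ _) (hM' _ _) (norm_nonneg _) ((abs_nonneg _).trans (hM x y))

/-- Fubini applies without restriction: both kernels are bounded and `L²` is contained in `L¹` for a
finite measure. -/
lemma opCLM_mul {G H : X → X → ℝ} (hG : IsBddKernel G) (hH : IsBddKernel H) :
    opCLM σ hG * opCLM σ hH = opCLM σ (hG.comp hH : IsBddKernel (compKernel σ G H)) := by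
  ext1 f
  refine Lp.ext ?_
  refine (coeFn_opCLM hG _).trans (EventuallyEq.trans ?_ (coeFn_opCLM _ f).symm)
  refine (integralOp_congr G (coeFn_opCLM hH f)).eventuallyEq.trans ?_
  refine ae_of_all _ fun x => ?_
  have hf : Integrable f σ := (Lp.memLp f).integrable one_le_two
  simp only [integralOp, compKernel]
  obtain ⟨M, hM⟩ := hG.bdd
  obtain ⟨M', hM'⟩ := hH.bdd
  have hinteg : Integrable (fun p : X × X => ((G x p.1 * H p.1 p.2 : ℝ) : ℂ) * f p.2) (σ.prod σ) := by
    refine (hf.comp_snd σ).bdd_mul (c := M * M') ?_ (ae_of_all _ fun p => ?_)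
    · refine (Complex.measurable_ofReal.comp ?_).aestronglyMeasurable
      exact (hG.meas.comp (measurable_const.prodMk measurable_fst)).mul hH.meas
    · rw [Complex.norm_real, norm_mul]
      exact mul_le_mul (hM _ _) (hM' _ _) (norm_nonneg _) ((abs_nonneg _).trans (hM x p.1))
  calc ∫ y, (G x y : ℂ) * ∫ w, (H y w : ℂ) * f w ∂σ ∂σ
      = ∫ y, ∫ w, ((G x y * H y w : ℝ) : ℂ) * f w ∂σ ∂σ := by
        congr 1; ext y
        rw [← integral_const_mul]
        congr 1; ext w
        push_cast; ring
    _ = ∫ w, ∫ y, ((G x y * H y w : ℝ) : ℂ) * f w ∂σ ∂σ := integral_integral_swap hinteg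
    _ = _ := by
        congr 1; ext w
        rw [integral_mul_const, integral_complex_ofReal]

lemma star_opCLM {G : X → X → ℝ} (hG : IsBddKernel G) :
    star (opCLM σ hG) = opCLM σ hG.flip := by
  rw [ContinuousLinearMap.star_eq_adjoint]
  symm
  rw [ContinuousLinearMap.eq_adjoint_iff]
  intro f g
  have hf : Integrable f σ := (Lp.memLp f).integrable one_le_two
  have hg : Integrable g σ := (Lp.memLp g).integrable one_le_two
  rw [L2.inner_def, L2.inner_def]
  have e1 : ∫ x, inner ℂ ((opCLM σ hG.flip f : Lp ℂ 2 σ) x) (g x) ∂σ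
      = ∫ x, ∫ y, (G y x : ℂ) * ((starRingEnd ℂ) (f y) * g x) ∂σ ∂σ := by
    refine integral_congr_ae ?_
    filter_upwards [coeFn_opCLM hG.flip f] with x hx
    rw [hx, RCLike.inner_apply', integralOp, ← integral_conj, ← integral_mul_const]
    congr 1; ext y
    simp; ring
  have e2 : ∫ y, inner ℂ (f y) ((opCLM σ hG g : Lp ℂ 2 σ) y) ∂σ
      = ∫ y, ∫ x, (G y x : ℂ) * ((starRingEnd ℂ) (f y) * g x) ∂σ ∂σ := by
    refine integral_congr_ae ?_
    filter_upwards [coeFn_opCLM hG g] with y hy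
    rw [hy, RCLike.inner_apply', integralOp, ← integral_const_mul]
    congr 1; ext x
    ring
  rw [e1, e2]
  refine integral_integral_swap (f := fun x y => (G y x : ℂ) * ((starRingEnd ℂ) (f y) * g x)) ?_
  obtain ⟨M, hM⟩ := hG.bdd
  refine Integrable.bdd_mul (c := M) ?_ ?_ (ae_of_all _ fun p => by simpa using hM p.2 p.1)
  · have hf' : Integrable (fun y => (starRingEnd ℂ) (f y)) σ :=
      (LinearIsometryEquiv.integrable_comp_iff (Complex.conjLIE)).2 hf
    have := (hg.mul_prod hf')
    refine this.congr (ae_of_all _ fun p => ?_)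
    simp [mul_comm]
  · exact (Complex.measurable_ofReal.comp (hG.meas.comp measurable_swap)).aestronglyMeasurable

end IntegralOperators

/-! ### Odd singular kernels on regular measures -/

section OpSums

variable {X : Type*} [MeasurableSpace X] {σ : Measure X} [IsFiniteMeasure σ]

lemma opCLM_eq_add {G H K : X → X → ℝ} (hG : IsBddKernel G) (hH : IsBddKernel H)
    (hK : IsBddKernel K) (h : ∀ x y, K x y = G x y + H x y) :
    opCLM σ hK = opCLM σ hG + opCLM σ hH := by
  obtain rfl : K = fun x y => G x y + H x y := by ext x y; exact h x y
  ext1 f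
  have hf : Integrable f σ := (Lp.memLp f).integrable one_le_two
  refine Lp.ext ?_
  rw [add_apply]
  filter_upwards [coeFn_opCLM hK f, coeFn_opCLM hG f, coeFn_opCLM hH f,
    Lp.coeFn_add (opCLM σ hG f) (opCLM σ hH f)] with x h1 h2 h3 h4
  rw [h4, h1, Pi.add_apply, h2, h3, integralOp_add_left hG hH hf, Pi.add_apply]

lemma opCLM_eq_sum {ι : Type*} [Fintype ι] {G : ι → X → X → ℝ} {K : X → X → ℝ}
    (hG : ∀ i, IsBddKernel (G i)) (hK : IsBddKernel K) (h : ∀ x y, K x y = ∑ i, G i x y) :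
    opCLM σ hK = ∑ i, opCLM σ (hG i) := by
  obtain rfl : K = fun x y => ∑ i, G i x y := by ext x y; exact h x y
  ext1 f
  have hf : Integrable f σ := (Lp.memLp f).integrable one_le_two
  refine Lp.ext ?_
  have hall : ∀ᵐ x ∂σ, ∀ i, opCLM σ (hG i) f x = integralOp σ (G i) f x :=
    ae_all_iff.2 fun i => coeFn_opCLM (hG i) f
  rw [sum_apply]
  filter_upwards [coeFn_opCLM hK f, hall,
    Lp.coeFn_finsetSum Finset.univ fun i => opCLM σ (hG i) f] with x h1 h2 h3
  rw [h1, h3, integralOp_sum_left _ (fun i _ => hG i) hf, Finset.sum_apply, Finset.sum_apply]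
  exact Finset.sum_congr rfl fun i _ => (h2 i).symm

end OpSums

section Singular

variable {E : Type*} [NormedAddCommGroup E]

/-- An odd Lipschitz function that lives on the scale `r` and is normalized in `L¹(ℝⁿ)`. -/
structure IsOddBump (n : ℕ) (A r : ℝ) (k : E → ℝ) : Prop where
  odd : ∀ z, k (-z) = -k z
  supp : ∀ z, r < ‖z‖ → k z = 0
  size : ∀ z, |k z| ≤ A / r ^ n
  lip : ∀ z w, |k z - k w| ≤ A / r ^ (n + 1) * ‖z - w‖

lemma IsOddBump.continuous {n : ℕ} {A r : ℝ} {k : E → ℝ} (hk : IsOddBump n A r k) :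
    Continuous k :=
  (LipschitzWith.of_dist_le' (K := A / r ^ (n + 1)) fun z w => by
    rw [Real.dist_eq, dist_eq_norm]; exact hk.lip z w).continuous

variable [MeasurableSpace E]

/-- `σ` is concentrated on `Γ`, balls of radius `r` centred on `Γ` have measure `O(rⁿ)`, and odd
kernels have cancellation. -/
structure IsSurfaceLike (σ : Measure E) (Γ : Set E) (n : ℕ) (C₀ C₁ : ℝ) : Prop where
  ae_mem : ∀ᵐ x ∂σ, x ∈ Γ
  measure_ball_le : ∀ x ∈ Γ, ∀ r, 0 < r → σ.real (Metric.closedBall x r) ≤ C₀ * r ^ n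
  abs_integral_le : ∀ x ∈ Γ, ∀ r, 0 < r → ∀ A, 0 ≤ A → ∀ k : E → ℝ, IsOddBump n A r k →
    |∫ y, k (x - y) ∂σ| ≤ C₁ * A * r

lemma compKernel_eq_zero {n : ℕ} {σ : Measure E} {r s A : ℝ} (hrs : r ≤ s)
    {k q : E → ℝ} (hk : IsOddBump n A r k) (hq : IsOddBump n A s q) {x w : E}
    (hxw : 2 * s < ‖x - w‖) :
    compKernel σ (fun x y => k (x - y)) (fun x y => q (x - y)) x w = 0 := by
  refine integral_eq_zero_of_ae (ae_of_all _ fun y => ?_)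
  rcases le_or_gt ‖x - y‖ r with hy | hy
  · have : s < ‖y - w‖ := by
      have := norm_sub_le_norm_sub_add_norm_sub x y w
      linarith
    simp [hq.supp _ this]
  · simp [hk.supp _ hy]

variable {n : ℕ} {σ : Measure E} [IsFiniteMeasure σ] {Γ : Set E} {C₀ C₁ : ℝ}

lemma lintegral_enorm_le_of_ball {x : E} {f : E → ℝ} {s B m : ℝ} (hB : 0 ≤ B)
    (hm : σ.real (Metric.closedBall x s) ≤ m)
    (hf : ∀ᵐ y ∂σ, |f y| ≤ B) (hf0 : ∀ᵐ y ∂σ, s < ‖x - y‖ → f y = 0) :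
    ∫⁻ y, ‖f y‖ₑ ∂σ ≤ ENNReal.ofReal (B * m) := by
  calc ∫⁻ y, ‖f y‖ₑ ∂σ
      ≤ ∫⁻ y, (Metric.closedBall x s).indicator (fun _ => ENNReal.ofReal B) y ∂σ := by
        refine lintegral_mono_ae ?_
        filter_upwards [hf, hf0] with y h1 h2
        by_cases hy : y ∈ Metric.closedBall x s
        · rw [indicator_of_mem hy, Real.enorm_eq_ofReal_abs]
          exact ENNReal.ofReal_le_ofReal h1
        · rw [mem_closedBall_iff_norm', not_le] at hy
          simp [h2 hy]
    _ ≤ ENNReal.ofReal B * σ (Metric.closedBall x s) := lintegral_indicator_const_le _ _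
    _ = ENNReal.ofReal (B * σ.real (Metric.closedBall x s)) := by
        rw [ENNReal.ofReal_mul hB, ofReal_measureReal]
    _ ≤ _ := ENNReal.ofReal_le_ofReal (mul_le_mul_of_nonneg_left hm hB)

lemma IsSurfaceLike.lintegral_bump_le (h : IsSurfaceLike σ Γ n C₀ C₁) {x : E} (hx : x ∈ Γ)
    {r : ℝ} (hr : 0 < r) {A : ℝ} (hA : 0 ≤ A) {k : E → ℝ} (hk : IsOddBump n A r k) :
    ∫⁻ y, ‖k (x - y)‖ₑ ∂σ ≤ ENNReal.ofReal (A * C₀) := by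
  refine (lintegral_enorm_le_of_ball (B := A / r ^ n) (by positivity)
    (h.measure_ball_le x hx r hr) (ae_of_all _ fun y => hk.size _)
    (ae_of_all _ fun y hy => hk.supp _ hy)).trans_eq ?_
  congr 1
  field_simp

/-- Transposing a real convolution-type kernel replaces `k (x - y)` by `k (y - x)`. This
skew-adjointness lets one estimate for products replace the two estimates (for `t i * star (t j)`
and `star (t i) * t j`) of the usual Cotlar–Stein lemma. -/
lemma star_opCLM_of_odd {k : E → ℝ} (hk : ∀ z, k (-z) = -k z)
    (hb : IsBddKernel fun x y : E => k (x - y)) :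
    star (opCLM σ hb) = -opCLM σ hb := by
  rw [star_opCLM]
  ext1 f
  refine Lp.ext ?_
  filter_upwards [coeFn_opCLM hb f, coeFn_opCLM hb.flip f, Lp.coeFn_neg (opCLM σ hb f)]
    with x h1 h2 h3
  rw [neg_apply, h2, h3, Pi.neg_apply, h1, integralOp, integralOp, ← integral_neg]
  congr 1; ext y
  rw [← neg_sub x y, hk]
  push_cast; ring

variable [BorelSpace E]

lemma IsOddBump.integrable {A r : ℝ} {k : E → ℝ} (hk : IsOddBump n A r k) (x : E) :
    Integrable (fun y => k (x - y)) σ :=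
  Integrable.of_bound (C := A / r ^ n)
    (hk.continuous.comp (continuous_const.sub continuous_id)).aestronglyMeasurable
    (ae_of_all _ fun _ => hk.size _)

/-- At the scale `r` of `k` the wider bump `q` is almost constant. Replacing `q (y - w)` by `q (x -
w)` costs the Lipschitz bound times `r`; what remains is a multiple of `∫ k (x - y)`, which is small
by cancellation. Either way a factor `r / s` is gained over the trivial bound `s ^ (-n)`. -/
lemma IsSurfaceLike.abs_compKernel_le (h : IsSurfaceLike σ Γ n C₀ C₁) (hC₀ : 0 ≤ C₀)
    (hC₁ : 0 ≤ C₁) {r s A : ℝ} (hr : 0 < r) (hrs : r ≤ s) (hs : s ≤ 1) (hA : 0 ≤ A)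
    {k q : E → ℝ} (hk : IsOddBump n A r k) (hq : IsOddBump n A s q) {x : E} (hx : x ∈ Γ) (w : E) :
    |compKernel σ (fun x y => k (x - y)) (fun x y => q (x - y)) x w|
      ≤ A ^ 2 * (C₀ + C₁) * (r / s) / s ^ n := by
  have hs0 : 0 < s := hr.trans_le hrs
  have hki := hk.integrable (σ := σ) x
  have hqi : Integrable (fun y => k (x - y) * (q (y - w) - q (x - w))) σ := by
    refine hki.mul_bdd (c := A / s ^ n + A / s ^ n) ?_ (ae_of_all _ fun y => ?_)
    · exact ((hq.continuous.comp (continuous_id.sub continuous_const)).sub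
        continuous_const).aestronglyMeasurable
    · exact (norm_sub_le _ _).trans (add_le_add (hq.size _) (hq.size _))
  have e : compKernel σ (fun x y => k (x - y)) (fun x y => q (x - y)) x w
      = ∫ y, k (x - y) * (q (y - w) - q (x - w)) ∂σ + q (x - w) * ∫ y, k (x - y) ∂σ := by
    rw [compKernel, ← integral_const_mul, ← integral_add hqi (hki.const_mul _)]
    congr 1; ext y; ring
  have hL1 : ∫ y, |k (x - y)| ∂σ ≤ A * C₀ := by
    have h1 := h.lintegral_bump_le hx hr hA hk
    rw [← ENNReal.toReal_le_toReal (ne_top_of_le_ne_top ENNReal.ofReal_ne_top h1)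
      ENNReal.ofReal_ne_top, ENNReal.toReal_ofReal (by positivity)] at h1
    rwa [← integral_norm_eq_lintegral_enorm hki.1] at h1
  have h1 : |∫ y, k (x - y) * (q (y - w) - q (x - w)) ∂σ| ≤ A / s ^ (n + 1) * r * (A * C₀) := by
    calc |∫ y, k (x - y) * (q (y - w) - q (x - w)) ∂σ|
        ≤ ∫ y, A / s ^ (n + 1) * r * |k (x - y)| ∂σ := by
          refine abs_integral_le_integral_abs.trans (integral_mono hqi.abs
            (hki.abs.const_mul _) fun y => ?_)
          simp only [abs_mul]
          rw [mul_comm]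
          rcases le_or_gt ‖x - y‖ r with hy | hy
          · refine mul_le_mul_of_nonneg_right ((hq.lip _ _).trans ?_) (abs_nonneg _)
            refine mul_le_mul_of_nonneg_left ?_ (by positivity)
            rwa [sub_sub_sub_cancel_right, norm_sub_rev]
          · simp [hk.supp _ hy]
      _ = A / s ^ (n + 1) * r * ∫ y, |k (x - y)| ∂σ := integral_const_mul _ _
      _ ≤ _ := mul_le_mul_of_nonneg_left hL1 (by positivity)
  have h2 : |q (x - w) * ∫ y, k (x - y) ∂σ| ≤ A / s ^ n * (C₁ * A * r) := by
    rw [abs_mul]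
    exact mul_le_mul (hq.size _) (h.abs_integral_le x hx r hr A hA k hk) (abs_nonneg _)
      (by positivity)
  rw [e]
  refine ((abs_add_le _ _).trans (add_le_add h1 h2)).trans ?_
  have e1 : A / s ^ (n + 1) * r * (A * C₀) = A ^ 2 * C₀ * (r / s) / s ^ n := by
    field_simp; ring
  have e2 : A / s ^ n * (C₁ * A * r) ≤ A ^ 2 * C₁ * (r / s) / s ^ n := by
    -- The only use of `s ≤ 1`: the cancellation term gains `r`, which is better than `r / s`.
    have : r ≤ r / s := (le_div_iff₀ hs0).2 (mul_le_of_le_one_right hr.le hs)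
    calc A / s ^ n * (C₁ * A * r) = A ^ 2 * C₁ * r / s ^ n := by ring
      _ ≤ _ := by gcongr
  rw [e1]
  calc _ ≤ A ^ 2 * C₀ * (r / s) / s ^ n + A ^ 2 * C₁ * (r / s) / s ^ n := by gcongr
    _ = _ := by ring

variable [SecondCountableTopology E]

lemma isBddKernel_sub {k : E → ℝ} (hk : Measurable k) {M : ℝ} (hM : ∀ z, |k z| ≤ M) :
    IsBddKernel fun x y : E => k (x - y) :=
  ⟨hk.comp (measurable_fst.sub measurable_snd), M, fun _ _ => hM _⟩

lemma IsOddBump.isBddKernel {A r : ℝ} {k : E → ℝ} (hk : IsOddBump n A r k) :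
    IsBddKernel fun x y : E => k (x - y) :=
  isBddKernel_sub hk.continuous.measurable hk.size

/-- Compositions of odd bumps on different scales are small. -/
lemma IsSurfaceLike.norm_opCLM_mul_le (h : IsSurfaceLike σ Γ n C₀ C₁) (hC₀ : 0 ≤ C₀)
    (hC₁ : 0 ≤ C₁) {r s A : ℝ} (hr : 0 < r) (hrs : r ≤ s) (hs : s ≤ 1) (hA : 0 ≤ A)
    {k q : E → ℝ} (hk : IsOddBump n A r k) (hq : IsOddBump n A s q) :
    ‖opCLM σ hk.isBddKernel * opCLM σ hq.isBddKernel‖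
      ≤ 2 ^ n * C₀ * (C₀ + C₁) * A ^ 2 * (r / s) := by
  have hs0 : 0 < s := hr.trans_le hrs
  have hD : 0 ≤ 2 ^ n * C₀ * (C₀ + C₁) * A ^ 2 * (r / s) := by positivity
  have key : ∀ x ∈ Γ, ∀ f : E → ℝ, (∀ᵐ y ∂σ, |f y| ≤ A ^ 2 * (C₀ + C₁) * (r / s) / s ^ n) →
      (∀ᵐ y ∂σ, 2 * s < ‖x - y‖ → f y = 0) →
      ∫⁻ y, ‖f y‖ₑ ∂σ ≤ ENNReal.ofReal (2 ^ n * C₀ * (C₀ + C₁) * A ^ 2 * (r / s)) := by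
    intro x hx f hf hf0
    -- The composed kernel lives on a ball of radius `2 * s`, whose measure `C₀ * (2 * s) ^ n`
    -- cancels `s ^ n` and leaves `2 ^ n`.
    refine (lintegral_enorm_le_of_ball (by positivity) (h.measure_ball_le x hx (2 * s)
      (by positivity)) hf hf0).trans ?_
    refine ENNReal.ofReal_le_ofReal (le_of_eq ?_)
    rw [mul_pow]
    field_simp
  rw [opCLM_mul, ← Real.coe_toNNReal _ hD]
  refine norm_opCLM_le _ ?_ ?_
  · filter_upwards [h.ae_mem] with x hx
    exact key x hx _ (ae_of_all _ fun w => h.abs_compKernel_le hC₀ hC₁ hr hrs hs hA hk hq hx w)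
      (ae_of_all _ fun w hw => compKernel_eq_zero hrs hk hq hw)
  · filter_upwards [h.ae_mem] with w hw
    refine key w hw _ ?_ (ae_of_all _ fun x hx => compKernel_eq_zero hrs hk hq ?_)
    · filter_upwards [h.ae_mem] with x hx
      exact h.abs_compKernel_le hC₀ hC₁ hr hrs hs hA hk hq hx w
    · rwa [norm_sub_rev]

/-- The opposite order is the adjoint of the first, since both factors are skew-adjoint and the two
signs cancel. -/
lemma IsSurfaceLike.norm_opCLM_mul_le' (h : IsSurfaceLike σ Γ n C₀ C₁) (hC₀ : 0 ≤ C₀)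
    (hC₁ : 0 ≤ C₁) {r s A : ℝ} (hr : 0 < r) (hrs : r ≤ s) (hs : s ≤ 1) (hA : 0 ≤ A)
    {k q : E → ℝ} (hk : IsOddBump n A r k) (hq : IsOddBump n A s q) :
    ‖opCLM σ hq.isBddKernel * opCLM σ hk.isBddKernel‖
      ≤ 2 ^ n * C₀ * (C₀ + C₁) * A ^ 2 * (r / s) := by
  rw [← norm_star, star_mul, star_opCLM_of_odd hk.odd, star_opCLM_of_odd hq.odd, neg_mul_neg]
  exact h.norm_opCLM_mul_le hC₀ hC₁ hr hrs hs hA hk hq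

/-! ### Dyadic decomposition of homogeneous-type kernels -/

section StdKernel

variable {E : Type*} [NormedAddCommGroup E]

/-- Functions with the size and the smoothness of a homogeneous function of degree `m`. -/
structure IsStdKernel (m : ℤ) (A : ℝ) (k : E → ℝ) : Prop where
  size : ∀ z, z ≠ 0 → |k z| ≤ A * ‖z‖ ^ m
  smooth : ∀ z w, z ≠ 0 → ‖z - w‖ ≤ ‖z‖ / 2 → |k z - k w| ≤ A * ‖z‖ ^ (m - 1) * ‖z - w‖

/-- A Lipschitz cutoff function, `1` on `[0, 1/2]` and `0` on `[1, ∞)`. -/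
def cut (t : ℝ) : ℝ := max 0 (min 1 (2 - 2 * t))

lemma cut_nonneg (t : ℝ) : 0 ≤ cut t := le_max_left _ _

lemma cut_le_one (t : ℝ) : cut t ≤ 1 := max_le zero_le_one (min_le_left _ _)

lemma cut_eq_zero {t : ℝ} (h : 1 ≤ t) : cut t = 0 :=
  max_eq_left ((min_le_right _ _).trans (by linarith))

lemma cut_eq_one {t : ℝ} (h : t ≤ 1 / 2) : cut t = 1 := by
  rw [cut, min_eq_left (by linarith), max_eq_right zero_le_one]

lemma continuous_cut : Continuous cut := by unfold cut; fun_prop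

lemma abs_cut_sub_cut_le (s t : ℝ) : |cut s - cut t| ≤ 2 * |s - t| := by
  unfold cut
  refine (abs_max_sub_max_le_max _ _ _ _).trans (max_le (by simp) ?_)
  refine (abs_min_sub_min_le_max _ _ _ _).trans (max_le (by simp) ?_)
  rw [show 2 - 2 * s - (2 - 2 * t) = -(2 * (s - t)) by ring, abs_neg, abs_mul, abs_two]

/-- A cutoff to the annulus `r/4 ≤ ‖z‖ ≤ r`. -/
def annulus (r : ℝ) (z : E) : ℝ := cut (‖z‖ / r) - cut (2 * ‖z‖ / r)

lemma abs_annulus_le (r : ℝ) (z : E) : |annulus r z| ≤ 1 := by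
  rw [annulus, abs_le]
  constructor <;> linarith [cut_nonneg (‖z‖ / r), cut_nonneg (2 * ‖z‖ / r), cut_le_one (‖z‖ / r),
    cut_le_one (2 * ‖z‖ / r)]

lemma annulus_eq_zero_of_lt {r : ℝ} (hr : 0 < r) {z : E} (hz : r < ‖z‖) : annulus r z = 0 := by
  rw [annulus, cut_eq_zero ((one_le_div hr).2 hz.le), cut_eq_zero ((one_le_div hr).2 (by linarith)),
    sub_zero]

lemma annulus_eq_zero_of_le {r : ℝ} (hr : 0 < r) {z : E} (hz : ‖z‖ ≤ r / 4) :
    annulus r z = 0 := by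
  rw [annulus, cut_eq_one ((div_le_iff₀ hr).2 (by linarith)),
    cut_eq_one ((div_le_iff₀ hr).2 (by linarith)), sub_self]

lemma abs_annulus_sub_le {r : ℝ} (hr : 0 < r) (z w : E) :
    |annulus r z - annulus r w| ≤ 6 / r * ‖z - w‖ := by
  have h1 := abs_cut_sub_cut_le (‖z‖ / r) (‖w‖ / r)
  have h2 := abs_cut_sub_cut_le (2 * ‖z‖ / r) (2 * ‖w‖ / r)
  have h3 := abs_norm_sub_norm_le z w
  have e1 : |‖z‖ / r - ‖w‖ / r| = |‖z‖ - ‖w‖| / r := by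
    rw [← sub_div, abs_div, abs_of_pos hr]
  have e2 : |2 * ‖z‖ / r - 2 * ‖w‖ / r| = 2 * |‖z‖ - ‖w‖| / r := by
    rw [← sub_div, abs_div, abs_of_pos hr, ← mul_sub, abs_mul, abs_two]
  rw [e1] at h1
  rw [e2] at h2
  calc |annulus r z - annulus r w|
      = |(cut (‖z‖ / r) - cut (‖w‖ / r)) - (cut (2 * ‖z‖ / r) - cut (2 * ‖w‖ / r))| := by
        rw [annulus, annulus]; ring_nf
    _ ≤ _ := abs_sub _ _
    _ ≤ 2 * (|‖z‖ - ‖w‖| / r) + 2 * (2 * |‖z‖ - ‖w‖| / r) := add_le_add h1 h2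
    _ = 6 / r * |‖z‖ - ‖w‖| := by ring
    _ ≤ _ := mul_le_mul_of_nonneg_left h3 (by positivity)

/-- On the support of the cutoff `‖z‖` is comparable to `r`, so powers of `‖z‖` turn into powers of
`r` at the price of powers of `4`. -/
lemma IsStdKernel.isOddBump {n : ℕ} {A : ℝ} (hA : 0 ≤ A) {k : E → ℝ}
    (hk : IsStdKernel (-n : ℤ) A k) (hodd : ∀ z, k (-z) = -k z) {r : ℝ} (hr : 0 < r) :
    IsOddBump n (16 * 4 ^ n * A) r fun z => k z * annulus r z := by
  have hsz : ∀ z, r / 4 ≤ ‖z‖ → |k z| ≤ 4 ^ n * A / r ^ n := fun z hz => by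
    have hz0 : 0 < ‖z‖ := lt_of_lt_of_le (by positivity) hz
    refine (hk.size z (norm_pos_iff.1 hz0)).trans ?_
    rw [zpow_neg, zpow_natCast, ← div_eq_mul_inv]
    calc A / ‖z‖ ^ n ≤ A / (r / 4) ^ n := by gcongr
      _ = _ := by rw [div_pow]; field_simp
  have hsize : ∀ z, |k z * annulus r z| ≤ 4 ^ n * A / r ^ n := fun z => by
    rcases le_or_gt ‖z‖ (r / 4) with hz | hz
    · rw [annulus_eq_zero_of_le hr hz, mul_zero, abs_zero]; positivity
    · rw [abs_mul]
      exact (mul_le_of_le_one_right (abs_nonneg _) (abs_annulus_le r z)).trans (hsz z hz.le)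
  -- The threshold `r / 8` lies below `‖z‖ / 2`, so the smoothness hypothesis on `k` applies to the
  -- pair.
  have hlip : ∀ z w, r / 4 < ‖z‖ → ‖z - w‖ < r / 8 →
      |k z * annulus r z - k w * annulus r w| ≤ 16 * 4 ^ n * A / r ^ (n + 1) * ‖z - w‖ := by
    intro z w hz hzw
    have hz0 : 0 < ‖z‖ := lt_trans (by positivity) hz
    have h1 : |k z - k w| ≤ 4 ^ (n + 1) * A / r ^ (n + 1) * ‖z - w‖ := by
      refine (hk.smooth z w (norm_pos_iff.1 hz0) (by linarith)).trans
        (mul_le_mul_of_nonneg_right ?_ (norm_nonneg _))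
      rw [show (-n - 1 : ℤ) = -((n + 1 : ℕ) : ℤ) by push_cast; ring, zpow_neg, zpow_natCast,
        ← div_eq_mul_inv]
      calc A / ‖z‖ ^ (n + 1) ≤ A / (r / 4) ^ (n + 1) := by gcongr
        _ = _ := by rw [div_pow]; field_simp
    have h2 : |k z| * |annulus r z - annulus r w| ≤ 4 ^ n * A / r ^ n * (6 / r * ‖z - w‖) :=
      mul_le_mul (hsz z hz.le) (abs_annulus_sub_le hr z w) (abs_nonneg _) (by positivity)
    calc |k z * annulus r z - k w * annulus r w|
        = |(k z - k w) * annulus r w + k z * (annulus r z - annulus r w)| := by ring_nf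
      _ ≤ |k z - k w| * 1 + |k z| * |annulus r z - annulus r w| := by
          refine (abs_add_le _ _).trans ?_
          rw [abs_mul, abs_mul]
          gcongr
          exact abs_annulus_le r w
      _ ≤ 4 ^ (n + 1) * A / r ^ (n + 1) * ‖z - w‖ + 4 ^ n * A / r ^ n * (6 / r * ‖z - w‖) := by
          rw [mul_one]; exact add_le_add h1 h2
      _ = 10 * (4 ^ n * A / r ^ (n + 1) * ‖z - w‖) := by field_simp; ring
      _ ≤ 16 * (4 ^ n * A / r ^ (n + 1) * ‖z - w‖) := by
          refine mul_le_mul_of_nonneg_right (by norm_num) (by positivity)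
      _ = _ := by ring
  refine ⟨fun z => ?_, fun z hz => ?_, fun z => ?_, fun z w => ?_⟩
  · simp only [hodd, annulus, norm_neg, neg_mul]
  · rw [annulus_eq_zero_of_lt hr hz, mul_zero]
  · refine (hsize z).trans ?_
    gcongr
    nlinarith [pow_pos (by norm_num : (0 : ℝ) < 4) n,
      mul_nonneg (pow_pos (by norm_num : (0 : ℝ) < 4) n).le hA]
  · rcases lt_or_ge ‖z - w‖ (r / 8) with hzw | hzw
    · rcases lt_or_ge (r / 4) ‖z‖ with hz | hz
      · exact hlip z w hz hzw
      · rcases lt_or_ge (r / 4) ‖w‖ with hw | hw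
        · rw [abs_sub_comm, norm_sub_rev]
          exact hlip w z hw (by rwa [norm_sub_rev])
        · rw [annulus_eq_zero_of_le hr hz, annulus_eq_zero_of_le hr hw]
          simp only [mul_zero, sub_zero, abs_zero]
          positivity
    -- For points at distance at least `r / 8` the size bound is already a Lipschitz bound.
    · refine (abs_sub _ _).trans ((add_le_add (hsize z) (hsize w)).trans ?_)
      calc 4 ^ n * A / r ^ n + 4 ^ n * A / r ^ n = 16 * 4 ^ n * A / r ^ (n + 1) * (r / 8) := by
            field_simp; ring
        _ ≤ _ := by gcongr

/-- Telescoping, because the inner cutoff of one annulus is the outer cutoff of the next. -/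
lemma sum_annulus (z : E) (J : ℕ) :
    ∑ j ∈ Finset.range J, annulus ((1 / 2 : ℝ) ^ j) z
      = cut ‖z‖ - cut (‖z‖ / (1 / 2 : ℝ) ^ J) := by
  induction J with
  | zero => simp
  | succ J ih =>
    rw [Finset.sum_range_succ, ih, annulus]
    have : ‖z‖ / (1 / 2 : ℝ) ^ (J + 1) = 2 * ‖z‖ / (1 / 2 : ℝ) ^ J := by
      rw [pow_succ]; field_simp
    rw [this]; ring

lemma sum_pow_dist_le {q : ℝ} (hq0 : 0 ≤ q) (hq1 : q < 1) (J i : ℕ) :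
    ∑ j ∈ Finset.range J, q ^ (Nat.dist i j) ≤ 2 * (1 - q)⁻¹ := by
  have hgeo : ∀ s : Finset ℕ, ∑ m ∈ s, q ^ m ≤ (1 - q)⁻¹ := fun s => by
    rw [← tsum_geometric_of_lt_one hq0 hq1]
    exact (summable_geometric_of_lt_one hq0 hq1).sum_le_tsum s fun m _ => by positivity
  have h1 : ∑ j ∈ (Finset.range J).filter (· ≤ i), q ^ (Nat.dist i j) ≤ (1 - q)⁻¹ := by
    refine le_trans (le_of_eq ?_) (hgeo (((Finset.range J).filter (· ≤ i)).image fun j => i - j))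
    rw [Finset.sum_image]
    · refine Finset.sum_congr rfl fun j hj => ?_
      rw [Nat.dist_eq_sub_of_le_right (Finset.mem_filter.1 hj).2]
    · intro a ha b hb hab
      simp only [Finset.coe_filter, Finset.mem_range, mem_ofPred_eq] at ha hb hab
      omega
  have h2 : ∑ j ∈ (Finset.range J).filter (¬ · ≤ i), q ^ (Nat.dist i j) ≤ (1 - q)⁻¹ := by
    refine le_trans (le_of_eq ?_) (hgeo (((Finset.range J).filter (¬ · ≤ i)).image fun j => j - i))
    rw [Finset.sum_image]
    · refine Finset.sum_congr rfl fun j hj => ?_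
      rw [Nat.dist_eq_sub_of_le (not_le.1 (Finset.mem_filter.1 hj).2).le]
    · intro a ha b hb hab
      simp only [Finset.coe_filter, Finset.mem_range, mem_ofPred_eq] at ha hb hab
      omega
  rw [← Finset.sum_filter_add_sum_filter_not (Finset.range J) (· ≤ i)]
  linarith

end StdKernel

/-- The dyadic pieces of an odd standard kernel add up to a bounded operator. -/
lemma IsSurfaceLike.norm_sum_opCLM_le (h : IsSurfaceLike σ Γ n C₀ C₁) (hC₀ : 0 ≤ C₀)
    (hC₁ : 0 ≤ C₁) {A : ℝ} (hA : 0 < A) (J : ℕ) {k : Fin J → E → ℝ}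
    (hk : ∀ i : Fin J, IsOddBump n A ((1 / 2 : ℝ) ^ (i : ℕ)) (k i)) :
    ‖∑ i, opCLM σ (hk i).isBddKernel‖
      ≤ (√(2 ^ n * C₀ * (C₀ + C₁)) + 1) * A * (2 * (1 - √(1 / 2))⁻¹) := by
  -- The almost orthogonality lemma needs the identity operator to have norm one, which fails on the
  -- zero space.
  rcases subsingleton_or_nontrivial (Lp ℂ 2 σ) with hs | hs
  · have : ∑ i, opCLM σ (hk i).isBddKernel = 0 := by
      ext1 f; exact Subsingleton.elim _ _
    have hq : √(1 / 2 : ℝ) < 1 := by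
      rw [Real.sqrt_lt' one_pos]; norm_num
    have : 0 ≤ 1 - √(1 / 2 : ℝ) := by linarith
    rw [‹∑ i, _ = _›, norm_zero]; positivity
  have hq : √(1 / 2 : ℝ) < 1 := by
    rw [Real.sqrt_lt' one_pos]; norm_num
  have hq' : 0 < 1 - √(1 / 2 : ℝ) := by linarith
  set D := √(2 ^ n * C₀ * (C₀ + C₁)) + 1 with hD
  have hD0 : 0 < D := by positivity
  have hD2 : 2 ^ n * C₀ * (C₀ + C₁) ≤ D ^ 2 := by
    have h0 : 0 ≤ 2 ^ n * C₀ * (C₀ + C₁) := by positivity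
    have h1 := Real.sq_sqrt h0
    have h2 := Real.sqrt_nonneg (2 ^ n * C₀ * (C₀ + C₁))
    nlinarith
  -- Products of pieces are bounded by `c i j ^ 2`, so a decay `(1/2) ^ |i - j|` of the products
  -- gives the ratio `√(1/2)` for the weights.
  refine norm_sum_le_of_almost_orthogonal (c := fun i j : Fin J => D * A * √(1 / 2) ^ Nat.dist i j)
    (mul_pos (mul_pos hD0 hA) (mul_pos two_pos (inv_pos.2 hq'))) (fun i j => by positivity) (fun i => ?_)
    (fun i => star_opCLM_of_odd (hk i).odd _) (fun i j => ?_)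
  · rw [← Finset.mul_sum]
    refine mul_le_mul_of_nonneg_left ?_ (by positivity)
    rw [Fin.sum_univ_eq_sum_range fun j => √(1 / 2 : ℝ) ^ Nat.dist i j]
    exact sum_pow_dist_le (Real.sqrt_nonneg _) hq J i
  · have e : (D * A * √(1 / 2) ^ Nat.dist i j) ^ 2 = D ^ 2 * A ^ 2 * (1 / 2) ^ Nat.dist i j := by
      rw [mul_pow, mul_pow, ← pow_mul, mul_comm (Nat.dist _ _), pow_mul,
        Real.sq_sqrt (by norm_num)]
    rw [e]
    have hr : ∀ i : ℕ, 0 < (1 / 2 : ℝ) ^ i := fun i => by positivity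
    rcases le_total (i : ℕ) j with hij | hij
    · refine (h.norm_opCLM_mul_le' hC₀ hC₁ (hr j) (pow_le_pow_of_le_one (by norm_num)
        (by norm_num) hij) (pow_le_one₀ (by norm_num) (by norm_num)) hA.le (hk j) (hk i)).trans ?_
      rw [Nat.dist_eq_sub_of_le hij, pow_sub₀ _ (by norm_num) hij, ← div_eq_mul_inv]
      gcongr
    · refine (h.norm_opCLM_mul_le hC₀ hC₁ (hr i) (pow_le_pow_of_le_one (by norm_num)
        (by norm_num) hij) (pow_le_one₀ (by norm_num) (by norm_num)) hA.le (hk i) (hk j)).trans ?_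
      rw [Nat.dist_eq_sub_of_le_right hij, pow_sub₀ _ (by norm_num) hij, ← div_eq_mul_inv]
      gcongr

/-- Odd standard kernels of degree `-n` define bounded operators on `L²`, with a bound that does
not depend on the size of the kernel near the diagonal. -/
theorem IsSurfaceLike.exists_norm_opCLM_le (h : IsSurfaceLike σ Γ n C₀ C₁) (hC₀ : 0 ≤ C₀)
    (hC₁ : 0 ≤ C₁) (hn : 1 ≤ n) :
    ∃ C : ℝ, 0 ≤ C ∧ ∀ A, 0 < A → ∀ k : E → ℝ, Measurable k → (∀ z, k (-z) = -k z) →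
      IsStdKernel (-n : ℤ) A k → ∀ hb : IsBddKernel (fun x y : E => k (x - y)),
        ‖opCLM σ hb‖ ≤ C * A := by
  set Q := (√(2 ^ n * C₀ * (C₀ + C₁)) + 1) * (16 * 4 ^ n) * (2 * (1 - √(1 / 2 : ℝ))⁻¹) with hQ
  have hq : √(1 / 2 : ℝ) < 1 := by
    rw [Real.sqrt_lt' one_pos]; norm_num
  have hq' : 0 < 1 - √(1 / 2 : ℝ) := by linarith
  -- The three summands are the parts of the kernel at distance of order one and more, in the dyadic
  -- annuli, and next to the diagonal.
  refine ⟨2 ^ n * σ.real univ + Q + 1, by positivity, fun A hA k hkm hodd hk hb => ?_⟩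
  obtain ⟨M, hM⟩ : ∃ M : ℝ, ∀ z, |k z| ≤ M := by
    obtain ⟨M, hM⟩ := hb.bdd
    exact ⟨M, fun z => by simpa using hM z 0⟩
  have hM0 : 0 ≤ M := (abs_nonneg _).trans (hM 0)
  -- The number of annuli depends on the supremum `M` of the kernel and is chosen so large that the
  -- innermost part has norm at most `A`. Since the bound for the annuli does not depend on `J`, `M`
  -- drops out of the result.
  obtain ⟨J, hJ⟩ : ∃ J : ℕ, M * C₀ * (1 / 2 : ℝ) ^ J ≤ A := by
    have h1 : Tendsto (fun J : ℕ => M * C₀ * (1 / 2 : ℝ) ^ J) atTop (𝓝 (M * C₀ * 0)) :=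
      (tendsto_pow_atTop_nhds_zero_of_lt_one (by norm_num) (by norm_num)).const_mul _
    rw [mul_zero] at h1
    exact ((h1.eventually_lt_const hA).exists).imp fun _ h => h.le
  have hbump := fun i : Fin J => hk.isOddBump hA.le hodd (r := (1 / 2 : ℝ) ^ (i : ℕ)) (by positivity)
  set kf : E → ℝ := fun z => k z * (1 - cut ‖z‖) with hkf
  set kn : E → ℝ := fun z => k z * cut (‖z‖ / (1 / 2 : ℝ) ^ J) with hkn
  have hkfb : ∀ z, |kf z| ≤ 2 ^ n * A := fun z => by
    rcases le_or_gt ‖z‖ (1 / 2) with hz | hz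
    · simp only [hkf, cut_eq_one hz, sub_self, mul_zero, abs_zero]; positivity
    · have hz0 : 0 < ‖z‖ := by linarith
      have h1 := hk.size z (norm_pos_iff.1 hz0)
      rw [zpow_neg, zpow_natCast, ← div_eq_mul_inv] at h1
      have h2 : A / ‖z‖ ^ n ≤ A / (1 / 2) ^ n := by gcongr
      have h3 : A / (1 / 2) ^ n = 2 ^ n * A := by rw [div_pow, one_pow]; field_simp
      have h4 : |1 - cut ‖z‖| ≤ 1 := by
        rw [abs_le]; constructor <;> linarith [cut_nonneg ‖z‖, cut_le_one ‖z‖]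
      rw [hkf, abs_mul]
      exact (mul_le_of_le_one_right (abs_nonneg _) h4).trans (by linarith)
  have hknb : ∀ z, |kn z| ≤ M := fun z => by
    rw [hkn, abs_mul]
    refine (mul_le_of_le_one_right (abs_nonneg _) ?_).trans (hM z)
    rw [abs_of_nonneg (cut_nonneg _)]; exact cut_le_one _
  have hkfm : IsBddKernel fun x y : E => kf (x - y) :=
    isBddKernel_sub (hkm.mul ((measurable_const.sub (continuous_cut.measurable.comp measurable_norm))))
      hkfb
  have hknm : IsBddKernel fun x y : E => kn (x - y) :=
    isBddKernel_sub (hkm.mul (continuous_cut.measurable.comp (measurable_norm.div_const _))) hknb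
  have hsum : IsBddKernel fun x y : E => ∑ i : Fin J, k (x - y) * annulus ((1 / 2 : ℝ) ^ (i : ℕ)) (x - y) :=
    IsBddKernel.finset_sum fun i _ => (hbump i).isBddKernel
  have hop : opCLM σ hb = opCLM σ (hkfm.add hknm) + ∑ i, opCLM σ (hbump i).isBddKernel := by
    rw [← opCLM_eq_sum (fun i => (hbump i).isBddKernel) hsum fun _ _ => rfl]
    refine opCLM_eq_add _ _ _ fun x y => ?_
    rw [← Finset.mul_sum, Fin.sum_univ_eq_sum_range fun i => annulus ((1 / 2 : ℝ) ^ i) (x - y),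
      sum_annulus]
    simp only [hkf, hkn]; ring
  have hadd : opCLM σ (hkfm.add hknm) = opCLM σ hkfm + opCLM σ hknm :=
    opCLM_eq_add _ _ _ fun _ _ => rfl
  have h1 : ‖opCLM σ hkfm‖ ≤ 2 ^ n * A * σ.real univ := by
    have hle : ∀ f : E → ℝ, (∀ y, |f y| ≤ 2 ^ n * A) →
        ∫⁻ y, ‖f y‖ₑ ∂σ ≤ ENNReal.ofReal (2 ^ n * A * σ.real univ) := fun f hf => by
      rw [ENNReal.ofReal_mul (by positivity), ofReal_measureReal, ← lintegral_const]
      refine lintegral_mono fun y => ?_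
      rw [Real.enorm_eq_ofReal_abs]
      exact ENNReal.ofReal_le_ofReal (hf y)
    rw [← Real.coe_toNNReal (2 ^ n * A * σ.real univ) (by positivity)]
    exact norm_opCLM_le _ (ae_of_all _ fun x => hle _ fun y => hkfb _)
      (ae_of_all _ fun y => hle _ fun x => hkfb _)
  have h2 : ‖opCLM σ hknm‖ ≤ A := by
    have hle : ∀ x ∈ Γ, ∀ f : E → ℝ, (∀ y, |f y| ≤ M) → (∀ y, (1 / 2) ^ J < ‖x - y‖ → f y = 0) →
        ∫⁻ y, ‖f y‖ₑ ∂σ ≤ ENNReal.ofReal A := fun x hx f hf hf0 => by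
      refine (lintegral_enorm_le_of_ball hM0 (h.measure_ball_le x hx ((1 / 2) ^ J) (by positivity))
        (ae_of_all _ hf) (ae_of_all _ hf0)).trans (ENNReal.ofReal_le_ofReal (le_trans ?_ hJ))
      rw [mul_assoc]
      gcongr
      exact pow_le_of_le_one (by positivity) (pow_le_one₀ (by norm_num) (by norm_num)) (by omega)
    have hz : ∀ z : E, (1 / 2) ^ J < ‖z‖ → kn z = 0 := fun z hz => by
      simp only [hkn]
      rw [cut_eq_zero ((one_le_div (by positivity)).2 hz.le), mul_zero]
    rw [← Real.coe_toNNReal A hA.le]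
    refine norm_opCLM_le _ ?_ ?_
    · filter_upwards [h.ae_mem] with x hx
      exact hle x hx _ (fun y => hknb _) fun y hy => hz _ hy
    · filter_upwards [h.ae_mem] with x hx
      exact hle x hx _ (fun y => hknb _) fun y hy => hz _ (by rwa [norm_sub_rev])
  have h3 := h.norm_sum_opCLM_le hC₀ hC₁ (A := 16 * 4 ^ n * A) (by positivity) J hbump
  rw [hop, hadd]
  calc _ ≤ (2 ^ n * A * σ.real univ + A) + Q * A := by
        refine (norm_add_le _ _).trans (add_le_add ((norm_add_le _ _).trans (add_le_add h1 h2))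
          (h3.trans_eq ?_))
        rw [hQ]; ring
    _ = _ := by ring

end Singular

/-! ### Weakly singular kernels -/

section WeaklySingular

variable {E : Type*} [NormedAddCommGroup E] [MeasurableSpace E]
  {n : ℕ} {σ : Measure E} [IsFiniteMeasure σ] {Γ : Set E} {C₀ C₁ : ℝ}

/-- Lets the diagonal be ignored, where the singular kernels carry no information. -/
lemma IsSurfaceLike.measure_singleton (h : IsSurfaceLike σ Γ n C₀ C₁) (hn : 1 ≤ n) {x : E}
    (hx : x ∈ Γ) : σ {x} = 0 := by
  rw [← measureReal_eq_zero_iff]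
  refine le_antisymm ?_ measureReal_nonneg
  have h1 : Tendsto (fun r : ℝ => C₀ * r ^ n) (𝓝[>] 0) (𝓝 0) := by
    have : Tendsto (fun r : ℝ => C₀ * r ^ n) (𝓝 0) (𝓝 (C₀ * 0 ^ n)) :=
      ((continuous_const.mul (continuous_pow n)).tendsto 0)
    rw [zero_pow (by omega), mul_zero] at this
    exact this.mono_left nhdsWithin_le_nhds
  refine ge_of_tendsto h1 ?_
  filter_upwards [self_mem_nhdsWithin] with r hr
  refine le_trans (measureReal_mono ?_) (h.measure_ball_le x hx r hr)
  simp [le_of_lt (mem_Ioi.1 hr)]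

variable [BorelSpace E]

/-- `∫ ‖x - y‖^{β-n} dσ(y)` is bounded uniformly in `x ∈ Γ`. -/
theorem IsSurfaceLike.exists_lintegral_rpow_le (h : IsSurfaceLike σ Γ n C₀ C₁) (hC₀ : 0 ≤ C₀)
    {β : ℝ} (hβ : 0 < β) (hβn : β ≤ n) :
    ∃ C : ℝ, 0 ≤ C ∧ ∀ x ∈ Γ, ∫⁻ y, ENNReal.ofReal (‖x - y‖ ^ (β - n)) ∂σ ≤ ENNReal.ofReal C := by
  -- The shell `2⁻ʲ⁻¹ < ‖x - y‖ ≤ 2⁻ʲ` contributes about `2^(-j(β-n)) · 2^(-jn) = q ^ j`, a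
  -- convergent geometric series because `β > 0`.
  set q : ℝ := (1 / 2 : ℝ) ^ β with hq
  have hq0 : 0 < q := by positivity
  have hq1 : q < 1 := Real.rpow_lt_one (by norm_num) (by norm_num) hβ
  set c : ℕ → ℝ := fun j => ((1 / 2 : ℝ) ^ (j + 1)) ^ (β - n) with hc
  have hcC : ∀ j, c j * (C₀ * ((1 / 2 : ℝ) ^ j) ^ n) = C₀ * (1 / 2 : ℝ) ^ (β - n) * q ^ j := by
    intro j
    have h1 : c j = (1 / 2 : ℝ) ^ (β - n) * (q ^ j * (((1 / 2 : ℝ) ^ j) ^ n)⁻¹) := by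
      rw [hc, hq]
      simp only
      rw [pow_succ, Real.mul_rpow (by positivity) (by positivity), mul_comm,
        Real.rpow_sub (x := (1 / 2 : ℝ) ^ j) (by positivity), Real.rpow_natCast,
        Real.rpow_pow_comm (by norm_num), div_eq_mul_inv (((1 / 2 : ℝ) ^ j) ^ β)]
    rw [h1]; field_simp
  set S : ℝ := C₀ * (1 / 2 : ℝ) ^ (β - n) * (1 - q)⁻¹ with hS
  have h1q : 0 < 1 - q := by linarith
  have hS0 : 0 ≤ S := mul_nonneg (by positivity) (inv_nonneg.2 h1q.le)
  refine ⟨σ.real univ + S, by positivity, fun x hx => ?_⟩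
  have hpt : ∀ y, ENNReal.ofReal (‖x - y‖ ^ (β - n)) ≤ 1 +
      ∑' j : ℕ, (Metric.closedBall x ((1 / 2 : ℝ) ^ j)).indicator
        (fun _ => ENNReal.ofReal (c j)) y := by
    intro y
    rcases lt_or_ge ‖x - y‖ 1 with hr | hr
    · rcases (norm_nonneg (x - y)).eq_or_lt' with h0 | h0
      -- At `y = x` the real power of zero is `0`, or `1` when `β = n`; the summand `1` covers both.
      · rw [h0]
        refine le_add_right ?_
        rw [← ENNReal.ofReal_one]
        refine ENNReal.ofReal_le_ofReal ?_
        rcases eq_or_ne (β - n) 0 with he | he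
        · simp [he]
        · rw [Real.zero_rpow he]; exact zero_le_one
      · obtain ⟨j, hj1, hj2⟩ := exists_nat_pow_near_of_lt_one h0 hr.le
          (by norm_num : (0 : ℝ) < 1 / 2) (by norm_num)
        refine le_add_left (le_trans ?_ (ENNReal.le_tsum j))
        rw [indicator_of_mem (by rwa [mem_closedBall_iff_norm'])]
        exact ENNReal.ofReal_le_ofReal
          (Real.rpow_le_rpow_of_nonpos (by positivity) hj1.le (by linarith))
    · refine le_add_right ?_
      rw [← ENNReal.ofReal_one]
      exact ENNReal.ofReal_le_ofReal (Real.rpow_le_one_of_one_le_of_nonpos hr (by linarith))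
  calc ∫⁻ y, ENNReal.ofReal (‖x - y‖ ^ (β - n)) ∂σ
      ≤ ∫⁻ y, (1 + ∑' j : ℕ, (Metric.closedBall x ((1 / 2 : ℝ) ^ j)).indicator
        (fun _ => ENNReal.ofReal (c j)) y) ∂σ := lintegral_mono hpt
    _ = σ univ + ∑' j : ℕ, ENNReal.ofReal (c j) * σ (Metric.closedBall x ((1 / 2 : ℝ) ^ j)) := by
        rw [lintegral_add_left measurable_const, lintegral_one, lintegral_tsum]
        · congr 2; ext j
          rw [lintegral_indicator_const Metric.isClosed_closedBall.measurableSet]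
        · intro j
          exact (measurable_const.indicator Metric.isClosed_closedBall.measurableSet).aemeasurable
    _ ≤ σ univ + ∑' j : ℕ, ENNReal.ofReal (C₀ * (1 / 2 : ℝ) ^ (β - n) * q ^ j) := by
        gcongr with j
        rw [← hcC, ENNReal.ofReal_mul (by positivity), ← ofReal_measureReal]
        gcongr
        exact h.measure_ball_le x hx _ (by positivity)
    _ = _ := by
        have hs : Summable fun j : ℕ => C₀ * (1 / 2 : ℝ) ^ (β - n) * q ^ j :=
          (summable_geometric_of_lt_one hq0.le hq1).mul_left _
        rw [← ENNReal.ofReal_tsum_of_nonneg (fun j => by positivity) hs, tsum_mul_left,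
          tsum_geometric_of_lt_one hq0.le hq1, ENNReal.ofReal_add (by positivity) hS0,
          ofReal_measureReal]

end WeaklySingular

/-! ### Radial symbols -/

section Radial

/-- `a(t²)` behaves like `t^{-p}`, together with two derivatives. -/
structure IsSymbol (p : ℕ) (A : ℝ) (a : ℝ → ℝ) : Prop where
  contDiffOn : ContDiffOn ℝ 2 a (Ioi 0)
  bound₀ : ∀ t, 0 < t → |a (t ^ 2)| ≤ A / t ^ p
  bound₁ : ∀ t, 0 < t → |deriv a (t ^ 2)| ≤ A / t ^ (p + 2)
  bound₂ : ∀ t, 0 < t → |deriv (deriv a) (t ^ 2)| ≤ A / t ^ (p + 4)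

lemma IsSymbol.contDiffOn_deriv {p : ℕ} {A : ℝ} {a : ℝ → ℝ} (ha : IsSymbol p A a) :
    ContDiffOn ℝ 1 (deriv a) (Ioi 0) :=
  ha.contDiffOn.deriv_of_isOpen isOpen_Ioi (by norm_num)

lemma IsSymbol.nonneg {p : ℕ} {A : ℝ} {a : ℝ → ℝ} (ha : IsSymbol p A a) : 0 ≤ A := by
  simpa using (abs_nonneg _).trans (ha.bound₀ 1 one_pos)

/-- Moving the singularity of a symbol off the half line does not affect its bounds. -/
lemma IsSymbol.shift {p : ℕ} {A : ℝ} {a : ℝ → ℝ} (ha : IsSymbol p A a) (ε : ℝ) :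
    IsSymbol p A fun s => a (s + ε ^ 2) := by
  have hA := ha.nonneg
  have hd : deriv (fun s => a (s + ε ^ 2)) = fun s => deriv a (s + ε ^ 2) := by
    ext s; exact deriv_comp_add_const _ _ _
  have hd2 : deriv (deriv fun s => a (s + ε ^ 2)) = fun s => deriv (deriv a) (s + ε ^ 2) := by
    rw [hd]; ext s; exact deriv_comp_add_const _ _ _
  -- Use the bound at `√(t² + ε²)`, which is at least `t`; negative powers only decrease. Hence
  -- every later estimate is uniform in `ε`.
  have key : ∀ (f : ℝ → ℝ) (m : ℕ), (∀ t, 0 < t → |f (t ^ 2)| ≤ A / t ^ m) → ∀ t, 0 < t →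
      |f (t ^ 2 + ε ^ 2)| ≤ A / t ^ m := fun f m hf t ht => by
    have h1 : 0 < t ^ 2 + ε ^ 2 := by positivity
    have h2 := hf (√(t ^ 2 + ε ^ 2)) (Real.sqrt_pos.2 h1)
    rw [Real.sq_sqrt h1.le] at h2
    refine h2.trans ?_
    gcongr
    exact Real.le_sqrt_of_sq_le (by linarith [sq_nonneg ε])
  refine ⟨?_, key _ _ ha.bound₀, ?_, ?_⟩
  · refine ha.contDiffOn.comp (by fun_prop) fun s hs => ?_
    exact lt_of_lt_of_le (mem_Ioi.1 hs) (by simpa using sq_nonneg ε)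
  · rw [hd]; exact key _ _ ha.bound₁
  · rw [hd2]; exact key _ _ ha.bound₂

variable {E : Type*} [NormedAddCommGroup E]

lemma IsStdKernel.mul {m₁ m₂ : ℤ} {A₁ A₂ : ℝ} (hA₁ : 0 ≤ A₁) (hA₂ : 0 ≤ A₂) {k q : E → ℝ}
    (hk : IsStdKernel m₁ A₁ k) (hq : IsStdKernel m₂ A₂ q) :
    IsStdKernel (m₁ + m₂) (3 * A₁ * A₂) fun z => k z * q z := by
  refine ⟨fun z hz => ?_, fun z w hz hzw => ?_⟩
  · have hz0 : 0 < ‖z‖ := norm_pos_iff.2 hz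
    rw [abs_mul, zpow_add₀ hz0.ne']
    calc |k z| * |q z| ≤ (A₁ * ‖z‖ ^ m₁) * (A₂ * ‖z‖ ^ m₂) :=
          mul_le_mul (hk.size z hz) (hq.size z hz) (abs_nonneg _) (by positivity)
      _ = 1 * A₁ * A₂ * (‖z‖ ^ m₁ * ‖z‖ ^ m₂) := by ring
      _ ≤ _ := by gcongr; norm_num
  · have hz0 : 0 < ‖z‖ := norm_pos_iff.2 hz
    have hqw : |q w| ≤ 2 * A₂ * ‖z‖ ^ m₂ := by
      have h1 := hq.smooth z w hz hzw
      have h2 : A₂ * ‖z‖ ^ (m₂ - 1) * ‖z - w‖ ≤ A₂ * ‖z‖ ^ m₂ := by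
        rw [zpow_sub_one₀ hz0.ne']
        calc A₂ * (‖z‖ ^ m₂ * ‖z‖⁻¹) * ‖z - w‖ ≤ A₂ * (‖z‖ ^ m₂ * ‖z‖⁻¹) * ‖z‖ := by
              gcongr; linarith
          _ = _ := by field_simp
      have h3 := hq.size z hz
      have h4 : |q w| ≤ |q z| + |q z - q w| := by
        have := abs_sub (q z) (q z - q w)
        rwa [sub_sub_cancel] at this
      linarith
    calc |k z * q z - k w * q w| = |(k z - k w) * q w + k z * (q z - q w)| := by ring_nf
      _ ≤ |k z - k w| * |q w| + |k z| * |q z - q w| := by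
          refine (abs_add_le _ _).trans_eq ?_
          rw [abs_mul, abs_mul]
      _ ≤ (A₁ * ‖z‖ ^ (m₁ - 1) * ‖z - w‖) * (2 * A₂ * ‖z‖ ^ m₂)
          + (A₁ * ‖z‖ ^ m₁) * (A₂ * ‖z‖ ^ (m₂ - 1) * ‖z - w‖) := by
          refine add_le_add (mul_le_mul (hk.smooth z w hz hzw) hqw (abs_nonneg _) (by positivity))
            (mul_le_mul (hk.size z hz) (hq.smooth z w hz hzw) (abs_nonneg _) (by positivity))
      _ = _ := by
          rw [show m₁ + m₂ - 1 = m₁ + (m₂ - 1) by ring, zpow_add₀ hz0.ne',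
            zpow_sub_one₀ hz0.ne', zpow_sub_one₀ hz0.ne']
          ring

lemma isStdKernel_linear (ℓ : E →+ ℝ) (hℓ : ∀ z, |ℓ z| ≤ ‖z‖) : IsStdKernel 1 1 ℓ := by
  refine ⟨fun z _ => by simpa using hℓ z, fun z w _ _ => ?_⟩
  rw [← map_sub]
  simpa using hℓ (z - w)

/-- The mean value inequality in the variable `‖z‖²`. The condition `‖z - w‖ ≤ ‖z‖ / 2` keeps both
squared norms above `(‖z‖ / 2) ^ 2`, where the derivative is under control. -/
lemma isStdKernel_radial {p : ℕ} {A : ℝ} {f : ℝ → ℝ} (hf : DifferentiableOn ℝ f (Ioi 0))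
    (h0 : ∀ t, 0 < t → |f (t ^ 2)| ≤ A / t ^ p)
    (h1 : ∀ t, 0 < t → |deriv f (t ^ 2)| ≤ A / t ^ (p + 2)) :
    IsStdKernel (-p : ℤ) (3 * 2 ^ (p + 2) * A) fun z : E => f (‖z‖ ^ 2) := by
  have hA : 0 ≤ A := by simpa using (abs_nonneg _).trans (h0 1 one_pos)
  refine ⟨fun z hz => ?_, fun z w hz hzw => ?_⟩
  · have hz0 : 0 < ‖z‖ := norm_pos_iff.2 hz
    rw [zpow_neg, zpow_natCast, ← div_eq_mul_inv]
    refine (h0 _ hz0).trans ?_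
    gcongr
    have : (1 : ℝ) ≤ 2 ^ (p + 2) := one_le_pow₀ (by norm_num)
    nlinarith
  · have hz0 : 0 < ‖z‖ := norm_pos_iff.2 hz
    have hw1 : ‖z‖ / 2 ≤ ‖w‖ := by
      have := norm_sub_norm_le z w; linarith
    have hw2 : ‖w‖ ≤ 3 / 2 * ‖z‖ := by
      have := norm_sub_norm_le w z; rw [norm_sub_rev] at this; linarith
    have hmv : ‖f (‖z‖ ^ 2) - f (‖w‖ ^ 2)‖
        ≤ A / (‖z‖ / 2) ^ (p + 2) * ‖‖z‖ ^ 2 - ‖w‖ ^ 2‖ := by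
      refine (convex_Ici ((‖z‖ / 2) ^ 2)).norm_image_sub_le_of_norm_deriv_le (𝕜 := ℝ)
        (fun s hs => ?_) (fun s hs => ?_) ?_ ?_
      · have hs0 : 0 < s := lt_of_lt_of_le (by positivity) (mem_Ici.1 hs)
        exact (hf s hs0).differentiableAt (Ioi_mem_nhds hs0)
      · have hs0 : 0 < s := lt_of_lt_of_le (by positivity) (mem_Ici.1 hs)
        have := h1 (√s) (Real.sqrt_pos.2 hs0)
        rw [Real.sq_sqrt hs0.le] at this
        refine this.trans ?_
        gcongr
        exact Real.le_sqrt_of_sq_le (mem_Ici.1 hs)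
      · exact mem_Ici.2 (by gcongr)
      · exact mem_Ici.2 (by gcongr; linarith)
    have h3 : ‖‖z‖ ^ 2 - ‖w‖ ^ 2‖ ≤ 3 * ‖z‖ * ‖z - w‖ := by
      rw [sq_sub_sq, norm_mul, Real.norm_eq_abs, Real.norm_eq_abs, abs_of_nonneg (by positivity)]
      refine mul_le_mul (by linarith) (abs_norm_sub_norm_le z w) (abs_nonneg _) (by positivity)
    rw [← Real.norm_eq_abs]
    refine hmv.trans ((mul_le_mul_of_nonneg_left h3 (by positivity)).trans_eq ?_)
    rw [show (-p - 1 : ℤ) = -((p + 1 : ℕ) : ℤ) by push_cast; ring, zpow_neg, zpow_natCast, div_pow]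
    field_simp
    ring

lemma IsSymbol.isStdKernel {p : ℕ} {A : ℝ} {a : ℝ → ℝ} (ha : IsSymbol p A a) :
    IsStdKernel (-p : ℤ) (3 * 2 ^ (p + 2) * A) fun z : E => a (‖z‖ ^ 2) :=
  isStdKernel_radial (ha.contDiffOn.differentiableOn (by norm_num)) ha.bound₀ ha.bound₁

lemma IsSymbol.isStdKernel_deriv {p : ℕ} {A : ℝ} {a : ℝ → ℝ} (ha : IsSymbol p A a) :
    IsStdKernel (-(p + 2 : ℕ) : ℤ) (3 * 2 ^ (p + 2 + 2) * A) fun z : E => deriv a (‖z‖ ^ 2) :=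
  isStdKernel_radial (ha.contDiffOn_deriv.differentiableOn (by norm_num)) ha.bound₁ ha.bound₂

end Radial

/-! ### The fundamental solution as a function of the squared distance -/

section Entire

/-- Factorial decay makes the radius of convergence infinite, so the sum is analytic on the whole
line, including `s = 0`. -/
lemma contDiff_tsum_pow {c : ℕ → ℝ} {C κ : ℝ} (hc : ∀ m, |c m| ≤ C * (κ ^ m / m.factorial)) :
    ContDiff ℝ ∞ fun s : ℝ => ∑' m, c m * s ^ m := by
  have hrad : (FormalMultilinearSeries.ofScalars ℝ c).radius = ⊤ := by
    refine FormalMultilinearSeries.radius_eq_top_of_summable_norm _ fun r => ?_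
    refine Summable.of_nonneg_of_le (fun m => by positivity) (fun m => ?_)
      ((Real.summable_pow_div_factorial (κ * r)).mul_left C)
    rw [FormalMultilinearSeries.ofScalars_norm, Real.norm_eq_abs, mul_pow]
    calc |c m| * (r : ℝ) ^ m ≤ C * (κ ^ m / m.factorial) * (r : ℝ) ^ m := by gcongr; exact hc m
      _ = _ := by ring
  have h := (FormalMultilinearSeries.ofScalars ℝ c).hasFPowerSeriesOnBall (by rw [hrad]; simp)
  rw [hrad] at h
  have han : AnalyticOnNhd ℝ (FormalMultilinearSeries.ofScalars ℝ c).sum univ := by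
    intro x _
    exact h.analyticAt_of_mem (by simp)
  have he : (fun s : ℝ => ∑' m, c m * s ^ m) = (FormalMultilinearSeries.ofScalars ℝ c).sum := by
    ext s
    simp [FormalMultilinearSeries.sum, mul_comm]
  rw [he]
  exact han.contDiff

/-- By the functional equation the reciprocals decrease in absolute value once `μ + m + 1 ≥ 1`; only
finitely many terms precede. -/
lemma exists_abs_inv_Gamma_le (μ : ℝ) : ∃ C : ℝ, ∀ m : ℕ, |(Real.Gamma (μ + m + 1))⁻¹| ≤ C := by
  set b : ℕ → ℝ := fun m => |(Real.Gamma (μ + m + 1))⁻¹| with hb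
  obtain ⟨M, hM⟩ := exists_nat_ge (-μ)
  have hstep : ∀ m, M ≤ m → b (m + 1) ≤ b m := fun m hm => by
    have h1 : (1 : ℝ) ≤ μ + m + 1 := by
      have : (M : ℝ) ≤ m := by exact_mod_cast hm
      linarith
    have h2 : Real.Gamma (μ + (m + 1 : ℕ) + 1) = (μ + m + 1) * Real.Gamma (μ + m + 1) := by
      rw [← Real.Gamma_add_one (by linarith)]
      congr 1; push_cast; ring
    simp only [hb]
    rw [h2, mul_inv, abs_mul]
    refine mul_le_of_le_one_left (abs_nonneg _) ?_
    rw [abs_inv, abs_of_nonneg (by linarith)]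
    exact inv_le_one_of_one_le₀ h1
  refine ⟨∑ i ∈ Finset.range (M + 1), b i, fun m => ?_⟩
  have hle : ∀ i ≤ M, b i ≤ ∑ i ∈ Finset.range (M + 1), b i := fun i hi =>
    Finset.single_le_sum (f := b) (fun j _ => abs_nonneg _) (Finset.mem_range.2 (by omega))
  rcases le_total m M with hm | hm
  · exact hle m hm
  · induction m, hm using Nat.le_induction with
    | base => exact hle M le_rfl
    | succ m hm ih => exact (hstep m hm).trans ih

/-- The entire function in `J_μ(k√s) = (k√s/2)^μ (besselEntire k μ s)`. -/
def besselEntire (k μ s : ℝ) : ℝ :=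
  ∑' m : ℕ, ((-1) ^ m * (k ^ 2 / 4) ^ m / (m.factorial * Real.Gamma (μ + m + 1))) * s ^ m

lemma contDiff_besselEntire (k μ : ℝ) : ContDiff ℝ ∞ (besselEntire k μ) := by
  obtain ⟨C, hC⟩ := exists_abs_inv_Gamma_le μ
  refine contDiff_tsum_pow (C := C) (κ := k ^ 2 / 4) fun m => ?_
  have h1 : (-1 : ℝ) ^ m * (k ^ 2 / 4) ^ m / (m.factorial * Real.Gamma (μ + m + 1))
      = (-1) ^ m * ((Real.Gamma (μ + m + 1))⁻¹ * ((k ^ 2 / 4) ^ m / m.factorial)) := by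
    rw [div_eq_mul_inv, mul_inv]; ring
  rw [h1, abs_mul, abs_pow, abs_neg, abs_one, one_pow, one_mul, abs_mul,
    abs_of_nonneg (by positivity : 0 ≤ (k ^ 2 / 4) ^ m / (m.factorial : ℝ))]
  exact mul_le_mul_of_nonneg_right (hC m) (by positivity)

lemma besselJ_eq (k μ : ℝ) (r : ℝ) :
    besselJ μ (k * r) = (k * r / 2) ^ μ * besselEntire k μ (r ^ 2) := by
  rw [besselJ, besselEntire]
  congr 1
  refine tsum_congr fun m => ?_
  rw [show (k * r) ^ 2 / 4 = k ^ 2 / 4 * r ^ 2 by ring, mul_pow]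
  ring

/-- The logarithmic growth is not needed: a linear bound is absorbed by one of the two factorials in
the series of `besselYEntire`. -/
lemma abs_digammaSucc_le (m : ℕ) :
    |digammaSucc m| ≤ |Real.eulerMascheroniConstant| + m := by
  have h1 : (0 : ℝ) ≤ (harmonic m : ℝ) ∧ (harmonic m : ℝ) ≤ m := by
    induction m with
    | zero => simp
    | succ m ih =>
      rw [harmonic_succ]
      push_cast
      have h2 : (0 : ℝ) ≤ ((m : ℝ) + 1)⁻¹ := by positivity
      have h3 : ((m : ℝ) + 1)⁻¹ ≤ 1 := inv_le_one_of_one_le₀ (by linarith [m.cast_nonneg (α := ℝ)])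
      constructor <;> linarith [ih.1, ih.2]
  rw [digammaSucc]
  refine (abs_add_le _ _).trans ?_
  rw [abs_neg, abs_of_nonneg h1.1]
  linarith [h1.2]

/-- The entire function in the last term of `Y_N`. -/
def besselYEntire (k : ℝ) (N : ℕ) (s : ℝ) : ℝ :=
  ∑' j : ℕ, ((digammaSucc j + digammaSucc (N + j)) * (-(k ^ 2 / 4)) ^ j
        / (j.factorial * (N + j).factorial)) * s ^ j

lemma contDiff_besselYEntire (k : ℝ) (N : ℕ) : ContDiff ℝ ∞ (besselYEntire k N) := by
  refine contDiff_tsum_pow (C := 2 * (|Real.eulerMascheroniConstant| + 1)) (κ := k ^ 2 / 4)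
    fun j => ?_
  set γ := |Real.eulerMascheroniConstant|
  have hγ : 0 ≤ γ := abs_nonneg _
  have hf1 : (1 : ℝ) ≤ (N + j).factorial := by exact_mod_cast Nat.factorial_pos _
  have hf2 : ((N + j : ℕ) : ℝ) ≤ (N + j).factorial := by exact_mod_cast Nat.self_le_factorial _
  have hd : |digammaSucc j + digammaSucc (N + j)| ≤ 2 * (γ + 1) * (N + j).factorial := by
    have h1 := abs_digammaSucc_le j
    have h2 := abs_digammaSucc_le (N + j)
    have h3 : (j : ℝ) ≤ ((N + j : ℕ) : ℝ) := by push_cast; linarith [N.cast_nonneg (α := ℝ)]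
    have := abs_add_le (digammaSucc j) (digammaSucc (N + j))
    nlinarith
  rw [abs_div, abs_mul, abs_pow, abs_neg, abs_of_nonneg (by positivity : 0 ≤ k ^ 2 / 4),
    abs_of_nonneg (by positivity : (0 : ℝ) ≤ j.factorial * (N + j).factorial), div_le_iff₀
    (by positivity)]
  calc |digammaSucc j + digammaSucc (N + j)| * (k ^ 2 / 4) ^ j
      ≤ 2 * (γ + 1) * (N + j).factorial * (k ^ 2 / 4) ^ j := by gcongr
    _ = _ := by field_simp

lemma rpow_mul_rpow_eq {k r : ℝ} (hk : 0 < k) (hr : 0 < r) (ν : ℝ) :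
    (k / (2 * Real.pi * r)) ^ ν * (k * r / 2) ^ ν = (k ^ 2 / (4 * Real.pi)) ^ ν := by
  have := Real.pi_pos
  rw [← Real.mul_rpow (by positivity) (by positivity)]
  congr 1
  field_simp
  ring

lemma rpow_mul_rpow_neg_eq {k r : ℝ} (hk : 0 < k) (hr : 0 < r) (ν : ℝ) :
    (k / (2 * Real.pi * r)) ^ ν * (k * r / 2) ^ (-ν) = Real.pi ^ (-ν) * (r ^ 2) ^ (-ν) := by
  have := Real.pi_pos
  rw [Real.rpow_neg (by positivity), Real.rpow_neg (by positivity), Real.rpow_neg (by positivity),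
    ← Real.inv_rpow (by positivity), ← Real.inv_rpow (by positivity), ← Real.inv_rpow (by positivity),
    ← Real.mul_rpow (by positivity) (by positivity), ← Real.mul_rpow (by positivity) (by positivity)]
  congr 1
  field_simp

/-- The normalizing power turns `(k r / 2) ^ ν` into a constant and `(k r / 2) ^ (-ν)` into a
multiple of `(r²) ^ (-ν)`, so that only functions of `r²` remain. For integer `ν` the finite sum in
`Y_N` gives `P` and the logarithm gives `Q`; otherwise `J_{-ν}` gives `P` and no logarithm occurs.
-/
theorem exists_besselY_eq {k : ℝ} (hk : 0 < k) {ν : ℝ} :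
    ∃ P Q S : ℝ → ℝ, ContDiff ℝ ∞ P ∧ ContDiff ℝ ∞ Q ∧ ContDiff ℝ ∞ S ∧ ∀ r, 0 < r →
      (k / (2 * Real.pi * r)) ^ ν * besselY ν (k * r)
        = (r ^ 2) ^ (-ν) * P (r ^ 2) + Real.log (r ^ 2) * Q (r ^ 2) + S (r ^ 2) := by
  have hpi := Real.pi_pos
  set c := (k ^ 2 / (4 * Real.pi)) ^ ν with hc
  by_cases hν : ν = (⌊ν⌋₊ : ℝ)
  · set N := ⌊ν⌋₊ with hN
    refine ⟨fun s => -(Real.pi ^ (-ν) / Real.pi) *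
        ∑ j ∈ Finset.range N, ((N - j - 1).factorial : ℝ) / j.factorial * (k ^ 2 / 4 * s) ^ j,
      fun s => c / Real.pi * besselEntire k ν s,
      fun s => 2 / Real.pi * Real.log (k / 2) * c * besselEntire k ν s
        - c / Real.pi * besselYEntire k N s, ?_, ?_, ?_, ?_⟩
    · fun_prop
    · exact contDiff_const.mul (contDiff_besselEntire _ _)
    · exact (contDiff_const.mul (contDiff_besselEntire _ _)).sub
        (contDiff_const.mul (contDiff_besselYEntire _ _))
    · intro r hr
      have h1 := rpow_mul_rpow_eq hk hr ν
      have h2 := rpow_mul_rpow_neg_eq hk hr ν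
      rw [← hc] at h1
      have hlog : Real.log (k * r / 2) = 1 / 2 * Real.log (r ^ 2) + Real.log (k / 2) := by
        rw [Real.log_pow, show k * r / 2 = r * (k / 2) by ring, Real.log_mul (by positivity)
          (by positivity)]
        push_cast; ring
      have hYE : ∑' j : ℕ, (digammaSucc j + digammaSucc (N + j)) * (-((k * r) ^ 2 / 4)) ^ j
          / (j.factorial * (N + j).factorial) = besselYEntire k N (r ^ 2) := by
        rw [besselYEntire]
        refine tsum_congr fun j => ?_
        rw [show -((k * r) ^ 2 / 4) = -(k ^ 2 / 4) * r ^ 2 by ring, mul_pow]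
        ring
      have hJ : besselJ (N : ℝ) (k * r) = (k * r / 2) ^ ν * besselEntire k ν (r ^ 2) := by
        rw [← hν]; exact besselJ_eq k ν r
      have hpow : (k * r / 2) ^ N = (k * r / 2) ^ ν := by rw [hν, Real.rpow_natCast]
      rw [besselY, if_pos hν, besselYNat, hYE, hJ, hlog, hpow,
        show (k * r) ^ 2 / 4 = k ^ 2 / 4 * r ^ 2 by ring, ← Real.rpow_neg (by positivity)]
      simp only [← hN]
      set T := ∑ j ∈ Finset.range N, ((N - j - 1).factorial : ℝ) / j.factorial
        * (k ^ 2 / 4 * r ^ 2) ^ j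
      set u := (k / (2 * Real.pi * r)) ^ ν
      set v := (k * r / 2) ^ ν
      set w := (k * r / 2) ^ (-ν)
      set L := Real.log (r ^ 2)
      set L' := Real.log (k / 2)
      set eJ := besselEntire k ν (r ^ 2)
      set eY := besselYEntire k N (r ^ 2)
      calc _ = -((u * w) / Real.pi) * T + 2 / Real.pi * (1 / 2 * L + L') * ((u * v) * eJ)
            - (u * v) / Real.pi * eY := by ring
        _ = _ := by rw [h1, h2]; ring
  · refine ⟨fun s => -(Real.pi ^ (-ν) / Real.sin (ν * Real.pi)) * besselEntire k (-ν) s, fun _ => 0,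
      fun s => Real.cos (ν * Real.pi) / Real.sin (ν * Real.pi) * c * besselEntire k ν s,
      contDiff_const.mul (contDiff_besselEntire _ _), contDiff_const,
      contDiff_const.mul (contDiff_besselEntire _ _), fun r hr => ?_⟩
    have h1 := rpow_mul_rpow_eq hk hr ν
    have h2 := rpow_mul_rpow_neg_eq hk hr ν
    rw [← hc] at h1
    rw [besselY, if_neg hν, besselJ_eq, besselJ_eq]
    set u := (k / (2 * Real.pi * r)) ^ ν
    set v := (k * r / 2) ^ ν
    set w := (k * r / 2) ^ (-ν)
    calc _ = ((u * v) * besselEntire k ν (r ^ 2) * Real.cos (ν * Real.pi)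
          - (u * w) * besselEntire k (-ν) (r ^ 2)) / Real.sin (ν * Real.pi) := by ring
      _ = _ := by rw [h1, h2]; ring

end Entire

/-! ### Calculus of functions with an algebraic singularity at the origin -/

section Symbols

/-- `f` and its first `m` derivatives are, near `0`, bounded like those of `s^{-p}`. -/
def IsLocalSymbol : ℕ → ℝ → (ℝ → ℝ) → Prop
  | 0, p, f => ∀ R : ℝ, ∃ C : ℝ, ∀ s, 0 < s → s ≤ R → |f s| ≤ C * s ^ (-p)
  | m + 1, p, f => (∀ R : ℝ, ∃ C : ℝ, ∀ s, 0 < s → s ≤ R → |f s| ≤ C * s ^ (-p)) ∧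
      DifferentiableOn ℝ f (Ioi 0) ∧ IsLocalSymbol m (p + 1) (deriv f)

namespace IsLocalSymbol

variable {m : ℕ} {p q : ℝ} {f g : ℝ → ℝ}

lemma bound (h : IsLocalSymbol m p f) :
    ∀ R : ℝ, ∃ C : ℝ, ∀ s, 0 < s → s ≤ R → |f s| ≤ C * s ^ (-p) := by
  cases m with
  | zero => exact h
  | succ m => exact h.1

lemma congr (h : IsLocalSymbol m p f) (hfg : EqOn f g (Ioi 0)) : IsLocalSymbol m p g := by
  have hb : ∀ {p : ℝ} {f g : ℝ → ℝ}, EqOn f g (Ioi 0) →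
      (∀ R : ℝ, ∃ C : ℝ, ∀ s, 0 < s → s ≤ R → |f s| ≤ C * s ^ (-p)) →
      ∀ R : ℝ, ∃ C : ℝ, ∀ s, 0 < s → s ≤ R → |g s| ≤ C * s ^ (-p) := fun hfg h R => by
    obtain ⟨C, hC⟩ := h R
    exact ⟨C, fun s hs hsR => by rw [← hfg hs]; exact hC s hs hsR⟩
  induction m generalizing p f g with
  | zero => exact hb hfg h
  | succ m ih =>
    refine ⟨hb hfg h.1, h.2.1.congr fun s hs => (hfg hs).symm, ih h.2.2 fun s hs => ?_⟩
    exact Filter.EventuallyEq.deriv_eq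
      (Filter.eventuallyEq_of_mem (Ioi_mem_nhds (mem_Ioi.1 hs)) hfg)

/-- Raising the order is harmless because only `s ≤ R` matters: the spare factor `s ^ (q - p)` is
bounded there. -/
lemma bound_mono (hpq : p ≤ q)
    (h : ∀ R : ℝ, ∃ C : ℝ, ∀ s, 0 < s → s ≤ R → |f s| ≤ C * s ^ (-p)) :
    ∀ R : ℝ, ∃ C : ℝ, ∀ s, 0 < s → s ≤ R → |f s| ≤ C * s ^ (-q) := fun R => by
  obtain ⟨C, hC⟩ := h R
  refine ⟨|C| * |R| ^ (q - p), fun s hs hsR => (hC s hs hsR).trans ?_⟩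
  have h1 : s ^ (-p) = s ^ (q - p) * s ^ (-q) := by
    rw [← Real.rpow_add hs]; ring_nf
  rw [h1, ← mul_assoc]
  refine mul_le_mul_of_nonneg_right (mul_le_mul (le_abs_self C) ?_ (by positivity)
    (abs_nonneg _)) (by positivity)
  exact Real.rpow_le_rpow hs.le (hsR.trans (le_abs_self R)) (by linarith)

lemma mono (h : IsLocalSymbol m p f) (hpq : p ≤ q) : IsLocalSymbol m q f := by
  induction m generalizing p q f with
  | zero => exact bound_mono hpq h
  | succ m ih => exact ⟨bound_mono hpq h.1, h.2.1, ih h.2.2 (by linarith)⟩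

lemma of_succ (h : IsLocalSymbol (m + 1) p f) : IsLocalSymbol m p f := by
  induction m generalizing p f with
  | zero => exact h.1
  | succ m ih => exact ⟨h.1, h.2.1, ih h.2.2⟩

lemma add (hf : IsLocalSymbol m p f) (hg : IsLocalSymbol m p g) :
    IsLocalSymbol m p fun s => f s + g s := by
  have hb : ∀ {p : ℝ} {f g : ℝ → ℝ},
      (∀ R : ℝ, ∃ C : ℝ, ∀ s, 0 < s → s ≤ R → |f s| ≤ C * s ^ (-p)) →
      (∀ R : ℝ, ∃ C : ℝ, ∀ s, 0 < s → s ≤ R → |g s| ≤ C * s ^ (-p)) →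
      ∀ R : ℝ, ∃ C : ℝ, ∀ s, 0 < s → s ≤ R → |f s + g s| ≤ C * s ^ (-p) := fun hf hg R => by
    obtain ⟨C, hC⟩ := hf R
    obtain ⟨C', hC'⟩ := hg R
    refine ⟨C + C', fun s hs hsR => (abs_add_le _ _).trans ?_⟩
    rw [add_mul]
    exact add_le_add (hC s hs hsR) (hC' s hs hsR)
  induction m generalizing p f g with
  | zero => exact hb hf hg
  | succ m ih =>
    refine ⟨hb hf.1 hg.1, hf.2.1.add hg.2.1, (ih hf.2.2 hg.2.2).congr fun s hs => ?_⟩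
    exact (deriv_fun_add ((hf.2.1 s hs).differentiableAt (Ioi_mem_nhds hs))
      ((hg.2.1 s hs).differentiableAt (Ioi_mem_nhds hs))).symm

lemma mul (hf : IsLocalSymbol m p f) (hg : IsLocalSymbol m q g) :
    IsLocalSymbol m (p + q) fun s => f s * g s := by
  have hb : ∀ {p q : ℝ} {f g : ℝ → ℝ},
      (∀ R : ℝ, ∃ C : ℝ, ∀ s, 0 < s → s ≤ R → |f s| ≤ C * s ^ (-p)) →
      (∀ R : ℝ, ∃ C : ℝ, ∀ s, 0 < s → s ≤ R → |g s| ≤ C * s ^ (-q)) →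
      ∀ R : ℝ, ∃ C : ℝ, ∀ s, 0 < s → s ≤ R → |f s * g s| ≤ C * s ^ (-(p + q)) := by
    intro p q f g hf hg R
    obtain ⟨C, hC⟩ := hf R
    obtain ⟨C', hC'⟩ := hg R
    refine ⟨C * C', fun s hs hsR => ?_⟩
    have h1 := hC s hs hsR
    rw [abs_mul, neg_add, Real.rpow_add hs]
    calc |f s| * |g s| ≤ (C * s ^ (-p)) * (C' * s ^ (-q)) :=
          mul_le_mul h1 (hC' s hs hsR) (abs_nonneg _) ((abs_nonneg _).trans h1)
      _ = _ := by ring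
  induction m generalizing p q f g with
  | zero => exact hb hf hg
  | succ m ih =>
    refine ⟨hb hf.1 hg.1, hf.2.1.mul hg.2.1, ?_⟩
    have h1 := (ih hf.2.2 hg.of_succ).mono (q := p + q + 1) (by linarith)
    have h2 := (ih hf.of_succ hg.2.2).mono (q := p + q + 1) (by linarith)
    refine (h1.add h2).congr fun s hs => ?_
    exact (deriv_fun_mul ((hf.2.1 s hs).differentiableAt (Ioi_mem_nhds hs))
      ((hg.2.1 s hs).differentiableAt (Ioi_mem_nhds hs))).symm

lemma of_contDiff (hf : ContDiff ℝ ∞ f) : IsLocalSymbol m 0 f := by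
  have hb : ∀ {f : ℝ → ℝ}, Continuous f →
      ∀ R : ℝ, ∃ C : ℝ, ∀ s, 0 < s → s ≤ R → |f s| ≤ C * s ^ (-(0 : ℝ)) := fun hf R => by
    obtain ⟨C, hC⟩ := (isCompact_Icc (a := 0) (b := R)).exists_bound_of_continuousOn hf.continuousOn
    exact ⟨C, fun s hs hsR => by simpa using hC s ⟨hs.le, hsR⟩⟩
  induction m generalizing f with
  | zero => exact hb hf.continuous
  | succ m ih =>
    refine ⟨hb hf.continuous, (hf.differentiable (by simp)).differentiableOn, ?_⟩
    exact (ih (contDiff_infty_iff_deriv.1 hf).2).mono (by norm_num)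

lemma const_mul (hf : IsLocalSymbol m p f) (c : ℝ) : IsLocalSymbol m p fun s => c * f s := by
  simpa using (of_contDiff (m := m) (f := fun _ => c) contDiff_const).mul hf

lemma rpow (p : ℝ) : IsLocalSymbol m p fun s => s ^ (-p) := by
  induction m generalizing p with
  | zero => exact fun R => ⟨1, fun s hs _ => by rw [one_mul, abs_of_nonneg (by positivity)]⟩
  | succ m ih =>
    refine ⟨fun R => ⟨1, fun s hs _ => by rw [one_mul, abs_of_nonneg (by positivity)]⟩, ?_, ?_⟩
    · exact fun s hs => (Real.differentiableAt_rpow_const_of_ne _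
        (mem_Ioi.1 hs).ne').differentiableWithinAt
    · refine ((ih (p + 1)).const_mul (-p)).congr fun s hs => ?_
      simp only
      rw [Real.deriv_rpow_const (x := s), neg_add']

/-- The order `1` is crude for the logarithm itself but is exact for its derivative, and it suffices
wherever the logarithm occurs. -/
lemma log : IsLocalSymbol m 1 Real.log := by
  have hb : ∀ R : ℝ, ∃ C : ℝ, ∀ s, 0 < s → s ≤ R → |Real.log s| ≤ C * s ^ (-(1 : ℝ)) := fun R => by
    refine ⟨1 + R ^ 2, fun s hs hsR => ?_⟩
    rw [Real.rpow_neg_one, ← div_eq_mul_inv, le_div_iff₀ hs]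
    have h1 : Real.log s ≤ s := (Real.log_le_sub_one_of_pos hs).trans (by linarith)
    have h2 : -Real.log s ≤ s⁻¹ := by
      rw [← Real.log_inv]
      exact (Real.log_le_sub_one_of_pos (inv_pos.2 hs)).trans (by linarith)
    have h3 : s⁻¹ * s = 1 := inv_mul_cancel₀ hs.ne'
    rcases abs_cases (Real.log s) with ⟨h, _⟩ | ⟨h, _⟩ <;> rw [h] <;> nlinarith
  cases m with
  | zero => exact hb
  | succ m =>
    refine ⟨hb, fun s hs => (Real.differentiableAt_log
      (mem_Ioi.1 hs).ne').differentiableWithinAt, ?_⟩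
    refine ((rpow 1).mono (q := 1 + 1) (by norm_num)).congr fun s _ => ?_
    simp only [Real.deriv_log, Real.rpow_neg_one]

end IsLocalSymbol

end Symbols

/-! ### The normal derivatives of the fundamental solution -/

section FundamentalSolution

/-- The order in `s = t²` is half the order in `t`. Vanishing beyond `R` turns the local bounds into
global ones. -/
lemma IsLocalSymbol.exists_isSymbol {p : ℕ} {f : ℝ → ℝ} (hf : IsLocalSymbol 2 ((p : ℝ) / 2) f)
    (hc : ContDiffOn ℝ 2 f (Ioi 0)) {R : ℝ} (h0 : ∀ s, R < s → f s = 0) :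
    ∃ A, ∀ A', A ≤ A' → IsSymbol p A' f := by
  have hd : ∀ {f : ℝ → ℝ}, (∀ s, R < s → f s = 0) → ∀ s, R < s → deriv f s = 0 := by
    intro f h0 s hs
    have : f =ᶠ[𝓝 s] fun _ => 0 := by
      filter_upwards [Ioi_mem_nhds hs] with u hu using h0 u hu
    rw [this.deriv_eq, deriv_const]
  have key : ∀ {f : ℝ → ℝ} {m : ℕ}, (∀ s, R < s → f s = 0) →
      (∃ C : ℝ, ∀ s, 0 < s → s ≤ R → |f s| ≤ C * s ^ (-((m : ℝ) / 2))) →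
      ∃ C : ℝ, 0 ≤ C ∧ ∀ t, 0 < t → |f (t ^ 2)| ≤ C / t ^ m := by
    rintro f m h0 ⟨C, hC⟩
    refine ⟨|C|, abs_nonneg C, fun t ht => ?_⟩
    rcases le_or_gt (t ^ 2) R with hR | hR
    · have h1 : (t ^ 2) ^ (-((m : ℝ) / 2)) = (t ^ m)⁻¹ := by
        rw [← Real.rpow_natCast t 2, ← Real.rpow_mul ht.le, ← Real.rpow_natCast t m,
          ← Real.rpow_neg ht.le]
        congr 1; push_cast; ring
      refine (hC _ (by positivity) hR).trans ?_
      rw [h1, div_eq_mul_inv]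
      exact mul_le_mul_of_nonneg_right (le_abs_self C) (by positivity)
    · rw [h0 _ hR, abs_zero]; positivity
  obtain ⟨C₀, hC₀, b₀⟩ := key (m := p) h0 (hf.1 R)
  obtain ⟨C₁, hC₁, b₁⟩ := key (m := p + 2) (hd h0) (by
    obtain ⟨C, hC⟩ := hf.2.2.1 R
    exact ⟨C, fun s hs hsR => (hC s hs hsR).trans_eq (by congr 2; push_cast; ring)⟩)
  obtain ⟨C₂, hC₂, b₂⟩ := key (m := p + 4) (hd (hd h0)) (by
    obtain ⟨C, hC⟩ := hf.2.2.2.2.bound R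
    exact ⟨C, fun s hs hsR => (hC s hs hsR).trans_eq (by congr 2; push_cast; ring)⟩)
  refine ⟨C₀ + C₁ + C₂, fun A hA => ⟨hc, fun t ht => (b₀ t ht).trans ?_,
    fun t ht => (b₁ t ht).trans ?_, fun t ht => (b₂ t ht).trans ?_⟩⟩ <;> gcongr <;> linarith

/-- Cutting off the derivative of a function with the singularity of the fundamental solution. -/
lemma exists_isSymbol_cutoff {n : ℕ} (hn : 1 ≤ n) {P Q S g : ℝ → ℝ} (hP : ContDiff ℝ ∞ P)
    (hQ : ContDiff ℝ ∞ Q) (hS : ContDiff ℝ ∞ S)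
    (hg : ∀ s, 0 < s → g s = s ^ (-(((n : ℝ) - 1) / 2)) * P s + Real.log s * Q s + S s) (R : ℝ) :
    ContDiffOn ℝ ∞ g (Ioi 0) ∧ ∃ (a : ℝ → ℝ) (A : ℝ), (∀ A', A ≤ A' → IsSymbol (n + 1) A' a) ∧
      ∀ s, s ≤ R → a s = 2 * deriv g s := by
  set ν : ℝ := ((n : ℝ) - 1) / 2 with hν
  have hn' : (1 : ℝ) ≤ n := by exact_mod_cast hn
  have hν0 : 0 ≤ ν := by rw [hν]; linarith
  have hrp : ContDiffOn ℝ ∞ (fun s : ℝ => s ^ (-ν)) (Ioi 0) := fun s hs =>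
    (Real.contDiffAt_rpow_const_of_ne (mem_Ioi.1 hs).ne').contDiffWithinAt
  have hlg : ContDiffOn ℝ ∞ Real.log (Ioi 0) := fun s hs =>
    (Real.contDiffAt_log.2 (mem_Ioi.1 hs).ne').contDiffWithinAt
  have hgc : ContDiffOn ℝ ∞ g (Ioi 0) :=
    (((hrp.mul hP.contDiffOn).add (hlg.mul hQ.contDiffOn)).add hS.contDiffOn).congr hg
  refine ⟨hgc, ?_⟩
  have hgd : ContDiffOn ℝ ∞ (deriv g) (Ioi 0) := hgc.deriv_of_isOpen isOpen_Ioi (by simp)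
  have hsm := fun {f : ℝ → ℝ} (hf : ContDiff ℝ ∞ f) => IsLocalSymbol.of_contDiff (m := 2) hf
  have hder := fun {f : ℝ → ℝ} (hf : ContDiff ℝ ∞ f) => (contDiff_infty_iff_deriv.1 hf).2
  have hsym : IsLocalSymbol 2 (ν + 1) (deriv g) := by
    have h1 : IsLocalSymbol 2 (ν + 1) fun s => deriv (fun s : ℝ => s ^ (-ν)) s * P s := by
      simpa using (IsLocalSymbol.rpow (m := 3) ν).2.2.mul (hsm hP)
    have h2 : IsLocalSymbol 2 (ν + 1) fun s => s ^ (-ν) * deriv P s :=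
      ((IsLocalSymbol.rpow (m := 2) ν).mul (hsm (hder hP))).mono (by linarith)
    have h3 : IsLocalSymbol 2 (ν + 1) fun s => s ^ (-(1 : ℝ)) * Q s :=
      ((IsLocalSymbol.rpow (m := 2) 1).mul (hsm hQ)).mono (by linarith)
    -- Order `1` for the logarithm is enough because `ν ≥ 0`; this is where `1 ≤ n` enters.
    have h4 : IsLocalSymbol 2 (ν + 1) fun s => Real.log s * deriv Q s :=
      (IsLocalSymbol.log.mul (hsm (hder hQ))).mono (by linarith)
    have h5 : IsLocalSymbol 2 (ν + 1) (deriv S) := (hsm (hder hS)).mono (by linarith)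
    refine (((h1.add h2).add (h3.add h4)).add h5).congr fun s hs => ?_
    have hs0 : 0 < s := hs
    have d1 : DifferentiableAt ℝ (fun s : ℝ => s ^ (-ν)) s :=
      Real.differentiableAt_rpow_const_of_ne _ hs0.ne'
    have dP := (hP.differentiable (by simp)) s
    have dQ := (hQ.differentiable (by simp)) s
    have dS := (hS.differentiable (by simp)) s
    have dl : DifferentiableAt ℝ Real.log s := Real.differentiableAt_log hs0.ne'
    have e : g =ᶠ[𝓝 s] fun s => s ^ (-ν) * P s + Real.log s * Q s + S s := by
      filter_upwards [Ioi_mem_nhds hs0] with u hu using hg u hu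
    have hd := ((d1.hasDerivAt.mul dP.hasDerivAt).add (dl.hasDerivAt.mul dQ.hasDerivAt)).add
      dS.hasDerivAt
    rw [e.deriv_eq]
    refine Eq.trans ?_ hd.deriv.symm
    simp only [Real.deriv_log, Real.rpow_neg_one]
  -- A smooth cutoff, `1` for `s ≤ R` and `0` for `s ≥ R + 1`: on the bounded boundary nothing
  -- changes, and the behaviour of Hankel functions at infinity never has to be known.
  set χ : ℝ → ℝ := fun s => Real.smoothTransition (R + 1 - s) with hχ
  have hχc : ContDiff ℝ ∞ χ := Real.smoothTransition.contDiff.comp (by fun_prop)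
  have hac : ContDiffOn ℝ 2 (fun s => 2 * deriv g s * χ s) (Ioi 0) :=
    ((contDiffOn_const.mul hgd).mul hχc.contDiffOn).of_le ENat.LEInfty.out
  have has : IsLocalSymbol 2 (((n + 1 : ℕ) : ℝ) / 2) fun s => 2 * deriv g s * χ s := by
    have := (hsym.const_mul 2).mul (hsm hχc)
    rw [hν] at this
    convert this using 1
    push_cast; ring
  obtain ⟨A, hA⟩ := has.exists_isSymbol hac (R := R + 1) fun s hs => by
    simp only [hχ]
    rw [Real.smoothTransition.zero_of_nonpos (by linarith), mul_zero]
  refine ⟨_, A, hA, fun s hs => ?_⟩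
  simp only [hχ]
  rw [Real.smoothTransition.one_of_one_le (by linarith), mul_one]

lemma hasFDerivAt_comp_norm_sq {F : Type*} [NormedAddCommGroup F] [InnerProductSpace ℝ F]
    {g : ℝ → ℝ} {w : F} (hg : DifferentiableAt ℝ g (‖w‖ ^ 2)) :
    HasFDerivAt (fun w : F => g (‖w‖ ^ 2)) ((2 * deriv g (‖w‖ ^ 2)) • innerSL ℝ w) w := by
  have h1 : HasFDerivAt (fun w : F => ‖w‖ ^ 2) (2 • innerSL ℝ w) w :=
    (hasStrictFDerivAt_norm_sq w).hasFDerivAt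
  have h2 := hg.hasDerivAt.comp_hasFDerivAt w h1
  refine h2.congr_fderiv ?_
  ext v
  simp; ring

/-- The normal derivatives of the fundamental solution, on a bounded set. -/
theorem exists_fderiv_fundSol_eq {n : ℕ} (hn : 1 ≤ n) {k : ℝ} (hk : 0 < k) (R : ℝ) :
    ∃ (a b : ℝ → ℝ) (A : ℝ), IsSymbol (n + 1) A a ∧ IsSymbol (n + 1) A b ∧
      ∀ x y : Euc (n + 1), x ≠ y → ‖x - y‖ ^ 2 ≤ R → ∀ v,
        fderiv ℝ (fun z => fundSol k z y) x v
          = ((a (‖x - y‖ ^ 2) * inner ℝ (x - y) v : ℝ) : ℂ)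
            + Complex.I * ((b (‖x - y‖ ^ 2) * inner ℝ (x - y) v : ℝ) : ℂ) ∧
        fderiv ℝ (fun z => fundSol k x z) y v
          = -(((a (‖x - y‖ ^ 2) * inner ℝ (x - y) v : ℝ) : ℂ)
            + Complex.I * ((b (‖x - y‖ ^ 2) * inner ℝ (x - y) v : ℝ) : ℂ)) := by
  set ν : ℝ := ((n : ℝ) - 1) / 2 with hν
  obtain ⟨P, Q, S, hP, hQ, hS, hY⟩ := exists_besselY_eq hk (ν := ν)
  -- From `(i/4)(J + iY) = -Y/4 + iJ/4`: the real part `g₁` carries the singularity, while `g₂` is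
  -- smooth in the squared distance.
  set g₁ : ℝ → ℝ := fun s => -(1 / 4) * (s ^ (-ν) * P s + Real.log s * Q s + S s) with hg₁
  set g₂ : ℝ → ℝ := fun s => 1 / 4 * ((k ^ 2 / (4 * Real.pi)) ^ ν * besselEntire k ν s) with hg₂
  have hg₂c : ContDiff ℝ ∞ g₂ := contDiff_const.mul (contDiff_const.mul (contDiff_besselEntire k ν))
  obtain ⟨hc₁, a, A, haA, ha⟩ := exists_isSymbol_cutoff hn (P := fun s => -(1 / 4) * P s)
    (Q := fun s => -(1 / 4) * Q s) (S := fun s => -(1 / 4) * S s) (g := g₁)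
    (contDiff_const.mul hP) (contDiff_const.mul hQ) (contDiff_const.mul hS)
    (fun s _ => by simp only [hg₁]; ring) R
  obtain ⟨hc₂, b, B, hbB, hb⟩ := exists_isSymbol_cutoff hn (P := fun _ => 0) (Q := fun _ => 0)
    (S := g₂) (g := g₂) contDiff_const contDiff_const hg₂c (fun s _ => by simp) R
  refine ⟨a, b, max A B, haA _ (le_max_left _ _), hbB _ (le_max_right _ _), ?_⟩
  have hfund : ∀ x y : Euc (n + 1), x ≠ y →
      fundSol k x y = (g₁ (‖x - y‖ ^ 2) : ℂ) + Complex.I * (g₂ (‖x - y‖ ^ 2) : ℂ) := by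
    intro x y hxy
    have hr : 0 < ‖x - y‖ := norm_pos_iff.2 (sub_ne_zero.2 hxy)
    have h1 := hY _ hr
    have h2 := rpow_mul_rpow_eq hk hr ν
    have h3 : (k / (2 * Real.pi * ‖x - y‖)) ^ ν * besselJ ν (k * ‖x - y‖) = 4 * g₂ (‖x - y‖ ^ 2) := by
      rw [besselJ_eq, ← mul_assoc, h2, hg₂]; ring
    have h4 : (k / (2 * Real.pi * ‖x - y‖)) ^ ν * besselY ν (k * ‖x - y‖)
        = -4 * g₁ (‖x - y‖ ^ 2) := by
      rw [h1, hg₁]; ring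
    rw [fundSol, hankel1, ← hν]
    have h3' := congrArg (fun t : ℝ => (t : ℂ)) h3
    have h4' := congrArg (fun t : ℝ => (t : ℂ)) h4
    push_cast at h3' h4' ⊢
    linear_combination Complex.I / 4 * h3' + Complex.I ^ 2 / 4 * h4'
      - (g₁ (‖x - y‖ ^ 2) : ℂ) * Complex.I_sq
  have hder : ∀ w : Euc (n + 1), w ≠ 0 → HasFDerivAt
      (fun w : Euc (n + 1) => (g₁ (‖w‖ ^ 2) : ℂ) + Complex.I * (g₂ (‖w‖ ^ 2) : ℂ))
      (Complex.ofRealCLM.comp ((2 * deriv g₁ (‖w‖ ^ 2)) • innerSL ℝ w)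
        + Complex.I • Complex.ofRealCLM.comp ((2 * deriv g₂ (‖w‖ ^ 2)) • innerSL ℝ w)) w := by
    intro w hw
    have hw0 : 0 < ‖w‖ ^ 2 := by positivity
    have d1 := hasFDerivAt_comp_norm_sq (g := g₁) (w := w)
      ((hc₁.differentiableOn (by simp) _ hw0).differentiableAt (Ioi_mem_nhds hw0))
    have d2 := hasFDerivAt_comp_norm_sq (g := g₂) (w := w)
      ((hc₂.differentiableOn (by simp) _ hw0).differentiableAt (Ioi_mem_nhds hw0))
    have e1 := Complex.ofRealCLM.hasFDerivAt.comp w d1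
    have e2 := (Complex.ofRealCLM.hasFDerivAt.comp w d2).const_mul Complex.I
    exact e1.add e2
  intro x y hxy hR v
  have hxy0 : x - y ≠ 0 := sub_ne_zero.2 hxy
  constructor
  · have h1 : HasFDerivAt (fun z => fundSol k z y) _ x :=
      ((hder (x - y) hxy0).comp x ((hasFDerivAt_id x).sub_const y)).congr_of_eventuallyEq (by
        filter_upwards [isOpen_ne.mem_nhds hxy] with z hz
        exact hfund z y hz)
    rw [h1.fderiv, ha _ hR, hb _ hR]
    simp [inner_sub_left]
  · have h1 : HasFDerivAt (fun z => fundSol k x z) _ y :=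
      ((hder (x - y) hxy0).comp y ((hasFDerivAt_id y).const_sub x)).congr_of_eventuallyEq (by
        filter_upwards [isOpen_ne.mem_nhds hxy.symm] with z hz
        exact hfund x z (Ne.symm hz))
    rw [h1.fderiv, ha _ hR, hb _ hR]
    simp [inner_sub_left]

end FundamentalSolution

/-! ### Taylor estimates -/

section Taylor

variable {E F : Type*} [NormedAddCommGroup E] [NormedSpace ℝ E] [NormedAddCommGroup F]
  [NormedSpace ℝ F]

/-- One constant for all three estimates, from the maxima of the first two derivatives on `K`.
Convexity keeps the segments used by the mean value inequality inside `K`. -/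
lemma exists_norm_sub_fderiv_le_sq {f : E → F} {U K : Set E} (hU : IsOpen U)
    (hf : ContDiffOn ℝ 2 f U) (hKU : K ⊆ U) (hK : IsCompact K) (hc : Convex ℝ K) :
    ∃ C : ℝ, 0 ≤ C ∧ (∀ y ∈ K, ‖fderiv ℝ f y‖ ≤ C) ∧ (∀ x ∈ K, ∀ y ∈ K, ‖f x - f y‖ ≤ C * ‖x - y‖) ∧
      ∀ x ∈ K, ∀ y ∈ K, ‖f x - f y - fderiv ℝ f y (x - y)‖ ≤ C * ‖x - y‖ ^ 2 := by
  have hd : ∀ x ∈ U, DifferentiableAt ℝ f x := fun x hx =>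
    (hf.differentiableOn (by norm_num) x hx).differentiableAt (hU.mem_nhds hx)
  have hf1 : ContDiffOn ℝ 1 (fderiv ℝ f) U := hf.fderiv_of_isOpen hU (by norm_num)
  have hd1 : ∀ x ∈ U, DifferentiableAt ℝ (fderiv ℝ f) x := fun x hx =>
    (hf1.differentiableOn (by norm_num) x hx).differentiableAt (hU.mem_nhds hx)
  have hf2 : ContinuousOn (fderiv ℝ (fderiv ℝ f)) U :=
    (hf1.fderiv_of_isOpen (m := 0) hU (by norm_num)).continuousOn
  obtain ⟨B, hB⟩ := hK.exists_bound_of_continuousOn (f := fderiv ℝ (fderiv ℝ f)) (hf2.mono hKU)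
  obtain ⟨B', hB'⟩ := hK.exists_bound_of_continuousOn (hf1.continuousOn.mono hKU)
  have hBC : |B| ≤ |B| + |B'| := by linarith [abs_nonneg B']
  have hBC' : |B'| ≤ |B| + |B'| := by linarith [abs_nonneg B]
  have hfd : ∀ y ∈ K, ‖fderiv ℝ f y‖ ≤ |B| + |B'| := fun y hy =>
    (hB' y hy).trans ((le_abs_self B').trans hBC')
  refine ⟨|B| + |B'|, by positivity, hfd, fun x hx y hy => ?_, fun x hx y hy => ?_⟩
  · exact hc.norm_image_sub_le_of_norm_fderiv_le (𝕜 := ℝ) (fun z hz => hd z (hKU hz)) hfd hy hx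
  have hL : ∀ z ∈ segment ℝ y x, ‖fderiv ℝ f z - fderiv ℝ f y‖ ≤ (|B| + |B'|) * ‖x - y‖ := by
    intro z hz
    have hzK : z ∈ K := hc.segment_subset hy hx hz
    have h1 := hc.norm_image_sub_le_of_norm_fderiv_le (𝕜 := ℝ) (f := fderiv ℝ f)
      (fun z hz => hd1 z (hKU hz))
      (fun z hz => (hB z hz).trans ((le_abs_self B).trans hBC)) hy hzK
    refine h1.trans (mul_le_mul_of_nonneg_left ?_ (by positivity))
    rw [← dist_eq_norm, ← dist_eq_norm, dist_comm z y, dist_comm x y]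
    obtain ⟨t, ht, rfl⟩ := (segment_eq_image_lineMap ℝ y x ▸ hz :
      z ∈ AffineMap.lineMap y x '' Icc (0 : ℝ) 1)
    rw [dist_left_lineMap, Real.norm_eq_abs, abs_of_nonneg ht.1]
    exact mul_le_of_le_one_left dist_nonneg ht.2
  have h2 := (convex_segment (𝕜 := ℝ) y x).norm_image_sub_le_of_norm_hasFDerivWithin_le'
    (f := f) (f' := fderiv ℝ f) (φ := fderiv ℝ f y) (C := (|B| + |B'|) * ‖x - y‖)
    (fun z hz => (hd z (hKU (hc.segment_subset hy hx hz))).hasFDerivAt.hasFDerivWithinAt) hL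
    (left_mem_segment ℝ y x) (right_mem_segment ℝ y x)
  calc _ ≤ _ := h2
    _ = _ := by ring

lemma norm_lineMap_sub_left_le {x y z : E} (hz : z ∈ segment ℝ y x) : ‖z - y‖ ≤ ‖x - y‖ := by
  obtain ⟨t, ht, rfl⟩ := (segment_eq_image_lineMap ℝ y x ▸ hz :
      z ∈ AffineMap.lineMap y x '' Icc (0 : ℝ) 1)
  rw [← dist_eq_norm, ← dist_eq_norm, dist_comm _ y, dist_comm x y, dist_left_lineMap,
    Real.norm_eq_abs, abs_of_nonneg ht.1]
  exact mul_le_of_le_one_left dist_nonneg ht.2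

/-- First-order Taylor estimate for a function with Hölder derivative. -/
lemma norm_sub_fderiv_le_of_holder {f : E → F} (hf : Differentiable ℝ f) {M α : ℝ} (hα : 0 < α)
    (hM : ∀ x y, ‖fderiv ℝ f x - fderiv ℝ f y‖ ≤ M * ‖x - y‖ ^ α) (hM0 : 0 ≤ M) (x y : E) :
    ‖f x - f y - fderiv ℝ f y (x - y)‖ ≤ M * ‖x - y‖ ^ α * ‖x - y‖ :=
  (convex_segment (𝕜 := ℝ) y x).norm_image_sub_le_of_norm_hasFDerivWithin_le'
    (f := f) (f' := fderiv ℝ f) (φ := fderiv ℝ f y) (C := M * ‖x - y‖ ^ α)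
    (fun z _ => (hf z).hasFDerivAt.hasFDerivWithinAt)
    (fun z hz => (hM z y).trans (mul_le_mul_of_nonneg_left
      (Real.rpow_le_rpow (norm_nonneg _) (norm_lineMap_sub_left_le hz) hα.le) hM0))
    (left_mem_segment ℝ y x) (right_mem_segment ℝ y x)

/-- The trapezoidal rule for a function with Hölder second derivative. -/
lemma abs_sub_trapezoid_le_of_holder {f : E → ℝ} (hf : ContDiff ℝ 2 f) {M α : ℝ} (hα : 0 < α)
    (hM : ∀ x y, ‖fderiv ℝ (fderiv ℝ f) x - fderiv ℝ (fderiv ℝ f) y‖ ≤ M * ‖x - y‖ ^ α)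
    (hM0 : 0 ≤ M) (x y : E) :
    |f x - f y - 1 / 2 * (fderiv ℝ f x (x - y) + fderiv ℝ f y (x - y))|
      ≤ M * ‖x - y‖ ^ α * ‖x - y‖ ^ 2 := by
  have hd : Differentiable ℝ f := hf.differentiable (by norm_num)
  have hd1 : Differentiable ℝ (fderiv ℝ f) :=
    (hf.fderiv_right (m := 1) (by norm_num)).differentiable (by norm_num)
  set v := x - y with hv
  set γ : ℝ → E := fun t => y + t • v with hγ
  have hγd : ∀ t, HasDerivAt γ v t := fun t => by
    exact (((hasDerivAt_id t).smul_const v).const_add y).congr_deriv (one_smul _ _)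
  have h1 : ∀ t, HasDerivAt (fun t => f (γ t)) (fderiv ℝ f (γ t) v) t := fun t =>
    (hd (γ t)).hasFDerivAt.comp_hasDerivAt t (hγd t)
  have h2 : ∀ t, HasDerivAt (fun t => fderiv ℝ f (γ t) v)
      (fderiv ℝ (fderiv ℝ f) (γ t) v v) t := fun t =>
    ((hd1 (γ t)).hasFDerivAt.comp_hasDerivAt t (hγd t)).clm_apply (hasDerivAt_const t v) |>.congr_deriv
      (by simp)
  have hγs : ∀ s t : ℝ, γ s - γ t = (s - t) • v := fun s t => by simp [hγ, sub_smul]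
  have h3 : ∀ t ∈ Icc (0 : ℝ) 1,
      |fderiv ℝ f (γ t) v - fderiv ℝ f (γ 0) v - t * fderiv ℝ (fderiv ℝ f) (γ t) v v|
        ≤ M * ‖v‖ ^ α * ‖v‖ ^ 2 := by
    intro t ht
    have h := norm_sub_fderiv_le_of_holder hd1 hα hM hM0 (γ 0) (γ t)
    rw [hγs, zero_sub, neg_smul, norm_neg, norm_smul, Real.norm_eq_abs, abs_of_nonneg ht.1,
      map_neg, map_smul] at h
    have h' := (fderiv ℝ f (γ 0) - fderiv ℝ f (γ t)
      - -(t • fderiv ℝ (fderiv ℝ f) (γ t) v)).le_of_opNorm_le h v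
    have e : (fderiv ℝ f (γ 0) - fderiv ℝ f (γ t) - -(t • fderiv ℝ (fderiv ℝ f) (γ t) v)) v
        = -(fderiv ℝ f (γ t) v - fderiv ℝ f (γ 0) v - t * fderiv ℝ (fderiv ℝ f) (γ t) v v) := by
      simp; ring
    rw [e, norm_neg, Real.norm_eq_abs] at h'
    refine h'.trans ?_
    have h4 : t * ‖v‖ ≤ ‖v‖ := mul_le_of_le_one_left (norm_nonneg _) ht.2
    calc M * (t * ‖v‖) ^ α * (t * ‖v‖) * ‖v‖ ≤ M * ‖v‖ ^ α * ‖v‖ * ‖v‖ := by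
          gcongr
          · exact mul_nonneg ht.1 (norm_nonneg _)
          · exact mul_nonneg ht.1 (norm_nonneg _)
      _ = _ := by ring
  -- The error of the rule on `[0, t]`. Its derivative is half the first-order Taylor error of the
  -- derivative of `f` along the segment, expanded about `γ t`, which the Hölder condition controls.
  set ψ : ℝ → ℝ := fun t => f (γ t) - f (γ 0)
    - t / 2 * (fderiv ℝ f (γ t) v + fderiv ℝ f (γ 0) v) with hψ
  have hψd : ∀ t, HasDerivAt ψ (1 / 2 * (fderiv ℝ f (γ t) v - fderiv ℝ f (γ 0) v
      - t * fderiv ℝ (fderiv ℝ f) (γ t) v v)) t := fun t => by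
    have h5 : HasDerivAt (fun t : ℝ => t / 2) (1 / 2) t := (hasDerivAt_id t).div_const 2
    have h6 := ((h1 t).sub_const (f (γ 0))).sub (h5.mul ((h2 t).add_const (fderiv ℝ f (γ 0) v)))
    exact h6.congr_deriv (by ring)
  have h7 := (convex_Icc (0 : ℝ) 1).norm_image_sub_le_of_norm_hasDerivWithin_le
    (f := ψ) (C := M * ‖v‖ ^ α * ‖v‖ ^ 2) (fun t _ => (hψd t).hasDerivWithinAt)
    (fun t ht => by
      rw [norm_mul, Real.norm_eq_abs, Real.norm_eq_abs, abs_of_pos (by norm_num : (0 : ℝ) < 1 / 2)]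
      have h8 := h3 t ht
      have h9 := abs_nonneg (fderiv ℝ f (γ t) v - fderiv ℝ f (γ 0) v
        - t * fderiv ℝ (fderiv ℝ f) (γ t) v v)
      linarith) (left_mem_Icc.2 zero_le_one) (right_mem_Icc.2 zero_le_one)
  have hγ1 : γ 1 = x := by simp [hγ, hv]
  have hγ0 : γ 0 = y := by simp [hγ]
  simp only [hψ, hγ1, hγ0] at h7
  simpa [hψ, hγ1, hγ0] using h7

end Taylor

/-! ### Local defining functions and the outward normal -/

section Normal

variable {n : ℕ}

/-- `Ω ∩ W = {ρ < 0} ∩ W` with `ρ` of class `C^{2,α}`, strictly increasing in the direction `e`. -/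
structure IsDefiningFun (Ω W : Set (Euc (n + 1))) (α : ℝ) (ρ : Euc (n + 1) → ℝ)
    (e : Euc (n + 1)) : Prop where
  isOpen : IsOpen W
  contDiff : ContDiff ℝ 2 ρ
  fderiv_e : ∀ x, fderiv ℝ ρ x e = 1
  norm_e : ‖e‖ ≤ 1
  holder : ∃ M : ℝ, 0 ≤ M ∧ ∀ x y,
    ‖fderiv ℝ (fderiv ℝ ρ) x - fderiv ℝ (fderiv ℝ ρ) y‖ ≤ M * ‖x - y‖ ^ α
  mem_iff : ∀ x ∈ W, x ∈ Ω ↔ ρ x < 0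

variable {Ω W : Set (Euc (n + 1))} {α : ℝ} {ρ : Euc (n + 1) → ℝ} {e x : Euc (n + 1)}

/-- If the two differed, the ray in the direction `ν' - ν` would start inside `Ω` according to `ν`
and outside according to `ν'`. -/
lemma isOutwardNormal_unique {ν ν' : Euc (n + 1)} (h : IsOutwardNormal Ω x ν)
    (h' : IsOutwardNormal Ω x ν') : ν = ν' := by
  by_contra hne
  have h1 : inner ℝ ν ν' < 1 := by
    refine lt_of_le_of_ne ?_ fun h1 => hne ?_
    · have := real_inner_le_norm ν ν'
      rwa [h.1, h'.1, one_mul] at this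
    · exact (inner_eq_one_iff_of_norm_eq_one h.1 h'.1).1 h1
  have h2 : inner ℝ (ν' - ν) ν < 0 := by
    rw [inner_sub_left, real_inner_self_eq_norm_sq, h.1, real_inner_comm]; linarith
  have h3 : 0 < inner ℝ (ν' - ν) ν' := by
    rw [inner_sub_left, real_inner_self_eq_norm_sq, h'.1]; linarith
  obtain ⟨t, ht1, ht2⟩ := ((h.2.1 _ h2).and (h'.2.2 _ h3)).exists
  exact ht2 ht1

lemma IsOutwardNormal.outwardNormal_eq {ν : Euc (n + 1)} (h : IsOutwardNormal Ω x ν) :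
    outwardNormal Ω x = ν :=
  isOutwardNormal_unique (Classical.epsilon_spec (p := IsOutwardNormal Ω x) ⟨ν, h⟩) h

lemma inner_gradient (ρ : Euc (n + 1) → ℝ) (x v : Euc (n + 1)) :
    inner ℝ (gradient ρ x) v = fderiv ℝ ρ x v := by
  rw [gradient, InnerProductSpace.toDual_symm_apply]

namespace IsDefiningFun

lemma differentiable (h : IsDefiningFun Ω W α ρ e) : Differentiable ℝ ρ :=
  h.contDiff.differentiable (by norm_num)

lemma eventually_lt (h : IsDefiningFun Ω W α ρ e) (hx0 : ρ x = 0) {v : Euc (n + 1)} :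
    (fderiv ℝ ρ x v < 0 → ∀ᶠ t : ℝ in 𝓝[>] 0, ρ (x + t • v) < 0) ∧
    (0 < fderiv ℝ ρ x v → ∀ᶠ t : ℝ in 𝓝[>] 0, 0 < ρ (x + t • v)) := by
  have h1 : HasDerivAt (fun t : ℝ => ρ (x + t • v)) (fderiv ℝ ρ x v) 0 := by
    have h2 : HasDerivAt (fun t : ℝ => x + t • v) v 0 := by
      simpa using ((hasDerivAt_id (0 : ℝ)).smul_const v).const_add x
    have h3 : HasFDerivAt ρ (fderiv ℝ ρ x) (x + (0 : ℝ) • v) := by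
      rw [zero_smul, add_zero]; exact (h.differentiable x).hasFDerivAt
    exact h3.comp_hasDerivAt 0 h2
  have h4 := (hasDerivAt_iff_tendsto_slope.1 h1).mono_left
    (nhdsWithin_mono 0 (fun t (ht : 0 < t) => ht.ne') : 𝓝[>] (0 : ℝ) ≤ 𝓝[≠] 0)
  have hsl : ∀ t : ℝ, slope (fun t : ℝ => ρ (x + t • v)) 0 t = t⁻¹ * ρ (x + t • v) := fun t => by
    simp [slope, hx0]
  constructor
  · intro hv
    filter_upwards [h4.eventually_lt_const hv, self_mem_nhdsWithin] with t ht ht0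
    rw [hsl] at ht
    exact neg_of_mul_neg_right ht (inv_pos.2 (mem_Ioi.1 ht0)).le
  · intro hv
    filter_upwards [h4.eventually_const_lt hv, self_mem_nhdsWithin] with t ht ht0
    rw [hsl] at ht
    exact (mul_pos_iff_of_pos_left (inv_pos.2 (mem_Ioi.1 ht0))).1 ht

lemma eventually_mem (h : IsDefiningFun Ω W α ρ e) (hx : x ∈ W) (v : Euc (n + 1)) :
    ∀ᶠ t : ℝ in 𝓝[>] 0, x + t • v ∈ W := by
  have hc : ContinuousAt (fun t : ℝ => x + t • v) 0 := by fun_prop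
  refine (hc.eventually_mem (h.isOpen.mem_nhds (by simpa using hx))).filter_mono nhdsWithin_le_nhds

/-- Where `ρ ≠ 0` continuity makes the point interior to `Ω` or to its complement. A zero of `ρ` is
outside `Ω`, but moving from it in the direction `-e`, along which `ρ` decreases, enters `Ω`. -/
lemma mem_frontier_iff (h : IsDefiningFun Ω W α ρ e) (hx : x ∈ W) :
    x ∈ frontier Ω ↔ ρ x = 0 := by
  constructor
  · intro hf
    have hc := h.contDiff.continuous
    rcases lt_trichotomy (ρ x) 0 with hlt | heq | hgt
    · have : Ω ∈ 𝓝 x := by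
        filter_upwards [h.isOpen.mem_nhds hx, hc.continuousAt.eventually_lt_const hlt]
          with z hz1 hz2 using (h.mem_iff z hz1).2 hz2
      exact absurd (mem_interior_iff_mem_nhds.2 this) hf.2
    · exact heq
    · have : Ωᶜ ∈ 𝓝 x := by
        filter_upwards [h.isOpen.mem_nhds hx, hc.continuousAt.eventually_const_lt hgt]
          with z hz1 hz2 using fun hz => absurd ((h.mem_iff z hz1).1 hz) (not_lt.2 hz2.le)
      obtain ⟨z, hz1, hz2⟩ := mem_closure_iff_nhds.1 hf.1 _ this
      exact absurd hz2 hz1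
  · intro h0
    have hnot : x ∉ Ω := fun hxΩ => by
      have := (h.mem_iff x hx).1 hxΩ; linarith
    refine ⟨?_, fun hi => hnot (interior_subset hi)⟩
    have h1 : ∀ᶠ t : ℝ in 𝓝[>] 0, x + t • (-e) ∈ Ω := by
      filter_upwards [(h.eventually_lt h0 (v := -e)).1 (by rw [map_neg, h.fderiv_e]; norm_num),
        h.eventually_mem hx (-e)] with t ht1 ht2 using (h.mem_iff _ ht2).2 ht1
    have h2 : Tendsto (fun t : ℝ => x + t • (-e)) (𝓝[>] 0) (𝓝 x) := by
      have : Continuous fun t : ℝ => x + t • (-e) := by fun_prop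
      simpa using (this.tendsto 0).mono_left nhdsWithin_le_nhds
    exact mem_closure_of_tendsto h2 h1

/-- The normalization of `e` gives a lower bound without constants, so that normalizing the gradient
is uniformly harmless. -/
lemma one_le_norm_gradient (h : IsDefiningFun Ω W α ρ e) (x : Euc (n + 1)) :
    1 ≤ ‖gradient ρ x‖ := by
  have h1 := real_inner_le_norm (gradient ρ x) e
  rw [inner_gradient, h.fderiv_e] at h1
  exact h1.trans (mul_le_of_le_one_right (norm_nonneg _) h.norm_e)

lemma isOutwardNormal (h : IsDefiningFun Ω W α ρ e) (hx : x ∈ W) (hx0 : ρ x = 0) :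
    IsOutwardNormal Ω x (‖gradient ρ x‖⁻¹ • gradient ρ x) := by
  have hp : 0 < ‖gradient ρ x‖ := one_pos.trans_le (h.one_le_norm_gradient x)
  have hin : ∀ v, inner ℝ v (‖gradient ρ x‖⁻¹ • gradient ρ x) = ‖gradient ρ x‖⁻¹ * fderiv ℝ ρ x v :=
    fun v => by rw [inner_smul_right, real_inner_comm, inner_gradient]
  refine ⟨?_, fun v hv => ?_, fun v hv => ?_⟩
  · rw [norm_smul, norm_inv, norm_norm, inv_mul_cancel₀ hp.ne']
  · rw [hin] at hv
    replace hv := neg_of_mul_neg_right hv (inv_pos.2 hp).le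
    filter_upwards [(h.eventually_lt hx0).1 hv, h.eventually_mem hx v] with t h1 h2
      using (h.mem_iff _ h2).2 h1
  · rw [hin, mul_pos_iff_of_pos_left (inv_pos.2 hp)] at hv
    filter_upwards [(h.eventually_lt hx0).2 hv, h.eventually_mem hx v] with t h1 h2 h3
    exact absurd ((h.mem_iff _ h2).1 h3) (not_lt.2 h1.le)

lemma outwardNormal_eq (h : IsDefiningFun Ω W α ρ e) (hx : x ∈ W) (hxf : x ∈ frontier Ω) :
    outwardNormal Ω x = ‖gradient ρ x‖⁻¹ • gradient ρ x :=
  (h.isOutwardNormal hx ((h.mem_frontier_iff hx).1 hxf)).outwardNormal_eq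

end IsDefiningFun

end Normal

/-! ### Hölder expansion of the normal along the boundary -/

section NormalEstimates

variable {n : ℕ} {Ω W : Set (Euc (n + 1))} {α : ℝ} {ρ : Euc (n + 1) → ℝ} {e x : Euc (n + 1)}

lemma contDiffOn_normalize {F : Type*} [NormedAddCommGroup F] [InnerProductSpace ℝ F] :
    ContDiffOn ℝ 2 (fun v : F => ‖v‖⁻¹ • v) {0}ᶜ := fun _ hv =>
  (((contDiffAt_norm ℝ hv).inv (norm_ne_zero_iff.2 hv)).smul contDiffAt_id).contDiffWithinAt

/-- The Riesz representation of functionals on a real Hilbert space, as a linear map. -/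
def rieszCLM (F : Type*) [NormedAddCommGroup F] [InnerProductSpace ℝ F] [CompleteSpace F] :
    StrongDual ℝ F →L[ℝ] F :=
  LinearMap.mkContinuous
    { toFun := (InnerProductSpace.toDual ℝ F).symm
      map_add' := map_add _
      map_smul' := fun c x => by simp } 1
    fun x => by simp

namespace IsDefiningFun

lemma hasFDerivAt_gradient (h : IsDefiningFun Ω W α ρ e) (x : Euc (n + 1)) :
    HasFDerivAt (gradient ρ) ((rieszCLM (Euc (n + 1))).comp (fderiv ℝ (fderiv ℝ ρ) x)) x := by
  have h1 : Differentiable ℝ (fderiv ℝ ρ) :=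
    (h.contDiff.fderiv_right (m := 1) (by norm_num)).differentiable (by norm_num)
  exact ((rieszCLM (Euc (n + 1))).hasFDerivAt (x := fderiv ℝ ρ x)).comp x (h1 x).hasFDerivAt

lemma contDiff_gradient (h : IsDefiningFun Ω W α ρ e) : ContDiff ℝ 1 (gradient ρ) :=
  (rieszCLM (Euc (n + 1))).contDiff.comp (h.contDiff.fderiv_right (m := 1) (by norm_num))

lemma holder_gradient (h : IsDefiningFun Ω W α ρ e) : ∃ M : ℝ, 0 ≤ M ∧
    (∀ x y, ‖fderiv ℝ (gradient ρ) x - fderiv ℝ (gradient ρ) y‖ ≤ M * ‖x - y‖ ^ α) ∧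
    ∀ x y, ‖fderiv ℝ (fderiv ℝ ρ) x - fderiv ℝ (fderiv ℝ ρ) y‖ ≤ M * ‖x - y‖ ^ α := by
  obtain ⟨M, hM0, hM⟩ := h.holder
  refine ⟨M, hM0, fun x y => le_trans ?_ (hM x y), hM⟩
  rw [(h.hasFDerivAt_gradient x).fderiv, (h.hasFDerivAt_gradient y).fderiv,
    ← ContinuousLinearMap.comp_sub]
  refine ContinuousLinearMap.opNorm_le_bound _
    (norm_nonneg (fderiv ℝ (fderiv ℝ ρ) x - fderiv ℝ (fderiv ℝ ρ) y)) fun v => ?_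
  rw [ContinuousLinearMap.comp_apply]
  refine le_trans (le_of_eq ?_)
    ((fderiv ℝ (fderiv ℝ ρ) x - fderiv ℝ (fderiv ℝ ρ) y).le_opNorm v)
  exact (InnerProductSpace.toDual ℝ (Euc (n + 1))).symm.norm_map _

lemma continuous_normal (h : IsDefiningFun Ω W α ρ e) :
    Continuous fun x => ‖gradient ρ x‖⁻¹ • gradient ρ x := by
  have h1 := h.contDiff_gradient.continuous
  exact (h1.norm.inv₀ fun x => (one_pos.trans_le (h.one_le_norm_gradient x)).ne').smul h1

/-- Near a boundary point the normal is differentiable along the boundary, with Hölder remainder. -/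
lemma exists_local_weingarten (h : IsDefiningFun Ω W α ρ e) (hα : 0 < α) {x₀ : Euc (n + 1)}
    (hx₀ : x₀ ∈ W) :
    ∃ r₀ : ℝ, 0 < r₀ ∧ ∃ (S : Euc (n + 1) → Euc (n + 1) →L[ℝ] Euc (n + 1)) (C : ℝ),
      Continuous S ∧ 0 ≤ C ∧ (∀ y ∈ Metric.ball x₀ r₀, ‖S y‖ ≤ C) ∧
      ∀ y ∈ Metric.ball x₀ r₀ ∩ frontier Ω, ∀ x ∈ frontier Ω, ‖x - y‖ ≤ r₀ →
        ‖outwardNormal Ω x - outwardNormal Ω y - S y (x - y)‖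
          ≤ C * ‖x - y‖ ^ (min α 1) * ‖x - y‖ ∧
        |inner ℝ (x - y) (outwardNormal Ω x + outwardNormal Ω y)|
          ≤ C * ‖x - y‖ ^ (min α 1) * ‖x - y‖ ^ 2 := by
  obtain ⟨R, hR0, hRW⟩ := Metric.isOpen_iff.1 h.isOpen x₀ hx₀
  obtain ⟨M, hM0, hM, hM'⟩ := h.holder_gradient
  set p := gradient ρ with hp
  have hpc : Continuous p := h.contDiff_gradient.continuous
  have hpd : Differentiable ℝ p := h.contDiff_gradient.differentiable (by norm_num)
  have hpd' : Continuous (fderiv ℝ p) := h.contDiff_gradient.continuous_fderiv (by norm_num)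
  -- Keeps both end points in a compact ball inside `W`, and chords shorter than one, so that `r ^
  -- α` and `r` are both at most `r ^ β`.
  set r₀ := min (R / 4) (1 / 2) with hr₀
  have hr₀0 : 0 < r₀ := by positivity
  set K₀ := Metric.closedBall x₀ (2 * r₀) with hK₀
  have hK₀c : IsCompact K₀ := isCompact_closedBall _ _
  have hK₀W : K₀ ⊆ W := fun z hz => hRW (by
    rw [hK₀, Metric.mem_closedBall] at hz
    rw [Metric.mem_ball]
    have : r₀ ≤ R / 4 := min_le_left _ _
    linarith)
  obtain ⟨B, hB⟩ := hK₀c.exists_bound_of_continuousOn hpc.continuousOn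
  obtain ⟨L, hL⟩ := hK₀c.exists_bound_of_continuousOn (f := fderiv ℝ p) hpd'.continuousOn
  have hL0 : 0 ≤ L := (norm_nonneg _).trans (hL x₀ (Metric.mem_closedBall_self (by positivity)))
  have hLip : ∀ x ∈ K₀, ∀ y ∈ K₀, ‖p x - p y‖ ≤ L * ‖x - y‖ := fun x hx y hy =>
    (convex_closedBall x₀ _).norm_image_sub_le_of_norm_fderiv_le (𝕜 := ℝ) (fun z _ => hpd z) hL hy hx
  set G : Euc (n + 1) → Euc (n + 1) := fun v => ‖v‖⁻¹ • v with hG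
  -- Taylor's formula for the normalization `G` needs a convex compact set that avoids the origin.
  -- All gradients of `ρ` lie in the hyperplane of vectors whose inner product with `e` is `1`,
  -- which provides one.
  set K : Set (Euc (n + 1)) := Metric.closedBall 0 B ∩ {v | inner ℝ v e = 1} with hK
  have hKc : IsCompact K := (isCompact_closedBall _ _).inter_right
    (isClosed_eq (by fun_prop) continuous_const)
  have hKx : Convex ℝ K := by
    refine (convex_closedBall _ _).inter ?_
    have : {v : Euc (n + 1) | inner ℝ v e = 1} = (innerₗ (Euc (n + 1)) e) ⁻¹' {1} := by
      ext v; simp [real_inner_comm]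
    rw [this]
    exact (convex_singleton _).linear_preimage _
  have hK0 : K ⊆ {0}ᶜ := fun v hv h0 => by
    rw [mem_singleton_iff] at h0
    have := hv.2
    simp [h0] at this
  have hpK : ∀ x ∈ K₀, p x ∈ K := fun x hx => ⟨by simpa using hB x hx, by
    change inner ℝ (gradient ρ x) e = 1
    rw [inner_gradient, h.fderiv_e]⟩
  obtain ⟨D, hD0, hD1, -, hD2⟩ := exists_norm_sub_fderiv_le_sq isOpen_compl_singleton
    contDiffOn_normalize hK0 hKc hKx
  have hp0 : ∀ x, p x ∈ ({0}ᶜ : Set (Euc (n + 1))) := fun x h0 => by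
    have h1 := h.one_le_norm_gradient x
    rw [← hp, mem_singleton_iff.1 h0, norm_zero] at h1
    linarith
  have hGc : ContinuousOn (fderiv ℝ G) {0}ᶜ :=
    (contDiffOn_normalize.fderiv_of_isOpen (m := 1) isOpen_compl_singleton
      (by norm_num)).continuousOn
  set C := D * L + D * L ^ 2 + D * M + 2 * M + L * (M + L) with hC
  have hC0 : 0 ≤ C := by positivity
  -- The derivative of the normalized gradient `G ∘ p`, by the chain rule.
  refine ⟨r₀, hr₀0, fun y => (fderiv ℝ G (p y)).comp (fderiv ℝ p y), C,
    (hGc.comp_continuous hpc hp0).clm_comp hpd', hC0, fun y hy => ?_, ?_⟩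
  · have hyK : y ∈ K₀ := Metric.closedBall_subset_closedBall (by linarith)
      (Metric.ball_subset_closedBall hy)
    calc _ ≤ ‖fderiv ℝ G (p y)‖ * ‖fderiv ℝ p y‖ := ContinuousLinearMap.opNorm_comp_le _ _
      _ ≤ D * L := mul_le_mul (hD1 _ (hpK y hyK)) (hL y hyK) (norm_nonneg _) hD0
      _ ≤ C := by
        have h1 : 0 ≤ D * L ^ 2 + D * M + 2 * M + L * (M + L) := by positivity
        rw [hC]; linarith
  · rintro y ⟨hyb, hyΓ⟩ x hxΓ hxy
    have hyK : y ∈ K₀ := Metric.closedBall_subset_closedBall (by linarith)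
      (Metric.ball_subset_closedBall hyb)
    have hxK : x ∈ K₀ := by
      rw [hK₀, Metric.mem_closedBall]
      have h1 := dist_triangle x y x₀
      rw [dist_eq_norm x y] at h1
      have h2 := Metric.mem_ball.1 hyb
      linarith
    rw [h.outwardNormal_eq (hK₀W hxK) hxΓ, h.outwardNormal_eq (hK₀W hyK) hyΓ]
    have hρx := (h.mem_frontier_iff (hK₀W hxK)).1 hxΓ
    have hρy := (h.mem_frontier_iff (hK₀W hyK)).1 hyΓ
    set r := ‖x - y‖ with hr
    have hrn : 0 ≤ r := norm_nonneg _
    have hr1 : r ≤ 1 := hxy.trans ((min_le_right _ _).trans (by norm_num))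
    set β := min α 1 with hβ
    have hβ0 : 0 < β := lt_min hα one_pos
    have hrα : r ^ α ≤ r ^ β := Real.rpow_le_rpow_of_exponent_ge_of_imp hrn hr1 (min_le_left _ _)
      (fun _ h0 => absurd h0 hα.ne')
    have hrr : r ≤ r ^ β := by
      have := Real.rpow_le_rpow_of_exponent_ge_of_imp (y := 1) hrn hr1 (min_le_right α 1)
        (fun _ h0 => absurd h0 one_ne_zero)
      rwa [Real.rpow_one] at this
    have hrβ : 0 ≤ r ^ β := by positivity
    have hrα1 : r ^ α ≤ 1 := Real.rpow_le_one hrn hr1 hα.le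
    have hLxy := hLip x hxK y hyK
    constructor
    · have e1 := hD2 (p x) (hpK x hxK) (p y) (hpK y hyK)
      have e2 := norm_sub_fderiv_le_of_holder hpd hα hM hM0 x y
      have e3 : ‖fderiv ℝ G (p y) (p x - p y - fderiv ℝ p y (x - y))‖ ≤ D * (M * r ^ α * r) :=
        (ContinuousLinearMap.le_opNorm _ _).trans
          (mul_le_mul (hD1 _ (hpK y hyK)) e2 (norm_nonneg _) hD0)
      have e4 : G (p x) - G (p y) - ((fderiv ℝ G (p y)).comp (fderiv ℝ p y)) (x - y)
          = (G (p x) - G (p y) - fderiv ℝ G (p y) (p x - p y))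
            + fderiv ℝ G (p y) (p x - p y - fderiv ℝ p y (x - y)) := by
        rw [ContinuousLinearMap.comp_apply, map_sub (fderiv ℝ G (p y)) (p x - p y)]
        abel
      calc ‖G (p x) - G (p y) - ((fderiv ℝ G (p y)).comp (fderiv ℝ p y)) (x - y)‖
          ≤ D * ‖p x - p y‖ ^ 2 + D * (M * r ^ α * r) := by
            rw [e4]; exact (norm_add_le _ _).trans (add_le_add e1 e3)
        _ ≤ D * (L * r) ^ 2 + D * (M * r ^ β * r) := by gcongr
        _ = D * L ^ 2 * r * r + D * M * r ^ β * r := by ring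
        _ ≤ D * L ^ 2 * r ^ β * r + D * M * r ^ β * r := by gcongr
        _ = (D * L ^ 2 + D * M) * r ^ β * r := by ring
        _ ≤ C * r ^ β * r := by
            have h1 : 0 ≤ D * L + 2 * M + L * (M + L) := by positivity
            gcongr
            rw [hC]; linarith
    -- Both end points are zeros of `ρ`, so the trapezoidal rule bounds the pairing of the chord
    -- with the sum of the unnormalized gradients, to order `r ^ (2 + α)`.
    · have t1 := abs_sub_trapezoid_le_of_holder h.contDiff hα hM' hM0 x y
      rw [hρx, hρy, ← inner_gradient, ← inner_gradient, ← hp, ← hr] at t1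
      set ix := inner ℝ (p x) (x - y) with hix
      set iy := inner ℝ (p y) (x - y) with hiy
      have t2 : |ix + iy| ≤ 2 * M * r ^ α * r ^ 2 := by
        have : |0 - 0 - 1 / 2 * (ix + iy)| = 1 / 2 * |ix + iy| := by
          rw [sub_self, zero_sub, abs_neg, abs_mul, abs_of_pos (by norm_num : (0 : ℝ) < 1 / 2)]
        rw [this] at t1; linarith
      have t3 : |ix - iy| ≤ L * r ^ 2 := by
        rw [hix, hiy, ← inner_sub_left]
        refine (abs_real_inner_le_norm _ _).trans ?_
        calc ‖p x - p y‖ * ‖x - y‖ ≤ L * r * r := mul_le_mul_of_nonneg_right hLxy (norm_nonneg _)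
          _ = _ := by ring
      have t4 : |iy| ≤ (M + L) * r ^ 2 := by
        have h1 : |2 * iy| ≤ |ix + iy| + |ix - iy| := by
          have := abs_sub (ix + iy) (ix - iy)
          rwa [show ix + iy - (ix - iy) = 2 * iy by ring] at this
        rw [abs_mul, abs_two] at h1
        have h2 : 2 * M * r ^ α * r ^ 2 ≤ 2 * M * 1 * r ^ 2 := by gcongr
        nlinarith [mul_nonneg hL0 (sq_nonneg r)]
      set a := ‖p x‖⁻¹ with ha
      set b := ‖p y‖⁻¹ with hb
      have hpx := h.one_le_norm_gradient x
      have hpy := h.one_le_norm_gradient y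
      rw [← hp] at hpx hpy
      have ha0 : 0 ≤ a := by positivity
      have ha1 : a ≤ 1 := inv_le_one_of_one_le₀ hpx
      have hb1 : b ≤ 1 := inv_le_one_of_one_le₀ hpy
      have hb0 : 0 ≤ b := by positivity
      have hab : |b - a| ≤ L * r := by
        have h1 : b - a = (‖p x‖ - ‖p y‖) * (a * b) := by
          rw [ha, hb]; field_simp
        rw [h1, abs_mul, abs_of_nonneg (mul_nonneg ha0 hb0)]
        exact (mul_le_of_le_one_right (abs_nonneg _) (mul_le_one₀ ha1 hb0 hb1)).trans
          ((abs_norm_sub_norm_le _ _).trans hLxy)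
      -- Normalizing costs `(b - a) * iy`, which is of third order: `b - a` is `O(r)` and the chord
      -- is tangent up to `O(r ^ 2)`.
      have e5 : inner ℝ (x - y) (a • p x + b • p y) = a * (ix + iy) + (b - a) * iy := by
        rw [inner_add_right, inner_smul_right, inner_smul_right, real_inner_comm (p x),
          real_inner_comm (p y)]
        ring
      rw [e5]
      calc |a * (ix + iy) + (b - a) * iy| ≤ a * |ix + iy| + |b - a| * |iy| := by
            refine (abs_add_le _ _).trans_eq ?_
            rw [abs_mul, abs_mul, abs_of_nonneg ha0]
        _ ≤ 1 * (2 * M * r ^ α * r ^ 2) + L * r * ((M + L) * r ^ 2) := by gcongr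
        _ ≤ 1 * (2 * M * r ^ β * r ^ 2) + L * r ^ β * ((M + L) * r ^ 2) := by gcongr
        _ = (2 * M + L * (M + L)) * r ^ β * r ^ 2 := by ring
        _ ≤ C * r ^ β * r ^ 2 := by
            have h1 : 0 ≤ D * L + D * L ^ 2 + D * M := by positivity
            gcongr
            rw [hC]; linarith

end IsDefiningFun

/-- Every boundary point has a local defining function of class `C^{2,α}`. -/
def HasDefiningFuns (Ω : Set (Euc (n + 1))) (α : ℝ) : Prop :=
  ∀ x ∈ frontier Ω, ∃ W ρ e, x ∈ W ∧ IsDefiningFun Ω W α ρ e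

lemma HasDefiningFuns.norm_outwardNormal (H : HasDefiningFuns Ω α) (hx : x ∈ frontier Ω) :
    ‖outwardNormal Ω x‖ = 1 := by
  obtain ⟨W, ρ, e, hxW, h⟩ := H x hx
  have h1 := h.isOutwardNormal hxW ((h.mem_frontier_iff hxW).1 hx)
  rw [h1.outwardNormal_eq]
  exact h1.1

lemma HasDefiningFuns.continuousOn_outwardNormal (H : HasDefiningFuns Ω α) :
    ContinuousOn (outwardNormal Ω) (frontier Ω) := by
  intro x hx
  obtain ⟨W, ρ, e, hxW, h⟩ := H x hx
  refine (h.continuous_normal.continuousWithinAt (s := frontier Ω) (x := x)).congr_of_eventuallyEq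
    ?_ (h.outwardNormal_eq hxW hx)
  filter_upwards [mem_nhdsWithin_of_mem_nhds (h.isOpen.mem_nhds hxW), self_mem_nhdsWithin]
    with y hy1 hy2 using h.outwardNormal_eq hy1 hy2

/-- The outward normal has a bounded measurable derivative along the boundary, with Hölder
remainder, and chords are almost orthogonal to the sum of the normals at their end points. -/
theorem HasDefiningFuns.exists_weingarten (H : HasDefiningFuns Ω α) (hα : 0 < α)
    (hc : IsCompact (frontier Ω)) :
    ∃ (S : Euc (n + 1) → Euc (n + 1) →L[ℝ] Euc (n + 1)) (C : ℝ), Measurable S ∧ 0 ≤ C ∧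
      (∀ y ∈ frontier Ω, ‖S y‖ ≤ C) ∧ ∀ x ∈ frontier Ω, ∀ y ∈ frontier Ω,
        ‖outwardNormal Ω x - outwardNormal Ω y - S y (x - y)‖
          ≤ C * ‖x - y‖ ^ (min α 1) * ‖x - y‖ ∧
        |inner ℝ (x - y) (outwardNormal Ω x + outwardNormal Ω y)|
          ≤ C * ‖x - y‖ ^ (min α 1) * ‖x - y‖ ^ 2 := by
  set β := min α 1 with hβ
  have hβ0 : 0 < β := lt_min hα one_pos
  -- Induction on compact sets glues the local estimates. The measurable enlargement `t` is needed
  -- so that the piecewise defined `S` stays measurable.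
  let Q : Set (Euc (n + 1)) → Prop := fun s => ∃ t, s ⊆ t ∧ MeasurableSet t ∧
    ∃ r₀ : ℝ, 0 < r₀ ∧ ∃ (S : Euc (n + 1) → Euc (n + 1) →L[ℝ] Euc (n + 1)) (C : ℝ),
      Measurable S ∧ 0 ≤ C ∧ (∀ y ∈ t, ‖S y‖ ≤ C) ∧
      ∀ y ∈ t ∩ frontier Ω, ∀ x ∈ frontier Ω, ‖x - y‖ ≤ r₀ →
        ‖outwardNormal Ω x - outwardNormal Ω y - S y (x - y)‖ ≤ C * ‖x - y‖ ^ β * ‖x - y‖ ∧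
        |inner ℝ (x - y) (outwardNormal Ω x + outwardNormal Ω y)|
          ≤ C * ‖x - y‖ ^ β * ‖x - y‖ ^ 2
  have hQ : Q (frontier Ω) := by
    refine hc.induction_on (p := Q) ?_ ?_ ?_ ?_
    · exact ⟨∅, subset_rfl, MeasurableSet.empty, 1, one_pos, fun _ => 0, 0, measurable_const,
        le_rfl, by simp, by simp⟩
    · rintro s s' hss ⟨t, hst, h⟩
      exact ⟨t, hss.trans hst, h⟩
    · rintro s s' ⟨t, hst, hm, r, hr, S, C, hS, hC, hSC, h⟩
        ⟨t', hst', hm', r', hr', S', C', hS', hC', hSC', h'⟩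
      classical
      refine ⟨t ∪ t', union_subset_union hst hst', hm.union hm', min r r', lt_min hr hr',
        t.piecewise S S', max C C', Measurable.piecewise hm hS hS', hC.trans (le_max_left _ _),
        fun y hy => ?_, fun y hy x hx hxy => ?_⟩
      · by_cases hyt : y ∈ t
        · rw [piecewise_eq_of_mem _ _ _ hyt]; exact (hSC y hyt).trans (le_max_left _ _)
        · rw [piecewise_eq_of_notMem _ _ _ hyt]
          exact (hSC' y (hy.resolve_left hyt)).trans (le_max_right _ _)
      · by_cases hyt : y ∈ t
        · rw [piecewise_eq_of_mem _ _ _ hyt]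
          obtain ⟨h1, h2⟩ := h y ⟨hyt, hy.2⟩ x hx (hxy.trans (min_le_left _ _))
          exact ⟨h1.trans (by gcongr; exact le_max_left _ _),
            h2.trans (by gcongr; exact le_max_left _ _)⟩
        · rw [piecewise_eq_of_notMem _ _ _ hyt]
          obtain ⟨h1, h2⟩ := h' y ⟨hy.1.resolve_left hyt, hy.2⟩ x hx (hxy.trans (min_le_right _ _))
          exact ⟨h1.trans (by gcongr; exact le_max_right _ _),
            h2.trans (by gcongr; exact le_max_right _ _)⟩
    · intro x hx
      obtain ⟨W, ρ, e, hxW, h⟩ := H x hx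
      obtain ⟨r₀, hr₀, S, C, hS, hC, hSC, hest⟩ := h.exists_local_weingarten hα hxW
      exact ⟨Metric.ball x r₀, mem_nhdsWithin_of_mem_nhds (Metric.ball_mem_nhds x hr₀),
        Metric.ball x r₀, subset_rfl, Metric.isOpen_ball.measurableSet, r₀, hr₀, S, C,
        hS.measurable, hC, hSC, hest⟩
  obtain ⟨t, hst, -, r₀, hr₀, S, C, hS, hC, hSC, h⟩ := hQ
  have hr₀β : 0 < r₀ ^ β := by positivity
  -- The two extra terms absorb chords longer than `r₀`, for which only unit length of the normals
  -- and the bound on `S` are used.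
  refine ⟨S, C + 2 / (r₀ ^ β * r₀) + C / r₀ ^ β, hS, by positivity,
    fun y hy => (hSC y (hst hy)).trans ?_, fun x hx y hy => ?_⟩
  · have : 0 ≤ 2 / (r₀ ^ β * r₀) + C / r₀ ^ β := by positivity
    linarith
  · rcases le_or_gt ‖x - y‖ r₀ with hxy | hxy
    · obtain ⟨h1, h2⟩ := h y ⟨hst hy, hy⟩ x hx hxy
      have : C ≤ C + 2 / (r₀ ^ β * r₀) + C / r₀ ^ β := by
        have : 0 ≤ 2 / (r₀ ^ β * r₀) + C / r₀ ^ β := by positivity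
        linarith
      exact ⟨h1.trans (by gcongr), h2.trans (by gcongr)⟩
    · have hr0 : 0 < ‖x - y‖ := hr₀.trans hxy
      have hN : ‖outwardNormal Ω x‖ + ‖outwardNormal Ω y‖ = 2 := by
        rw [H.norm_outwardNormal hx, H.norm_outwardNormal hy]; norm_num
      have hrβ : r₀ ^ β ≤ ‖x - y‖ ^ β := Real.rpow_le_rpow hr₀.le hxy.le hβ0.le
      have e1 : 2 ≤ 2 / (r₀ ^ β * r₀) * (‖x - y‖ ^ β * ‖x - y‖) := by
        rw [div_mul_eq_mul_div, le_div_iff₀ (by positivity)]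
        gcongr
      have e2 : C ≤ C / r₀ ^ β * ‖x - y‖ ^ β := by
        rw [div_mul_eq_mul_div, le_div_iff₀ hr₀β]
        gcongr
      have e3 : 0 ≤ C * ‖x - y‖ ^ β * ‖x - y‖ := by positivity
      constructor
      · calc _ ≤ ‖outwardNormal Ω x‖ + ‖outwardNormal Ω y‖ + ‖S y‖ * ‖x - y‖ :=
              (norm_sub_le _ _).trans (add_le_add (norm_sub_le _ _)
                (ContinuousLinearMap.le_opNorm _ _))
          _ ≤ 2 / (r₀ ^ β * r₀) * (‖x - y‖ ^ β * ‖x - y‖) + C / r₀ ^ β * ‖x - y‖ ^ β * ‖x - y‖ := by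
              rw [hN]
              refine add_le_add e1 (mul_le_mul_of_nonneg_right ((hSC y (hst hy)).trans e2)
                (norm_nonneg _))
          _ ≤ _ := by linarith
      · calc _ ≤ ‖x - y‖ * (‖outwardNormal Ω x‖ + ‖outwardNormal Ω y‖) :=
              (abs_real_inner_le_norm _ _).trans
                (mul_le_mul_of_nonneg_left (norm_add_le _ _) (norm_nonneg _))
          _ ≤ ‖x - y‖ * (2 / (r₀ ^ β * r₀) * (‖x - y‖ ^ β * ‖x - y‖)) := by
              rw [hN]; gcongr
          _ = 2 / (r₀ ^ β * r₀) * ‖x - y‖ ^ β * ‖x - y‖ ^ 2 := by ring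
          _ ≤ _ := by
              gcongr
              have : 0 ≤ C / r₀ ^ β := by positivity
              linarith

end NormalEstimates

/-! ### Graph charts and surface measure -/

section Coordinates

variable {n : ℕ}

@[simp] lemma horiz_apply (x : Euc (n + 1)) (i : Fin n) : horiz x i = x i.castSucc := rfl

@[simp] lemma horiz_pair (x' : Euc n) (t : ℝ) : horiz (pair x' t) = x' := by
  ext i; simp [pair]

@[simp] lemma vert_pair (x' : Euc n) (t : ℝ) : vert (pair x' t) = t := by
  simp [vert, pair]

@[simp] lemma pair_horiz_vert (x : Euc (n + 1)) : pair (horiz x) (vert x) = x := by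
  ext i
  refine Fin.lastCases ?_ (fun i => ?_) i <;> simp [pair, vert]

lemma norm_sq_eq_horiz_vert (x : Euc (n + 1)) : ‖x‖ ^ 2 = ‖horiz x‖ ^ 2 + vert x ^ 2 := by
  rw [EuclideanSpace.norm_sq_eq, EuclideanSpace.norm_sq_eq, Fin.sum_univ_castSucc]
  simp [vert]

lemma norm_horiz_le (x : Euc (n + 1)) : ‖horiz x‖ ≤ ‖x‖ := by
  have := norm_sq_eq_horiz_vert x
  exact (sq_le_sq₀ (norm_nonneg _) (norm_nonneg _)).1 (by nlinarith [sq_nonneg (vert x)])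

/-- `horiz` as a continuous linear map. -/
def horizCLM (n : ℕ) : Euc (n + 1) →L[ℝ] Euc n :=
  LinearMap.mkContinuous
    { toFun := horiz
      map_add' := fun x y => by ext i; simp
      map_smul' := fun c x => by ext i; simp } 1
    fun x => by simpa using norm_horiz_le x

/-- `vert` as a continuous linear map. -/
def vertCLM (n : ℕ) : Euc (n + 1) →L[ℝ] ℝ := EuclideanSpace.proj (Fin.last n)

@[simp] lemma vertCLM_apply (x : Euc (n + 1)) : vertCLM n x = vert x := rfl

lemma contDiff_pair {m : WithTop ℕ∞} {f : Euc n → ℝ} (hf : ContDiff ℝ m f) :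
    ContDiff ℝ m fun x' => pair x' (f x') := by
  rw [contDiff_euclidean]
  intro i
  refine Fin.lastCases ?_ (fun i => ?_) i
  · simpa [pair] using hf
  · simpa [pair] using (EuclideanSpace.proj (𝕜 := ℝ) i : Euc n →L[ℝ] ℝ).contDiff

lemma contDiff_affineIsometryEquiv {m : WithTop ℕ∞} (f : Euc n ≃ᵃⁱ[ℝ] Euc n) : ContDiff ℝ m f := by
  have : (f : Euc n → Euc n) = fun x => f.linearIsometryEquiv x + f 0 := by
    funext x
    have := f.map_vsub x 0
    rw [vsub_eq_sub, vsub_eq_sub, sub_zero] at this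
    rw [this, sub_add_cancel]
  rw [this]
  exact f.linearIsometryEquiv.contDiff.add contDiff_const

end Coordinates

namespace LocalGraph

variable {n : ℕ} {Ω : Set (Euc (n + 1))} {α : ℝ} (c : LocalGraph Ω)

/-- The chart: the horizontal coordinates after the rigid motion. -/
def proj (x : Euc (n + 1)) : Euc n := horiz (c.motion x)

/-- The height above the graph. -/
def defFun (x : Euc (n + 1)) : ℝ := vert (c.motion x) - c.F (c.proj x)

/-- The linear part of the rigid motion. -/
def linear : Euc (n + 1) →L[ℝ] Euc (n + 1) :=
  (c.motion.linearIsometryEquiv.toContinuousLinearEquiv : Euc (n + 1) →L[ℝ] Euc (n + 1))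

/-- The vertical direction in the original coordinates. -/
def dir : Euc (n + 1) := c.motion.linearIsometryEquiv.symm (pair 0 1)

lemma motion_sub (x y : Euc (n + 1)) : c.motion x - c.motion y = c.linear (x - y) :=
  (c.motion.map_vsub x y).symm

lemma motion_eq (x : Euc (n + 1)) : c.motion x = c.linear x + c.motion 0 := by
  have := c.motion_sub x 0
  rw [sub_zero] at this
  rw [← this, sub_add_cancel]

lemma norm_linear (v : Euc (n + 1)) : ‖c.linear v‖ = ‖v‖ :=
  c.motion.linearIsometryEquiv.norm_map v

@[simp] lemma linear_dir : c.linear c.dir = pair 0 1 :=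
  c.motion.linearIsometryEquiv.apply_symm_apply _

lemma norm_dir : ‖c.dir‖ = 1 := by
  rw [← c.norm_linear, linear_dir]
  have := norm_sq_eq_horiz_vert (pair (0 : Euc n) 1)
  rw [horiz_pair, vert_pair, norm_zero] at this
  exact (pow_eq_one_iff_of_nonneg (norm_nonneg _) two_ne_zero).1 (by rw [this]; norm_num)

/-- The linear part of the chart. -/
def projLinear : Euc (n + 1) →L[ℝ] Euc n := (horizCLM n).comp c.linear

lemma norm_projLinear_le : ‖c.projLinear‖ ≤ 1 :=
  ContinuousLinearMap.opNorm_le_bound _ zero_le_one fun v => by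
    rw [one_mul]
    exact (norm_horiz_le _).trans_eq (c.norm_linear v)

lemma proj_sub (x y : Euc (n + 1)) : c.proj x - c.proj y = c.projLinear (x - y) := by
  change horizCLM n (c.motion x) - horizCLM n (c.motion y) = horizCLM n (c.linear (x - y))
  rw [← map_sub, motion_sub]

lemma norm_proj_sub_le (x y : Euc (n + 1)) : ‖c.proj x - c.proj y‖ ≤ ‖x - y‖ := by
  rw [proj_sub]
  exact (c.projLinear.le_of_opNorm_le c.norm_projLinear_le _).trans_eq (one_mul _)

lemma lipschitzWith_proj : LipschitzWith 1 c.proj :=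
  LipschitzWith.of_dist_le_mul fun x y => by
    rw [dist_eq_norm, dist_eq_norm, NNReal.coe_one, one_mul]; exact c.norm_proj_sub_le x y

@[simp] lemma proj_param (x' : Euc n) : c.proj (c.param x') = x' := by
  simp [proj, param]

lemma defFun_param (x' : Euc n) : c.defFun (c.param x') = 0 := by
  simp [defFun, proj, param]

lemma param_proj {x : Euc (n + 1)} (hx : c.defFun x = 0) : c.param (c.proj x) = x := by
  rw [param]
  have : c.F (c.proj x) = vert (c.motion x) := by rw [defFun] at hx; linarith
  rw [this, proj, pair_horiz_vert, AffineIsometryEquiv.symm_apply_apply]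

lemma contDiff_param {m : WithTop ℕ∞} (hF : ContDiff ℝ m c.F) : ContDiff ℝ m c.param :=
  (contDiff_affineIsometryEquiv c.motion.symm).comp (contDiff_pair hF)

lemma isOpen_dom (hF : Continuous c.F) : IsOpen c.dom :=
  c.isOpen_W.preimage (c.contDiff_param (contDiff_zero.2 hF)).continuous

/-- The graph is of class `C^{2,α}`. -/
def IsC2Holder (α : ℝ) : Prop :=
  ContDiff ℝ 2 c.F ∧ ∃ M : ℝ, ∀ y z : Euc n,
    ‖fderiv ℝ (fderiv ℝ c.F) y - fderiv ℝ (fderiv ℝ c.F) z‖ ≤ M * ‖y - z‖ ^ α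

variable {c}

lemma hasFDerivAt_defFun (hF : ContDiff ℝ 2 c.F) (x : Euc (n + 1)) :
    HasFDerivAt c.defFun
      ((vertCLM n).comp c.linear - (fderiv ℝ c.F (c.proj x)).comp c.projLinear) x := by
  have h1 : HasFDerivAt c.proj c.projLinear x := by
    have : c.proj = fun z => c.projLinear z + c.proj 0 := by
      funext z
      have := c.proj_sub z 0
      rw [sub_zero] at this
      rw [← this, sub_add_cancel]
    rw [this]
    exact c.projLinear.hasFDerivAt.add_const _
  have h2 : HasFDerivAt (fun z => vert (c.motion z)) ((vertCLM n).comp c.linear) x := by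
    have : (fun z => vert (c.motion z)) = fun z => (vertCLM n).comp c.linear z
        + vertCLM n (c.motion 0) := by
      funext z
      rw [c.motion_eq z, ← vertCLM_apply, map_add]; rfl
    rw [this]
    exact ((vertCLM n).comp c.linear).hasFDerivAt.add_const _
  exact h2.sub (((hF.differentiable (by norm_num)) (c.proj x)).hasFDerivAt.comp x h1)

lemma IsC2Holder.isDefiningFun (hα : 0 < α) (h : c.IsC2Holder α) :
    IsDefiningFun Ω c.W α c.defFun c.dir := by
  obtain ⟨hF, M, hM⟩ := h
  have hd : fderiv ℝ c.defFun = fun x => (vertCLM n).comp c.linear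
      - (fderiv ℝ c.F (c.proj x)).comp c.projLinear :=
    funext fun x => (hasFDerivAt_defFun hF x).fderiv
  have hproj : ContDiff ℝ 2 c.proj :=
    (horizCLM n).contDiff.comp (contDiff_affineIsometryEquiv c.motion)
  have hpd : ∀ x, HasFDerivAt c.proj c.projLinear x := fun x => by
    have : c.proj = fun z => c.projLinear z + c.proj 0 := by
      funext z
      have := c.proj_sub z 0
      rw [sub_zero] at this
      rw [← this, sub_add_cancel]
    rw [this]
    exact c.projLinear.hasFDerivAt.add_const _
  have hd1 : Differentiable ℝ (fderiv ℝ c.F) :=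
    (hF.fderiv_right (m := 1) (by norm_num)).differentiable (by norm_num)
  set T := (ContinuousLinearMap.compL ℝ (Euc (n + 1)) (Euc n) ℝ).flip c.projLinear with hT
  have hTle : ∀ φ, ‖T φ‖ ≤ ‖φ‖ := fun φ => by
    refine (ContinuousLinearMap.opNorm_comp_le φ c.projLinear).trans ?_
    exact mul_le_of_le_one_right (norm_nonneg _) c.norm_projLinear_le
  -- The height is affine and drops out; precomposition with the linear part of the chart, of norm
  -- at most one, transfers the Hölder constant of `F` unchanged.
  have hd2 : ∀ x, fderiv ℝ (fderiv ℝ c.defFun) x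
      = -(T.comp ((fderiv ℝ (fderiv ℝ c.F) (c.proj x)).comp c.projLinear)) := fun x => by
    rw [hd]
    have h1 := (T.hasFDerivAt.comp x ((hd1 (c.proj x)).hasFDerivAt.comp x (hpd x))).const_sub
      ((vertCLM n).comp c.linear)
    exact h1.fderiv
  refine ⟨c.isOpen_W, ?_, fun x => ?_, c.norm_dir.le, ⟨max M 0, le_max_right _ _, fun x y => ?_⟩,
    fun x hx => ?_⟩
  · exact ((vertCLM n).contDiff.comp (contDiff_affineIsometryEquiv c.motion)).sub (hF.comp hproj)
  · rw [hd]
    have : c.projLinear c.dir = 0 := by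
      change horiz (c.linear c.dir) = 0
      rw [linear_dir, horiz_pair]
    simp [this]
  · rw [hd2, hd2, neg_sub_neg, ← ContinuousLinearMap.comp_sub, ← ContinuousLinearMap.sub_comp]
    have h1 : ‖fderiv ℝ (fderiv ℝ c.F) (c.proj y) - fderiv ℝ (fderiv ℝ c.F) (c.proj x)‖
        ≤ max M 0 * ‖x - y‖ ^ α := by
      refine (hM _ _).trans ?_
      rw [norm_sub_rev x y]
      gcongr
      · exact le_max_left _ _
      · exact c.norm_proj_sub_le _ _
    refine le_trans (ContinuousLinearMap.opNorm_le_bound _ (norm_nonneg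
      (fderiv ℝ (fderiv ℝ c.F) (c.proj y) - fderiv ℝ (fderiv ℝ c.F) (c.proj x))) fun v => ?_) h1
    refine (hTle _).trans (((fderiv ℝ (fderiv ℝ c.F) (c.proj y)
      - fderiv ℝ (fderiv ℝ c.F) (c.proj x)).le_opNorm (c.projLinear v)).trans ?_)
    gcongr
    exact (c.projLinear.le_of_opNorm_le c.norm_projLinear_le _).trans_eq (one_mul _)
  · rw [c.mem_iff x hx, defFun, sub_neg]; rfl

lemma IsC2Holder.param_mem_frontier (hα : 0 < α) (h : c.IsC2Holder α) {x' : Euc n}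
    (hx : x' ∈ c.dom) : c.param x' ∈ frontier Ω :=
  ((h.isDefiningFun hα).mem_frontier_iff hx).2 (c.defFun_param x')

lemma IsC2Holder.param_proj (hα : 0 < α) (h : c.IsC2Holder α) {x : Euc (n + 1)} (hx : x ∈ c.W)
    (hxf : x ∈ frontier Ω) : c.param (c.proj x) = x :=
  c.param_proj (((h.isDefiningFun hα).mem_frontier_iff hx).1 hxf)

end LocalGraph

lemma HasC2HolderBoundary.hasDefiningFuns {n : ℕ} {Ω : Set (Euc (n + 1))} {α : ℝ} (hα : 0 < α)
    (h : HasC2HolderBoundary Ω α) : HasDefiningFuns Ω α := fun x hx => by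
  obtain ⟨c, hcx, hc⟩ := h x hx
  exact ⟨c.W, c.defFun, c.dir, hcx, LocalGraph.IsC2Holder.isDefiningFun hα hc⟩

lemma _root_.LipschitzOnWith.euclideanHausdorffMeasure_image_le {X Y : Type*}
    [EMetricSpace X] [MeasurableSpace X] [BorelSpace X]
    [EMetricSpace Y] [MeasurableSpace Y] [BorelSpace Y] {K : ℝ≥0} {f : X → Y} {s : Set X}
    (h : LipschitzOnWith K f s) (d : ℕ) : μHE[d] (f '' s) ≤ (K : ℝ≥0∞) ^ d * μHE[d] s := by
  simp only [Measure.euclideanHausdorffMeasure_def, Measure.smul_apply, ENNReal.smul_def,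
    smul_eq_mul]
  rw [mul_left_comm]
  gcongr
  simpa using h.hausdorffMeasure_image_le (Nat.cast_nonneg d)

/-- The chart `c.proj` is 1-Lipschitz and inverts `c.param`, so it does not increase Hausdorff
measure. This one-sided comparison replaces the area formula and is all that is needed to pull `L²`
functions back to charts. -/
lemma LocalGraph.IsC2Holder.map_param_le {n : ℕ} {Ω : Set (Euc (n + 1))} {α : ℝ}
    {c : LocalGraph Ω} (hα : 0 < α) (h : c.IsC2Holder α) :
    Measure.map c.param (volume.restrict c.dom) ≤ surfaceMeasure Ω := by
  have hc : Continuous c.param := (c.contDiff_param h.1).continuous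
  refine Measure.le_iff.2 fun s hs => ?_
  rw [Measure.map_apply hc.measurable hs, Measure.restrict_apply (hc.measurable hs),
    surfaceMeasure, Measure.restrict_apply hs, ← EuclideanSpace.euclideanHausdorffMeasure_eq_volume]
  set t := c.param ⁻¹' s ∩ c.dom with ht
  have h1 : c.proj '' (c.param '' t) = t := by
    rw [image_image]; simp
  calc μHE[n] t = μHE[n] (c.proj '' (c.param '' t)) := by rw [h1]
    _ ≤ ((1 : ℝ≥0) : ℝ≥0∞) ^ n * μHE[n] (c.param '' t) :=
      (c.lipschitzWith_proj.lipschitzOnWith).euclideanHausdorffMeasure_image_le n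
    _ = μHE[n] (c.param '' t) := by simp
    _ ≤ _ := by
      refine measure_mono ?_
      rintro _ ⟨x', hx', rfl⟩
      exact ⟨hx'.1, h.param_mem_frontier hα hx'.2⟩

/-! ### Cancellation by almost measure-preserving reflections -/

section Reflection

variable {X : Type*} [MeasurableSpace X]

/-- Adding `B` makes the integrand nonnegative, so the comparison of measures applies; as the total
masses agree, the added constants cancel. -/
lemma integral_sub_le_of_measure_le {μ ν : Measure X} [IsFiniteMeasure μ] [IsFiniteMeasure ν]
    {L : ℝ≥0} (hL : 1 ≤ L) (h : ν ≤ L • μ) (hm : ν.real univ = μ.real univ) {f : X → ℝ}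
    (hf : Measurable f) {B : ℝ} (hB : ∀ x, |f x| ≤ B) :
    ∫ x, f x ∂ν - ∫ x, f x ∂μ ≤ 2 * B * ((L : ℝ) - 1) * μ.real univ := by
  have hi : ∀ κ : Measure X, IsFiniteMeasure κ → Integrable f κ := fun κ _ =>
    Integrable.of_bound hf.aestronglyMeasurable B (ae_of_all _ hB)
  have hg : ∀ κ : Measure X, IsFiniteMeasure κ → Integrable (fun x => f x + B) κ := fun κ hκ =>
    (hi κ hκ).add (integrable_const B)
  have hs : ∀ κ : Measure X, IsFiniteMeasure κ →
      ∫ x, (f x + B) ∂κ = ∫ x, f x ∂κ + κ.real univ * B := fun κ hκ => by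
    rw [integral_add (hi κ hκ) (integrable_const B), integral_const, smul_eq_mul]
  have h1 : ∫ x, (f x + B) ∂ν ≤ L * ∫ x, (f x + B) ∂μ := by
    have h2 := integral_mono_measure (f := fun x => f x + B) h
      (ae_of_all _ fun x => by have := (abs_le.1 (hB x)).1; change 0 ≤ f x + B; linarith)
      ((hg μ inferInstance).smul_measure_nnreal)
    rwa [integral_smul_nnreal_measure] at h2
  have h3 : ∫ x, (f x + B) ∂μ ≤ 2 * B * μ.real univ := by
    calc ∫ x, (f x + B) ∂μ ≤ ∫ _, 2 * B ∂μ :=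
          integral_mono (hg μ inferInstance) (integrable_const _) fun x => by
            have := (abs_le.1 (hB x)).2; change f x + B ≤ 2 * B; linarith
      _ = _ := by rw [integral_const, smul_eq_mul]; ring
  have hL' : (0 : ℝ) ≤ (L : ℝ) - 1 := by
    have : (1 : ℝ) ≤ L := by exact_mod_cast hL
    linarith
  have h4 := mul_le_mul_of_nonneg_left h3 hL'
  have h5 := hs ν inferInstance
  have h6 := hs μ inferInstance
  rw [hm] at h5
  nlinarith

/-- If a function is almost odd under a reflection that almost preserves the measure, then its
integral is small. -/
lemma abs_integral_le_of_reflection {μ : Measure X} [IsFiniteMeasure μ] {R : X → X}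
    (hR : Measurable R) {L : ℝ≥0} (hL : 1 ≤ L) (hmap : Measure.map R μ ≤ L • μ)
    (hRR : ∀ᵐ x ∂μ, R (R x) = x) {f : X → ℝ} (hf : Measurable f) {B D : ℝ}
    (hB : ∀ x, |f x| ≤ B) (hD : ∀ᵐ x ∂μ, |f (R x) + f x| ≤ D) :
    |∫ x, f x ∂μ| ≤ (D / 2 + B * ((L : ℝ) - 1)) * μ.real univ := by
  have hmm : Measure.map R (Measure.map R μ) = μ := by
    rw [Measure.map_map hR hR]
    conv_rhs => rw [← Measure.map_id (μ := μ)]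
    exact Measure.map_congr hRR
  have hfin : IsFiniteMeasure (Measure.map R μ) := inferInstance
  have hm : (Measure.map R μ).real univ = μ.real univ := by
    rw [map_measureReal_apply hR MeasurableSet.univ, preimage_univ]
  -- Pushing the inequality forward by the involution `R` reverses it, which gives the lower
  -- estimate of the integral as well.
  have hback : μ ≤ L • Measure.map R μ := by
    conv_lhs => rw [← hmm]
    rw [← Measure.map_smul]
    exact Measure.map_mono hmap hR
  have e1 := integral_sub_le_of_measure_le hL hmap hm hf hB
  have e2 := integral_sub_le_of_measure_le hL hback hm.symm hf hB
  rw [hm] at e2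
  rw [integral_map hR.aemeasurable hf.aestronglyMeasurable] at e1 e2
  have hi : Integrable f μ := Integrable.of_bound hf.aestronglyMeasurable B (ae_of_all _ hB)
  have hi' : Integrable (fun x => f (R x)) μ :=
    Integrable.of_bound (hf.comp hR).aestronglyMeasurable B (ae_of_all _ fun x => hB _)
  have e3 : |∫ x, f (R x) ∂μ + ∫ x, f x ∂μ| ≤ D * μ.real univ := by
    rw [← integral_add hi' hi]
    rw [← Real.norm_eq_abs]
    exact norm_integral_le_of_norm_le_const (by simpa only [Real.norm_eq_abs] using hD)
  rw [abs_le] at e3 ⊢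
  constructor <;> nlinarith

end Reflection

/-! ### The boundary measure is regular and annihilates odd kernels up to lower order -/

section SurfaceLike

variable {n : ℕ}

/-- Cancellation of odd kernels on a parametrized surface patch. -/
lemma abs_setIntegral_le_of_param {Ψ : Euc n → Euc (n + 1)} {π : Euc (n + 1) → Euc n}
    (hΨ : Continuous Ψ) (hπ : LipschitzWith 1 π) (hπΨ : ∀ z, π (Ψ z) = z) {p : Euc n}
    {r M : ℝ} {K : ℝ≥0} (hr : 0 < r) (hM : 0 ≤ M)
    (hK : LipschitzOnWith K Ψ (Metric.closedBall p r))
    (hs : ∀ z ∈ Metric.closedBall (0 : Euc n) r, ∀ w ∈ Metric.closedBall (0 : Euc n) r,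
      ‖(Ψ (p + z) + Ψ (p - z)) - (Ψ (p + w) + Ψ (p - w))‖ ≤ M * r * ‖z - w‖)
    {A : ℝ} (hA : 0 ≤ A) {k : Euc (n + 1) → ℝ} (hk : IsOddBump n A r k) :
    |∫ y in Ψ '' Metric.closedBall p r, k (Ψ p - y) ∂μHE[n]|
      ≤ (M / 2 * A * r / r ^ n + A / r ^ n * ((1 + M * r) ^ n - 1))
        * (μHE[n] : Measure (Euc (n + 1))).real (Ψ '' Metric.closedBall p r) := by
  set U := Ψ '' Metric.closedBall p r with hU
  have hUc : IsCompact U := (isCompact_closedBall p r).image hΨ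
  have hUm : MeasurableSet U := hUc.isClosed.measurableSet
  have hUfin : μHE[n] U < ⊤ := by
    refine (hK.euclideanHausdorffMeasure_image_le n).trans_lt ?_
    rw [EuclideanSpace.euclideanHausdorffMeasure_eq_volume]
    exact ENNReal.mul_lt_top (by simp) (isCompact_closedBall p r).measure_lt_top
  have hfin : IsFiniteMeasure ((μHE[n] : Measure (Euc (n + 1))).restrict U) :=
    ⟨by rwa [Measure.restrict_apply_univ]⟩
  have hpm : ∀ z, z ∈ Metric.closedBall p r → p + p - z ∈ Metric.closedBall p r := fun z hz => by
    rw [Metric.mem_closedBall, dist_eq_norm] at hz ⊢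
    rwa [show p + p - z - p = -(z - p) by abel, norm_neg]
  -- The point reflection `z ↦ 2p - z` of the parameter ball, transported to the surface.
  set R : Euc (n + 1) → Euc (n + 1) := fun y => Ψ (p + p - π y) with hRdef
  have hRc : Continuous R := hΨ.comp (continuous_const.sub hπ.continuous)
  have hRU : ∀ y ∈ U, R y ∈ U := by
    rintro _ ⟨z, hz, rfl⟩
    exact ⟨p + p - z, hpm z hz, by rw [hRdef]; simp only [hπΨ]⟩
  have hRR : ∀ y ∈ U, R (R y) = y := by
    rintro _ ⟨z, hz, rfl⟩
    simp [hRdef, hπΨ]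
  set L : ℝ≥0 := ⟨1 + M * r, by positivity⟩ with hLdef
  have hLv : (L : ℝ) = 1 + M * r := rfl
  have hball : ∀ z ∈ Metric.closedBall p r, z - p ∈ Metric.closedBall (0 : Euc n) r :=
    fun z hz => by simpa [dist_eq_norm] using hz
  -- The image difference is minus the original difference plus the variation of `Ψ (p + z) + Ψ (p -
  -- z)`, which has Lipschitz constant `M * r`. Hence `R` is `(1 + M * r)`-Lipschitz and, being an
  -- involution, changes Hausdorff measure at most by the factor `L ^ n` either way.
  have hRL : LipschitzOnWith L R U := by
    refine LipschitzOnWith.of_dist_le_mul ?_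
    rintro _ ⟨z, hz, rfl⟩ _ ⟨w, hw, rfl⟩
    rw [dist_eq_norm, dist_eq_norm, hLv]
    simp only [hRdef, hπΨ]
    have h1 := hs (z - p) (hball z hz) (w - p) (hball w hw)
    rw [show p + (z - p) = z by abel, show p + (w - p) = w by abel,
      show p - (z - p) = p + p - z by abel, show p - (w - p) = p + p - w by abel,
      show z - p - (w - p) = z - w by abel] at h1
    have h2 : ‖z - w‖ ≤ ‖Ψ z - Ψ w‖ := by
      have := hπ.dist_le_mul (Ψ z) (Ψ w)
      rwa [hπΨ, hπΨ, dist_eq_norm, dist_eq_norm, NNReal.coe_one, one_mul] at this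
    have h3 : Ψ (p + p - z) - Ψ (p + p - w)
        = (Ψ z + Ψ (p + p - z) - (Ψ w + Ψ (p + p - w))) - (Ψ z - Ψ w) := by abel
    rw [h3]
    refine (norm_sub_le _ _).trans ?_
    have h4 : M * r * ‖z - w‖ ≤ M * r * ‖Ψ z - Ψ w‖ :=
      mul_le_mul_of_nonneg_left h2 (by positivity)
    linarith
  have hmap : Measure.map R ((μHE[n] : Measure (Euc (n + 1))).restrict U)
      ≤ (L ^ n : ℝ≥0) • (μHE[n] : Measure (Euc (n + 1))).restrict U := by
    refine Measure.le_iff.2 fun s hsm => ?_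
    rw [Measure.map_apply hRc.measurable hsm, Measure.restrict_apply (hRc.measurable hsm),
      Measure.smul_apply, Measure.restrict_apply hsm]
    have h1 : R ⁻¹' s ∩ U ⊆ R '' (s ∩ U) := fun y hy => ⟨R y, ⟨hy.1, hRU y hy.2⟩, hRR y hy.2⟩
    refine (measure_mono h1).trans
      (((hRL.mono inter_subset_right).euclideanHausdorffMeasure_image_le n).trans_eq ?_)
    rw [ENNReal.smul_def, smul_eq_mul, ENNReal.coe_pow]
  have hkm : Measurable fun y => k (Ψ p - y) :=
    (hk.continuous.comp (continuous_const.sub continuous_id)).measurable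
  have hL1 : 1 ≤ L := by
    rw [← NNReal.coe_le_coe, hLv, NNReal.coe_one]
    have : 0 ≤ M * r := by positivity
    linarith
  have key := abs_integral_le_of_reflection (μ := (μHE[n] : Measure (Euc (n + 1))).restrict U)
    hRc.measurable (one_le_pow₀ hL1 : 1 ≤ L ^ n) hmap
    ((ae_restrict_iff' hUm).2 (ae_of_all _ fun y hy => hRR y hy)) hkm (fun y => hk.size _)
    -- `R` reflects through `Ψ p` up to an error `M * r ^ 2`; the Lipschitz constant `A / r ^ (n +
    -- 1)` of `k` and its oddness give this bound.
    (D := M * A * r / r ^ n)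
    ((ae_restrict_iff' hUm).2 (ae_of_all _ fun y hy => by
      obtain ⟨z, hz, rfl⟩ := hy
      have h1 := hs (z - p) (hball z hz) 0 (by simp [hr.le])
      rw [show p + (z - p) = z by abel, show p - (z - p) = p + p - z by abel, add_zero, sub_zero,
        sub_zero] at h1
      have h0 : ‖z - p‖ ≤ r := by simpa [dist_eq_norm] using hz
      simp only [hRdef, hπΨ]
      have h2 : k (Ψ p - Ψ (p + p - z)) + k (Ψ p - Ψ z)
          = k (Ψ p - Ψ (p + p - z)) - k (-(Ψ p - Ψ z)) := by rw [hk.odd]; ring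
      rw [h2]
      refine (hk.lip _ _).trans ?_
      have h3 : ‖Ψ p - Ψ (p + p - z) - -(Ψ p - Ψ z)‖ ≤ M * r * r := by
        rw [show Ψ p - Ψ (p + p - z) - -(Ψ p - Ψ z)
          = -((Ψ z + Ψ (p + p - z)) - (Ψ p + Ψ p)) by abel, norm_neg]
        exact h1.trans (by gcongr)
      calc A / r ^ (n + 1) * _ ≤ A / r ^ (n + 1) * (M * r * r) := by gcongr
        _ = M * A * r / r ^ n := by field_simp; ring))
  refine key.trans_eq ?_
  rw [measureReal_restrict_apply_univ, NNReal.coe_pow, hLv]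
  ring

/-- The derivative of the symmetric sum is `fderiv Ψ (p + z) - fderiv Ψ (p - z)`: the first-order
parts cancel and the second derivative leaves `O(‖z‖)`. -/
lemma exists_symmetric_sum_le {V F : Type*} [NormedAddCommGroup V] [NormedSpace ℝ V]
    [FiniteDimensional ℝ V] [NormedAddCommGroup F] [NormedSpace ℝ F] {Ψ : V → F}
    (hΨ : ContDiff ℝ 2 Ψ) (p₀ : V) (R : ℝ) :
    ∃ M : ℝ, 0 ≤ M ∧ ∀ p r, 0 ≤ r → Metric.closedBall p r ⊆ Metric.closedBall p₀ R →
      ∀ z ∈ Metric.closedBall (0 : V) r, ∀ w ∈ Metric.closedBall (0 : V) r,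
        ‖(Ψ (p + z) + Ψ (p - z)) - (Ψ (p + w) + Ψ (p - w))‖ ≤ M * r * ‖z - w‖ := by
  have hd : Differentiable ℝ Ψ := hΨ.differentiable (by norm_num)
  have hd1 : ContDiff ℝ 1 (fderiv ℝ Ψ) := hΨ.fderiv_right (by norm_num)
  obtain ⟨B, hB⟩ := (isCompact_closedBall p₀ R).exists_bound_of_continuousOn
    (f := fderiv ℝ (fderiv ℝ Ψ)) (hd1.continuous_fderiv (by norm_num)).continuousOn
  refine ⟨2 * max B 0, by positivity, fun p r hr hsub z hz w hw => ?_⟩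
  have hmem : ∀ z ∈ Metric.closedBall (0 : V) r, p + z ∈ Metric.closedBall p₀ R ∧
      p - z ∈ Metric.closedBall p₀ R := fun z hz => by
    rw [mem_closedBall_zero_iff] at hz
    exact ⟨hsub (by simpa [dist_eq_norm] using hz), hsub (by simpa [dist_eq_norm] using hz)⟩
  refine (convex_closedBall (0 : V) r).norm_image_sub_le_of_norm_hasFDerivWithin_le
    (f := fun z => Ψ (p + z) + Ψ (p - z)) (f' := fun z => fderiv ℝ Ψ (p + z) - fderiv ℝ Ψ (p - z))
    (C := 2 * max B 0 * r) (fun z _ => ?_) (fun z hz => ?_) hw hz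
  · have h1 : HasFDerivAt (fun z => Ψ (p + z)) (fderiv ℝ Ψ (p + z)) z :=
      (hd (p + z)).hasFDerivAt.comp z ((hasFDerivAt_id z).const_add p)
    have h2 : HasFDerivAt (fun z => Ψ (p - z)) (-fderiv ℝ Ψ (p - z)) z := by
      have := (hd (p - z)).hasFDerivAt.comp z ((hasFDerivAt_id z).const_sub p)
      refine this.congr_fderiv ?_
      ext v; simp
    rw [sub_eq_add_neg]
    exact (h1.add h2).hasFDerivWithinAt
  · have h1 := (convex_closedBall p₀ R).norm_image_sub_le_of_norm_fderiv_le (𝕜 := ℝ)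
      (f := fderiv ℝ Ψ) (fun z _ => (hd1.differentiable (by norm_num)) z) hB (hmem z hz).2
      (hmem z hz).1
    rw [show p + z - (p - z) = (2 : ℝ) • z by rw [two_smul]; abel, norm_smul] at h1
    rw [mem_closedBall_zero_iff] at hz
    calc _ ≤ B * (‖(2 : ℝ)‖ * ‖z‖) := h1
      _ ≤ max B 0 * (2 * r) := by
        rw [Real.norm_eq_abs, abs_two]
        gcongr
        exact le_max_left _ _
      _ = _ := by ring

/-- Regularity and cancellation near a boundary point. -/
lemma LocalGraph.IsC2Holder.exists_local_surfaceLike {Ω : Set (Euc (n + 1))} {α : ℝ}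
    {c : LocalGraph Ω} (hα : 0 < α) (h : c.IsC2Holder α) {x₀ : Euc (n + 1)} (hx₀ : x₀ ∈ c.W)
    (hx₀f : x₀ ∈ frontier Ω) :
    ∃ r₀ : ℝ, 0 < r₀ ∧ ∃ C : ℝ, 0 ≤ C ∧ ∀ x ∈ Metric.ball x₀ r₀ ∩ frontier Ω, ∀ r, 0 < r → r ≤ r₀ →
      surfaceMeasure Ω (Metric.closedBall x r) ≤ ENNReal.ofReal (C * r ^ n) ∧
      ∀ A, 0 ≤ A → ∀ k : Euc (n + 1) → ℝ, IsOddBump n A r k →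
        |∫ y, k (x - y) ∂(surfaceMeasure Ω)| ≤ C * A * r := by
  obtain ⟨R, hR0, hRW⟩ := Metric.isOpen_iff.1 c.isOpen_W x₀ hx₀
  set p₀ := c.proj x₀ with hp₀
  have hΨ2 : ContDiff ℝ 2 c.param := c.contDiff_param h.1
  obtain ⟨K, hK0, -, hKlip, -⟩ := exists_norm_sub_fderiv_le_sq isOpen_univ hΨ2.contDiffOn
    (subset_univ (Metric.closedBall p₀ R)) (isCompact_closedBall _ _) (convex_closedBall _ _)
  obtain ⟨M, hM0, hM⟩ := exists_symmetric_sum_le hΨ2 p₀ R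
  -- Parameters within `2 * r₀` of `p₀` are mapped by the `K`-Lipschitz parametrization to within
  -- `R` of `x₀`, so the whole patch is boundary inside `W`.
  set r₀ := min (R / (4 * (K + 1))) 1 with hr₀
  have hr₀0 : 0 < r₀ := by positivity
  have hr₀1 : r₀ ≤ 1 := min_le_right _ _
  have hr₀R : 4 * (K + 1) * r₀ ≤ R := by
    have := min_le_left (R / (4 * (K + 1))) 1
    rw [← hr₀, le_div_iff₀ (by positivity)] at this
    linarith
  have hr₀R' : 4 * r₀ ≤ R := by nlinarith [mul_nonneg hK0 hr₀0.le]
  set v₁ := (volume : Measure (Euc n)).real (Metric.ball 0 1) with hv₁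
  have hv₁0 : 0 ≤ v₁ := measureReal_nonneg
  set C := K ^ n * v₁ + (M / 2 + M * (n * (1 + M) ^ n)) * (K ^ n * v₁) with hC
  have hC0 : 0 ≤ C := by positivity
  refine ⟨r₀, hr₀0, C, hC0, fun x hx r hr hrr₀ => ?_⟩
  set p := c.proj x with hp
  have hxW : x ∈ c.W := hRW (Metric.ball_subset_ball (by linarith) hx.1)
  have hΨp : c.param p = x := h.param_proj hα hxW hx.2
  have hpp₀ : ‖p - p₀‖ ≤ r₀ :=
    (c.norm_proj_sub_le x x₀).trans (by simpa [dist_eq_norm] using (Metric.mem_ball.1 hx.1).le)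
  have hsub : Metric.closedBall p r ⊆ Metric.closedBall p₀ R := by
    refine Metric.closedBall_subset_closedBall' ?_
    rw [dist_eq_norm]; linarith
  have hdom : Metric.closedBall p r ⊆ c.dom := fun z hz => by
    refine hRW ?_
    rw [Metric.mem_ball, dist_eq_norm]
    have h1 := hKlip z (hsub hz) p₀ (Metric.mem_closedBall_self hR0.le)
    rw [hp₀, h.param_proj hα hx₀ hx₀f, ← hp₀] at h1
    rw [Metric.mem_closedBall, dist_eq_norm] at hz
    have h2 : ‖z - p₀‖ ≤ 2 * r₀ := by
      have := norm_sub_le_norm_sub_add_norm_sub z p p₀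
      linarith
    have h3 : K * ‖z - p₀‖ ≤ K * (2 * r₀) := by gcongr
    nlinarith
  set U := c.param '' Metric.closedBall p r with hU
  have hUΓ : U ⊆ frontier Ω := by
    rintro _ ⟨z, hz, rfl⟩
    exact h.param_mem_frontier hα (hdom hz)
  -- Since the chart does not increase distances, the patch over the parameter ball of radius `r`
  -- contains all of the boundary on which a bump of scale `r` centred at `x` can live.
  have hΓU : Metric.closedBall x r ∩ frontier Ω ⊆ U := by
    rintro y ⟨hy, hyf⟩
    have hyW : y ∈ c.W := hRW (by
      have h1 := dist_triangle y x x₀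
      have h2 := Metric.mem_closedBall.1 hy
      have h3 := Metric.mem_ball.1 hx.1
      rw [Metric.mem_ball]; linarith)
    refine ⟨c.proj y, ?_, h.param_proj hα hyW hyf⟩
    rw [Metric.mem_closedBall, dist_eq_norm] at hy ⊢
    exact (c.norm_proj_sub_le y x).trans hy
  have hUm : MeasurableSet U :=
    ((isCompact_closedBall p r).image hΨ2.continuous).isClosed.measurableSet
  have hKL : LipschitzOnWith ⟨K, hK0⟩ c.param (Metric.closedBall p r) :=
    LipschitzOnWith.of_dist_le_mul fun z hz w hw => by
      rw [dist_eq_norm, dist_eq_norm]; exact hKlip z (hsub hz) w (hsub hw)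
  have hUmeas : μHE[n] U ≤ ENNReal.ofReal (K ^ n * v₁ * r ^ n) := by
    refine (hKL.euclideanHausdorffMeasure_image_le n).trans_eq ?_
    rw [EuclideanSpace.euclideanHausdorffMeasure_eq_volume, Measure.addHaar_closedBall _ _ hr.le,
      finrank_euclideanSpace_fin, mul_assoc, ENNReal.ofReal_mul (by positivity),
      ENNReal.ofReal_mul hv₁0, hv₁, measureReal_def, ENNReal.ofReal_toReal measure_ball_lt_top.ne,
      ENNReal.ofReal_pow hK0, mul_comm (volume _)]
    congr 2
    exact (ENNReal.ofReal_eq_coe_nnreal hK0).symm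
  have hUreal : (μHE[n] : Measure (Euc (n + 1))).real U ≤ K ^ n * v₁ * r ^ n :=
    ENNReal.toReal_le_of_le_ofReal (by positivity) hUmeas
  refine ⟨?_, fun A hA k hk => ?_⟩
  · rw [surfaceMeasure, Measure.restrict_apply Metric.isClosed_closedBall.measurableSet]
    refine (measure_mono hΓU).trans (hUmeas.trans (ENNReal.ofReal_le_ofReal ?_))
    gcongr
    rw [hC]
    have : 0 ≤ (M / 2 + M * (n * (1 + M) ^ n)) * (K ^ n * v₁) := by positivity
    linarith
  · have h1 : ∫ y, k (x - y) ∂(surfaceMeasure Ω) = ∫ y in U, k (x - y) ∂μHE[n] := by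
      rw [surfaceMeasure]
      refine setIntegral_eq_of_subset_of_forall_sdiff_eq_zero
        isClosed_frontier.measurableSet hUΓ fun y hy => hk.supp _ ?_
      by_contra! hlt
      refine hy.2 (hΓU ⟨?_, hy.1⟩)
      rwa [Metric.mem_closedBall, dist_eq_norm, norm_sub_rev]
    have h2 := abs_setIntegral_le_of_param hΨ2.continuous c.lipschitzWith_proj c.proj_param hr hM0
      hKL (hM p r hr.le hsub) hA hk
    rw [hΨp, ← hU] at h2
    rw [h1]
    have hr1 : r ≤ 1 := hrr₀.trans hr₀1
    have h3 : (1 + M * r) ^ n - 1 ≤ M * r * (n * (1 + M) ^ n) := by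
      have hb : ∀ m : ℕ, (1 + M * r) ^ m - 1 ≤ M * r * (m * (1 + M) ^ m) := by
        intro m
        induction m with
        | zero => simp
        | succ m ih =>
          have hMr : M * r ≤ M := mul_le_of_le_one_right hM0 hr1
          have hMr0 : 0 ≤ M * r := by positivity
          have e1 : (1 + M * r) ^ m ≤ (1 + M) ^ m := by gcongr
          have e2 : (1 + M) ^ m ≤ (1 + M) ^ (m + 1) := pow_le_pow_right₀ (by linarith) (by omega)
          have e3 : M * r * (m * (1 + M) ^ m) ≤ M * r * (m * (1 + M) ^ (m + 1)) := by gcongr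
          have e4 : M * r * (1 + M * r) ^ m ≤ M * r * (1 + M) ^ (m + 1) := by
            gcongr; exact e1.trans e2
          push_cast
          rw [pow_succ]
          linarith
      exact hb n
    calc _ ≤ _ := h2
      _ ≤ (M / 2 * A * r / r ^ n + A / r ^ n * (M * r * (n * (1 + M) ^ n)))
          * (K ^ n * v₁ * r ^ n) := by gcongr
      _ = (M / 2 + M * (n * (1 + M) ^ n)) * (K ^ n * v₁) * A * r := by field_simp
      _ ≤ C * A * r := by
        gcongr
        rw [hC]
        have : 0 ≤ K ^ n * v₁ := by positivity
        linarith

lemma HasC2HolderBoundary.exists_surfaceLike {Ω : Set (Euc (n + 1))} {α : ℝ} (hα : 0 < α)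
    (h : HasC2HolderBoundary Ω α) (hc : IsCompact (frontier Ω)) :
    IsFiniteMeasure (surfaceMeasure Ω) ∧ ∃ C₀ C₁ : ℝ, 0 ≤ C₀ ∧ 0 ≤ C₁ ∧
      IsSurfaceLike (surfaceMeasure Ω) (frontier Ω) n C₀ C₁ := by
  let Q : Set (Euc (n + 1)) → Prop := fun s => ∃ r₀ : ℝ, 0 < r₀ ∧ ∃ C : ℝ, 0 ≤ C ∧
    ∀ x ∈ s ∩ frontier Ω, ∀ r, 0 < r → r ≤ r₀ →
      surfaceMeasure Ω (Metric.closedBall x r) ≤ ENNReal.ofReal (C * r ^ n) ∧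
      ∀ A, 0 ≤ A → ∀ k : Euc (n + 1) → ℝ, IsOddBump n A r k →
        |∫ y, k (x - y) ∂(surfaceMeasure Ω)| ≤ C * A * r
  have hQ : Q (frontier Ω) := by
    refine hc.induction_on (p := Q) ?_ ?_ ?_ ?_
    · exact ⟨1, one_pos, 0, le_rfl, by simp⟩
    · rintro s s' hss ⟨r₀, hr₀, C, hC, h⟩
      exact ⟨r₀, hr₀, C, hC, fun x hx => h x ⟨hss hx.1, hx.2⟩⟩
    · rintro s s' ⟨r, hr, C, hC, h⟩ ⟨r', hr', C', hC', h'⟩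
      refine ⟨min r r', lt_min hr hr', max C C', hC.trans (le_max_left _ _),
        fun x hx t ht htr => ?_⟩
      rcases hx.1 with hxs | hxs
      · obtain ⟨h1, h2⟩ := h x ⟨hxs, hx.2⟩ t ht (htr.trans (min_le_left _ _))
        refine ⟨h1.trans (ENNReal.ofReal_le_ofReal ?_), fun A hA k hk => (h2 A hA k hk).trans ?_⟩ <;>
        · gcongr; exact le_max_left _ _
      · obtain ⟨h1, h2⟩ := h' x ⟨hxs, hx.2⟩ t ht (htr.trans (min_le_right _ _))
        refine ⟨h1.trans (ENNReal.ofReal_le_ofReal ?_), fun A hA k hk => (h2 A hA k hk).trans ?_⟩ <;>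
        · gcongr; exact le_max_right _ _
    · intro x hx
      obtain ⟨c, hcx, hcc⟩ := h x hx
      obtain ⟨r₀, hr₀, C, hC, hloc⟩ :=
        LocalGraph.IsC2Holder.exists_local_surfaceLike hα hcc hcx hx
      exact ⟨Metric.ball x r₀, mem_nhdsWithin_of_mem_nhds (Metric.ball_mem_nhds x hr₀), r₀, hr₀,
        C, hC, hloc⟩
  obtain ⟨r₀, hr₀, C, hC, hloc⟩ := hQ
  have hfin : IsFiniteMeasure (surfaceMeasure Ω) := by
    refine ⟨?_⟩
    rw [surfaceMeasure, Measure.restrict_apply_univ, ← Measure.restrict_apply_self]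
    refine hc.measure_lt_top_of_nhdsWithin fun x hx => ?_
    refine ⟨Metric.closedBall x r₀,
      mem_nhdsWithin_of_mem_nhds (Metric.closedBall_mem_nhds x hr₀), ?_⟩
    exact (hloc x ⟨hx, hx⟩ r₀ hr₀ le_rfl).1.trans_lt ENNReal.ofReal_lt_top
  set m := (surfaceMeasure Ω).real univ with hm
  have hm0 : 0 ≤ m := measureReal_nonneg
  -- For radii above `r₀` the total mass `m` gives both estimates with the added constants.
  refine ⟨hfin, C + m / r₀ ^ n, C + m / r₀ ^ (n + 1), by positivity, by positivity, ?_, ?_, ?_⟩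
  · exact ae_restrict_mem isClosed_frontier.measurableSet
  · intro x hx r hr
    rcases le_or_gt r r₀ with hrr | hrr
    · refine (ENNReal.toReal_le_of_le_ofReal (by positivity)
        (hloc x ⟨hx, hx⟩ r hr hrr).1).trans ?_
      gcongr
      have : 0 ≤ m / r₀ ^ n := by positivity
      linarith
    · refine (measureReal_mono (subset_univ _)).trans ?_
      rw [← hm]
      calc m = m / r₀ ^ n * r₀ ^ n := by field_simp
        _ ≤ m / r₀ ^ n * r ^ n := by gcongr
        _ ≤ _ := by gcongr; linarith
  · intro x hx r hr A hA k hk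
    rcases le_or_gt r r₀ with hrr | hrr
    · refine ((hloc x ⟨hx, hx⟩ r hr hrr).2 A hA k hk).trans ?_
      gcongr
      have : 0 ≤ m / r₀ ^ (n + 1) := by positivity
      linarith
    · have h1 : |∫ y, k (x - y) ∂(surfaceMeasure Ω)| ≤ A / r ^ n * m := by
        rw [← Real.norm_eq_abs]
        exact norm_integral_le_of_norm_le_const (ae_of_all _ fun y => hk.size _)
      refine h1.trans ?_
      calc A / r ^ n * m = m / r ^ (n + 1) * A * r := by field_simp; ring
        _ ≤ m / r₀ ^ (n + 1) * A * r := by gcongr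
        _ ≤ _ := by gcongr; linarith

end SurfaceLike

/-! ### Weak limits in Hilbert space -/

section WeakLimit

/-- Bounded sequences in a Hilbert space converge weakly along ultrafilters. -/
lemma exists_weak_limit {H ι : Type*} [NormedAddCommGroup H] [InnerProductSpace ℂ H]
    [CompleteSpace H] (l : Ultrafilter ι) {v : ι → H} {B : ℝ} (hv : ∀ m, ‖v m‖ ≤ B) :
    ∃ w : H, ‖w‖ ≤ B ∧ ∀ ℓ : StrongDual ℂ H, Tendsto (fun m => ℓ (v m)) l (𝓝 (ℓ w)) := by
  let d : ι → WeakDual ℂ H := fun m =>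
    StrongDual.toWeakDual (InnerProductSpace.toDual ℂ H (v m))
  have hd : ∀ m, d m ∈ (WeakDual.toStrongDual ⁻¹' Metric.closedBall (0 : StrongDual ℂ H) B :
      Set (WeakDual ℂ H)) := fun m => by
    change InnerProductSpace.toDual ℂ H (v m) ∈ Metric.closedBall (0 : StrongDual ℂ H) B
    rw [mem_closedBall_zero_iff, LinearIsometryEquiv.norm_map]
    exact hv m
  -- Banach–Alaoglu on the dual; along an ultrafilter no subsequence has to be extracted.
  obtain ⟨φ, hφ, hlim⟩ := (WeakDual.isCompact_closedBall (0 : StrongDual ℂ H) B).ultrafilter_le_nhds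
    (l.map d) (by
      rw [le_principal_iff]
      exact Filter.mem_map.2 (Filter.univ_mem' hd))
  refine ⟨(InnerProductSpace.toDual ℂ H).symm (WeakDual.toStrongDual φ), ?_, fun ℓ => ?_⟩
  · rw [LinearIsometryEquiv.norm_map]
    simpa using hφ
  · obtain ⟨r, rfl⟩ := (InnerProductSpace.toDual ℂ H).surjective ℓ
    have h1 : Tendsto (fun m => d m r) l (𝓝 (φ r)) :=
      ((WeakDual.eval_continuous r).tendsto φ).comp (hlim : Tendsto d l (𝓝 φ))
    have h2 : Tendsto (fun m => star (d m r)) l (𝓝 (star (φ r))) :=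
      (continuous_star.tendsto _).comp h1
    have h3 : ∀ m, star (d m r) = InnerProductSpace.toDual ℂ H r (v m) := fun m => by
      change star (InnerProductSpace.toDual ℂ H (v m) r) = _
      rw [InnerProductSpace.toDual_apply_apply, InnerProductSpace.toDual_apply_apply]
      exact inner_conj_symm _ _
    have h4 : star (φ r) = InnerProductSpace.toDual ℂ H r
        ((InnerProductSpace.toDual ℂ H).symm (WeakDual.toStrongDual φ)) := by
      rw [InnerProductSpace.toDual_apply_apply, ← inner_conj_symm,
        InnerProductSpace.toDual_symm_apply]
      rfl
    rw [← h4]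
    exact h2.congr h3

end WeakLimit

/-! ### Pull-back to charts and classical differentiation along the boundary -/

section Charts

variable {n : ℕ} {Ω : Set (Euc (n + 1))} {α : ℝ} {c : LocalGraph Ω}

lemma LocalGraph.IsC2Holder.continuous_param (h : c.IsC2Holder α) : Continuous c.param :=
  (c.contDiff_param h.1).continuous

lemma LocalGraph.IsC2Holder.quasiMeasurePreserving (hα : 0 < α) (h : c.IsC2Holder α) :
    Measure.QuasiMeasurePreserving c.param (volume.restrict c.dom) (surfaceMeasure Ω) :=
  ⟨h.continuous_param.measurable, Measure.absolutelyContinuous_of_le (h.map_param_le hα)⟩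

/-- Makes pairing with a chart weight a continuous functional on `L²(∂Ω)`, which is how weak
derivatives pass to the limit. -/
lemma LocalGraph.IsC2Holder.eLpNorm_comp_param_le {F : Type*} [NormedAddCommGroup F] (hα : 0 < α)
    (h : c.IsC2Holder α) {f : Euc (n + 1) → F} (hf : AEStronglyMeasurable f (surfaceMeasure Ω)) :
    eLpNorm (fun x' => f (c.param x')) 2 (volume.restrict c.dom)
      ≤ eLpNorm f 2 (surfaceMeasure Ω) := by
  have h1 := eLpNorm_map_measure (p := 2) (f := c.param) (μ := volume.restrict c.dom)
    (hf.mono_measure (h.map_param_le hα)) h.continuous_param.aemeasurable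
  exact h1.symm.le.trans (eLpNorm_mono_measure f (h.map_param_le hα))

lemma LocalGraph.IsC2Holder.memLp_comp_param {F : Type*} [NormedAddCommGroup F] (hα : 0 < α)
    (h : c.IsC2Holder α) {f : Euc (n + 1) → F} (hf : MemLp f 2 (surfaceMeasure Ω)) :
    MemLp (fun x' => f (c.param x')) 2 (volume.restrict c.dom) :=
  ⟨hf.1.comp_quasiMeasurePreserving (h.quasiMeasurePreserving hα),
    (h.eLpNorm_comp_param_le hα hf.1).trans_lt hf.2⟩

lemma LocalGraph.IsC2Holder.integrable_comp_param_mul (hα : 0 < α) (h : c.IsC2Holder α)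
    {f : Euc (n + 1) → ℂ} (hf : MemLp f 2 (surfaceMeasure Ω)) {q : Euc n → ℂ}
    (hq : MemLp q 2 (volume.restrict c.dom)) :
    IntegrableOn (fun x' => f (c.param x') * q x') c.dom :=
  MemLp.integrable_mul (h.memLp_comp_param hα hf) hq

lemma LocalGraph.IsC2Holder.norm_integral_comp_param_mul_le (hα : 0 < α) (h : c.IsC2Holder α)
    {f : Euc (n + 1) → ℂ} (hf : MemLp f 2 (surfaceMeasure Ω)) {q : Euc n → ℂ}
    (hq : MemLp q 2 (volume.restrict c.dom)) :
    ‖∫ x' in c.dom, f (c.param x') * q x'‖ ≤ (eLpNorm q 2 (volume.restrict c.dom)).toReal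
      * (eLpNorm f 2 (surfaceMeasure Ω)).toReal := by
  have hf' := h.memLp_comp_param hα hf
  have h1 : eLpNorm ((fun x' => f (c.param x')) • q) 1 (volume.restrict c.dom)
      ≤ eLpNorm (fun x' => f (c.param x')) 2 (volume.restrict c.dom)
        * eLpNorm q 2 (volume.restrict c.dom) :=
    eLpNorm_smul_le_mul_eLpNorm (p := 2) (q := 2) (r := 1) hq.1 hf'.1
  have h2 : ‖∫ x' in c.dom, f (c.param x') * q x'‖ₑ
      ≤ eLpNorm f 2 (surfaceMeasure Ω) * eLpNorm q 2 (volume.restrict c.dom) := by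
    refine (enorm_integral_le_lintegral_enorm _).trans ?_
    rw [← eLpNorm_one_eq_lintegral_enorm]
    refine h1.trans ?_
    gcongr
    exact h.eLpNorm_comp_param_le hα hf.1
  rw [mul_comm, ← ENNReal.toReal_mul, ← toReal_enorm]
  exact ENNReal.toReal_mono (ENNReal.mul_ne_top hf.2.ne hq.2.ne) h2

/-- Integration of the pull-back of an `L²` function to a chart against a weight. -/
def chartFunctional (c : LocalGraph Ω) (hα : 0 < α) (h : c.IsC2Holder α) (q : Euc n → ℂ)
    (hq : MemLp q 2 (volume.restrict c.dom)) :
    StrongDual ℂ (Lp ℂ 2 (surfaceMeasure Ω)) :=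
  LinearMap.mkContinuous
    { toFun := fun f => ∫ x' in c.dom, f (c.param x') * q x'
      map_add' := fun f g => by
        have h1 := h.integrable_comp_param_mul hα (Lp.memLp f) hq
        have h2 := h.integrable_comp_param_mul hα (Lp.memLp g) hq
        rw [← integral_add h1 h2]
        refine integral_congr_ae ?_
        filter_upwards [(h.quasiMeasurePreserving hα).ae (Lp.coeFn_add f g)] with x' hx'
        rw [hx', Pi.add_apply, add_mul]
      map_smul' := fun a f => by
        rw [RingHom.id_apply, smul_eq_mul, ← integral_const_mul]
        refine integral_congr_ae ?_
        filter_upwards [(h.quasiMeasurePreserving hα).ae (Lp.coeFn_smul a f)] with x' hx'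
        rw [hx', Pi.smul_apply, smul_eq_mul, mul_assoc] }
    (eLpNorm q 2 (volume.restrict c.dom)).toReal
    (fun f => h.norm_integral_comp_param_mul_le hα (Lp.memLp f) hq)

lemma chartFunctional_apply (hα : 0 < α) (h : c.IsC2Holder α) {q : Euc n → ℂ}
    (hq : MemLp q 2 (volume.restrict c.dom))
    (f : Lp ℂ 2 (surfaceMeasure Ω)) :
    chartFunctional c hα h q hq f = ∫ x' in c.dom, f (c.param x') * q x' := rfl

lemma chartFunctional_toLp (hα : 0 < α) (h : c.IsC2Holder α) {q : Euc n → ℂ}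
    (hq : MemLp q 2 (volume.restrict c.dom)) {f : Euc (n + 1) → ℂ}
    (hf : MemLp f 2 (surfaceMeasure Ω)) :
    chartFunctional c hα h q hq (hf.toLp f) = ∫ x' in c.dom, f (c.param x') * q x' := by
  rw [chartFunctional_apply]
  refine integral_congr_ae ?_
  filter_upwards [(h.quasiMeasurePreserving hα).ae hf.coeFn_toLp] with x' hx'
  rw [hx']

/-- The first-order Taylor expansion of `u` on `∂Ω`, with gradient `g` and Hölder remainder. -/
def HasWhitneyGradient (Ω : Set (Euc (n + 1))) (β : ℝ) (u : Euc (n + 1) → ℂ)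
    (g : Euc (n + 1) → EuclideanSpace ℂ (Fin (n + 1))) : Prop :=
  ∃ C : ℝ, ∀ x ∈ frontier Ω, ∀ w ∈ frontier Ω,
    ‖u x - u w - dotRC (x - w) (g w)‖ ≤ C * ‖x - w‖ ^ β * ‖x - w‖

/-- `dotRC` as a real-linear map in its first argument. -/
def dotCLM {m : ℕ} (g : EuclideanSpace ℂ (Fin m)) : Euc m →L[ℝ] ℂ :=
  LinearMap.toContinuousLinearMap
    { toFun := fun v => dotRC v g
      map_add' := fun v w => by simp [dotRC, add_mul, Finset.sum_add_distrib]
      map_smul' := fun a v => by simp [dotRC, Finset.mul_sum, mul_assoc] }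

@[simp] lemma dotCLM_apply {m : ℕ} (g : EuclideanSpace ℂ (Fin m)) (v : Euc m) :
    dotCLM g v = dotRC v g := rfl

/-- The parametrization runs inside `∂Ω`, so the expansion along `∂Ω` can be composed with it and
`u` need not be extended off the surface. The remainder is `o(‖y' - x'‖)` because the
parametrization is differentiable and `β > 0`. -/
lemma HasWhitneyGradient.hasFDerivAt_comp_param {β : ℝ} (hβ : 0 < β) (hα : 0 < α)
    (h : c.IsC2Holder α) {u : Euc (n + 1) → ℂ}
    {g : Euc (n + 1) → EuclideanSpace ℂ (Fin (n + 1))} (hu : HasWhitneyGradient Ω β u g)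
    {x' : Euc n} (hx' : x' ∈ c.dom) :
    HasFDerivAt (fun y' => u (c.param y'))
      ((dotCLM (g (c.param x'))).comp (fderiv ℝ c.param x')) x' := by
  obtain ⟨C, hC⟩ := hu
  have hΨ : HasFDerivAt c.param (fderiv ℝ c.param x') x' :=
    ((c.contDiff_param h.1).differentiable (by norm_num) x').hasFDerivAt
  set w := c.param x' with hw
  have h1 : HasFDerivAt (fun y' => dotCLM (g w) (c.param y'))
      ((dotCLM (g w)).comp (fderiv ℝ c.param x')) x' := (dotCLM (g w)).hasFDerivAt.comp x' hΨ
  have h2 : HasFDerivAt (fun y' => u (c.param y') - u w - dotCLM (g w) (c.param y' - w))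
      (0 : Euc n →L[ℝ] ℂ) x' := by
    refine HasFDerivAt.of_isLittleO ?_
    have e1 : (fun y' => c.param y' - w) =O[𝓝 x'] fun y' => y' - x' := hΨ.isBigO_sub
    have e2 : Tendsto (fun y' => ‖c.param y' - w‖ ^ β) (𝓝 x') (𝓝 0) := by
      have : Continuous fun y' => ‖c.param y' - w‖ ^ β :=
        ((h.continuous_param.sub continuous_const).norm).rpow_const fun _ => Or.inr hβ.le
      have h3 := this.tendsto x'
      simpa [← hw, Real.zero_rpow hβ.ne'] using h3
    have e3 : (fun y' => C * ‖c.param y' - w‖ ^ β * ‖c.param y' - w‖) =o[𝓝 x']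
        fun y' => y' - x' := by
      have e4 : (fun y' => C * ‖c.param y' - w‖ ^ β) =o[𝓝 x'] fun _ => (1 : ℝ) := by
        rw [Asymptotics.isLittleO_one_iff]
        simpa using e2.const_mul C
      have e5 := e4.mul_isBigO e1.norm_norm
      simpa using e5
    refine Asymptotics.IsBigO.trans_isLittleO (Asymptotics.IsBigO.of_bound 1 ?_) e3
    filter_upwards [(c.isOpen_dom h.1.continuous).mem_nhds hx'] with y' hy'
    have := hC _ (h.param_mem_frontier hα hy') w (h.param_mem_frontier hα hx')
    rw [one_mul]
    refine le_trans (le_of_eq ?_) (this.trans (le_abs_self _))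
    simp only [← hw, sub_self, map_zero, sub_zero, zero_apply, dotCLM_apply]
  have h3 := (h2.add h1).add_const (u w - dotCLM (g w) w)
  rw [zero_add] at h3
  refine h3.congr_of_eventuallyEq (Eventually.of_forall fun y' => ?_)
  simp only [Pi.add_apply, map_sub]
  ring

variable {u : Euc (n + 1) → ℂ} {g : Euc (n + 1) → EuclideanSpace ℂ (Fin (n + 1))} {ψ : Euc n → ℝ}

lemma integrable_of_integrableOn_of_tsupport {f : Euc n → ℂ} {U : Set (Euc n)}
    (hψs : tsupport ψ ⊆ U) (hf : IntegrableOn f U) (h0 : ∀ x', x' ∉ tsupport ψ → f x' = 0) :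
    Integrable f := by
  rw [← integrableOn_iff_integrable_of_support_subset (s := U)]
  · exact hf
  · intro x' hx'
    by_contra hd
    exact hx' (h0 x' fun ht => hd (hψs ht))

lemma fderiv_eq_zero_of_notMem_tsupport {x' : Euc n} (hx' : x' ∉ tsupport ψ) :
    fderiv ℝ ψ x' = 0 := by
  by_contra h
  exact hx' (support_fderiv_subset ℝ h)

lemma memLp_fderiv_testFun (hψ : ContDiff ℝ 1 ψ) (hψc : HasCompactSupport ψ) (v : Euc n) :
    MemLp (fun x' => (fderiv ℝ ψ x' v : ℂ)) 2 :=
  (Complex.continuous_ofReal.comp ((hψ.continuous_fderiv (by norm_num)).clm_apply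
    continuous_const)).memLp_of_hasCompactSupport
    ((hψc.fderiv (𝕜 := ℝ)).comp_left (g := fun L : Euc n →L[ℝ] ℝ => (L v : ℂ)) (by simp))

lemma memLp_testFun (hψ : ContDiff ℝ 1 ψ) (hψc : HasCompactSupport ψ) :
    MemLp (fun x' => (ψ x' : ℂ)) 2 :=
  (Complex.continuous_ofReal.comp hψ.continuous).memLp_of_hasCompactSupport
    (hψc.comp_left (g := fun t : ℝ => (t : ℂ)) Complex.ofReal_zero)

lemma LocalGraph.IsC2Holder.continuous_fderiv_param (h : c.IsC2Holder α) (v : Euc n)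
    (j : Fin (n + 1)) : Continuous fun x' => (((fderiv ℝ c.param x' v) j : ℝ) : ℂ) :=
  Complex.continuous_ofReal.comp
    ((EuclideanSpace.proj (𝕜 := ℝ) j : Euc (n + 1) →L[ℝ] ℝ).continuous.comp
      (((c.contDiff_param h.1).continuous_fderiv (by norm_num)).clm_apply continuous_const))

lemma LocalGraph.IsC2Holder.memLp_weight (h : c.IsC2Holder α) (hψ : ContDiff ℝ 1 ψ)
    (hψc : HasCompactSupport ψ) (v : Euc n) (j : Fin (n + 1)) :
    MemLp (fun x' => (((fderiv ℝ c.param x' v) j : ℝ) : ℂ) * (ψ x' : ℂ)) 2 :=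
  ((h.continuous_fderiv_param v j).mul
    (Complex.continuous_ofReal.comp hψ.continuous)).memLp_of_hasCompactSupport
    ((hψc.comp_left (g := fun t : ℝ => (t : ℂ)) Complex.ofReal_zero).mul_left)

lemma memLp_component (hg : MemLp g 2 (surfaceMeasure Ω)) (j : Fin (n + 1)) :
    MemLp (fun x => g x j) 2 (surfaceMeasure Ω) :=
  (EuclideanSpace.proj (𝕜 := ℂ) j : EuclideanSpace ℂ (Fin (n + 1)) →L[ℂ] ℂ).comp_memLp' hg

lemma LocalGraph.IsC2Holder.integrable_mul_fderiv (hα : 0 < α) (h : c.IsC2Holder α)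
    (hu : MemLp u 2 (surfaceMeasure Ω)) (hψ : ContDiff ℝ 1 ψ) (hψc : HasCompactSupport ψ)
    (hψs : tsupport ψ ⊆ c.dom) (v : Euc n) :
    Integrable fun x' => u (c.param x') * (fderiv ℝ ψ x' v : ℂ) :=
  integrable_of_integrableOn_of_tsupport hψs
    (h.integrable_comp_param_mul hα hu ((memLp_fderiv_testFun hψ hψc v).restrict _))
    fun x' hx' => by simp [fderiv_eq_zero_of_notMem_tsupport hx']

lemma dotRC_mul_eq_sum {m : ℕ} (v : Euc m) (g : EuclideanSpace ℂ (Fin m)) (a : ℂ) :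
    dotRC v g * a = ∑ j, g j * ((v j : ℂ) * a) := by
  rw [dotRC, Finset.sum_mul]
  exact Finset.sum_congr rfl fun j _ => by ring

lemma LocalGraph.IsC2Holder.integrableOn_weight (hα : 0 < α) (h : c.IsC2Holder α)
    (hg : MemLp g 2 (surfaceMeasure Ω)) (hψ : ContDiff ℝ 1 ψ) (hψc : HasCompactSupport ψ)
    (v : Euc n) (j : Fin (n + 1)) :
    IntegrableOn (fun x' => g (c.param x') j
      * ((((fderiv ℝ c.param x' v) j : ℝ) : ℂ) * (ψ x' : ℂ))) c.dom :=
  h.integrable_comp_param_mul hα (memLp_component hg j) ((h.memLp_weight hψ hψc v j).restrict _)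

lemma LocalGraph.IsC2Holder.integrable_dotRC_mul (hα : 0 < α) (h : c.IsC2Holder α)
    (hg : MemLp g 2 (surfaceMeasure Ω)) (hψ : ContDiff ℝ 1 ψ) (hψc : HasCompactSupport ψ)
    (hψs : tsupport ψ ⊆ c.dom) (v : Euc n) :
    Integrable fun x' => dotRC (fderiv ℝ c.param x' v) (g (c.param x')) * (ψ x' : ℂ) := by
  simp only [dotRC_mul_eq_sum]
  refine integrable_of_integrableOn_of_tsupport hψs (integrable_finsetSum _ fun j _ =>
    h.integrableOn_weight hα hg hψ hψc v j) fun x' hx' => ?_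
  simp [image_eq_zero_of_notMem_tsupport hx']

/-- Integration by parts needs differentiability of the pull-back only on the support of `ψ`,
together with integrability; continuity of `g` is not required. -/
lemma HasWhitneyGradient.integral_eq {β : ℝ} (hβ : 0 < β) (hα : 0 < α)
    (h : c.IsC2Holder α) (hu : HasWhitneyGradient Ω β u g)
    (hu2 : MemLp u 2 (surfaceMeasure Ω)) (hg2 : MemLp g 2 (surfaceMeasure Ω))
    (hψ : ContDiff ℝ 1 ψ) (hψc : HasCompactSupport ψ) (hψs : tsupport ψ ⊆ c.dom) (v : Euc n) :
    ∫ x', u (c.param x') * (fderiv ℝ ψ x' v : ℂ)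
      = -∫ x', dotRC (fderiv ℝ c.param x' v) (g (c.param x')) * (ψ x' : ℂ) := by
  have hg' : ∀ x', HasFDerivAt (fun y' => (ψ y' : ℂ))
      (Complex.ofRealCLM.comp (fderiv ℝ ψ x')) x' := fun x' =>
    Complex.ofRealCLM.hasFDerivAt.comp x' (hψ.differentiable (by norm_num) x').hasFDerivAt
  have hts : tsupport (fun y' => (ψ y' : ℂ)) ⊆ tsupport ψ :=
    closure_mono fun x' hx' h0 => hx' (by simp [h0])
  refine integral_bilinear_hasFDerivAt_right_eq_neg_left_of_integrable
    (f := fun x' => u (c.param x')) (g := fun x' => (ψ x' : ℂ))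
    (f' := fun x' => (dotCLM (g (c.param x'))).comp (fderiv ℝ c.param x'))
    (g' := fun x' => Complex.ofRealCLM.comp (fderiv ℝ ψ x')) (v := v)
    (B := ContinuousLinearMap.mul ℝ ℂ) (h.integrable_dotRC_mul hα hg2 hψ hψc hψs v)
    (h.integrable_mul_fderiv hα hu2 hψ hψc hψs v)
    (integrable_of_integrableOn_of_tsupport hψs
      (h.integrable_comp_param_mul hα hu2 ((memLp_testFun hψ hψc).restrict _)) fun x' hx' => ?_)
    (fun x' hx' => hu.hasFDerivAt_comp_param hβ hα h (hψs (hts hx'))) (fun x' _ => hg' x')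
  simp [image_eq_zero_of_notMem_tsupport hx']

end Charts

/-! ### Weak surface gradients in `L²` and their limits -/

variable {n : ℕ} {Ω : Set (Euc (n + 1))} {α : ℝ}

/-- `g ∈ L²` is tangential and is the weak surface gradient of `u ∈ L²` in every `C^{2,α}` chart. -/
structure HasL2Gradient (Ω : Set (Euc (n + 1))) (α : ℝ) (u : Euc (n + 1) → ℂ)
    (g : Euc (n + 1) → EuclideanSpace ℂ (Fin (n + 1))) : Prop where
  memLp : MemLp u 2 (surfaceMeasure Ω)
  memLp_grad : MemLp g 2 (surfaceMeasure Ω)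
  tangential : ∀ᵐ x ∂(surfaceMeasure Ω), dotRC (outwardNormal Ω x) (g x) = 0
  integral_eq : ∀ c : LocalGraph Ω, c.IsC2Holder α → ∀ ψ : Euc n → ℝ, ContDiff ℝ 1 ψ →
    HasCompactSupport ψ → tsupport ψ ⊆ c.dom → ∀ v : Euc n,
      ∫ x', u (c.param x') * (fderiv ℝ ψ x' v : ℂ)
        = -∫ x', dotRC (fderiv ℝ c.param x' v) (g (c.param x')) * (ψ x' : ℂ)

namespace HasL2Gradient

variable {u u' : Euc (n + 1) → ℂ} {g g' : Euc (n + 1) → EuclideanSpace ℂ (Fin (n + 1))}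

lemma isWeakSurfaceGradient (hα : 0 < α) (hΩ : HasC2HolderBoundary Ω α)
    (h : HasL2Gradient Ω α u g) : IsWeakSurfaceGradient Ω u g := by
  refine ⟨h.memLp_grad.1, h.tangential, fun x hx => ?_⟩
  obtain ⟨c, hcx, hc⟩ := hΩ x hx
  have hcc : c.IsC2Holder α := hc
  refine ⟨c, hcx, hc.1.of_le (by norm_num), fun i => ⟨?_, ?_, fun ψ hψ hψc hψs => ?_⟩⟩
  · exact locallyIntegrableOn_of_locallyIntegrable_restrict
      ((hcc.memLp_comp_param hα h.memLp).locallyIntegrable (by norm_num))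
  · refine locallyIntegrableOn_of_locallyIntegrable_restrict ?_
    refine locallyIntegrable_finsetSum _ fun j _ => ?_
    have h1 := (hcc.memLp_comp_param hα (memLp_component h.memLp_grad j)).locallyIntegrable
      (by norm_num)
    have h2 := hcc.continuous_fderiv_param (EuclideanSpace.single i 1) j
    exact h1.continuous_mul h2
  · exact h.integral_eq c hcc ψ (hψ.of_le (by exact_mod_cast le_top)) hψc hψs _

lemma memH1 (hα : 0 < α) (hΩ : HasC2HolderBoundary Ω α) (h : HasL2Gradient Ω α u g) :
    MemH1 Ω u :=
  ⟨h.memLp, g, h.isWeakSurfaceGradient hα hΩ, h.memLp_grad⟩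

lemma h1Norm_le (hα : 0 < α) (hΩ : HasC2HolderBoundary Ω α) (h : HasL2Gradient Ω α u g) :
    h1Norm Ω u ≤ eLpNorm u 2 (surfaceMeasure Ω) + eLpNorm g 2 (surfaceMeasure Ω) := by
  refine (iInf₂_le g (h.isWeakSurfaceGradient hα hΩ)).trans ?_
  set a := eLpNorm u 2 (surfaceMeasure Ω)
  set b := eLpNorm g 2 (surfaceMeasure Ω)
  have h1 : a ^ 2 + b ^ 2 ≤ (a + b) ^ 2 := by
    rw [show (a + b) ^ 2 = a ^ 2 + b ^ 2 + 2 * a * b by ring]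
    exact le_self_add
  refine (ENNReal.rpow_le_rpow h1 (by norm_num)).trans_eq ?_
  rw [← ENNReal.rpow_natCast, ← ENNReal.rpow_mul]
  norm_num

lemma add (hα : 0 < α) (h : HasL2Gradient Ω α u g) (h' : HasL2Gradient Ω α u' g') :
    HasL2Gradient Ω α (fun x => u x + u' x) (fun x => g x + g' x) := by
  have hdot : ∀ (v : Euc (n + 1)) x, dotRC v (g x + g' x) = dotRC v (g x) + dotRC v (g' x) :=
    fun v x => by simp [dotRC, mul_add, Finset.sum_add_distrib]
  refine ⟨h.memLp.add h'.memLp, h.memLp_grad.add h'.memLp_grad, ?_,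
    fun c hc ψ hψ hψc hψs v => ?_⟩
  · filter_upwards [h.tangential, h'.tangential] with x hx hx'
    rw [hdot, hx, hx', add_zero]
  · simp only [hdot, add_mul]
    rw [integral_add (hc.integrable_mul_fderiv hα h.memLp hψ hψc hψs v)
      (hc.integrable_mul_fderiv hα h'.memLp hψ hψc hψs v),
      integral_add (hc.integrable_dotRC_mul hα h.memLp_grad hψ hψc hψs v)
      (hc.integrable_dotRC_mul hα h'.memLp_grad hψ hψc hψs v),
      h.integral_eq c hc ψ hψ hψc hψs v, h'.integral_eq c hc ψ hψ hψc hψs v]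
    ring

lemma const_mul (h : HasL2Gradient Ω α u g) (a : ℂ) :
    HasL2Gradient Ω α (fun x => a * u x) (fun x => a • g x) := by
  have hdot : ∀ (v : Euc (n + 1)) x, dotRC v (a • g x) = a * dotRC v (g x) :=
    fun v x => by simp only [dotRC, PiLp.smul_apply, smul_eq_mul, Finset.mul_sum]; congr; ext; ring
  refine ⟨h.memLp.const_mul a, h.memLp_grad.const_smul a, ?_,
    fun c hc ψ hψ hψc hψs v => ?_⟩
  · filter_upwards [h.tangential] with x hx
    rw [hdot, hx, mul_zero]
  · simp only [hdot, mul_assoc]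
    rw [integral_const_mul, integral_const_mul, h.integral_eq c hc ψ hψ hψc hψs v, mul_neg]

/-- Boundary null sets pull back to null sets of parameters because the push-forward of Lebesgue
measure is dominated by surface measure. -/
lemma congr_ae (hα : 0 < α) (h : HasL2Gradient Ω α u g) (hu : u =ᵐ[surfaceMeasure Ω] u') :
    HasL2Gradient Ω α u' g := by
  refine ⟨(memLp_congr_ae hu).1 h.memLp, h.memLp_grad, h.tangential,
    fun c hc ψ hψ hψc hψs v => ?_⟩
  rw [← h.integral_eq c hc ψ hψ hψc hψs v]
  have h1 := (ae_restrict_iff' (c.isOpen_dom hc.1.continuous).measurableSet).1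
    ((hc.quasiMeasurePreserving hα).ae hu)
  refine integral_congr_ae ?_
  filter_upwards [h1] with x' hx'
  by_cases hs : x' ∈ tsupport ψ
  · rw [hx' (hψs hs)]
  · simp [fderiv_eq_zero_of_notMem_tsupport hs]

lemma integral_eq_chartFunctional {c : LocalGraph Ω} (hα : 0 < α) (hc : c.IsC2Holder α)
    (hu : MemLp u 2 (surfaceMeasure Ω)) {ψ : Euc n → ℝ} (hψ : ContDiff ℝ 1 ψ)
    (hψc : HasCompactSupport ψ) (hψs : tsupport ψ ⊆ c.dom) (v : Euc n) :
    ∫ x', u (c.param x') * (fderiv ℝ ψ x' v : ℂ)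
      = chartFunctional c hα hc _ ((memLp_fderiv_testFun hψ hψc v).restrict _) (hu.toLp u) := by
  rw [chartFunctional_toLp]
  refine (setIntegral_eq_integral_of_forall_compl_eq_zero fun x' hx' => ?_).symm
  simp [fderiv_eq_zero_of_notMem_tsupport fun hs => hx' (hψs hs)]

lemma integral_eq_sum_chartFunctional {c : LocalGraph Ω} (hα : 0 < α) (hc : c.IsC2Holder α)
    (hg : MemLp g 2 (surfaceMeasure Ω)) {ψ : Euc n → ℝ} (hψ : ContDiff ℝ 1 ψ)
    (hψc : HasCompactSupport ψ) (hψs : tsupport ψ ⊆ c.dom) (v : Euc n) :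
    ∫ x', dotRC (fderiv ℝ c.param x' v) (g (c.param x')) * (ψ x' : ℂ)
      = ∑ j, chartFunctional c hα hc _ ((hc.memLp_weight hψ hψc v j).restrict _)
          ((memLp_component hg j).toLp fun x => g x j) := by
  simp only [chartFunctional_toLp]
  rw [← integral_finsetSum _ fun j _ => hc.integrableOn_weight hα hg hψ hψc v j]
  simp only [dotRC_mul_eq_sum]
  refine (setIntegral_eq_integral_of_forall_compl_eq_zero fun x' hx' => ?_).symm
  simp [image_eq_zero_of_notMem_tsupport fun hs => hx' (hψs hs)]

/-- The weak gradient of a limit of functions with bounded weak gradients. -/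
theorem exists_of_tendsto (hα : 0 < α) [IsFiniteMeasure (surfaceMeasure Ω)]
    (hN : AEStronglyMeasurable (outwardNormal Ω) (surfaceMeasure Ω))
    (hN1 : ∀ᵐ x ∂(surfaceMeasure Ω), ‖outwardNormal Ω x‖ ≤ 1)
    {v : ℕ → Euc (n + 1) → ℂ} {q : ℕ → Euc (n + 1) → EuclideanSpace ℂ (Fin (n + 1))}
    (h : ∀ m, HasL2Gradient Ω α (v m) (q m)) (hu : MemLp u 2 (surfaceMeasure Ω))
    (hlim : Tendsto (fun m => eLpNorm (v m - u) 2 (surfaceMeasure Ω)) atTop (𝓝 0)) {B : ℝ≥0∞}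
    (hBt : B ≠ ⊤) (hB : ∀ m j, eLpNorm (fun x => q m x j) 2 (surfaceMeasure Ω) ≤ B) :
    ∃ g, HasL2Gradient Ω α u g ∧ eLpNorm g 2 (surfaceMeasure Ω) ≤ (n + 1) * B := by
  set σ := surfaceMeasure Ω with hσ
  -- One ultrafilter for all components, so that the weak limits of the components are taken
  -- simultaneously.
  let l : Ultrafilter ℕ := Filter.hyperfilter ℕ
  have hl : (l : Filter ℕ) ≤ atTop := Nat.hyperfilter_le_atTop
  let Q : Fin (n + 1) → ℕ → Lp ℂ 2 σ := fun j m =>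
    (memLp_component (h m).memLp_grad j).toLp fun x => q m x j
  have hQ : ∀ j m, ‖Q j m‖ ≤ B.toReal := fun j m => by
    rw [Lp.norm_toLp]
    exact ENNReal.toReal_mono hBt (hB m j)
  choose w hwB hw using fun j => exists_weak_limit l (hQ j)
  let g : Euc (n + 1) → EuclideanSpace ℂ (Fin (n + 1)) := fun x =>
    ∑ j, w j x • EuclideanSpace.single j (1 : ℂ)
  have hgj : ∀ x j, g x j = w j x := fun x j => by
    simp [g, Pi.single_apply]
  have hterm : ∀ j, MemLp (fun x => w j x • EuclideanSpace.single j (1 : ℂ)) 2 σ := fun j =>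
    ((ContinuousLinearMap.id ℂ ℂ).smulRight (EuclideanSpace.single j (1 : ℂ))).comp_memLp' (Lp.memLp (w j))
  have hgL : MemLp g 2 σ := memLp_finsetSum _ fun j _ => hterm j
  have hgnorm : eLpNorm g 2 σ ≤ (n + 1) * B := by
    have e1 : g = ∑ j, fun x => w j x • EuclideanSpace.single j (1 : ℂ) := by
      funext x; simp [g]
    rw [e1]
    refine (eLpNorm_sum_le (fun j _ => (hterm j).1) (by norm_num)).trans ?_
    refine (Finset.sum_le_sum (g := fun _ => B) fun j _ => ?_).trans_eq (by simp)
    have e2 : eLpNorm (fun x => w j x • EuclideanSpace.single j (1 : ℂ)) 2 σ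
        = eLpNorm (w j) 2 σ := eLpNorm_congr_norm_ae (ae_of_all _ fun x => by simp [norm_smul])
    rw [e2, ← ENNReal.ofReal_toReal (Lp.memLp (w j)).2.ne, ← Lp.norm_def]
    exact ENNReal.ofReal_le_of_le_toReal (hwB j)
  have htoLp : ∀ j, ((memLp_component hgL j).toLp fun x => g x j) = w j := fun j => by
    refine Lp.ext ((MemLp.coeFn_toLp _).trans (ae_of_all _ fun x => hgj x j))
  refine ⟨g, ⟨hu, hgL, ?_, fun c hc ψ hψ hψc hψs y => ?_⟩, hgnorm⟩
  -- Tangentiality survives because, for every measurable `A`, the integral of the normal component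
  -- over `A` is a sum of bounded functionals of the components; it vanishes along the sequence and
  -- hence in the limit.
  · have hNj : ∀ j, MemLp (fun x => ((outwardNormal Ω x j : ℝ) : ℂ)) ⊤ σ := fun j => by
      refine memLp_top_of_bound (Complex.continuous_ofReal.comp_aestronglyMeasurable
        ((EuclideanSpace.proj (𝕜 := ℝ) j : Euc (n + 1) →L[ℝ] ℝ).continuous.comp_aestronglyMeasurable
          hN)) 1 ?_
      filter_upwards [hN1] with x hx
      rw [Complex.norm_real]
      exact (PiLp.norm_apply_le _ j).trans hx
    have hNA : ∀ (A : Set (Euc (n + 1))) j, MeasurableSet A →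
        MemLp (A.indicator fun x => ((outwardNormal Ω x j : ℝ) : ℂ)) 2 σ := fun A j hA =>
      ((hNj j).mono_exponent le_top).indicator hA
    have hinteg : ∀ (A : Set (Euc (n + 1))) (hA : MeasurableSet A) (j) (f : Euc (n + 1) → ℂ)
        (hf : MemLp f 2 σ), innerSL ℂ ((hNA A j hA).toLp _) (hf.toLp f)
          = ∫ x in A, (outwardNormal Ω x j : ℂ) * f x ∂σ := fun A hA j f hf => by
      rw [innerSL_apply_apply, L2.inner_def, ← integral_indicator hA]
      refine integral_congr_ae ?_
      filter_upwards [(hNA A j hA).coeFn_toLp, hf.coeFn_toLp] with x h1 h2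
      rw [h1, h2]
      by_cases hx : x ∈ A
      · simp [hx, mul_comm]
      · simp [hx]
    have hi : ∀ (f : Euc (n + 1) → EuclideanSpace ℂ (Fin (n + 1))), MemLp f 2 σ → ∀ j,
        Integrable (fun x => (outwardNormal Ω x j : ℂ) * f x j) σ := fun f hf j =>
      MemLp.integrable_mul ((hNj j).mono_exponent le_top : MemLp _ 2 σ) (memLp_component hf j)
    have hsum : ∀ (f : Euc (n + 1) → EuclideanSpace ℂ (Fin (n + 1))) (hf : MemLp f 2 σ)
        (A : Set (Euc (n + 1))) (hA : MeasurableSet A),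
        ∫ x in A, dotRC (outwardNormal Ω x) (f x) ∂σ = ∑ j, innerSL ℂ ((hNA A j hA).toLp _)
          ((memLp_component hf j).toLp fun x => f x j) := fun f hf A hA => by
      rw [Finset.sum_congr rfl fun j _ => hinteg A hA j _ (memLp_component hf j),
        ← integral_finsetSum _ fun j _ => (hi f hf j).integrableOn]
      rfl
    refine Integrable.ae_eq_zero_of_forall_setIntegral_eq_zero
      (integrable_finsetSum _ fun j _ => hi g hgL j) fun A hA _ => ?_
    refine (hsum g hgL A hA).trans ?_
    simp only [htoLp]
    refine tendsto_nhds_unique (tendsto_finsetSum _ fun j _ =>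
      hw j (innerSL ℂ ((hNA A j hA).toLp _))) ?_
    refine tendsto_const_nhds.congr fun m => ?_
    rw [← hsum (q m) (h m).memLp_grad A hA]
    refine (integral_eq_zero_of_ae ?_).symm
    exact ae_restrict_of_ae (h m).tangential
  -- Both sides of the weak-derivative identity are sums of chart functionals: the left converges by
  -- strong convergence of `v m`, the right by weak convergence of the components of `q m`.
  · rw [integral_eq_chartFunctional hα hc hu hψ hψc hψs y,
      integral_eq_sum_chartFunctional hα hc hgL hψ hψc hψs y]
    simp only [htoLp]
    have hL : Tendsto (fun m => (h m).memLp.toLp (v m)) atTop (𝓝 (hu.toLp u)) := by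
      rw [tendsto_iff_norm_sub_tendsto_zero]
      have : ∀ m, ‖(h m).memLp.toLp (v m) - hu.toLp u‖
          = (eLpNorm (v m - u) 2 σ).toReal := fun m => by
        rw [← MemLp.toLp_sub, Lp.norm_toLp]
      simp only [this]
      rw [← ENNReal.toReal_zero]
      exact (ENNReal.tendsto_toReal ENNReal.zero_ne_top).comp hlim
    refine tendsto_nhds_unique ((((chartFunctional c hα hc _
      ((memLp_fderiv_testFun hψ hψc y).restrict _)).continuous.tendsto _).comp hL).mono_left hl) ?_
    refine (tendsto_finsetSum _ fun j _ => hw j (chartFunctional c hα hc _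
      ((hc.memLp_weight hψ hψc y j).restrict _))).neg.congr fun m => ?_
    rw [Function.comp_apply, ← integral_eq_chartFunctional hα hc (h m).memLp hψ hψc hψs y,
      (h m).integral_eq c hc ψ hψ hψc hψs y,
      integral_eq_sum_chartFunctional hα hc (h m).memLp_grad hψ hψc hψs y]

end HasL2Gradient

lemma dotRC_integralOp {σ : Measure (Euc (n + 1))} [IsFiniteMeasure σ]
    {V : Euc (n + 1) → Euc (n + 1) → Euc (n + 1)}
    (hV : ∀ j, IsBddKernel fun x y => V x y j) {φ : Euc (n + 1) → ℂ} (hφ : Integrable φ σ)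
    (v x : Euc (n + 1)) :
    dotRC v (WithLp.toLp 2 fun j => integralOp σ (fun x y => V x y j) φ x)
      = ∫ y, ((inner ℝ v (V x y) : ℝ) : ℂ) * φ y ∂σ := by
  simp only [dotRC, integralOp, ← integral_const_mul]
  rw [← integral_finsetSum _ fun j _ => ((hV j).integrable hφ x).const_mul _]
  refine integral_congr_ae (ae_of_all _ fun y => ?_)
  simp only [PiLp.inner_apply, RCLike.inner_apply, conj_trivial, Complex.ofReal_sum, Finset.sum_mul,
    Complex.ofReal_mul]
  exact Finset.sum_congr rfl fun j _ => by ring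

/-- An integral operator is bounded from `L²` to `H¹` if its kernel is approximated by bounded
kernels whose tangential gradients are uniformly bounded as operators on `L²`. -/
theorem exists_gradient_of_kernels (hα : 0 < α) [IsFiniteMeasure (surfaceMeasure Ω)]
    (H : HasDefiningFuns Ω α) {β : ℝ} (hβ : 0 < β)
    {K₀ : Euc (n + 1) → Euc (n + 1) → ℝ} (hK₀ : Measurable (Function.uncurry K₀))
    {K : ℕ → Euc (n + 1) → Euc (n + 1) → ℝ} (hK : ∀ m, IsBddKernel (K m))
    {V : ℕ → Euc (n + 1) → Euc (n + 1) → Euc (n + 1)}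
    (hV : ∀ m j, IsBddKernel fun x y => V m x y j)
    (hKV : ∀ m, ∃ C : ℝ, ∀ x ∈ frontier Ω, ∀ w ∈ frontier Ω, ∀ y ∈ frontier Ω,
      |K m x y - K m w y - inner ℝ (x - w) (V m w y)| ≤ C * ‖x - w‖ ^ β * ‖x - w‖)
    (htan : ∀ m, ∀ x ∈ frontier Ω, ∀ y, inner ℝ (outwardNormal Ω x) (V m x y) = 0)
    {B : ℝ≥0} (hB : ∀ m j φ, MemLp φ 2 (surfaceMeasure Ω) →
      eLpNorm (integralOp (surfaceMeasure Ω) (fun x y => V m x y j) φ) 2 (surfaceMeasure Ω)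
        ≤ B * eLpNorm φ 2 (surfaceMeasure Ω))
    {C₀ : ℝ≥0}
    (h1 : ∀ᵐ x ∂(surfaceMeasure Ω), ∫⁻ y, ‖K₀ x y‖ₑ ∂(surfaceMeasure Ω) ≤ C₀)
    (h2 : ∀ᵐ y ∂(surfaceMeasure Ω), ∫⁻ x, ‖K₀ x y‖ₑ ∂(surfaceMeasure Ω) ≤ C₀)
    {δ : ℕ → ℝ≥0} (hδ : Tendsto δ atTop (𝓝 0))
    (hd1 : ∀ m, ∀ᵐ x ∂(surfaceMeasure Ω), ∫⁻ y, ‖K m x y - K₀ x y‖ₑ ∂(surfaceMeasure Ω) ≤ δ m)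
    (hd2 : ∀ m, ∀ᵐ y ∂(surfaceMeasure Ω), ∫⁻ x, ‖K m x y - K₀ x y‖ₑ ∂(surfaceMeasure Ω) ≤ δ m)
    {φ : Euc (n + 1) → ℂ} (hφ : MemLp φ 2 (surfaceMeasure Ω)) :
    (∀ᵐ x ∂(surfaceMeasure Ω), Integrable (fun y => (K₀ x y : ℂ) * φ y) (surfaceMeasure Ω)) ∧
    eLpNorm (integralOp (surfaceMeasure Ω) K₀ φ) 2 (surfaceMeasure Ω)
      ≤ C₀ * eLpNorm φ 2 (surfaceMeasure Ω) ∧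
    ∃ g, HasL2Gradient Ω α (integralOp (surfaceMeasure Ω) K₀ φ) g ∧
      eLpNorm g 2 (surfaceMeasure Ω) ≤ (n + 1) * (B * eLpNorm φ 2 (surfaceMeasure Ω)) := by
  set σ := surfaceMeasure Ω with hσ
  have hφ1 : Integrable φ σ := hφ.integrable one_le_two
  have hmem : ∀ᵐ x ∂σ, x ∈ frontier Ω := ae_restrict_mem isClosed_frontier.measurableSet
  have hinteg : ∀ᵐ x ∂σ, Integrable (fun y => (K₀ x y : ℂ) * φ y) σ :=
    ae_integrable_of_schur hK₀ ENNReal.coe_ne_top h1 h2 hφ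
  have hu0 := eLpNorm_integralOp_le hK₀ h1 h2 hφ.1
  refine ⟨hinteg, hu0, ?_⟩
  have hu : MemLp (integralOp σ K₀ φ) 2 σ :=
    ⟨aestronglyMeasurable_integralOp hK₀ hφ.1,
      hu0.trans_lt (ENNReal.mul_lt_top (by simp) hφ.2)⟩
  set q : ℕ → Euc (n + 1) → EuclideanSpace ℂ (Fin (n + 1)) := fun m x =>
    WithLp.toLp 2 fun j => integralOp σ (fun x y => V m x y j) φ x with hq
  have hqL : ∀ m, MemLp (q m) 2 σ := fun m => by
    have hterm : ∀ j, MemLp (fun x => integralOp σ (fun x y => V m x y j) φ x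
        • EuclideanSpace.single j (1 : ℂ)) 2 σ := fun j =>
      ((ContinuousLinearMap.id ℂ ℂ).smulRight (EuclideanSpace.single j (1 : ℂ))).comp_memLp'
        ((hV m j).memLp hφ)
    have : q m = fun x => ∑ j, integralOp σ (fun x y => V m x y j) φ x
        • EuclideanSpace.single j (1 : ℂ) := by
      funext x
      ext j
      simp [hq, Pi.single_apply]
    rw [this]
    exact memLp_finsetSum _ fun j _ => hterm j
  have hgrad : ∀ m, HasL2Gradient Ω α (integralOp σ (K m) φ) (q m) := fun m => by
    have hW : HasWhitneyGradient Ω β (integralOp σ (K m) φ) (q m) := by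
      obtain ⟨C, hC⟩ := hKV m
      -- The kernel expansion is uniform in the integration variable, so it may be integrated
      -- against `φ ∈ L¹`. The constant may depend on `m`.
      refine ⟨C * ∫ y, ‖φ y‖ ∂σ, fun x hx w hw => ?_⟩
      have hi1 := (hK m).integrable hφ1 x
      have hi2 := (hK m).integrable hφ1 w
      have hi3 : Integrable (fun y => ((inner ℝ (x - w) (V m w y) : ℝ) : ℂ) * φ y) σ := by
        simp only [PiLp.inner_apply, RCLike.inner_apply, conj_trivial, Complex.ofReal_sum,
          Finset.sum_mul, Complex.ofReal_mul, mul_assoc]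
        refine integrable_finsetSum _ fun j _ => ?_
        have := (((hV m j).integrable hφ1 w).const_mul (((x - w) j : ℝ) : ℂ))
        refine this.congr (ae_of_all _ fun y => ?_)
        simp only
        ring
      have hi4 : Integrable (fun y => (K m x y : ℂ) * φ y - (K m w y : ℂ) * φ y) σ := hi1.sub hi2
      rw [hq, dotRC_integralOp (hV m) hφ1, integralOp, integralOp, ← integral_sub hi1 hi2,
        ← integral_sub hi4 hi3]
      refine (norm_integral_le_of_norm_le (hφ1.norm.const_mul (C * ‖x - w‖ ^ β * ‖x - w‖)) ?_).trans_eq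
        ?_
      · filter_upwards [hmem] with y hy
        rw [← sub_mul, ← sub_mul, norm_mul]
        refine mul_le_mul_of_nonneg_right ?_ (norm_nonneg _)
        rw [← Complex.ofReal_sub, ← Complex.ofReal_sub, Complex.norm_real]
        exact hC x hx w hw y hy
      · rw [integral_const_mul]; ring
    refine ⟨(hK m).memLp hφ, hqL m, ?_, fun c hc ψ hψ hψc hψs v =>
      hW.integral_eq hβ hα hc ((hK m).memLp hφ) (hqL m) hψ hψc hψs v⟩
    filter_upwards [hmem] with x hx
    rw [hq, dotRC_integralOp (hV m) hφ1]
    simp [htan m x hx]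
  have hN : AEStronglyMeasurable (outwardNormal Ω) σ :=
    H.continuousOn_outwardNormal.aestronglyMeasurable isClosed_frontier.measurableSet
  have hN1 : ∀ᵐ x ∂σ, ‖outwardNormal Ω x‖ ≤ 1 := by
    filter_upwards [hmem] with x hx using (H.norm_outwardNormal hx).le
  have hdiff : ∀ m, eLpNorm (integralOp σ (K m) φ - integralOp σ K₀ φ) 2 σ
      ≤ δ m * eLpNorm φ 2 σ := fun m => by
    have e1 : (integralOp σ (K m) φ - integralOp σ K₀ φ : Euc (n + 1) → ℂ)
        =ᵐ[σ] integralOp σ (fun x y => K m x y - K₀ x y) φ := by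
      filter_upwards [hinteg] with x hx
      rw [Pi.sub_apply, integralOp, integralOp, integralOp,
        ← integral_sub ((hK m).integrable hφ1 x) hx]
      refine integral_congr_ae (ae_of_all _ fun y => ?_)
      simp only [Complex.ofReal_sub, sub_mul]
    rw [eLpNorm_congr_ae e1]
    exact eLpNorm_integralOp_le ((hK m).meas.sub hK₀) (hd1 m) (hd2 m) hφ.1
  refine HasL2Gradient.exists_of_tendsto hα hN hN1 hgrad hu ?_
    (ENNReal.mul_ne_top (by simp) hφ.2.ne) fun m j => hB m j φ hφ
  refine tendsto_of_tendsto_of_tendsto_of_le_of_le tendsto_const_nhds ?_ (fun _ => bot_le) hdiff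
  have : Tendsto (fun m => (δ m : ℝ≥0∞) * eLpNorm φ 2 σ) atTop
      (𝓝 (((0 : ℝ≥0) : ℝ≥0∞) * eLpNorm φ 2 σ)) :=
    ENNReal.Tendsto.mul_const (ENNReal.tendsto_coe.2 hδ) (Or.inr hφ.2.ne)
  simpa using this

/-! ### Schur and Cotlar–Stein bounds combined -/

section SingularOperators

lemma eLpNorm_mul_le_of_bdd {E : Type*} [MeasurableSpace E] {σ : Measure E} {f : E → ℂ}
    {p : E → ℝ} {M : ℝ≥0} (hM : ∀ x, |p x| ≤ M) :
    eLpNorm (fun x => (p x : ℂ) * f x) 2 σ ≤ M * eLpNorm f 2 σ := by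
  have := eLpNorm_le_nnreal_smul_eLpNorm_of_ae_le_mul (μ := σ) (p := 2) (c := M)
    (f := fun x => (p x : ℂ) * f x) (g := f) (ae_of_all _ fun x => by
      rw [nnnorm_mul]
      gcongr
      rw [← NNReal.coe_le_coe, coe_nnnorm, Complex.norm_real]
      exact hM x)
  rwa [ENNReal.smul_def, smul_eq_mul] at this

variable {E : Type*} [NormedAddCommGroup E] [MeasurableSpace E] [BorelSpace E]
  [SecondCountableTopology E] {σ : Measure E} [IsFiniteMeasure σ] {Γ : Set E} {n : ℕ} {C₀ C₁ : ℝ}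

/-- Schur bounds for weakly singular kernels. -/
lemma IsSurfaceLike.exists_schur_weaklySingular (h : IsSurfaceLike σ Γ n C₀ C₁) (hC₀ : 0 ≤ C₀)
    (hn : 1 ≤ n) {β : ℝ} (hβ : 0 < β) (hβn : β ≤ n) :
    ∃ C : ℝ≥0, ∀ (M : ℝ≥0) (G : E → E → ℝ),
      (∀ x ∈ Γ, ∀ y ∈ Γ, x ≠ y → |G x y| ≤ M * ‖x - y‖ ^ (β - n)) →
      (∀ᵐ x ∂σ, ∫⁻ y, ‖G x y‖ₑ ∂σ ≤ (M * C : ℝ≥0)) ∧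
      ∀ᵐ y ∂σ, ∫⁻ x, ‖G x y‖ₑ ∂σ ≤ (M * C : ℝ≥0) := by
  obtain ⟨C, hC0, hC⟩ := h.exists_lintegral_rpow_le hC₀ hβ hβn
  have key : ∀ (M : ℝ≥0) (G : E → E → ℝ),
      (∀ x ∈ Γ, ∀ y ∈ Γ, x ≠ y → |G x y| ≤ M * ‖x - y‖ ^ (β - n)) →
      ∀ᵐ x ∂σ, ∫⁻ y, ‖G x y‖ₑ ∂σ ≤ (M * C.toNNReal : ℝ≥0) := by
    intro M G hG
    filter_upwards [h.ae_mem] with x hx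
    have hne : ∀ᵐ y ∂σ, y ≠ x := by
      rw [ae_iff]; simpa using h.measure_singleton hn hx
    calc ∫⁻ y, ‖G x y‖ₑ ∂σ ≤ ∫⁻ y, (M : ℝ≥0∞) * ENNReal.ofReal (‖x - y‖ ^ (β - n)) ∂σ := by
          refine lintegral_mono_ae ?_
          filter_upwards [h.ae_mem, hne] with y hy hxy
          rw [← ENNReal.ofReal_coe_nnreal, ← ENNReal.ofReal_mul M.coe_nonneg, ← ofReal_norm]
          exact ENNReal.ofReal_le_ofReal (hG x hx y hy hxy.symm)
      _ = M * ∫⁻ y, ENNReal.ofReal (‖x - y‖ ^ (β - n)) ∂σ := by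
          refine lintegral_const_mul _ ?_
          exact ENNReal.measurable_ofReal.comp
            ((measurable_const.sub measurable_id).norm.pow_const _)
      _ ≤ M * ENNReal.ofReal C := by gcongr; exact hC x hx
      _ = (M * C.toNNReal : ℝ≥0) := by rw [ENNReal.coe_mul]; rfl
  refine ⟨C.toNNReal, fun M G hG => ⟨key M G hG, key M (fun y x => G x y) fun x hx y hy hxy => ?_⟩⟩
  rw [norm_sub_rev]
  exact hG y hy x hx hxy.symm

/-- Kernels that are, up to a weakly singular remainder, sums of odd singular kernels with bounded
coefficients, are bounded on `L²`. -/
theorem IsSurfaceLike.exists_eLpNorm_le_of_sum (h : IsSurfaceLike σ Γ n C₀ C₁) (hC₀ : 0 ≤ C₀)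
    (hC₁ : 0 ≤ C₁) (hn : 1 ≤ n) {β : ℝ} (hβ : 0 < β) (hβn : β ≤ n) (ι : Type) [Fintype ι]
    {A : ℝ} (hA : 0 < A) (M : ℝ≥0) :
    ∃ C : ℝ≥0, ∀ (G : E → E → ℝ) (p q k : ι → E → ℝ), IsBddKernel G →
      (∀ i, Measurable (p i)) → (∀ i x, |p i x| ≤ M) →
      (∀ i, Measurable (q i)) → (∀ i x, |q i x| ≤ M) →
      (∀ i, Measurable (k i)) → (∀ i z, k i (-z) = -k i z) →
      (∀ i, IsStdKernel (-n : ℤ) A (k i)) → (∀ i, ∃ B, ∀ z, |k i z| ≤ B) →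
      (∀ x ∈ Γ, ∀ y ∈ Γ, x ≠ y →
        |G x y - ∑ i, p i x * k i (x - y) * q i y| ≤ M * ‖x - y‖ ^ (β - n)) →
      ∀ φ : E → ℂ, MemLp φ 2 σ → eLpNorm (integralOp σ G φ) 2 σ ≤ C * eLpNorm φ 2 σ := by
  obtain ⟨C, hC⟩ := h.exists_schur_weaklySingular hC₀ hn hβ hβn
  obtain ⟨C', hC'0, hC'⟩ := h.exists_norm_opCLM_le hC₀ hC₁ hn
  set T : ℝ≥0 := ⟨C' * A, by positivity⟩ with hT
  refine ⟨Fintype.card ι * (M * T * M) + M * C, fun G p q k hG hp hpM hq hqM hk hodd hstd hbdd hR φ hφ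
    => ?_⟩
  have hφ1 : Integrable φ σ := hφ.integrable one_le_two
  have hkb : ∀ i, IsBddKernel fun x y : E => k i (x - y) := fun i =>
    isBddKernel_sub (hk i) (hbdd i).choose_spec
  have hterm : ∀ i, IsBddKernel fun x y : E => p i x * k i (x - y) * q i y := fun i =>
    ((isBddKernel_left (hp i) (hpM i)).mul (hkb i)).mul (isBddKernel_right (hq i) (hqM i))
  have hsum : IsBddKernel fun x y : E => ∑ i, p i x * k i (x - y) * q i y :=
    IsBddKernel.finset_sum fun i _ => hterm i
  have hRb : IsBddKernel fun x y : E => G x y - ∑ i, p i x * k i (x - y) * q i y := by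
    have := hG.add ((isBddKernel_left (measurable_const (a := (-1 : ℝ)))
      (fun _ => le_rfl)).mul hsum)
    simpa [sub_eq_add_neg] using this
  have hdec : integralOp σ G φ = (∑ i, integralOp σ (fun x y => p i x * k i (x - y) * q i y) φ)
      + integralOp σ (fun x y => G x y - ∑ i, p i x * k i (x - y) * q i y) φ := by
    rw [← integralOp_sum_left Finset.univ (fun i _ => hterm i) hφ1,
      ← integralOp_add_left hsum hRb hφ1]
    congr 1
    funext x y
    ring
  have hone : ∀ i, eLpNorm (integralOp σ (fun x y => p i x * k i (x - y) * q i y) φ) 2 σ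
      ≤ (M * T * M : ℝ≥0) * eLpNorm φ 2 σ := fun i => by
    -- The coefficients factor out as bounded multiplication operators on either side of the
    -- operator with odd kernel.
    have e1 : integralOp σ (fun x y => p i x * k i (x - y) * q i y) φ
        = fun x => (p i x : ℂ) * integralOp σ (fun x y => k i (x - y))
          (fun y => (q i y : ℂ) * φ y) x := by
      funext x
      simp only [integralOp, ← integral_const_mul]
      refine integral_congr_ae (ae_of_all _ fun y => ?_)
      simp only [Complex.ofReal_mul]
      ring
    have hqφ : MemLp (fun y => (q i y : ℂ) * φ y) 2 σ :=
      ⟨(Complex.measurable_ofReal.comp (hq i)).aestronglyMeasurable.mul hφ.1,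
        (eLpNorm_mul_le_of_bdd (hqM i)).trans_lt (ENNReal.mul_lt_top (by simp) hφ.2)⟩
    have e2 := eLpNorm_integralOp_le_of_norm_opCLM_le (C := T) (hkb i)
      (hC' A hA (k i) (hk i) (hodd i) (hstd i) (hkb i)) hqφ
    rw [e1]
    calc _ ≤ (M : ℝ≥0∞) * (T * (M * eLpNorm φ 2 σ)) := by
          refine (eLpNorm_mul_le_of_bdd (hpM i)).trans ?_
          gcongr
          refine e2.trans ?_
          gcongr
          exact eLpNorm_mul_le_of_bdd (hqM i)
      _ = _ := by push_cast; ring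
  obtain ⟨s1, s2⟩ := hC M _ hR
  rw [hdec]
  refine (eLpNorm_add_le (Finset.aestronglyMeasurable_sum _ fun i _ => ((hterm i).memLp hφ).1)
    (hRb.memLp hφ).1
    (by norm_num)).trans ?_
  calc _ ≤ ∑ _i : ι, ((M * T * M : ℝ≥0) : ℝ≥0∞) * eLpNorm φ 2 σ
        + ((M * C : ℝ≥0) : ℝ≥0∞) * eLpNorm φ 2 σ := by
        refine add_le_add ?_ (eLpNorm_integralOp_le hRb.meas s1 s2 hφ.1)
        exact (eLpNorm_sum_le (fun i _ => ((hterm i).memLp hφ).1) (by norm_num)).trans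
          (Finset.sum_le_sum fun i _ => hone i)
    _ = _ := by
        rw [Finset.sum_const, Finset.card_univ, nsmul_eq_mul]
        push_cast
        ring

end SingularOperators

/-! ### Quantitative estimates for the regularization -/

section Symbols

variable {p : ℕ} {A : ℝ} {a : ℝ → ℝ}

lemma add_sq_pos {s ε : ℝ} (hs : 0 ≤ s) (hε : 0 < ε) : 0 < s + ε ^ 2 := by positivity

/-- Bounds for a function with an algebraic singularity, away from the singularity. -/
lemma abs_shift_mul_pow_le {f : ℝ → ℝ} (hf : ∀ t, 0 < t → |f (t ^ 2)| ≤ A / t ^ p) (hA : 0 ≤ A)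
    {ε : ℝ} (hε : 0 < ε) {m : ℕ} (hm : m ≤ p) (t : ℝ) (ht : 0 ≤ t) :
    |f (t ^ 2 + ε ^ 2)| * t ^ m ≤ A / ε ^ (p - m) := by
  set s := √(t ^ 2 + ε ^ 2) with hs
  have hs2 : s ^ 2 = t ^ 2 + ε ^ 2 := Real.sq_sqrt (by positivity)
  have hs0 : 0 < s := Real.sqrt_pos.2 (by positivity)
  have hts : t ≤ s := Real.le_sqrt_of_sq_le (by nlinarith)
  have hes : ε ≤ s := Real.le_sqrt_of_sq_le (by nlinarith)
  rw [← hs2]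
  calc |f (s ^ 2)| * t ^ m ≤ A / s ^ p * s ^ m := by
        gcongr
        exact hf s hs0
    _ = A / s ^ (p - m) := by
        rw [← Nat.sub_add_cancel hm, pow_add, Nat.add_sub_cancel]
        field_simp
    _ ≤ A / ε ^ (p - m) := by gcongr

/-- For `t ≤ ε` the two terms are estimated separately; for `t > ε` the mean value inequality gains
`(ε / t) ^ 2`, more than needed. The exponent `1/2` is a compromise: some power of `ε` tends to
zero, while the kernels remain weakly singular. -/
lemma IsSymbol.abs_shift_sub_le (ha : IsSymbol p A a) {ε t : ℝ} (hε : 0 < ε) (ht : 0 < t) :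
    |a (t ^ 2 + ε ^ 2) - a (t ^ 2)| ≤ 2 * A * ε ^ (1 / 2 : ℝ) * t ^ (-(p : ℝ) - 1 / 2) := by
  have hA := ha.nonneg
  have h1 : |a (t ^ 2 + ε ^ 2)| ≤ A / t ^ p := (ha.shift ε).bound₀ t ht
  have h2 := ha.bound₀ t ht
  have hr : t ^ (-(p : ℝ) - 1 / 2) = (t ^ p)⁻¹ * (t ^ (1 / 2 : ℝ))⁻¹ := by
    rw [sub_eq_add_neg, Real.rpow_add ht, Real.rpow_neg ht.le, Real.rpow_natCast,
      Real.rpow_neg ht.le]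
  have hth : 0 < t ^ (1 / 2 : ℝ) := by positivity
  have hr2 : 2 * A * ε ^ (1 / 2 : ℝ) * t ^ (-(p : ℝ) - 1 / 2)
      = 2 * (A / t ^ p) * (ε / t) ^ (1 / 2 : ℝ) := by
    rw [hr, Real.div_rpow hε.le ht.le]
    field_simp
  rw [hr2]
  have hAt : 0 ≤ A / t ^ p := by positivity
  rcases le_or_gt t ε with hte | hte
  · have h3 : 1 ≤ (ε / t) ^ (1 / 2 : ℝ) :=
      Real.one_le_rpow ((one_le_div ht).2 hte) (by norm_num)
    calc _ ≤ |a (t ^ 2 + ε ^ 2)| + |a (t ^ 2)| := abs_sub _ _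
      _ ≤ 2 * (A / t ^ p) * 1 := by linarith
      _ ≤ _ := by gcongr
  · have hx : ε / t ≤ 1 := (div_le_one ht).2 hte.le
    have hx0 : 0 < ε / t := by positivity
    have h3 : |a (t ^ 2 + ε ^ 2) - a (t ^ 2)| ≤ A / t ^ (p + 2) * |t ^ 2 + ε ^ 2 - t ^ 2| := by
      refine (convex_Ici (t ^ 2)).norm_image_sub_le_of_norm_deriv_le (f := a) (fun s hs => ?_)
        (fun s hs => ?_) (mem_Ici.2 le_rfl) (by simp; positivity)
      · have : 0 < s := lt_of_lt_of_le (by positivity) hs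
        exact (ha.contDiffOn.differentiableOn (by norm_num) s this).differentiableAt
          (Ioi_mem_nhds this)
      · have hs' : t ^ 2 ≤ s := hs
        have h4 : t ≤ √s := Real.le_sqrt_of_sq_le hs'
        have h5 := ha.bound₁ (√s) (ht.trans_le h4)
        rw [Real.sq_sqrt ((sq_nonneg t).trans hs')] at h5
        refine h5.trans ?_
        gcongr
    rw [add_sub_cancel_left, abs_of_nonneg (sq_nonneg ε)] at h3
    have h4 : (ε / t) ^ 2 ≤ (ε / t) ^ (1 / 2 : ℝ) := by
      rw [← Real.rpow_natCast]
      exact Real.rpow_le_rpow_of_exponent_ge hx0 hx (by norm_num)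
    calc _ ≤ A / t ^ (p + 2) * ε ^ 2 := h3
      _ = A / t ^ p * (ε / t) ^ 2 := by field_simp; ring
      _ ≤ A / t ^ p * (ε / t) ^ (1 / 2 : ℝ) := by gcongr
      _ ≤ _ := by
        have : 0 ≤ A / t ^ p * (ε / t) ^ (1 / 2 : ℝ) := by positivity
        linarith

end Symbols

/-! ### Chords and normals -/

section NormalField

variable {d : ℕ}

/-- A unit normal field `N` on `Γ` with derivative `S` along `Γ`. -/
structure IsNormalField (Γ : Set (Euc d)) (β C : ℝ) (N : Euc d → Euc d)
    (S : Euc d → Euc d →L[ℝ] Euc d) : Prop where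
  measurable : Measurable N
  norm_le : ∀ x, ‖N x‖ ≤ 1
  norm_eq : ∀ x ∈ Γ, ‖N x‖ = 1
  measurable_deriv : Measurable S
  norm_deriv_le : ∀ x, ‖S x‖ ≤ C
  expand : ∀ x ∈ Γ, ∀ y ∈ Γ, ‖N x - N y - S y (x - y)‖ ≤ C * ‖x - y‖ ^ β * ‖x - y‖
  chord : ∀ x ∈ Γ, ∀ y ∈ Γ, |inner ℝ (x - y) (N x + N y)| ≤ C * ‖x - y‖ ^ β * ‖x - y‖ ^ 2

/-- The component of `v` orthogonal to the unit vector `ν`. -/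
def tang (ν v : Euc d) : Euc d := v - inner ℝ ν v • ν

lemma norm_tang_le {ν : Euc d} (hν : ‖ν‖ ≤ 1) (v : Euc d) : ‖tang ν v‖ ≤ 2 * ‖v‖ := by
  have h1 : ‖inner ℝ ν v • ν‖ ≤ ‖v‖ := by
    rw [norm_smul]
    calc ‖inner ℝ ν v‖ * ‖ν‖ ≤ (‖ν‖ * ‖v‖) * ‖ν‖ := by gcongr; exact norm_inner_le_norm _ _
      _ ≤ (1 * ‖v‖) * 1 := by gcongr
      _ = ‖v‖ := by ring
  refine (norm_sub_le _ _).trans ?_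
  linarith

lemma inner_tang_self {ν : Euc d} (hν : ‖ν‖ = 1) (v : Euc d) : inner ℝ ν (tang ν v) = 0 := by
  rw [tang, inner_sub_right, inner_smul_right, real_inner_self_eq_norm_sq, hν]
  ring

lemma inner_tang_comm (ν u v : Euc d) : inner ℝ u (tang ν v) = inner ℝ (tang ν u) v := by
  rw [tang, tang, inner_sub_right, inner_sub_left, inner_smul_right, inner_smul_left,
    real_inner_comm u ν]
  simp only [conj_trivial]
  ring

lemma sub_tang (ν v : Euc d) : v - tang ν v = inner ℝ ν v • ν := by
  rw [tang, sub_sub_cancel]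

namespace IsNormalField

variable {Γ : Set (Euc d)} {β C : ℝ} {N : Euc d → Euc d} {S : Euc d → Euc d →L[ℝ] Euc d}
  {x y : Euc d}

lemma nonneg (h : IsNormalField Γ β C N S) : 0 ≤ C := (norm_nonneg _).trans (h.norm_deriv_le 0)

/-- `chord` controls the pairing of `x - y` with `N x + N y`, and `expand` identifies its pairing
with `N x - N y`; subtracting and halving isolates `N y`. Symmetry of `S` is not needed. -/
lemma abs_inner_right_le (h : IsNormalField Γ β C N S) (hx : x ∈ Γ) (hy : y ∈ Γ) :
    |inner ℝ (x - y) (N y) + 1 / 2 * inner ℝ (x - y) (S y (x - y))|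
      ≤ C * ‖x - y‖ ^ β * ‖x - y‖ ^ 2 := by
  have h1 := h.chord x hx y hy
  have h2 : |inner ℝ (x - y) (N x - N y - S y (x - y))| ≤ C * ‖x - y‖ ^ β * ‖x - y‖ ^ 2 := by
    refine (abs_real_inner_le_norm _ _).trans ?_
    calc ‖x - y‖ * _ ≤ ‖x - y‖ * (C * ‖x - y‖ ^ β * ‖x - y‖) := by
          gcongr; exact h.expand x hx y hy
      _ = _ := by ring
  rw [inner_sub_right, inner_sub_right] at h2
  rw [inner_add_right] at h1
  rw [abs_le] at h1 h2 ⊢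
  constructor <;> linarith

lemma abs_inner_left_le (h : IsNormalField Γ β C N S) (hx : x ∈ Γ) (hy : y ∈ Γ) :
    |inner ℝ (x - y) (N x) - 1 / 2 * inner ℝ (x - y) (S x (x - y))|
      ≤ C * ‖x - y‖ ^ β * ‖x - y‖ ^ 2 := by
  have h1 := h.abs_inner_right_le hy hx
  rw [norm_sub_rev x y]
  refine le_trans (le_of_eq ?_) h1
  rw [← neg_sub y x, map_neg, inner_neg_left, inner_neg_left, inner_neg_right, ← abs_neg]
  congr 1
  ring

lemma abs_inner_left_le_sq (h : IsNormalField Γ β C N S) (hβ : 0 < β) {R : ℝ} (hx : x ∈ Γ)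
    (hy : y ∈ Γ) (hxy : ‖x - y‖ ≤ R) :
    |inner ℝ (x - y) (N x)| ≤ (C * R ^ β + C) * ‖x - y‖ ^ 2 := by
  have hC := h.nonneg
  have h1 := h.abs_inner_left_le hx hy
  have h2 : |inner ℝ (x - y) (S x (x - y))| ≤ C * ‖x - y‖ ^ 2 := by
    refine (abs_real_inner_le_norm _ _).trans ?_
    calc ‖x - y‖ * _ ≤ ‖x - y‖ * (C * ‖x - y‖) := by
          gcongr; exact (S x).le_of_opNorm_le (h.norm_deriv_le x) _
      _ = _ := by ring
  have h3 : C * ‖x - y‖ ^ β * ‖x - y‖ ^ 2 ≤ C * R ^ β * ‖x - y‖ ^ 2 := by gcongr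
  have h4 : 0 ≤ C * ‖x - y‖ ^ 2 := by positivity
  rw [add_mul]
  rw [abs_le] at h1 h2 ⊢
  constructor <;> linarith

lemma abs_inner_right_le_sq (h : IsNormalField Γ β C N S) (hβ : 0 < β) {R : ℝ} (hx : x ∈ Γ)
    (hy : y ∈ Γ) (hxy : ‖x - y‖ ≤ R) :
    |inner ℝ (x - y) (N y)| ≤ (C * R ^ β + C) * ‖x - y‖ ^ 2 := by
  have := h.abs_inner_left_le_sq hβ (R := R) hy hx (by rwa [norm_sub_rev])
  rwa [← neg_sub x y, inner_neg_left, abs_neg, norm_neg] at this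

lemma norm_sub_le (h : IsNormalField Γ β C N S) (hβ : 0 < β) {R : ℝ} (hx : x ∈ Γ)
    (hy : y ∈ Γ) (hxy : ‖x - y‖ ≤ R) : ‖N x - N y‖ ≤ (C * R ^ β + C) * ‖x - y‖ := by
  have hC := h.nonneg
  have h1 := h.expand x hx y hy
  have h2 := (S y).le_of_opNorm_le (h.norm_deriv_le y) (x - y)
  have h3 : C * ‖x - y‖ ^ β * ‖x - y‖ ≤ C * R ^ β * ‖x - y‖ := by gcongr
  have h4 : N x - N y = (N x - N y - S y (x - y)) + S y (x - y) := by abel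
  rw [h4, add_mul]
  refine (norm_add_le _ _).trans ?_
  linarith

end IsNormalField

end NormalField

/-! ### Regularized kernels and their tangential gradients -/

section RegularizedKernels

variable {d : ℕ}

/-- The vector field `a(|z|² + ε²) z`. -/
def regField (a : ℝ → ℝ) (ε : ℝ) (z : Euc d) : Euc d := a (‖z‖ ^ 2 + ε ^ 2) • z

/-- The regularized double-layer kernel. -/
def dlKernel (a : ℝ → ℝ) (ε : ℝ) (N : Euc d → Euc d) (x y : Euc d) : ℝ :=
  a (‖x - y‖ ^ 2 + ε ^ 2) * inner ℝ (x - y) (N y)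

/-- The tangential gradient of the regularized double-layer kernel. -/
def dlGrad (a : ℝ → ℝ) (ε : ℝ) (N : Euc d → Euc d) (x y : Euc d) : Euc d :=
  tang (N x) ((2 * deriv a (‖x - y‖ ^ 2 + ε ^ 2) * inner ℝ (x - y) (N y)) • (x - y)
    + a (‖x - y‖ ^ 2 + ε ^ 2) • N y)

/-- The regularized adjoint double-layer kernel. -/
def adjKernel (a : ℝ → ℝ) (ε : ℝ) (N : Euc d → Euc d) (x y : Euc d) : ℝ :=
  a (‖x - y‖ ^ 2 + ε ^ 2) * inner ℝ (x - y) (N x)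

/-- The tangential gradient of the regularized adjoint double-layer kernel. -/
def adjGrad (a : ℝ → ℝ) (ε : ℝ) (N : Euc d → Euc d) (S : Euc d → Euc d →L[ℝ] Euc d)
    (x y : Euc d) : Euc d :=
  tang (N x) ((2 * deriv a (‖x - y‖ ^ 2 + ε ^ 2) * inner ℝ (x - y) (N x)) • (x - y)
    + a (‖x - y‖ ^ 2 + ε ^ 2) • ContinuousLinearMap.adjoint (S x) (x - y))

variable {p : ℕ} {A : ℝ} {a : ℝ → ℝ} {ε : ℝ}

lemma IsSymbol.contDiff_shift (ha : IsSymbol p A a) (hε : 0 < ε) :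
    ContDiff ℝ 2 fun z : Euc d => a (‖z‖ ^ 2 + ε ^ 2) := by
  have h1 : ContDiff ℝ 2 fun z : Euc d => ‖z‖ ^ 2 + ε ^ 2 := (contDiff_norm_sq ℝ).add contDiff_const
  have := ha.contDiffOn.comp h1.contDiffOn (s := univ) fun z _ => add_sq_pos (sq_nonneg ‖z‖) hε
  exact contDiffOn_univ.1 this

lemma IsSymbol.continuous_deriv_shift (ha : IsSymbol p A a) (hε : 0 < ε) :
    Continuous fun z : Euc d => deriv a (‖z‖ ^ 2 + ε ^ 2) :=
  ha.contDiffOn_deriv.continuousOn.comp_continuous (by fun_prop)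
    fun z => add_sq_pos (sq_nonneg ‖z‖) hε

lemma IsSymbol.fderiv_regField (ha : IsSymbol p A a) (hε : 0 < ε) (z v : Euc d) :
    fderiv ℝ (regField a ε) z v = a (‖z‖ ^ 2 + ε ^ 2) • v
      + (2 * deriv a (‖z‖ ^ 2 + ε ^ 2) * inner ℝ z v) • z := by
  have hs := add_sq_pos (sq_nonneg ‖z‖) hε
  have h1 : HasDerivAt a (deriv a (‖z‖ ^ 2 + ε ^ 2)) (‖z‖ ^ 2 + ε ^ 2) :=
    ((ha.contDiffOn.differentiableOn (by norm_num) _ hs).differentiableAt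
      (Ioi_mem_nhds hs)).hasDerivAt
  have h2 : HasFDerivAt (fun z : Euc d => ‖z‖ ^ 2 + ε ^ 2) (2 • innerSL ℝ z) z :=
    ((hasStrictFDerivAt_norm_sq z).hasFDerivAt).add_const _
  have h3 := (h1.comp_hasFDerivAt z h2).smul (hasFDerivAt_id z)
  have h4 : HasFDerivAt (regField a ε) _ z := h3
  rw [h4.fderiv]
  simp [mul_assoc, mul_comm, mul_left_comm]

lemma dlKernel_eq (N : Euc d → Euc d) (x y : Euc d) :
    dlKernel a ε N x y = inner ℝ (regField a ε (x - y)) (N y) := by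
  rw [dlKernel, regField, inner_smul_left]; rfl

lemma adjKernel_eq (N : Euc d → Euc d) (x y : Euc d) :
    adjKernel a ε N x y = inner ℝ (regField a ε (x - y)) (N x) := by
  rw [adjKernel, regField, inner_smul_left]; rfl

lemma IsSymbol.inner_dlGrad (ha : IsSymbol p A a) (hε : 0 < ε) (N : Euc d → Euc d) (h w y : Euc d) :
    inner ℝ h (dlGrad a ε N w y)
      = inner ℝ (fderiv ℝ (regField a ε) (w - y) (tang (N w) h)) (N y) := by
  rw [dlGrad, inner_tang_comm, ha.fderiv_regField hε, inner_add_right, inner_add_left,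
    inner_smul_right, inner_smul_right, inner_smul_left, inner_smul_left,
    real_inner_comm (w - y) (tang (N w) h)]
  simp only [conj_trivial]
  ring

/-- The derivative falls on the vector field and on the normal at the same point. `adjGrad` contains
no term `a • N x`, since it would be paired with a tangential vector; this uses that the normal has
length one. -/
lemma IsSymbol.inner_adjGrad (ha : IsSymbol p A a) (hε : 0 < ε) {N : Euc d → Euc d}
    (S : Euc d → Euc d →L[ℝ] Euc d) (h : Euc d) {w : Euc d} (hw : ‖N w‖ = 1) (y : Euc d) :
    inner ℝ h (adjGrad a ε N S w y)
      = inner ℝ (fderiv ℝ (regField a ε) (w - y) (tang (N w) h)) (N w)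
        + inner ℝ (regField a ε (w - y)) (S w (tang (N w) h)) := by
  have h0 : inner ℝ (tang (N w) h) (N w) = 0 := by rw [real_inner_comm, inner_tang_self hw]
  rw [adjGrad, inner_tang_comm, ha.fderiv_regField hε, inner_add_right, inner_add_left,
    inner_smul_right, inner_smul_right, inner_smul_left, inner_smul_left, h0,
    real_inner_comm (w - y) (tang (N w) h), ContinuousLinearMap.adjoint_inner_right, regField,
    inner_smul_left, real_inner_comm (w - y) (S w _)]
  simp only [conj_trivial]
  ring

/-- Taylor estimates for the regularized kernels. -/
lemma IsSymbol.exists_taylor_regField (ha : IsSymbol p A a) (hε : 0 < ε) {R : ℝ} :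
    ∃ B : ℝ, 0 ≤ B ∧ ∀ z ∈ Metric.closedBall (0 : Euc d) R, ‖regField a ε z‖ ≤ B ∧
      ‖fderiv ℝ (regField a ε) z‖ ≤ B ∧ ∀ z' ∈ Metric.closedBall (0 : Euc d) R,
        ‖regField a ε z' - regField a ε z - fderiv ℝ (regField a ε) z (z' - z)‖
          ≤ B * ‖z' - z‖ ^ 2 := by
  have hb : ContDiff ℝ 2 (regField a ε : Euc d → Euc d) := (ha.contDiff_shift hε).smul contDiff_id
  obtain ⟨B, hB0, hB1, -, hB2⟩ := exists_norm_sub_fderiv_le_sq isOpen_univ hb.contDiffOn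
    (subset_univ (Metric.closedBall (0 : Euc d) R)) (isCompact_closedBall _ _)
    (convex_closedBall _ _)
  obtain ⟨B', hB'⟩ := (isCompact_closedBall (0 : Euc d) R).exists_bound_of_continuousOn
    hb.continuous.continuousOn
  refine ⟨max B B', hB0.trans (le_max_left _ _), fun z hz =>
    ⟨(hB' z hz).trans (le_max_right _ _), (hB1 z hz).trans (le_max_left _ _), fun z' hz' =>
      (hB2 z' hz' z hz).trans ?_⟩⟩
  gcongr
  exact le_max_left _ _

lemma le_const_mul_rpow {β R r : ℝ} (hβ : 0 < β) (hβ1 : β ≤ 1) (hr : 0 ≤ r) (hrR : r ≤ R) :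
    r ≤ (1 + R) * r ^ β := by
  have hR : 0 ≤ R := hr.trans hrR
  have hrβ : 0 ≤ r ^ β := by positivity
  rcases le_or_gt r 1 with h1 | h1
  · have := Real.rpow_le_rpow_of_exponent_ge_of_imp (y := 1) hr h1 hβ1
      (fun _ h0 => absurd h0 one_ne_zero)
    rw [Real.rpow_one] at this
    nlinarith
  · have := Real.one_le_rpow h1.le hβ.le
    nlinarith

variable {Γ : Set (Euc d)} {β C R : ℝ} {N : Euc d → Euc d} {S : Euc d → Euc d →L[ℝ] Euc d}

/-- Two errors: the second-order Taylor error of the regularized field, and the normal component of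
`x - w` dropped by the projection, which is quadratic. Constants may depend on `ε` here, since only
differentiability is at stake. -/
lemma IsNormalField.exists_whitney_dl (hN : IsNormalField Γ β C N S) (hβ : 0 < β) (hβ1 : β ≤ 1)
    (hR : ∀ x ∈ Γ, ∀ y ∈ Γ, ‖x - y‖ ≤ R) (ha : IsSymbol p A a) (hε : 0 < ε) :
    ∃ L : ℝ, ∀ x ∈ Γ, ∀ w ∈ Γ, ∀ y ∈ Γ,
      |dlKernel a ε N x y - dlKernel a ε N w y - inner ℝ (x - w) (dlGrad a ε N w y)|
        ≤ L * ‖x - w‖ ^ β * ‖x - w‖ := by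
  obtain ⟨B, hB0, hB⟩ := ha.exists_taylor_regField (d := d) hε (R := R)
  set Q := C * R ^ β + C with hQ
  refine ⟨(B + B * Q) * (1 + R), fun x hx w hw y hy => ?_⟩
  have hxw := hR x hx w hw
  have hR0 : 0 ≤ R := (norm_nonneg _).trans hxw
  have hQ0 : 0 ≤ Q := by have := hN.nonneg; positivity
  obtain ⟨-, h2, h3⟩ := hB (w - y) (by simpa using hR w hw y hy)
  have h4 := h3 (x - y) (by simpa using hR x hx y hy)
  rw [show x - y - (w - y) = x - w by abel] at h4
  set D := fderiv ℝ (regField a ε) (w - y)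
  set h := x - w with hh
  have hi : |inner ℝ (N w) h| ≤ Q * ‖h‖ ^ 2 := by
    rw [real_inner_comm]
    exact hN.abs_inner_right_le_sq hβ hx hw hxw
  have e1 : dlKernel a ε N x y - dlKernel a ε N w y - inner ℝ h (dlGrad a ε N w y)
      = inner ℝ (regField a ε (x - y) - regField a ε (w - y) - D h) (N y)
        + inner ℝ (D (h - tang (N w) h)) (N y) := by
    rw [dlKernel_eq, dlKernel_eq, ha.inner_dlGrad hε]
    simp only [map_sub, inner_sub_left]
    ring
  have e2 : |inner ℝ (regField a ε (x - y) - regField a ε (w - y) - D h) (N y)| ≤ B * ‖h‖ ^ 2 := by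
    refine (abs_real_inner_le_norm _ _).trans ?_
    calc _ ≤ B * ‖h‖ ^ 2 * 1 := by gcongr; exact hN.norm_le y
      _ = _ := mul_one _
  have e3 : |inner ℝ (D (h - tang (N w) h)) (N y)| ≤ B * Q * ‖h‖ ^ 2 := by
    rw [sub_tang, map_smul, inner_smul_left]
    simp only [conj_trivial]
    rw [abs_mul]
    calc _ ≤ Q * ‖h‖ ^ 2 * (B * 1 * 1) := by
          gcongr
          refine (abs_real_inner_le_norm _ _).trans ?_
          gcongr
          · exact (D.le_of_opNorm_le h2 _).trans (by gcongr; exact hN.norm_le w)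
          · exact hN.norm_le y
      _ = _ := by ring
  have e4 := le_const_mul_rpow hβ hβ1 (norm_nonneg h) hxw
  rw [e1]
  calc _ ≤ B * ‖h‖ ^ 2 + B * Q * ‖h‖ ^ 2 := (abs_add_le _ _).trans (add_le_add e2 e3)
    _ = (B + B * Q) * ‖h‖ * ‖h‖ := by ring
    _ ≤ (B + B * Q) * ((1 + R) * ‖h‖ ^ β) * ‖h‖ := by gcongr
    _ = _ := by ring

/-- Here the normal varies with `x` too. All errors are quadratic except the remainder in the
expansion of the normal, which is only of order `1 + β`. -/
lemma IsNormalField.exists_whitney_adj (hN : IsNormalField Γ β C N S) (hβ : 0 < β) (hβ1 : β ≤ 1)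
    (hR : ∀ x ∈ Γ, ∀ y ∈ Γ, ‖x - y‖ ≤ R) (ha : IsSymbol p A a) (hε : 0 < ε) :
    ∃ L : ℝ, ∀ x ∈ Γ, ∀ w ∈ Γ, ∀ y ∈ Γ,
      |adjKernel a ε N x y - adjKernel a ε N w y - inner ℝ (x - w) (adjGrad a ε N S w y)|
        ≤ L * ‖x - w‖ ^ β * ‖x - w‖ := by
  obtain ⟨B, hB0, hB⟩ := ha.exists_taylor_regField (d := d) hε (R := R)
  have hC := hN.nonneg
  set Q := C * R ^ β + C with hQ
  refine ⟨(B + B * Q + B * Q + B * C * Q) * (1 + R) + B * C, fun x hx w hw y hy => ?_⟩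
  have hxw := hR x hx w hw
  have hR0 : 0 ≤ R := (norm_nonneg _).trans hxw
  have hQ0 : 0 ≤ Q := by positivity
  obtain ⟨h1, h2, h3⟩ := hB (w - y) (by simpa using hR w hw y hy)
  have h4 := h3 (x - y) (by simpa using hR x hx y hy)
  rw [show x - y - (w - y) = x - w by abel] at h4
  have hexp := hN.expand x hx w hw
  have hlip := hN.norm_sub_le hβ hx hw hxw
  set D := fderiv ℝ (regField a ε) (w - y)
  set b := regField a ε (w - y)
  set h := x - w with hh
  have hi : |inner ℝ (N w) h| ≤ Q * ‖h‖ ^ 2 := by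
    rw [real_inner_comm]
    exact hN.abs_inner_right_le_sq hβ hx hw hxw
  have e1 : adjKernel a ε N x y - adjKernel a ε N w y - inner ℝ h (adjGrad a ε N S w y)
      = inner ℝ (regField a ε (x - y) - b - D h) (N x)
        + inner ℝ (D h) (N x - N w) + inner ℝ (D (h - tang (N w) h)) (N w)
        + inner ℝ b (S w (h - tang (N w) h)) + inner ℝ b (N x - N w - S w h) := by
    rw [adjKernel_eq, adjKernel_eq, ha.inner_adjGrad hε S h (hN.norm_eq w hw)]
    simp only [map_sub, inner_sub_left, inner_sub_right]
    ring
  have e2 : |inner ℝ (regField a ε (x - y) - b - D h) (N x)| ≤ B * ‖h‖ ^ 2 := by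
    refine (abs_real_inner_le_norm _ _).trans ?_
    calc _ ≤ B * ‖h‖ ^ 2 * 1 := by gcongr; exact hN.norm_le x
      _ = _ := mul_one _
  have e3 : |inner ℝ (D h) (N x - N w)| ≤ B * Q * ‖h‖ ^ 2 := by
    refine (abs_real_inner_le_norm _ _).trans ?_
    calc _ ≤ (B * ‖h‖) * (Q * ‖h‖) := by gcongr; exact D.le_of_opNorm_le h2 _
      _ = _ := by ring
  have e4 : |inner ℝ (D (h - tang (N w) h)) (N w)| ≤ B * Q * ‖h‖ ^ 2 := by
    rw [sub_tang, map_smul, inner_smul_left]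
    simp only [conj_trivial]
    rw [abs_mul]
    calc _ ≤ Q * ‖h‖ ^ 2 * (B * 1 * 1) := by
          gcongr
          refine (abs_real_inner_le_norm _ _).trans ?_
          gcongr
          · exact (D.le_of_opNorm_le h2 _).trans (by gcongr; exact hN.norm_le w)
          · exact hN.norm_le w
      _ = _ := by ring
  have e5 : |inner ℝ b (S w (h - tang (N w) h))| ≤ B * C * Q * ‖h‖ ^ 2 := by
    rw [sub_tang, map_smul, inner_smul_right, abs_mul]
    calc _ ≤ Q * ‖h‖ ^ 2 * (B * (C * 1)) := by
          gcongr
          refine (abs_real_inner_le_norm _ _).trans ?_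
          gcongr
          exact ((S w).le_of_opNorm_le (hN.norm_deriv_le w) _).trans (by gcongr; exact hN.norm_le w)
      _ = _ := by ring
  have e6 : |inner ℝ b (N x - N w - S w h)| ≤ B * C * ‖h‖ ^ β * ‖h‖ := by
    refine (abs_real_inner_le_norm _ _).trans ?_
    calc _ ≤ B * (C * ‖h‖ ^ β * ‖h‖) := by gcongr
      _ = _ := by ring
  have e7 := le_const_mul_rpow hβ hβ1 (norm_nonneg h) hxw
  rw [e1]
  calc _ ≤ B * ‖h‖ ^ 2 + B * Q * ‖h‖ ^ 2 + B * Q * ‖h‖ ^ 2 + B * C * Q * ‖h‖ ^ 2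
        + B * C * ‖h‖ ^ β * ‖h‖ := by
        refine (abs_add_le _ _).trans (add_le_add ?_ e6)
        refine (abs_add_le _ _).trans (add_le_add ?_ e5)
        refine (abs_add_le _ _).trans (add_le_add ?_ e4)
        exact (abs_add_le _ _).trans (add_le_add e2 e3)
    _ = (B + B * Q + B * Q + B * C * Q) * ‖h‖ * ‖h‖ + B * C * ‖h‖ ^ β * ‖h‖ := by ring
    _ ≤ (B + B * Q + B * Q + B * C * Q) * ((1 + R) * ‖h‖ ^ β) * ‖h‖
        + B * C * ‖h‖ ^ β * ‖h‖ := by gcongr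
    _ = _ := by ring

end RegularizedKernels

/-! ### Reduction of the gradients to odd kernels -/

section Decomposition

variable {d n : ℕ} {A : ℝ} {a : ℝ → ℝ} {ε : ℝ} {Γ : Set (Euc d)} {β C R : ℝ} {N : Euc d → Euc d}
  {S : Euc d → Euc d →L[ℝ] Euc d}

lemma abs_apply_le (v : Euc d) (i : Fin d) : |v i| ≤ ‖v‖ := PiLp.norm_apply_le v i

lemma inner_eq_sum (u v : Euc d) : inner ℝ u v = ∑ i, u i * v i := by
  simp [PiLp.inner_apply, mul_comm]

lemma apply_eq_sum (T : Euc d →L[ℝ] Euc d) (v : Euc d) (k : Fin d) :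
    T v k = ∑ l, v l * T (EuclideanSpace.single l 1) k := by
  have h1 : v = ∑ l, v l • EuclideanSpace.single l (1 : ℝ) := by
    ext k; simp [Pi.single_apply]
  conv_lhs => rw [h1]
  simp [map_sum]

lemma sum_triple_eq (T : Euc d →L[ℝ] Euc d) (u z : Euc d) (D : ℝ) :
    ∑ t : Fin d × Fin d × Fin d, u t.1 * (D * (z t.1 * z t.2.1 * z t.2.2))
      * T (EuclideanSpace.single t.2.2 1) t.2.1 = D * inner ℝ u z * inner ℝ z (T z) := by
  rw [inner_eq_sum, inner_eq_sum]
  simp only [apply_eq_sum T z, Fintype.sum_prod_type]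
  rw [mul_assoc, Finset.sum_mul_sum, Finset.mul_sum]
  refine Finset.sum_congr rfl fun i _ => ?_
  rw [Finset.mul_sum]
  refine Finset.sum_congr rfl fun k _ => ?_
  rw [Finset.mul_sum, Finset.mul_sum, Finset.mul_sum]
  exact Finset.sum_congr rfl fun l _ => by ring

lemma sum_pair_eq (T : Euc d →L[ℝ] Euc d) (u z : Euc d) (D : ℝ) :
    ∑ t : Fin d × Fin d, u t.1 * (D * z t.2) * T (EuclideanSpace.single t.2 1) t.1
      = D * inner ℝ u (T z) := by
  rw [inner_eq_sum]
  simp only [apply_eq_sum T z, Fintype.sum_prod_type, Finset.mul_sum]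
  exact Finset.sum_congr rfl fun i _ => Finset.sum_congr rfl fun k _ => by ring

/-- The indices of the odd singular kernels in the tangential gradients. -/
abbrev OddIndex (d : ℕ) : Type := (Fin d × Fin d × Fin d) ⊕ (Fin d × Fin d)

/-- The odd singular kernels `a'(|z|² + ε²) zᵢ zₖ zₗ` and `a(|z|² + ε²) zₖ`. -/
def oddKernel (a : ℝ → ℝ) (ε : ℝ) : OddIndex d → Euc d → ℝ
  | .inl t, z => deriv a (‖z‖ ^ 2 + ε ^ 2) * (z t.1 * z t.2.1 * z t.2.2)
  | .inr t, z => a (‖z‖ ^ 2 + ε ^ 2) * z t.2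

lemma oddKernel_neg (i : OddIndex d) (z : Euc d) : oddKernel a ε i (-z) = -oddKernel a ε i z := by
  rcases i with t | t <;> simp [oddKernel]

lemma continuous_coord (i : Fin d) : Continuous fun z : Euc d => z i :=
  (EuclideanSpace.proj (𝕜 := ℝ) i : Euc d →L[ℝ] ℝ).continuous

lemma IsSymbol.continuous_oddKernel (ha : IsSymbol (n + 1) A a) (hε : 0 < ε) (i : OddIndex d) :
    Continuous (oddKernel a ε i) := by
  rcases i with t | t
  · exact (ha.continuous_deriv_shift hε).mul
      (((continuous_coord _).mul (continuous_coord _)).mul (continuous_coord _))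
  · exact (ha.contDiff_shift hε).continuous.mul (continuous_coord _)

lemma IsSymbol.exists_abs_oddKernel_le (ha : IsSymbol (n + 1) A a) (hε : 0 < ε)
    (i : OddIndex d) : ∃ B, ∀ z, |oddKernel a ε i z| ≤ B := by
  have hA := ha.nonneg
  rcases i with t | t
  · refine ⟨A / ε ^ (n + 1 + 2 - 3), fun z => le_trans ?_ (abs_shift_mul_pow_le ha.bound₁ hA hε
      (m := 3) (by omega) ‖z‖ (norm_nonneg z))⟩
    simp only [oddKernel, abs_mul]
    gcongr
    calc |z t.1| * |z t.2.1| * |z t.2.2| ≤ ‖z‖ * ‖z‖ * ‖z‖ := by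
          gcongr <;> exact abs_apply_le _ _
      _ = ‖z‖ ^ 3 := by ring
  · refine ⟨A / ε ^ (n + 1 - 1), fun z => le_trans ?_ (abs_shift_mul_pow_le ha.bound₀ hA hε
      (m := 1) (by omega) ‖z‖ (norm_nonneg z))⟩
    simp only [oddKernel, abs_mul, pow_one]
    gcongr
    exact abs_apply_le _ _

lemma IsStdKernel.mono {E : Type*} [NormedAddCommGroup E] {m : ℤ} {A A' : ℝ} {k : E → ℝ}
    (hk : IsStdKernel m A k) (h : A ≤ A') : IsStdKernel m A' k :=
  ⟨fun z hz => (hk.size z hz).trans (by gcongr), fun z w hz hzw => (hk.smooth z w hz hzw).trans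
    (by gcongr)⟩

lemma isStdKernel_coord (i : Fin d) : IsStdKernel 1 1 fun z : Euc d => z i :=
  isStdKernel_linear ((EuclideanSpace.proj (𝕜 := ℝ) i : Euc d →L[ℝ] ℝ) : Euc d →+ ℝ)
    fun z => abs_apply_le z i

/-- Counting degrees: the derivative of the symbol has order `n + 3` and meets three coordinates,
the symbol has order `n + 1` and meets one, so both give degree `-n`. The constant is free of `ε` by
`IsSymbol.shift`. -/
lemma IsSymbol.exists_isStdKernel_oddKernel (ha : IsSymbol (n + 1) A a) :
    ∃ A', 0 < A' ∧ ∀ ε (i : OddIndex d), IsStdKernel (-n : ℤ) A' (oddKernel a ε i) := by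
  have hA := ha.nonneg
  refine ⟨3 * (3 * 2 ^ (n + 1 + 2 + 2) * A) * (3 * (3 * 1 * 1) * 1) + 3 * (3 * 2 ^ (n + 1 + 2) * A) * 1 + 1,
    by positivity, fun ε i => ?_⟩
  rcases i with t | t
  · have h1 := (ha.shift ε).isStdKernel_deriv (E := Euc d)
    have h2 := ((isStdKernel_coord (d := d) t.1).mul zero_le_one zero_le_one
      (isStdKernel_coord t.2.1)).mul (by norm_num) zero_le_one (isStdKernel_coord t.2.2)
    have h3 := h1.mul (by positivity) (by norm_num) h2
    have hd : deriv (fun s => a (s + ε ^ 2)) = fun s => deriv a (s + ε ^ 2) := by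
      ext s; exact deriv_comp_add_const _ _ _
    rw [hd] at h3
    have e : (-((n + 1 + 2 : ℕ) : ℤ) + (1 + 1 + 1)) = -n := by push_cast; ring
    rw [e] at h3
    refine h3.mono ?_
    have : 0 ≤ 3 * (3 * 2 ^ (n + 1 + 2) * A) * 1 := by positivity
    linarith
  · have h1 := (ha.shift ε).isStdKernel (E := Euc d)
    have h3 := h1.mul (by positivity) zero_le_one (isStdKernel_coord (d := d) t.2)
    have e : (-((n + 1 : ℕ) : ℤ) + 1) = -n := by push_cast; ring
    rw [e] at h3
    refine h3.mono ?_
    have : 0 ≤ 3 * (3 * 2 ^ (n + 1 + 2 + 2) * A) * (3 * (3 * 1 * 1) * 1) := by positivity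
    linarith

/-- The projection of a coordinate vector to the tangent space. -/
def tangBasis (N : Euc d → Euc d) (j : Fin d) (x : Euc d) : Euc d :=
  tang (N x) (EuclideanSpace.single j 1)

lemma apply_tang (ν v : Euc d) (j : Fin d) :
    tang ν v j = inner ℝ (tang ν (EuclideanSpace.single j 1)) v := by
  rw [← inner_tang_comm, EuclideanSpace.inner_single_left]
  simp

lemma IsNormalField.norm_tangBasis_le (hN : IsNormalField Γ β C N S) (j : Fin d) (x : Euc d) :
    ‖tangBasis N j x‖ ≤ 2 := by
  refine (norm_tang_le (hN.norm_le x) _).trans ?_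
  simp

lemma measurable_tang {f g : Euc d × Euc d → Euc d} (hf : Measurable f) (hg : Measurable g) :
    Measurable fun x => tang (f x) (g x) :=
  hg.sub ((hf.inner hg).fun_smul hf)

lemma IsNormalField.measurable_tangBasis (hN : IsNormalField Γ β C N S) (j : Fin d) :
    Measurable (tangBasis N j) :=
  measurable_const.sub ((hN.measurable.inner measurable_const).fun_smul hN.measurable)

lemma IsSymbol.dlGrad_apply (j : Fin d) (x y : Euc d) :
    dlGrad a ε N x y j = 2 * deriv a (‖x - y‖ ^ 2 + ε ^ 2) * inner ℝ (x - y) (N y)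
        * inner ℝ (tangBasis N j x) (x - y)
      + a (‖x - y‖ ^ 2 + ε ^ 2) * inner ℝ (tangBasis N j x) (N y) := by
  rw [dlGrad, apply_tang, inner_add_right, inner_smul_right, inner_smul_right, tangBasis]

lemma IsSymbol.adjGrad_apply (j : Fin d) (x y : Euc d) :
    adjGrad a ε N S x y j = 2 * deriv a (‖x - y‖ ^ 2 + ε ^ 2) * inner ℝ (x - y) (N x)
        * inner ℝ (tangBasis N j x) (x - y)
      + a (‖x - y‖ ^ 2 + ε ^ 2) * inner ℝ (x - y) (S x (tangBasis N j x)) := by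
  rw [adjGrad, apply_tang, inner_add_right, inner_smul_right, inner_smul_right, tangBasis,
    ContinuousLinearMap.adjoint_inner_right, real_inner_comm (x - y) (S x _)]

/-- The size of the remainder in the decomposition of the gradients. -/
lemma IsSymbol.abs_remainder_le (ha : IsSymbol (n + 1) A a) {r b₁ b₂ C : ℝ} (hr : 0 < r)
    (_ : 0 ≤ C) {u : ℝ} (hu : |u| ≤ 2 * r) (hb₁ : |b₁| ≤ C * r ^ β * r ^ 2)
    (hb₂ : |b₂| ≤ 2 * (C * r ^ β * r)) :
    |2 * deriv a (r ^ 2 + ε ^ 2) * u * b₁ + a (r ^ 2 + ε ^ 2) * b₂|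
      ≤ 6 * A * C * r ^ (β - n) := by
  have hA := ha.nonneg
  have h0 : |a (r ^ 2 + ε ^ 2)| ≤ A / r ^ (n + 1) := (ha.shift ε).bound₀ r hr
  have h1 : |deriv a (r ^ 2 + ε ^ 2)| ≤ A / r ^ (n + 3) := by
    have := (ha.shift ε).bound₁ r hr
    rwa [deriv_comp_add_const] at this
  rw [Real.rpow_sub hr, Real.rpow_natCast]
  calc _ ≤ |2 * deriv a (r ^ 2 + ε ^ 2) * u * b₁| + |a (r ^ 2 + ε ^ 2) * b₂| := abs_add_le _ _
    _ = 2 * |deriv a (r ^ 2 + ε ^ 2)| * |u| * |b₁| + |a (r ^ 2 + ε ^ 2)| * |b₂| := by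
        simp only [abs_mul, abs_two]
    _ ≤ 2 * (A / r ^ (n + 3)) * (2 * r) * (C * r ^ β * r ^ 2)
        + A / r ^ (n + 1) * (2 * (C * r ^ β * r)) := by gcongr
    _ = 6 * A * C * (r ^ β / r ^ n) := by
        rw [pow_add r n 3, pow_succ r n]
        field_simp
        ring

/-- The coefficients in the decomposition of the double-layer gradient. -/
def dlCoeff (N : Euc d → Euc d) (j : Fin d) : OddIndex d → Euc d → ℝ
  | .inl t, x => -tangBasis N j x t.1
  | .inr t, x => -tangBasis N j x t.1

/-- The coefficients in the decomposition of the double-layer gradient. -/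
def dlCoeff' (S : Euc d → Euc d →L[ℝ] Euc d) : OddIndex d → Euc d → ℝ
  | .inl t, y => S y (EuclideanSpace.single t.2.2 1) t.2.1
  | .inr t, y => S y (EuclideanSpace.single t.2 1) t.1

/-- The coefficients in the decomposition of the adjoint double-layer gradient. -/
def adjCoeff (N : Euc d → Euc d) (S : Euc d → Euc d →L[ℝ] Euc d) (j : Fin d) :
    OddIndex d → Euc d → ℝ
  | .inl t, x => tangBasis N j x t.1 * S x (EuclideanSpace.single t.2.2 1) t.2.1
  | .inr t, x => tangBasis N j x t.1 * S x (EuclideanSpace.single t.1 1) t.2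

/-- Replace the pairing of `x - y` with `N y` by minus half the quadratic form of `S y`, which
cancels the factor `2`. In the second term the tangential vector is orthogonal to `N x`, so `N y`
may be replaced by `N y - N x ≈ -S y (x - y)`. Expanding in coordinates separates `x`, `x - y` and
`y`. -/
lemma IsNormalField.abs_dlGrad_sub_le (hN : IsNormalField Γ β C N S)
    (ha : IsSymbol (n + 1) A a) (j : Fin d) {x y : Euc d} (hx : x ∈ Γ) (hy : y ∈ Γ)
    (hxy : x ≠ y) :
    |dlGrad a ε N x y j - ∑ i, dlCoeff N j i x * oddKernel a ε i (x - y) * dlCoeff' S i y|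
      ≤ 6 * A * C * ‖x - y‖ ^ (β - n) := by
  have hr : 0 < ‖x - y‖ := norm_pos_iff.2 (sub_ne_zero.2 hxy)
  have hsum : ∑ i, dlCoeff N j i x * oddKernel a ε i (x - y) * dlCoeff' S i y
      = -(deriv a (‖x - y‖ ^ 2 + ε ^ 2) * inner ℝ (tangBasis N j x) (x - y)
          * inner ℝ (x - y) (S y (x - y)))
        - a (‖x - y‖ ^ 2 + ε ^ 2) * inner ℝ (tangBasis N j x) (S y (x - y)) := by
    rw [Fintype.sum_sum_type]
    simp only [dlCoeff, dlCoeff', oddKernel, neg_mul, Finset.sum_neg_distrib]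
    rw [sum_triple_eq, sum_pair_eq]
    ring
  rw [IsSymbol.dlGrad_apply, hsum]
  have hp := hN.norm_tangBasis_le j x
  have h0 : inner ℝ (tangBasis N j x) (N x) = 0 := by
    rw [real_inner_comm, tangBasis, inner_tang_self (hN.norm_eq x hx)]
  have hu : |inner ℝ (tangBasis N j x) (x - y)| ≤ 2 * ‖x - y‖ :=
    (abs_real_inner_le_norm _ _).trans (by gcongr)
  have hb₂ : |inner ℝ (tangBasis N j x) (N y) + inner ℝ (tangBasis N j x) (S y (x - y))|
      ≤ 2 * (C * ‖x - y‖ ^ β * ‖x - y‖) := by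
    have e : inner ℝ (tangBasis N j x) (N y) + inner ℝ (tangBasis N j x) (S y (x - y))
        = -inner ℝ (tangBasis N j x) (N x - N y - S y (x - y)) := by
      rw [inner_sub_right, inner_sub_right, h0]; ring
    rw [e, abs_neg]
    refine (abs_real_inner_le_norm _ _).trans ?_
    gcongr
    exact hN.expand x hx y hy
  have key := ha.abs_remainder_le (ε := ε) hr hN.nonneg hu (hN.abs_inner_right_le hx hy) hb₂
  refine le_trans (le_of_eq ?_) key
  congr 1
  ring

/-- Only the pairing of `x - y` with `N x` has to be expanded; the term from differentiating the
normal is already linear in `x - y`. The coefficients depend on `x` alone. -/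
lemma IsNormalField.abs_adjGrad_sub_le (hN : IsNormalField Γ β C N S)
    (ha : IsSymbol (n + 1) A a) (j : Fin d) {x y : Euc d} (hx : x ∈ Γ) (hy : y ∈ Γ)
    (hxy : x ≠ y) :
    |adjGrad a ε N S x y j - ∑ i, adjCoeff N S j i x * oddKernel a ε i (x - y) * 1|
      ≤ 6 * A * C * ‖x - y‖ ^ (β - n) := by
  have hr : 0 < ‖x - y‖ := norm_pos_iff.2 (sub_ne_zero.2 hxy)
  have hsum : ∑ i, adjCoeff N S j i x * oddKernel a ε i (x - y) * 1
      = deriv a (‖x - y‖ ^ 2 + ε ^ 2) * inner ℝ (tangBasis N j x) (x - y)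
          * inner ℝ (x - y) (S x (x - y))
        + a (‖x - y‖ ^ 2 + ε ^ 2) * inner ℝ (x - y) (S x (tangBasis N j x)) := by
    rw [Fintype.sum_sum_type, ← sum_triple_eq, ← sum_pair_eq, ← Equiv.sum_comp (Equiv.prodComm _ _)
      (fun t : Fin d × Fin d => (x - y) t.1 * (a (‖x - y‖ ^ 2 + ε ^ 2) * tangBasis N j x t.2)
        * S x (EuclideanSpace.single t.2 1) t.1)]
    simp only [adjCoeff, oddKernel, Equiv.prodComm_apply, Prod.fst_swap, Prod.snd_swap]
    congr 1 <;> exact Finset.sum_congr rfl fun t _ => by ring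
  rw [IsSymbol.adjGrad_apply, hsum]
  have hp := hN.norm_tangBasis_le j x
  have hC := hN.nonneg
  have hu : |inner ℝ (tangBasis N j x) (x - y)| ≤ 2 * ‖x - y‖ :=
    (abs_real_inner_le_norm _ _).trans (by gcongr)
  have key := ha.abs_remainder_le (ε := ε) (b₂ := 0) hr hC hu
    (hN.abs_inner_left_le hx hy) (by rw [abs_zero]; positivity)
  refine le_trans (le_of_eq ?_) key
  congr 1
  ring

end Decomposition

/-! ### Boundedness of the regularized operators, uniformly in the regularization -/

section KernelBounds

variable {d n : ℕ} {A : ℝ} {a : ℝ → ℝ} {ε : ℝ} {Γ : Set (Euc d)} {β C R : ℝ} {N : Euc d → Euc d}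
  {S : Euc d → Euc d →L[ℝ] Euc d}

lemma measurable_sub_pair : Measurable fun q : Euc d × Euc d => q.1 - q.2 :=
  measurable_fst.sub measurable_snd

lemma IsSymbol.measurable_shift (ha : IsSymbol (n + 1) A a) (hε : 0 < ε) :
    Measurable fun q : Euc d × Euc d => a (‖q.1 - q.2‖ ^ 2 + ε ^ 2) :=
  (ha.contDiff_shift hε).continuous.measurable.comp measurable_sub_pair

lemma IsSymbol.measurable_deriv_shift (ha : IsSymbol (n + 1) A a) (hε : 0 < ε) :
    Measurable fun q : Euc d × Euc d => deriv a (‖q.1 - q.2‖ ^ 2 + ε ^ 2) :=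
  (ha.continuous_deriv_shift hε).measurable.comp measurable_sub_pair

lemma measurable_adjoint_apply (hS : Measurable S) :
    Measurable fun q : Euc d × Euc d => ContinuousLinearMap.adjoint (S q.1) (q.1 - q.2) := by
  have h1 : Measurable fun q : Euc d × Euc d => ContinuousLinearMap.adjoint (S q.1) :=
    (ContinuousLinearMap.adjoint (𝕜 := ℝ) (E := Euc d) (F := Euc d)).continuous.measurable.comp
      (hS.comp measurable_fst)
  exact ((ContinuousLinearMap.apply ℝ (Euc d)).continuous₂.measurable.comp
    (measurable_sub_pair.prodMk h1) :)

lemma measurable_coord {X : Type*} [MeasurableSpace X] {f : X → Euc d} (hf : Measurable f)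
    (j : Fin d) : Measurable fun x => f x j :=
  (continuous_coord j).measurable.comp hf

namespace IsNormalField

lemma isBddKernel_dlKernel (hN : IsNormalField Γ β C N S) (ha : IsSymbol (n + 1) A a)
    (hε : 0 < ε) : IsBddKernel (dlKernel a ε N) := by
  refine ⟨(ha.measurable_shift hε).mul (measurable_sub_pair.inner
    (hN.measurable.comp measurable_snd)), A / ε ^ (n + 1 - 1), fun x y => le_trans ?_
    (abs_shift_mul_pow_le ha.bound₀ ha.nonneg hε (m := 1) (by omega) ‖x - y‖ (norm_nonneg _))⟩
  rw [dlKernel, abs_mul, pow_one]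
  gcongr
  exact (abs_real_inner_le_norm _ _).trans (mul_le_of_le_one_right (norm_nonneg _) (hN.norm_le y))

lemma isBddKernel_adjKernel (hN : IsNormalField Γ β C N S) (ha : IsSymbol (n + 1) A a)
    (hε : 0 < ε) : IsBddKernel (adjKernel a ε N) := by
  refine ⟨(ha.measurable_shift hε).mul (measurable_sub_pair.inner
    (hN.measurable.comp measurable_fst)), A / ε ^ (n + 1 - 1), fun x y => le_trans ?_
    (abs_shift_mul_pow_le ha.bound₀ ha.nonneg hε (m := 1) (by omega) ‖x - y‖ (norm_nonneg _))⟩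
  rw [adjKernel, abs_mul, pow_one]
  gcongr
  exact (abs_real_inner_le_norm _ _).trans (mul_le_of_le_one_right (norm_nonneg _) (hN.norm_le x))

lemma norm_deriv_term_le (ha : IsSymbol (n + 1) A a) (hε : 0 < ε) {ν : Euc d} (hν : ‖ν‖ ≤ 1)
    (z : Euc d) : ‖(2 * deriv a (‖z‖ ^ 2 + ε ^ 2) * inner ℝ z ν) • z‖
      ≤ 2 * (A / ε ^ (n + 1 + 2 - 2)) := by
  have h1 := abs_shift_mul_pow_le ha.bound₁ ha.nonneg hε (m := 2) (by omega) ‖z‖ (norm_nonneg _)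
  rw [norm_smul, norm_mul, norm_mul, Real.norm_eq_abs, Real.norm_eq_abs, abs_two, Real.norm_eq_abs]
  calc _ ≤ 2 * |deriv a (‖z‖ ^ 2 + ε ^ 2)| * (‖z‖ * 1) * ‖z‖ := by
        gcongr
        exact (abs_real_inner_le_norm _ _).trans (by gcongr)
    _ = 2 * (|deriv a (‖z‖ ^ 2 + ε ^ 2)| * ‖z‖ ^ 2) := by ring
    _ ≤ _ := by gcongr

lemma isBddKernel_dlGrad (hN : IsNormalField Γ β C N S) (ha : IsSymbol (n + 1) A a)
    (hε : 0 < ε) (j : Fin d) : IsBddKernel fun x y => dlGrad a ε N x y j := by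
  refine ⟨measurable_coord (measurable_tang (hN.measurable.comp measurable_fst) ?_) j,
    2 * (2 * (A / ε ^ (n + 1 + 2 - 2)) + A / ε ^ (n + 1 - 0)), fun x y => ?_⟩
  · exact ((((ha.measurable_deriv_shift hε).const_mul 2).mul (measurable_sub_pair.inner
      (hN.measurable.comp measurable_snd))).fun_smul measurable_sub_pair).add
      ((ha.measurable_shift hε).fun_smul (hN.measurable.comp measurable_snd))
  · refine (abs_apply_le _ j).trans ((norm_tang_le (hN.norm_le x) _).trans ?_)
    gcongr
    refine (norm_add_le _ _).trans (add_le_add (norm_deriv_term_le ha hε (hN.norm_le y) _) ?_)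
    have := abs_shift_mul_pow_le ha.bound₀ ha.nonneg hε (m := 0) (by omega) ‖x - y‖ (norm_nonneg _)
    rw [pow_zero, mul_one] at this
    rw [norm_smul]
    exact (mul_le_of_le_one_right (norm_nonneg _) (hN.norm_le y)).trans this

lemma isBddKernel_adjGrad (hN : IsNormalField Γ β C N S) (ha : IsSymbol (n + 1) A a)
    (hε : 0 < ε) (j : Fin d) : IsBddKernel fun x y => adjGrad a ε N S x y j := by
  refine ⟨measurable_coord (measurable_tang (hN.measurable.comp measurable_fst) ?_) j,
    2 * (2 * (A / ε ^ (n + 1 + 2 - 2)) + A / ε ^ (n + 1 - 1) * C), fun x y => ?_⟩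
  · exact ((((ha.measurable_deriv_shift hε).const_mul 2).mul (measurable_sub_pair.inner
      (hN.measurable.comp measurable_fst))).fun_smul measurable_sub_pair).add
      ((ha.measurable_shift hε).fun_smul (measurable_adjoint_apply hN.measurable_deriv))
  · refine (abs_apply_le _ j).trans ((norm_tang_le (hN.norm_le x) _).trans ?_)
    gcongr
    refine (norm_add_le _ _).trans (add_le_add (norm_deriv_term_le ha hε (hN.norm_le x) _) ?_)
    have := abs_shift_mul_pow_le ha.bound₀ ha.nonneg hε (m := 1) (by omega) ‖x - y‖ (norm_nonneg _)
    rw [pow_one] at this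
    have hC := hN.nonneg
    rw [norm_smul]
    calc _ ≤ ‖a (‖x - y‖ ^ 2 + ε ^ 2)‖ * (C * ‖x - y‖) := by
          gcongr
          refine (ContinuousLinearMap.adjoint (S x)).le_of_opNorm_le ?_ _
          rw [LinearIsometryEquiv.norm_map]
          exact hN.norm_deriv_le x
      _ = |a (‖x - y‖ ^ 2 + ε ^ 2)| * ‖x - y‖ * C := by rw [Real.norm_eq_abs]; ring
      _ ≤ _ := by gcongr

section L2

variable {σ : Measure (Euc d)} [IsFiniteMeasure σ] {C₀ C₁ : ℝ}

lemma measurable_deriv_coeff (hN : IsNormalField Γ β C N S) (v : Euc d) (k : Fin d) :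
    Measurable fun y => S y v k :=
  measurable_coord ((ContinuousLinearMap.apply ℝ (Euc d) v).continuous.measurable.comp
    hN.measurable_deriv) k

lemma abs_deriv_coeff_le (hN : IsNormalField Γ β C N S) (l k : Fin d) (y : Euc d) :
    |S y (EuclideanSpace.single l 1) k| ≤ C :=
  (abs_apply_le _ k).trans (((S y).le_of_opNorm_le (hN.norm_deriv_le y) _).trans (by simp))

/-- The constant `M` bounding coefficients and remainder, and the kernel constant `A'`, do not
involve `ε`; the suprema of the regularized kernels do, but they do not enter the bound. -/
lemma exists_eLpNorm_dlGrad_le (hN : IsNormalField Γ β C N S)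
    (hσ : IsSurfaceLike σ Γ n C₀ C₁) (hC₀ : 0 ≤ C₀) (hC₁ : 0 ≤ C₁) (hn : 1 ≤ n) (hβ : 0 < β)
    (hβ1 : β ≤ 1) (ha : IsSymbol (n + 1) A a) :
    ∃ B : ℝ≥0, ∀ ε, 0 < ε → ∀ j φ, MemLp φ 2 σ →
      eLpNorm (integralOp σ (fun x y => dlGrad a ε N x y j) φ) 2 σ ≤ B * eLpNorm φ 2 σ := by
  have hC := hN.nonneg
  have hA := ha.nonneg
  obtain ⟨A', hA', hstd⟩ := ha.exists_isStdKernel_oddKernel (d := d)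
  set M : ℝ≥0 := ⟨6 * A * C + C + 2, by positivity⟩ with hM
  have hMv : (M : ℝ) = 6 * A * C + C + 2 := rfl
  have hAC : 0 ≤ 6 * A * C := by positivity
  obtain ⟨B, hB⟩ := hσ.exists_eLpNorm_le_of_sum hC₀ hC₁ hn hβ
    (hβ1.trans (by exact_mod_cast hn)) (OddIndex d) hA' M
  refine ⟨B, fun ε hε j φ hφ => hB _ (dlCoeff N j) (dlCoeff' S) (oddKernel a ε)
    (hN.isBddKernel_dlGrad ha hε j) (fun i => ?_) (fun i x => ?_) (fun i => ?_) (fun i y => ?_)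
    (fun i => (ha.continuous_oddKernel hε i).measurable) oddKernel_neg (hstd ε)
    (ha.exists_abs_oddKernel_le hε) (fun x hx y hy hxy => ?_) φ hφ⟩
  · rcases i with t | t <;> exact (measurable_coord (hN.measurable_tangBasis j) _).neg
  · have h1 : |dlCoeff N j i x| ≤ 2 := by
      rcases i with t | t <;>
      · rw [dlCoeff, abs_neg]
        exact (abs_apply_le _ _).trans (hN.norm_tangBasis_le j x)
    rw [hMv]; linarith
  · rcases i with t | t <;> exact hN.measurable_deriv_coeff _ _
  · have h1 : |dlCoeff' S i y| ≤ C := by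
      rcases i with t | t <;> exact hN.abs_deriv_coeff_le _ _ _
    rw [hMv]; linarith
  · refine (hN.abs_dlGrad_sub_le ha j hx hy hxy).trans ?_
    gcongr
    rw [hMv]; linarith

lemma exists_eLpNorm_adjGrad_le (hN : IsNormalField Γ β C N S)
    (hσ : IsSurfaceLike σ Γ n C₀ C₁) (hC₀ : 0 ≤ C₀) (hC₁ : 0 ≤ C₁) (hn : 1 ≤ n) (hβ : 0 < β)
    (hβ1 : β ≤ 1) (ha : IsSymbol (n + 1) A a) :
    ∃ B : ℝ≥0, ∀ ε, 0 < ε → ∀ j φ, MemLp φ 2 σ →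
      eLpNorm (integralOp σ (fun x y => adjGrad a ε N S x y j) φ) 2 σ ≤ B * eLpNorm φ 2 σ := by
  have hC := hN.nonneg
  have hA := ha.nonneg
  obtain ⟨A', hA', hstd⟩ := ha.exists_isStdKernel_oddKernel (d := d)
  set M : ℝ≥0 := ⟨6 * A * C + 2 * C + 1, by positivity⟩ with hM
  have hMv : (M : ℝ) = 6 * A * C + 2 * C + 1 := rfl
  have hAC : 0 ≤ 6 * A * C := by positivity
  obtain ⟨B, hB⟩ := hσ.exists_eLpNorm_le_of_sum hC₀ hC₁ hn hβ
    (hβ1.trans (by exact_mod_cast hn)) (OddIndex d) hA' M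
  refine ⟨B, fun ε hε j φ hφ => hB _ (adjCoeff N S j) (fun _ _ => 1) (oddKernel a ε)
    (hN.isBddKernel_adjGrad ha hε j) (fun i => ?_) (fun i x => ?_) (fun i => measurable_const)
    (fun i y => ?_) (fun i => (ha.continuous_oddKernel hε i).measurable) oddKernel_neg (hstd ε)
    (ha.exists_abs_oddKernel_le hε) (fun x hx y hy hxy => ?_) φ hφ⟩
  · rcases i with t | t <;> exact (measurable_coord (hN.measurable_tangBasis j) _).mul
      (hN.measurable_deriv_coeff _ _)
  · have h1 : |adjCoeff N S j i x| ≤ 2 * C := by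
      rcases i with t | t <;>
      · rw [adjCoeff, abs_mul]
        exact mul_le_mul ((abs_apply_le _ _).trans (hN.norm_tangBasis_le j x))
          (hN.abs_deriv_coeff_le _ _ _) (abs_nonneg _) (by norm_num)
    rw [hMv]; linarith
  · rw [abs_one, hMv]; linarith
  · refine (hN.abs_adjGrad_sub_le ha j hx hy hxy).trans ?_
    gcongr
    rw [hMv]; linarith

end L2

end IsNormalField

end KernelBounds

lemma HasDefiningFuns.exists_isNormalField (H : HasDefiningFuns Ω α) (hα : 0 < α)
    (hc : IsCompact (frontier Ω)) : ∃ N S C, IsNormalField (frontier Ω) (min α 1) C N S ∧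
      ∀ x ∈ frontier Ω, N x = outwardNormal Ω x := by
  classical
  obtain ⟨S, C, hS, hC, hSC, hest⟩ := H.exists_weingarten hα hc
  have hm : MeasurableSet (frontier Ω) := isClosed_frontier.measurableSet
  have hN : ∀ x ∈ frontier Ω, (frontier Ω).indicator (outwardNormal Ω) x = outwardNormal Ω x :=
    fun x hx => indicator_of_mem hx _
  have hS' : ∀ x ∈ frontier Ω, (frontier Ω).indicator S x = S x := fun x hx => indicator_of_mem hx _
  refine ⟨(frontier Ω).indicator (outwardNormal Ω), (frontier Ω).indicator S, C,
    ⟨?_, fun x => ?_, fun x hx => ?_, hS.indicator hm, fun x => ?_, fun x hx y hy => ?_,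
      fun x hx y hy => ?_⟩, hN⟩
  · rw [← piecewise_eq_indicator]
    exact H.continuousOn_outwardNormal.measurable_piecewise continuousOn_const hm
  · by_cases hx : x ∈ frontier Ω
    · rw [hN x hx, H.norm_outwardNormal hx]
    · rw [indicator_of_notMem hx, norm_zero]; exact zero_le_one
  · rw [hN x hx, H.norm_outwardNormal hx]
  · by_cases hx : x ∈ frontier Ω
    · rw [hS' x hx]; exact hSC x hx
    · rw [indicator_of_notMem hx, norm_zero]; exact hC
  · rw [hN x hx, hN y hy, hS' y hy]; exact (hest x hx y hy).1
  · rw [hN x hx, hN y hy]; exact (hest x hx y hy).2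

/-! ### Passage to the singular kernels -/

/-- The integral operator with kernel `K` is bounded from `L²(∂Ω)` to `H¹(∂Ω)`. -/
def MapsL2ToH1 (Ω : Set (Euc (n + 1))) (α : ℝ) (K : Euc (n + 1) → Euc (n + 1) → ℝ) : Prop :=
  ∃ C : ℝ≥0, ∀ φ : Euc (n + 1) → ℂ, MemLp φ 2 (surfaceMeasure Ω) →
    (∀ᵐ x ∂(surfaceMeasure Ω), Integrable (fun y => (K x y : ℂ) * φ y) (surfaceMeasure Ω)) ∧
    ∃ g, HasL2Gradient Ω α (integralOp (surfaceMeasure Ω) K φ) g ∧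
      eLpNorm (integralOp (surfaceMeasure Ω) K φ) 2 (surfaceMeasure Ω)
        + eLpNorm g 2 (surfaceMeasure Ω) ≤ C * eLpNorm φ 2 (surfaceMeasure Ω)

/-- A radial singular kernel of order `n + 1`, multiplied by a function that vanishes to second
order on the diagonal, maps `L²` to `H¹` if this holds uniformly for the regularized kernels. -/
theorem IsSymbol.mapsL2ToH1 {A : ℝ} {a : ℝ → ℝ} (ha : IsSymbol (n + 1) A a) (hn : 1 ≤ n)
    (hα : 0 < α) [IsFiniteMeasure (surfaceMeasure Ω)] (H : HasDefiningFuns Ω α) {C₀ C₁ : ℝ}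
    (hσ : IsSurfaceLike (surfaceMeasure Ω) (frontier Ω) n C₀ C₁) (hC₀ : 0 ≤ C₀) {β : ℝ}
    (hβ : 0 < β) {τ : Euc (n + 1) → Euc (n + 1) → ℝ} (hτm : Measurable (Function.uncurry τ))
    {Q : ℝ} (hQ : 0 ≤ Q) (hτ : ∀ x ∈ frontier Ω, ∀ y ∈ frontier Ω, |τ x y| ≤ Q * ‖x - y‖ ^ 2)
    (hK : ∀ ε, 0 < ε → IsBddKernel fun x y => a (‖x - y‖ ^ 2 + ε ^ 2) * τ x y)
    {V : ℝ → Euc (n + 1) → Euc (n + 1) → Euc (n + 1)}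
    (hV : ∀ ε, 0 < ε → ∀ j, IsBddKernel fun x y => V ε x y j)
    (hKV : ∀ ε, 0 < ε → ∃ L : ℝ, ∀ x ∈ frontier Ω, ∀ w ∈ frontier Ω, ∀ y ∈ frontier Ω,
      |a (‖x - y‖ ^ 2 + ε ^ 2) * τ x y - a (‖w - y‖ ^ 2 + ε ^ 2) * τ w y
        - inner ℝ (x - w) (V ε w y)| ≤ L * ‖x - w‖ ^ β * ‖x - w‖)
    (htan : ∀ ε, 0 < ε → ∀ x ∈ frontier Ω, ∀ y, inner ℝ (outwardNormal Ω x) (V ε x y) = 0)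
    (hB : ∃ B : ℝ≥0, ∀ ε, 0 < ε → ∀ j φ, MemLp φ 2 (surfaceMeasure Ω) →
      eLpNorm (integralOp (surfaceMeasure Ω) (fun x y => V ε x y j) φ) 2 (surfaceMeasure Ω)
        ≤ B * eLpNorm φ 2 (surfaceMeasure Ω)) :
    MapsL2ToH1 Ω α fun x y => a (‖x - y‖ ^ 2) * τ x y := by
  obtain ⟨B, hB⟩ := hB
  have hA := ha.nonneg
  have hn' : (1 : ℝ) ≤ n := by exact_mod_cast hn
  obtain ⟨D, hD⟩ := hσ.exists_schur_weaklySingular hC₀ hn (β := 1) one_pos hn'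
  -- Exponent `1` serves the limit kernel, of size `‖x - y‖ ^ (1 - n)`. The difference from the
  -- regularized kernel has half a power less, paid for by the factor `ε ^ (1/2)` that makes the
  -- Schur constants tend to zero.
  obtain ⟨D', hD'⟩ := hσ.exists_schur_weaklySingular hC₀ hn (β := 1 / 2) (by norm_num)
    (by linarith)
  set M : ℝ≥0 := ⟨A * Q, by positivity⟩ with hM
  obtain ⟨s1, s2⟩ := hD M (fun x y => a (‖x - y‖ ^ 2) * τ x y) fun x hx y hy hxy => by
    have hr : 0 < ‖x - y‖ := norm_pos_iff.2 (sub_ne_zero.2 hxy)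
    rw [abs_mul, Real.rpow_sub hr, Real.rpow_one, Real.rpow_natCast]
    calc _ ≤ A / ‖x - y‖ ^ (n + 1) * (Q * ‖x - y‖ ^ 2) := by
          gcongr
          · exact ha.bound₀ _ hr
          · exact hτ x hx y hy
      _ = A * Q * (‖x - y‖ / ‖x - y‖ ^ n) := by
          rw [pow_succ]; field_simp
  set e : ℕ → ℝ := fun m => 1 / ((m : ℝ) + 1) with he
  have he0 : ∀ m, 0 < e m := fun m => by positivity
  set M' : ℕ → ℝ≥0 := fun m => ⟨2 * A * Q * e m ^ (1 / 2 : ℝ), by have := he0 m; positivity⟩ with hM'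
  have hd := fun m => hD' (M' m)
    (fun x y => a (‖x - y‖ ^ 2 + e m ^ 2) * τ x y - a (‖x - y‖ ^ 2) * τ x y)
    fun x hx y hy hxy => by
      have hr : 0 < ‖x - y‖ := norm_pos_iff.2 (sub_ne_zero.2 hxy)
      rw [← sub_mul, abs_mul]
      calc _ ≤ (2 * A * e m ^ (1 / 2 : ℝ) * ‖x - y‖ ^ (-((n + 1 : ℕ) : ℝ) - 1 / 2))
              * (Q * ‖x - y‖ ^ 2) := by
            gcongr
            · exact ha.abs_shift_sub_le (he0 m) hr
            · exact hτ x hx y hy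
        _ = 2 * A * Q * e m ^ (1 / 2 : ℝ)
              * (‖x - y‖ ^ (-((n + 1 : ℕ) : ℝ) - 1 / 2) * ‖x - y‖ ^ 2) := by ring
        _ = 2 * A * Q * e m ^ (1 / 2 : ℝ) * ‖x - y‖ ^ (1 / 2 - (n : ℝ)) := by
            rw [← Real.rpow_natCast ‖x - y‖ 2, ← Real.rpow_add hr]
            congr 2
            push_cast
            ring
  have hlim : Tendsto (fun m => M' m * D') atTop (𝓝 0) := by
    have h1 : Tendsto e atTop (𝓝 0) := tendsto_one_div_add_atTop_nhds_zero_nat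
    have h2 : Tendsto (fun m => 2 * A * Q * e m ^ (1 / 2 : ℝ)) atTop (𝓝 0) := by
      have := (h1.rpow_const (p := 1 / 2) (Or.inr (by norm_num))).const_mul (2 * A * Q)
      rwa [Real.zero_rpow (by norm_num), mul_zero] at this
    have h3 : Tendsto M' atTop (𝓝 0) := by
      rw [← NNReal.tendsto_coe]
      exact h2
    simpa using h3.mul_const D'
  -- The symbol is uncontrolled at zero, but continuity off a single point suffices for
  -- measurability.
  have hK₀ : Measurable (Function.uncurry fun x y : Euc (n + 1) => a (‖x - y‖ ^ 2) * τ x y) := by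
    have h1 : Measurable fun z : Euc (n + 1) => a (‖z‖ ^ 2) := by
      refine measurable_of_continuousOn_compl_singleton 0 ?_
      refine ha.contDiffOn.continuousOn.comp (by fun_prop) fun z hz => ?_
      have : 0 < ‖z‖ := norm_pos_iff.2 hz
      exact (by positivity : 0 < ‖z‖ ^ 2)
    exact (h1.comp measurable_sub_pair).mul hτm
  refine ⟨M * D + (n + 1) * B, fun φ hφ => ?_⟩
  obtain ⟨h1, h2, g, hg, hgn⟩ := exists_gradient_of_kernels hα H hβ hK₀
    (K := fun m x y => a (‖x - y‖ ^ 2 + e m ^ 2) * τ x y) (fun m => hK _ (he0 m))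
    (V := fun m => V (e m)) (fun m => hV _ (he0 m)) (fun m => hKV _ (he0 m))
    (fun m => htan _ (he0 m)) (fun m j φ hφ => hB _ (he0 m) j φ hφ) s1 s2 hlim
    (fun m => (hd m).1) (fun m => (hd m).2) hφ
  refine ⟨h1, g, hg, (add_le_add h2 hgn).trans_eq ?_⟩
  push_cast
  ring

section Layers

variable {A : ℝ} {a : ℝ → ℝ} [IsFiniteMeasure (surfaceMeasure Ω)] {C₀ C₁ β C R : ℝ}
  {N : Euc (n + 1) → Euc (n + 1)} {S : Euc (n + 1) → Euc (n + 1) →L[ℝ] Euc (n + 1)}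

theorem IsSymbol.mapsL2ToH1_doubleLayer (ha : IsSymbol (n + 1) A a) (hn : 1 ≤ n)
    (hα : 0 < α) (H : HasDefiningFuns Ω α)
    (hσ : IsSurfaceLike (surfaceMeasure Ω) (frontier Ω) n C₀ C₁) (hC₀ : 0 ≤ C₀) (hC₁ : 0 ≤ C₁)
    (hβ : 0 < β) (hβ1 : β ≤ 1) (hN : IsNormalField (frontier Ω) β C N S)
    (hNΩ : ∀ x ∈ frontier Ω, N x = outwardNormal Ω x) (hR0 : 0 ≤ R)
    (hR : ∀ x ∈ frontier Ω, ∀ y ∈ frontier Ω, ‖x - y‖ ≤ R) :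
    MapsL2ToH1 Ω α fun x y => a (‖x - y‖ ^ 2) * inner ℝ (x - y) (N y) :=
  ha.mapsL2ToH1 hn hα H hσ hC₀ hβ
    (measurable_sub_pair.inner (hN.measurable.comp measurable_snd))
    (Q := C * R ^ β + C) (by have := hN.nonneg; positivity)
    (fun x hx y hy => hN.abs_inner_right_le_sq hβ hx hy (hR x hx y hy))
    (fun _ hε => hN.isBddKernel_dlKernel ha hε) (V := fun ε => dlGrad a ε N)
    (fun _ hε => hN.isBddKernel_dlGrad ha hε) (fun _ hε => hN.exists_whitney_dl hβ hβ1 hR ha hε)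
    (fun _ _ x hx y => by rw [← hNΩ x hx]; exact inner_tang_self (hN.norm_eq x hx) _)
    (hN.exists_eLpNorm_dlGrad_le hσ hC₀ hC₁ hn hβ hβ1 ha)

theorem IsSymbol.mapsL2ToH1_adjDoubleLayer (ha : IsSymbol (n + 1) A a) (hn : 1 ≤ n)
    (hα : 0 < α) (H : HasDefiningFuns Ω α)
    (hσ : IsSurfaceLike (surfaceMeasure Ω) (frontier Ω) n C₀ C₁) (hC₀ : 0 ≤ C₀) (hC₁ : 0 ≤ C₁)
    (hβ : 0 < β) (hβ1 : β ≤ 1) (hN : IsNormalField (frontier Ω) β C N S)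
    (hNΩ : ∀ x ∈ frontier Ω, N x = outwardNormal Ω x) (hR0 : 0 ≤ R)
    (hR : ∀ x ∈ frontier Ω, ∀ y ∈ frontier Ω, ‖x - y‖ ≤ R) :
    MapsL2ToH1 Ω α fun x y => a (‖x - y‖ ^ 2) * inner ℝ (x - y) (N x) :=
  ha.mapsL2ToH1 hn hα H hσ hC₀ hβ
    (measurable_sub_pair.inner (hN.measurable.comp measurable_fst))
    (Q := C * R ^ β + C) (by have := hN.nonneg; positivity)
    (fun x hx y hy => hN.abs_inner_left_le_sq hβ hx hy (hR x hx y hy))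
    (fun _ hε => hN.isBddKernel_adjKernel ha hε) (V := fun ε => adjGrad a ε N S)
    (fun _ hε => hN.isBddKernel_adjGrad ha hε) (fun _ hε => hN.exists_whitney_adj hβ hβ1 hR ha hε)
    (fun _ _ x hx y => by rw [← hNΩ x hx]; exact inner_tang_self (hN.norm_eq x hx) _)
    (hN.exists_eLpNorm_adjGrad_le hσ hC₀ hC₁ hn hβ hβ1 ha)

end Layers

/-- A complex kernel maps `L²` to `H¹` if its real and imaginary parts do, up to a constant factor. -/
theorem MapsL2ToH1.complex {K₁ K₂ : Euc (n + 1) → Euc (n + 1) → ℝ} (hα : 0 < α)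
    (hΩ : HasC2HolderBoundary Ω α) (hn : 1 ≤ n) {C₀ C₁ : ℝ} [IsFiniteMeasure (surfaceMeasure Ω)]
    (hσ : IsSurfaceLike (surfaceMeasure Ω) (frontier Ω) n C₀ C₁)
    (h₁ : MapsL2ToH1 Ω α K₁) (h₂ : MapsL2ToH1 Ω α K₂) (s : ℂ)
    {K : Euc (n + 1) → Euc (n + 1) → ℂ}
    (hK : ∀ x ∈ frontier Ω, ∀ y ∈ frontier Ω, x ≠ y →
      K x y = s * ((K₁ x y : ℂ) + Complex.I * (K₂ x y : ℂ))) :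
    ∃ C : ℝ≥0, ∀ φ : Euc (n + 1) → ℂ, MemLp φ 2 (surfaceMeasure Ω) →
      (∀ᵐ x ∂(surfaceMeasure Ω), Integrable (fun y => K x y * φ y) (surfaceMeasure Ω)) ∧
      MemH1 Ω (fun x => ∫ y, K x y * φ y ∂(surfaceMeasure Ω)) ∧
      h1Norm Ω (fun x => ∫ y, K x y * φ y ∂(surfaceMeasure Ω))
        ≤ C * eLpNorm φ 2 (surfaceMeasure Ω) := by
  obtain ⟨B₁, hB₁⟩ := h₁
  obtain ⟨B₂, hB₂⟩ := h₂
  set σ := surfaceMeasure Ω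
  have hI : ‖Complex.I‖ₑ = 1 := by rw [← ofReal_norm, Complex.norm_I, ENNReal.ofReal_one]
  refine ⟨‖s‖₊ * (B₁ + B₂), fun φ hφ => ?_⟩
  obtain ⟨i₁, g₁, hg₁, hn₁⟩ := hB₁ φ hφ
  obtain ⟨i₂, g₂, hg₂, hn₂⟩ := hB₂ φ hφ
  -- The formula for the kernel holds only off the diagonal, which is null for almost every `x`.
  have hker : ∀ᵐ x ∂σ, (fun y => K x y * φ y)
      =ᵐ[σ] fun y => s * ((K₁ x y : ℂ) * φ y + Complex.I * ((K₂ x y : ℂ) * φ y)) := by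
    filter_upwards [hσ.ae_mem] with x hx
    have hne : ∀ᵐ y ∂σ, y ≠ x := by
      rw [ae_iff]; simpa using hσ.measure_singleton hn hx
    filter_upwards [hσ.ae_mem, hne] with y hy hxy
    rw [hK x hx y hy hxy.symm]
    ring
  have hae : (fun x => s * (integralOp σ K₁ φ x + Complex.I * integralOp σ K₂ φ x))
      =ᵐ[σ] fun x => ∫ y, K x y * φ y ∂σ := by
    filter_upwards [hker, i₁, i₂] with x hx h1 h2
    rw [integral_congr_ae hx, integral_const_mul, integral_add h1 (h2.const_mul _),
      integral_const_mul]
    rfl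
  have hgrad := ((hg₁.add hα (hg₂.const_mul Complex.I)).const_mul s).congr_ae hα hae
  refine ⟨?_, hgrad.memH1 hα hΩ, (hgrad.h1Norm_le hα hΩ).trans ?_⟩
  · filter_upwards [hker, i₁, i₂] with x hx h1 h2
    exact ((h1.add (h2.const_mul _)).const_mul s).congr hx.symm
  · rw [← eLpNorm_congr_ae hae]
    have e1 : eLpNorm (fun x => s * (integralOp σ K₁ φ x + Complex.I * integralOp σ K₂ φ x)) 2 σ
        ≤ ‖s‖₊ * (eLpNorm (integralOp σ K₁ φ) 2 σ + eLpNorm (integralOp σ K₂ φ) 2 σ) := by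
      refine (eLpNorm_const_smul_le (c := s) (f := fun x => integralOp σ K₁ φ x
        + Complex.I * integralOp σ K₂ φ x)).trans ?_
      gcongr
      · exact le_rfl
      · refine (eLpNorm_add_le hg₁.memLp.1 (hg₂.const_mul Complex.I).memLp.1 (by norm_num)).trans ?_
        gcongr
        refine (eLpNorm_const_smul_le (c := Complex.I) (f := integralOp σ K₂ φ)).trans ?_
        rw [hI, one_mul]
    have e2 : eLpNorm (fun x => s • (g₁ x + Complex.I • g₂ x)) 2 σ
        ≤ ‖s‖₊ * (eLpNorm g₁ 2 σ + eLpNorm g₂ 2 σ) := by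
      refine (eLpNorm_const_smul_le (c := s) (f := fun x => g₁ x + Complex.I • g₂ x)).trans ?_
      gcongr
      · exact le_rfl
      · refine (eLpNorm_add_le hg₁.memLp_grad.1 (hg₂.const_mul Complex.I).memLp_grad.1
          (by norm_num)).trans ?_
        gcongr
        refine (eLpNorm_const_smul_le (c := Complex.I) (f := g₂)).trans ?_
        rw [hI, one_mul]
    calc _ ≤ ‖s‖₊ * (eLpNorm (integralOp σ K₁ φ) 2 σ + eLpNorm (integralOp σ K₂ φ) 2 σ)
          + ‖s‖₊ * (eLpNorm g₁ 2 σ + eLpNorm g₂ 2 σ) := add_le_add e1 e2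
      _ = ‖s‖₊ * ((eLpNorm (integralOp σ K₁ φ) 2 σ + eLpNorm g₁ 2 σ)
          + (eLpNorm (integralOp σ K₂ φ) 2 σ + eLpNorm g₂ 2 σ)) := by ring
      _ ≤ ‖s‖₊ * (B₁ * eLpNorm φ 2 σ + B₂ * eLpNorm φ 2 σ) := by gcongr
      _ = _ := by push_cast; ring

end BoundaryLayer

end

/-! ### The double-layer operators -/

theorem lemmaB1 (n : ℕ) (hn : 1 ≤ n) (Ω : Set (BoundaryLayer.Euc (n + 1)))
    (hopen : IsOpen Ω) (hbdd : Bornology.IsBounded Ω)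
    (α : ℝ) (hα : 0 < α) (hΩ : BoundaryLayer.HasC2HolderBoundary Ω α)
    (k : ℝ) (hk : 0 < k) :
    (∃ C : ℝ≥0, ∀ φ : BoundaryLayer.Euc (n + 1) → ℂ,
      MemLp φ 2 (BoundaryLayer.surfaceMeasure Ω) →
        (∀ᵐ x ∂(BoundaryLayer.surfaceMeasure Ω),
          Integrable (fun y => BoundaryLayer.doubleLayerKernel Ω k x y * φ y)
            (BoundaryLayer.surfaceMeasure Ω)) ∧
        BoundaryLayer.MemH1 Ω (BoundaryLayer.doubleLayer Ω k φ) ∧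
        BoundaryLayer.h1Norm Ω (BoundaryLayer.doubleLayer Ω k φ)
          ≤ C * eLpNorm φ 2 (BoundaryLayer.surfaceMeasure Ω)) ∧
    (∃ C : ℝ≥0, ∀ φ : BoundaryLayer.Euc (n + 1) → ℂ,
      MemLp φ 2 (BoundaryLayer.surfaceMeasure Ω) →
        (∀ᵐ x ∂(BoundaryLayer.surfaceMeasure Ω),
          Integrable (fun y => BoundaryLayer.adjDoubleLayerKernel Ω k x y * φ y)
            (BoundaryLayer.surfaceMeasure Ω)) ∧
        BoundaryLayer.MemH1 Ω (BoundaryLayer.adjDoubleLayer Ω k φ) ∧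
        BoundaryLayer.h1Norm Ω (BoundaryLayer.adjDoubleLayer Ω k φ)
          ≤ C * eLpNorm φ 2 (BoundaryLayer.surfaceMeasure Ω)) := by
  have hfb : Bornology.IsBounded (frontier Ω) := hbdd.closure.subset frontier_subset_closure
  have hc : IsCompact (frontier Ω) := Metric.isCompact_of_isClosed_isBounded isClosed_frontier hfb
  obtain ⟨R₀, hR₀⟩ := Metric.isBounded_iff.1 hfb
  have hR : ∀ x ∈ frontier Ω, ∀ y ∈ frontier Ω, ‖x - y‖ ≤ max R₀ 0 := fun x hx y hy => by
    rw [← dist_eq_norm]; exact (hR₀ hx hy).trans (le_max_left _ _)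
  have hR0 : 0 ≤ max R₀ 0 := le_max_right _ _
  have H := hΩ.hasDefiningFuns hα
  obtain ⟨hfin, C₀, C₁, hC₀, hC₁, hσ⟩ := hΩ.exists_surfaceLike hα hc
  obtain ⟨N, S, C, hN, hNΩ⟩ := H.exists_isNormalField hα hc
  have hβ : 0 < min α 1 := lt_min hα one_pos
  have hβ1 : min α 1 ≤ 1 := min_le_right _ _
  -- The square of a bound for the diameter of the boundary: up to it the cut-off symbols agree with
  -- the true ones.
  obtain ⟨a, b, A, ha, hb, hab⟩ := BoundaryLayer.exists_fderiv_fundSol_eq hn hk ((max R₀ 0) ^ 2)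
  have hab' : ∀ x ∈ frontier Ω, ∀ y ∈ frontier Ω, x ≠ y → _ := fun x hx y hy hxy =>
    hab x y hxy (pow_le_pow_left₀ (norm_nonneg _) (hR x hx y hy) 2)
  constructor
  · refine BoundaryLayer.MapsL2ToH1.complex hα hΩ hn hσ
      (ha.mapsL2ToH1_doubleLayer hn hα H hσ hC₀ hC₁ hβ hβ1 hN hNΩ hR0 hR)
      -- The sign `-1` comes from differentiating a function of `x - y` in `y`.
      (hb.mapsL2ToH1_doubleLayer hn hα H hσ hC₀ hC₁ hβ hβ1 hN hNΩ hR0 hR) (-1)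
      fun x hx y hy hxy => ?_
    rw [BoundaryLayer.doubleLayerKernel, (hab' x hx y hy hxy _).2, hNΩ y hy, neg_one_mul]
  · refine BoundaryLayer.MapsL2ToH1.complex hα hΩ hn hσ
      (ha.mapsL2ToH1_adjDoubleLayer hn hα H hσ hC₀ hC₁ hβ hβ1 hN hNΩ hR0 hR)
      (hb.mapsL2ToH1_adjDoubleLayer hn hα H hσ hC₀ hC₁ hβ hβ1 hN hNΩ hR0 hR) 1
      fun x hx y hy hxy => ?_
    rw [BoundaryLayer.adjDoubleLayerKernel, (hab' x hx y hy hxy _).1, hNΩ x hx, one_mul]
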